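/- **Setting.** Fix $r,d\in\mathbb N$ and put $n=2r+2$. Let $\Theta_n$ be the set of matrices $A=(a_{ij})_{i,j\in\mathbb Z}$ over $\mathbb N$ with finitely supported rows and $a_{i+n,j+n}=a_{ij}$, and write $\mathrm{ro}(A)_i=\sum_j a_{ij}$, $\mathrm{co}(A)_j=\sum_i a_{ij}$. Let ${}^{\mathfrak c}\Xi_{n,d}$ be the set of $A\in\Theta_n$ with $\sum_{i=i_0}^{i_0+n-1}\mathrm{ro}(A)_i=2d$ for all $i_0$, $a_{ij}=a_{-i,-j}$ and $a_{00},a_{r+1,r+1}$ even. Let $E^{ij}$ be the matrix with entry $1$ at $(i+mn,j+mn)$, $m\in\mathbb Z$, and $0$ elsewhere, $E_\theta^{ij}=E^{ij}+E^{-i,-j}$, and $\Xi_{n,d}=\{A+E^{00}+E^{r+1,r+1}: A\in{}^{\mathfrak c}\Xi_{n,d}\}$. For a finite field $k$ with $q$ elements and a $2d$-dimensional symplectic space $V$ over $k((\varepsilon))$ let $\mathcal X$ be the set of chains $(L_z)_{z\in\mathbb Z}$ of $k[[\varepsilon]]$-lattices in $V$ with $L_z\subseteq L_{z+1}$, $L_z=\varepsilon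 L_{z+n}$, $L_z^{\#}=L_{-z-1}$. A pair $(L,L')$ lies in $\mathcal O_A$ if $a_{ij}=\dim_k\frac{L_i\cap L'_j}{L_{i-1}\cap L'_j+L_i\cap L'_{j-1}}$ for all $i,j$. The algebra $\mathbf S^{\mathfrak c}_{n,d}$ over $\mathbb Q(v)$ has basis $e_A$ ($A\in{}^{\mathfrak c}\Xi_{n,d}$) and product $e_A*e_B=\sum_C g^C_{A,B}e_C$, where $g^C_{A,B}\in\mathbb Z[v,v^{-1}]$ satisfies $g^C_{A,B}(\sqrt q)=\#\{M\in\mathcal X:(L,M)\in\mathcal O_A,(M,L')\in\mathcal O_B\}$ for all $k$, $V$ and $(L,L')\in\mathcal O_C$. For $A\in{}^{\mathfrak c}\Xi_{n,d}$ put $$d^{\mathfrak c}_A=\tfrac12\Big(\sum_{1\le i\le n,\ i\ge k,\ j<l}a_{ij}a_{kl}+\sum_{i\ge0>j}a_{ij}+\sum_{i\ge r+1>j}a_{ij}\Big),\qquad [A]=v^{-d^{\mathfrak c}_A}e_A.$$ For $A\in\Xi_{n,d}$ the symbols $e_A$, $[A]$, $d_A$ mean those of $A-E^{00}-E^{r+1,r+1}$.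 **Notation.** $\left[{a\atop b}\right]=\prod_{i=1}^b\frac{v^{2(a-i+1)}-1}{v^{2i}-1}$ ($a\in\mathbb Z$, $b\in\mathbb N$), $[a]=\left[{a\atop1}\right]$, $[a]!=\prod_{i=1}^a[i]$. For $S=(s_{ij})$ put $\check s_{ij}=s_{i-1,j}$, and $A_{S,T}=A+S-T-(\check S-\check T)=(a'_{ij})$. For finitely supported $\alpha,\gamma,\beta:\mathbb Z\to\mathbb N$, $$n(\alpha,\gamma,\beta)=\sum_\sigma v^{2(\sum_{i,\,j>l}\sigma_{ij}\alpha_l+\sum_i\sigma_{ii}\alpha_i+\sum_{i>k,\,j<l}\sigma_{ij}\sigma_{kl})}\frac{\prod_i[\beta_i]!}{\prod_{i,j}[\sigma_{ij}]!}\prod_{j\in\mathbb Z}\ \prod_{0\le l\le\gamma_j-\sigma_{jj}-1}(v^{2\alpha_j}-v^{2l}),$$ the sum over upper triangular $\mathbb N$-matrices $\sigma$ with $\mathrm{ro}(\sigma)=\beta$, $\mathrm{co}(\sigma)=\gamma$; and $n(S,T)=\prod_{i=0}^r n\big((s_{ij})_j,(t_{ij})_j,(s_{-i-1,-j})_j\big)$.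 With $\mathcal J=(\{-r-1\}\times(-r-1,\infty))\sqcup([-r,-1]\times\mathbb Z)\sqcup(\{0\}\times(-\infty,0))$ and $\delta=0$ for $\mathfrak x=\mathfrak c$, $\delta=1$ for $\mathfrak x=\mathfrak b$, put $$\left[{A_{S,T}\atop S}\right]_{\mathfrak x}=\prod_{(i,j)\in\mathcal J}\left[{a'_{ij}\atop s_{ij}}\right]\left[{a'_{ij}-s_{ij}\atop s_{-i,-j}}\right]\prod_{i=0,-r-1}\ \prod_{0\le k\le s_{ii}-1}\frac{[a'_{ii}-2k-\delta]}{[k+1]},$$ $$\xi^{\mathfrak x}_{A,S,T}=\sum_{-r-1\le i\le r,\ j>l}(a'_{ij}-s_{ij})s_{il}-X_S-\sum_{i=-r-1,0;\ j<i}\frac{s_{ij}(s_{ij}-1+2\delta)}2,$$ $$X_S=\sum_{-r\le i\le-1,\ j>l}s_{-i,-j}s_{il}+\sum_{i=-r-1,0;\ 2i-l>j>l}s_{-i,-j}s_{il}.$$ **Theorem.** Let $\alpha=(\alpha_i)_{i\in\mathbb Z}\in\mathbb N^{\mathbb Z}$ with $\alpha_{i+n}=\alpha_i$. (1) Let $A,B\in{}^{\mathfrak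 c}\Xi_{n,d}$ with $\mathrm{co}(B)=\mathrm{ro}(A)$ and $B-\sum_{1\le i\le n}\alpha_iE_\theta^{i,i+1}$ diagonal. Then the structure constants $g^C_{B,A}$ exist, are unique, and vanish for all but finitely many $C$, and $$e_B*e_A=\sum_{S,T}v^{2\xi^{\mathfrak c}_{A,S,T}}\,n(S,T)\left[{A_{S,T}\atop S}\right]_{\mathfrak c}e_{A_{S,T}},$$ a finite sum over the $S,T\in\Theta_n$ with $$(\star)\quad s_{ij}+s_{-i-1,-j}=t_{ij}+t_{-i-1,-j}\ \text{ for all } i,j\in\mathbb Z,$$ $\mathrm{ro}(S)_i=\alpha_i$ and $\mathrm{ro}(T)_i=\alpha_{-i-1}$ for all $i$, $A-T+\check T\in\Theta_n$ and $A_{S,T}\in{}^{\mathfrak c}\Xi_{n,d}$. (2) Let $A,B\in\Xi_{n,d}$ with $\mathrm{co}(B)=\mathrm{ro}(A)$ and $B-\sum_{1\le i\le n}\alpha_iE_\theta^{i,i+1}$ diagonal. Then $$e_B*e_A=\sum_{S,T}v^{2\xi^{\mathfrak b}_{A,S,T}}\,n(S,T)\left[{A_{S,T}\atop S}\right]_{\mathfrak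 b}e_{A_{S,T}},\qquad [B]*[A]=\sum_{S,T}v^{h_{S,T}}\,n(S,T)\left[{A_{S,T}\atop S}\right]_{\mathfrak b}[A_{S,T}],$$ finite sums over the same pairs as in (1), with $A_{S,T}\in\Xi_{n,d}$ in place of $A_{S,T}\in{}^{\mathfrak c}\Xi_{n,d}$. Here $d_A,d_B,d_{A_{S,T}}$ and $h_{S,T}=d_{A_{S,T}}-d_A-d_B+2\xi^{\mathfrak b}_{A,S,T}$ are integers; explicitly $$\begin{aligned}h_{S,T}={}&\sum_{i=1}^n\Big(\sum_{j>l}a_{ij}s_{il}-\sum_{j<l}a_{ij}t_{il}-\sum_ja_{ij}s_{ij}+\alpha_i\alpha_{i-1}-\tfrac12\alpha_{n-i}\alpha_i+\tfrac12\alpha_i\alpha_{n-1-i}\\&-2\sum_{j>l}t_{ij}s_{il}-2\sum_{j>l}s_{i-1,j}s_{il}+2\sum_{j>l}t_{i-1,j}s_{il}+\tfrac12\sum_{j<l}\big((s_{ij}-t_{ij})-(s_{i-1,j}-t_{i-1,j})\big)(s_{il}-t_{il})\Big)\\&-2X_S-\sum_{i=-r-1,0;\ j<i}s_{ij}(s_{ij}-1)+\tfrac12\sum_{j>0}t_{0j}-\tfrac32\sum_{j<0}s_{0j}+\tfrac12s_{00}\\&+\tfrac12\sum_{j>r+1}t_{r+1,j}-\tfrac32\sum_{j<r+1}s_{r+1,j}+\tfrac12s_{r+1,r+1}.\end{aligned}$$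 -/

import Mathlib

open scoped LaurentSeries PowerSeries Pointwise LaurentPolynomial

noncomputable section

namespace AffineSchurC

/-! Throughout, `n = 2 r + 2`. -/

/-- The even period `n = 2 r + 2`, as an integer. -/
def per (r : ℕ) : ℤ := 2 * (r : ℤ) + 2

/-- Integer matrices indexed by `ℤ × ℤ`. -/
abbrev ZMat := Matrix ℤ ℤ ℤ

/-- Row sums. -/
def ro (A : ZMat) (i : ℤ) : ℤ := ∑ᶠ j : ℤ, A i j

/-- Column sums. -/
def co (A : ZMat) (j : ℤ) : ℤ := ∑ᶠ i : ℤ, A i j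

/-- The set `Θ_n`: matrices with entries in `ℕ`, invariant under the diagonal shift by `n`,
such that the entries in any `n` consecutive rows have a finite sum (that is, all rows are finitely
supported). -/
def Theta (r : ℕ) : Set ZMat :=
  {A | (∀ i j, 0 ≤ A i j) ∧ (∀ i j, A (i + per r) (j + per r) = A i j) ∧
    ∀ i, {j | A i j ≠ 0}.Finite}

/-- The set `Θ_{n,d}`: any `n` consecutive rows have total sum `d`. -/
def ThetaD (r d : ℕ) : Set ZMat :=
  {A | A ∈ Theta r ∧ ∀ i₀ : ℤ, ∑ i ∈ Finset.Ico i₀ (i₀ + per r), ro A i = d}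

/-- The set `ᶜΞ_{n,d}`. -/
def cXi (r d : ℕ) : Set ZMat :=
  {A | A ∈ ThetaD r (2 * d) ∧ (∀ i j, A i j = A (-i) (-j)) ∧
    Even (A 0 0) ∧ Even (A (r + 1) (r + 1))}

open Classical in
/-- The periodic matrix unit `E^{ij}`. -/
def E (r : ℕ) (i j : ℤ) : ZMat :=
  fun k l => if ∃ m : ℤ, k = i + m * per r ∧ l = j + m * per r then 1 else 0

/-- `E_θ^{ij} = E^{ij} + E^{-i,-j}`. -/
def Etheta (r : ℕ) (i j : ℤ) : ZMat := E r i j + E r (-i) (-j)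

/-- The matrix `E^{00} + E^{r+1,r+1}`. -/
def Efix (r : ℕ) : ZMat := E r 0 0 + E r (r + 1) (r + 1)

/-- The set `Ξ_{n,d} = {A + E^{00} + E^{r+1,r+1} | A ∈ ᶜΞ_{n,d}}`. -/
def Xi (r d : ℕ) : Set ZMat := (fun A => A + Efix r) '' cXi r d

/-! ### Symplectic lattice chains over a finite field -/

section Geometry

variable {k : Type} [Field k] {V : Type} [AddCommGroup V] [Module k⸨X⸩ V]
  [Module k⟦X⟧ V] [IsScalarTower k⟦X⟧ k⸨X⸩ V] [Module k V] [IsScalarTower k k⟦X⟧ V]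

/-- The set `𝒳^𝔠_{n,d}` of periodic self-dual chains of lattices: `L_z ⊆ L_{z+1}`,
`L_z = ε L_{z+n}` and `L_z^# = L_{-z-1}`, where `L^# = {v | (v, L) ⊆ 𝔬}`. -/
structure LatticeChain (r : ℕ) (ω : LinearMap.BilinForm k⸨X⸩ V) where
  /-- the lattices of the chain -/
  L : ℤ → Submodule k⟦X⟧ V
  isLattice : ∀ z, Submodule.IsLattice k⸨X⸩ (L z)
  mono : ∀ z, L z ≤ L (z + 1)
  periodic : ∀ z, L z = (PowerSeries.X : k⟦X⟧) • L (z + per r)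
  dual : ∀ z, ω.dualSubmodule (L z) = L (-z - 1)

/-- The matrix of a pair of chains:
`a_{ij} = dim_k (L_i ∩ L'_j) / (L_{i-1} ∩ L'_j + L_i ∩ L'_{j-1})`.
The `Sp(V)`-orbit of a pair is determined by this matrix; the orbit `𝒪_A` is the set of pairs with
matrix `A`. -/
def relPos {r : ℕ} {ω : LinearMap.BilinForm k⸨X⸩ V} (L L' : LatticeChain r ω) : ZMat :=
  fun i j => (Module.finrank k (↥(L.L i ⊓ L'.L j) ⧸
    ((L.L (i - 1) ⊓ L'.L j) ⊔ (L.L i ⊓ L'.L (j - 1))).submoduleOf (L.L i ⊓ L'.L j)) : ℤ)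

end Geometry

/-! ### The convolution algebra -/

/-- `g` is the structure constant `g^C_{A,B}`: for every finite field `k` with `q` elements, every
symplectic space `V` of dimension `2d` over `k((ε))`, and every pair `(L, L') ∈ 𝒪_C`, the number of
chains `M` with `(L, M) ∈ 𝒪_A` and `(M, L') ∈ 𝒪_B` is finite and equal to `g(√q)`. -/
def IsStructureConst (r d : ℕ) (A B C : ZMat) (g : ℤ[T;T⁻¹]) : Prop :=
  ∀ (k : Type) [Field k] [Finite k] (V : Type) [AddCommGroup V] [Module k⸨X⸩ V]
    [Module k⟦X⟧ V] [IsScalarTower k⟦X⟧ k⸨X⸩ V] [Module k V] [IsScalarTower k k⟦X⟧ V]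
    [FiniteDimensional k⸨X⸩ V] (ω : LinearMap.BilinForm k⸨X⸩ V),
    ω.IsAlt → ω.Nondegenerate → Module.finrank k⸨X⸩ V = 2 * d →
    ∀ L L' : LatticeChain r ω, relPos L L' = C →
      {M : LatticeChain r ω | relPos L M = A ∧ relPos M L' = B}.Finite ∧
      ∀ x : ℝˣ, (x : ℝ) = Real.sqrt (Nat.card k) →
        LaurentPolynomial.eval₂ (Int.castRingHom ℝ) x g =
          (Set.ncard {M : LatticeChain r ω | relPos L M = A ∧ relPos M L' = B} : ℝ)

open Classical in
/-- The structure constant `g^C_{A,B} ∈ ℤ[v, v⁻¹]`. -/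
def structureConst (r d : ℕ) (A B C : ZMat) : ℤ[T;T⁻¹] :=
  if h : ∃ g, IsStructureConst r d A B C g then h.choose else 0

/-- The field `ℚ(v)`. -/
abbrev Qv := RatFunc ℚ

/-- The indeterminate `v`. -/
def v : Qv := RatFunc.X

/-- The inclusion `ℤ[v, v⁻¹] → ℚ(v)`. -/
def toQv (g : ℤ[T;T⁻¹]) : Qv :=
  LaurentPolynomial.eval₂ (Int.castRingHom Qv) (Units.mk0 v RatFunc.X_ne_zero) g

/-- The `ℚ(v)`-vector space `𝐒^𝔠_{n,d}` with basis `e_A`, `A ∈ ᶜΞ_{n,d}`. -/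
abbrev Schur (r d : ℕ) := ↥(cXi r d) →₀ Qv

open Classical in
/-- The product `e_A * e_B = ∑_C g^C_{A,B} e_C` of two basis elements. -/
def basisMul (r d : ℕ) (A B : ↥(cXi r d)) : Schur r d :=
  if h : (Function.support fun C : ↥(cXi r d) =>
      toQv (structureConst r d A.1 B.1 C.1)).Finite then
    Finsupp.ofSupportFinite (fun C => toQv (structureConst r d A.1 B.1 C.1)) h
  else 0

/-- The convolution product of `𝐒^𝔠_{n,d}`, the bilinear extension of `basisMul`. -/
def conv (r d : ℕ) (x y : Schur r d) : Schur r d :=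
  x.sum fun A a => y.sum fun B b => (a * b) • basisMul r d A B

open Classical in
/-- The basis element `e_A` for `A ∈ ᶜΞ_{n,d}`. -/
def eC (r d : ℕ) (A : ZMat) : Schur r d :=
  if h : A ∈ cXi r d then Finsupp.single ⟨A, h⟩ 1 else 0

/-- The basis element `e_A` for `A ∈ Ξ_{n,d}`, through the bijection `ᶜΞ_{n,d} ≅ Ξ_{n,d}`. -/
def eB (r d : ℕ) (A : ZMat) : Schur r d := eC r d (A - Efix r)

/-- Twice the integer `d^𝔠_A`, for `A ∈ ᶜΞ_{n,d}`. -/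
def dTwice (r : ℕ) (A : ZMat) : ℤ :=
  (∑ i ∈ Finset.Icc 1 (per r), ∑ᶠ (k : ℤ) (_ : k ≤ i) (j : ℤ) (l : ℤ) (_ : j < l),
      A i j * A k l)
    + (∑ᶠ (i : ℤ) (_ : 0 ≤ i) (j : ℤ) (_ : j < 0), A i j)
    + ∑ᶠ (i : ℤ) (_ : (r : ℤ) + 1 ≤ i) (j : ℤ) (_ : j < (r : ℤ) + 1), A i j

/-- The standard basis element `[A] = v^{-d^𝔠} e_A` for `A ∈ Ξ_{n,d}`, where `d^𝔠` is that of the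
matrix in `ᶜΞ_{n,d}` corresponding to `A`. -/
def std (r d : ℕ) (A : ZMat) : Schur r d := v ^ (-(dTwice r (A - Efix r) / 2)) • eB r d A

/-! ### Quantum numbers and the coefficients of the formula -/

/-- The quantum binomial `[a; b] = ∏_{1 ≤ i ≤ b} (v^{2(a-i+1)} - 1) / (v^{2i} - 1)`, `a ∈ ℤ`. -/
def qbinom (a : ℤ) (b : ℕ) : Qv :=
  ∏ i ∈ Finset.Icc 1 b, (v ^ (2 * (a - i + 1)) - 1) / (v ^ (2 * (i : ℤ)) - 1)

/-- The quantum integer `[a]`. -/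
def qint (a : ℤ) : Qv := qbinom a 1

/-- The quantum factorial `[a]!`. -/
def qfact (a : ℕ) : Qv := ∏ i ∈ Finset.Icc 1 a, qint i

/-- The upper triangular matrices over `ℕ` with finite support, row sums `β` and column sums
`γ`. -/
def triangular (γ β : ℤ → ℕ) : Set (ℤ → ℤ → ℕ) :=
  {σ | (∀ i j, j < i → σ i j = 0) ∧ {p : ℤ × ℤ | σ p.1 p.2 ≠ 0}.Finite ∧
    (∀ i, ∑ᶠ j : ℤ, σ i j = β i) ∧ ∀ j, ∑ᶠ i : ℤ, σ i j = γ j}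

/-- The polynomial `n(α, γ, β)`. -/
def nPoly (α γ β : ℤ → ℕ) : Qv :=
  ∑ᶠ σ ∈ triangular γ β,
    v ^ (2 * ((∑ᶠ (i : ℤ) (j : ℤ) (l : ℤ) (_ : l < j), σ i j * α l) + (∑ᶠ i : ℤ, σ i i * α i)
        + ∑ᶠ (i : ℤ) (k : ℤ) (_ : k < i) (j : ℤ) (l : ℤ) (_ : j < l), σ i j * σ k l))
      * ((∏ᶠ i : ℤ, qfact (β i)) / ∏ᶠ p : ℤ × ℤ, qfact (σ p.1 p.2))
      * ∏ᶠ j : ℤ, ∏ l ∈ Finset.range (γ j - σ j j), (v ^ (2 * α j) - v ^ (2 * l))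

/-- `n(S, T) = ∏_{0 ≤ i ≤ r} n(S_i, T_i, (S_{-i-1})^J)`. -/
def nST (r : ℕ) (S T : ZMat) : Qv :=
  ∏ i ∈ Finset.Icc (0 : ℤ) r,
    nPoly (fun j => (S i j).toNat) (fun j => (T i j).toNat) (fun j => (S (-i - 1) (-j)).toNat)

/-- The row shift `Š`. -/
def rowShift (S : ZMat) : ZMat := fun i j => S (i - 1) j

/-- `A_{S,T} = A + S - T - (Š - Ť)`. -/
def AST (A S T : ZMat) : ZMat := A + S - T - (rowShift S - rowShift T)

/-- The index set `𝒥`. -/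
def J (r : ℕ) : Set (ℤ × ℤ) :=
  {p | (p.1 = -(r : ℤ) - 1 ∧ -(r : ℤ) - 1 < p.2) ∨ (-(r : ℤ) ≤ p.1 ∧ p.1 ≤ -1) ∨
    (p.1 = 0 ∧ p.2 < 0)}

/-- The coefficient `[A_{S,T}; S]_𝔠`, as a function of `A' = A_{S,T}` and `S`. -/
def bracketC (r : ℕ) (A' S : ZMat) : Qv :=
  (∏ᶠ p ∈ J r, qbinom (A' p.1 p.2) (S p.1 p.2).toNat *
      qbinom (A' p.1 p.2 - S p.1 p.2) (S (-p.1) (-p.2)).toNat)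
    * ∏ i ∈ ({0, -(r : ℤ) - 1} : Finset ℤ), ∏ k ∈ Finset.range (S i i).toNat,
        qint (A' i i - 2 * k) / qint (k + 1)

/-- The coefficient `[A_{S,T}; S]_𝔟`, as a function of `A' = A_{S,T}` and `S`. -/
def bracketB (r : ℕ) (A' S : ZMat) : Qv :=
  (∏ᶠ p ∈ J r, qbinom (A' p.1 p.2) (S p.1 p.2).toNat *
      qbinom (A' p.1 p.2 - S p.1 p.2) (S (-p.1) (-p.2)).toNat)
    * ∏ i ∈ ({0, -(r : ℤ) - 1} : Finset ℤ), ∏ k ∈ Finset.range (S i i).toNat,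
        qint (A' i i - 2 * k - 1) / qint (k + 1)

/-- The sum
`∑_{-r ≤ i ≤ -1, j > l} s_{-i,-j} s_{il} + ∑_{i = -r-1, 0; 2i-l > j > l} s_{-i,-j} s_{il}`. -/
def crossSum (r : ℕ) (S : ZMat) : ℤ :=
  (∑ i ∈ Finset.Icc (-(r : ℤ)) (-1), ∑ᶠ (j : ℤ) (l : ℤ) (_ : l < j), S (-i) (-j) * S i l)
    + ∑ i ∈ ({-(r : ℤ) - 1, 0} : Finset ℤ),
        ∑ᶠ (j : ℤ) (l : ℤ) (_ : l < j ∧ j < 2 * i - l), S (-i) (-j) * S i l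

/-- The exponent `ξ^𝔠_{A,S,T}`, as a function of `A' = A_{S,T}` and `S`. -/
def xiC (r : ℕ) (A' S : ZMat) : ℤ :=
  (∑ i ∈ Finset.Icc (-(r : ℤ) - 1) r, ∑ᶠ (j : ℤ) (l : ℤ) (_ : l < j), (A' i j - S i j) * S i l)
    - crossSum r S
    - ∑ i ∈ ({-(r : ℤ) - 1, 0} : Finset ℤ), ∑ᶠ (j : ℤ) (_ : j < i), S i j * (S i j - 1) / 2

/-- The exponent `ξ^𝔟_{A,S,T}`, as a function of `A' = A_{S,T}` and `S`. -/
def xiB (r : ℕ) (A' S : ZMat) : ℤ :=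
  (∑ i ∈ Finset.Icc (-(r : ℤ) - 1) r, ∑ᶠ (j : ℤ) (l : ℤ) (_ : l < j), (A' i j - S i j) * S i l)
    - (∑ i ∈ ({-(r : ℤ) - 1, 0} : Finset ℤ), ∑ᶠ (j : ℤ) (_ : j < i), S i j * (S i j + 1) / 2)
    - crossSum r S

/-- Twice the exponent `h_{S,T}`, written out in the entries of `A ∈ Ξ_{n,d}`, `S`, `T` and in
`α`. -/
def hTwice (r : ℕ) (α : ℤ → ℕ) (A S T : ZMat) : ℤ :=
  (∑ i ∈ Finset.Icc 1 (per r),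
      (2 * (∑ᶠ (j : ℤ) (l : ℤ) (_ : l < j), A i j * S i l)
        - 2 * (∑ᶠ (j : ℤ) (l : ℤ) (_ : j < l), A i j * T i l)
        - 2 * (∑ᶠ j : ℤ, A i j * S i j)
        + 2 * (α i * α (i - 1) : ℤ) - (α (per r - i) * α i : ℤ) + (α i * α (per r - 1 - i) : ℤ)
        - 4 * (∑ᶠ (j : ℤ) (l : ℤ) (_ : l < j), T i j * S i l)
        - 4 * (∑ᶠ (j : ℤ) (l : ℤ) (_ : l < j), S (i - 1) j * S i l)
        + 4 * (∑ᶠ (j : ℤ) (l : ℤ) (_ : l < j), T (i - 1) j * S i l)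
        + ∑ᶠ (j : ℤ) (l : ℤ) (_ : j < l),
            ((S i j - T i j) - (S (i - 1) j - T (i - 1) j)) * (S i l - T i l)))
    - 4 * crossSum r S
    - 2 * (∑ i ∈ ({-(r : ℤ) - 1, 0} : Finset ℤ), ∑ᶠ (j : ℤ) (_ : j < i), S i j * (S i j - 1))
    + (∑ᶠ (j : ℤ) (_ : 0 < j), T 0 j)
    - 3 * (∑ᶠ (j : ℤ) (_ : j < 0), S 0 j) + S 0 0
    + (∑ᶠ (j : ℤ) (_ : (r : ℤ) + 1 < j), T (r + 1) j)
    - 3 * (∑ᶠ (j : ℤ) (_ : j < (r : ℤ) + 1), S (r + 1) j) + S (r + 1) (r + 1)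

/-- The pairs `(S, T)` in `Θ_n × Θ_n` with `s_{ij} + s_{-i-1,-j} = t_{ij} + t_{-i-1,-j}`,
`ro(S)_i = α_i`, `ro(T)_i = α_{-i-1}`, `A - T + Ť ∈ Θ_n` and `A_{S,T} ∈ Ω`. -/
def pairs (r : ℕ) (Ω : Set ZMat) (α : ℤ → ℕ) (A : ZMat) : Set (ZMat × ZMat) :=
  {p | p.1 ∈ Theta r ∧ p.2 ∈ Theta r ∧
    (∀ i j, p.1 i j + p.1 (-i - 1) (-j) = p.2 i j + p.2 (-i - 1) (-j)) ∧
    (∀ i, ro p.1 i = α i) ∧ (∀ i, ro p.2 i = α (-i - 1)) ∧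
    A - p.2 + rowShift p.2 ∈ Theta r ∧ AST A p.1 p.2 ∈ Ω}

/-- The hypotheses on the two matrices: `co(B) = ro(A)`, and `B - ∑_{1 ≤ i ≤ n} α_i E_θ^{i,i+1}`
is diagonal. -/
def Compatible (r : ℕ) (α : ℤ → ℕ) (A B : ZMat) : Prop :=
  co B = ro A ∧ (B - ∑ i ∈ Finset.Icc 1 (per r), (α i : ℤ) • Etheta r i (i + 1)).IsDiag

end AffineSchurC

end

namespace AffineSchurC

open Module

set_option linter.unusedSectionVars false

/-! ### A one-step recursion for counting subspaces of a finite vector space -/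

section Step

variable {k W : Type*} [Field k] [Finite k] [AddCommGroup W] [Module k W] [Module.Finite k W]

theorem card_submodule_eq_pow (Q : Submodule k W) :
    Nat.card Q = Nat.card k ^ finrank k Q :=
  Module.natCard_eq_pow_finrank

theorem card_dual_eq_one {f : Dual k W} (hf : f ≠ 0) :
    Nat.card {x : W // f x = 1} * Nat.card k = Nat.card W := by
  obtain ⟨x₀, hx₀⟩ : ∃ x, f x = 1 := by
    obtain ⟨x, hx⟩ : ∃ x, f x ≠ 0 := by
      by_contra! h
      exact hf (LinearMap.ext h)
    exact ⟨(f x)⁻¹ • x, by simp [hx]⟩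
  have e : {x : W // f x = 1} ≃ LinearMap.ker f :=
    { toFun := fun x => ⟨x.1 - x₀, by simp [x.2, hx₀]⟩
      invFun := fun y => ⟨y.1 + x₀, by
        have := y.2
        rw [LinearMap.mem_ker] at this
        simp [this, hx₀]⟩
      left_inv := fun x => by simp
      right_inv := fun y => by simp }
  rw [Nat.card_congr e, card_submodule_eq_pow, Module.natCard_eq_pow_finrank (K := k) (V := W),
    ← Module.Dual.finrank_ker_add_one_of_ne_zero hf, pow_succ]

theorem card_dualAnnihilator_pairs (R : Submodule k W) {m t : ℕ}
    (hR : finrank k R + (m + 1) = finrank k W) (ht : finrank k W = t + 1) :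
    Nat.card {p : Dual k W × W // p.1 ∈ R.dualAnnihilator ∧ p.1 p.2 = 1} =
      (Nat.card k ^ (m + 1) - 1) * Nat.card k ^ t := by
  have : Finite W := Module.finite_of_finite k
  have : Finite (Dual k W) := Module.finite_of_finite k
  have : Fintype {f : Dual k W // f ∈ R.dualAnnihilator ∧ f ≠ 0} := Fintype.ofFinite _
  have e : {p : Dual k W × W // p.1 ∈ R.dualAnnihilator ∧ p.1 p.2 = 1} ≃
      Σ f : {f : Dual k W // f ∈ R.dualAnnihilator ∧ f ≠ 0}, {x : W // f.1 x = 1} :=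
    { toFun := fun p => ⟨⟨p.1.1, p.2.1, by
          intro h
          have := p.2.2
          rw [h] at this
          simp at this⟩, ⟨p.1.2, p.2.2⟩⟩
      invFun := fun s => ⟨(s.1.1, s.2.1), s.1.2.1, s.2.2⟩
      left_inv := fun _ => rfl
      right_inv := fun _ => rfl }
  have hk : 0 < Nat.card k := Nat.card_pos
  have hfib : ∀ f : {f : Dual k W // f ∈ R.dualAnnihilator ∧ f ≠ 0},
      Nat.card {x : W // f.1 x = 1} = Nat.card k ^ t := by
    intro f
    have := card_dual_eq_one f.2.2
    rw [Module.natCard_eq_pow_finrank (K := k) (V := W), ht, pow_succ] at this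
    exact Nat.eq_of_mul_eq_mul_right hk this
  have hann : finrank k R.dualAnnihilator = m + 1 := by
    have := Subspace.finrank_add_finrank_dualAnnihilator_eq R
    omega
  have hcard : Nat.card {f : Dual k W // f ∈ R.dualAnnihilator ∧ f ≠ 0} =
      Nat.card k ^ (m + 1) - 1 := by
    have h1 : {f : Dual k W // f ∈ R.dualAnnihilator ∧ f ≠ 0} ≃
        {f : R.dualAnnihilator // f ≠ 0} :=
      { toFun := fun f => ⟨⟨f.1, f.2.1⟩, fun h => f.2.2 (congrArg Subtype.val h)⟩
        invFun := fun f => ⟨f.1.1, f.1.2, fun h => f.2 (Subtype.ext h)⟩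
        left_inv := fun _ => rfl
        right_inv := fun _ => rfl }
    have : Fintype R.dualAnnihilator := Fintype.ofFinite _
    classical
    rw [Nat.card_congr h1, ← hann, ← card_submodule_eq_pow, Nat.card_eq_fintype_card,
      Nat.card_eq_fintype_card, Fintype.card_subtype_compl, Fintype.card_subtype_eq]
  rw [Nat.card_congr e, Nat.card_sigma, Finset.sum_congr rfl (fun f _ => hfib f)]
  rw [Finset.sum_const, Finset.card_univ, smul_eq_mul, ← Nat.card_eq_fintype_card, hcard]

theorem exists_dual_ker_eq {Q : Submodule k W} {x : W} (hx : x ∉ Q)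
    (hQ : Q ⊔ Submodule.span k {x} = ⊤) : ∃ f : Dual k W, f x = 1 ∧ LinearMap.ker f = Q := by
  obtain ⟨f, hfx, hf⟩ := Submodule.exists_le_ker_of_notMem hx
  refine ⟨(f x)⁻¹ • f, by simp [hfx], le_antisymm (fun y hy => ?_) (fun y hy => ?_)⟩
  · have hy' : f y = 0 := by simpa [hfx] using hy
    obtain ⟨z, hz, w, hw, rfl⟩ := Submodule.mem_sup.1 (hQ ▸ Submodule.mem_top : y ∈ Q ⊔ _)
    obtain ⟨c, rfl⟩ := Submodule.mem_span_singleton.1 hw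
    have hz' : f z = 0 := hf hz
    have : c = 0 := by simpa [hz', hfx] using hy'
    simpa [this] using hz
  · have : f y = 0 := hf hy
    simp [this]

/-- The pairs of a hyperplane containing `R` and a vector outside it. -/
theorem card_hyperplane_pairs (R : Submodule k W) {m t : ℕ}
    (hR : finrank k R + (m + 1) = finrank k W) (ht : finrank k W = t + 1) :
    Nat.card {p : Submodule k W × W // R ≤ p.1 ∧ p.2 ∉ p.1 ∧ p.1 ⊔ Submodule.span k {p.2} = ⊤} =
      (Nat.card k ^ (m + 1) - 1) * Nat.card k ^ t := by
  rw [← card_dualAnnihilator_pairs R hR ht]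
  have hmem : ∀ p : {p : Dual k W × W // p.1 ∈ R.dualAnnihilator ∧ p.1 p.2 = 1},
      R ≤ LinearMap.ker p.1.1 ∧ p.1.2 ∉ LinearMap.ker p.1.1 ∧
        LinearMap.ker p.1.1 ⊔ Submodule.span k {p.1.2} = ⊤ := by
    rintro ⟨⟨f, x⟩, hf, hx⟩
    simp only at hf hx ⊢
    refine ⟨fun y hy => (Submodule.mem_dualAnnihilator f).1 hf y hy, by simp [hx], ?_⟩
    refine eq_top_iff.2 fun y _ => Submodule.mem_sup.2 ⟨y - f y • x, by simp [hx], f y • x,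
      Submodule.mem_span_singleton.2 ⟨f y, rfl⟩, by simp⟩
  refine (Nat.card_congr (Equiv.ofBijective
    (fun p => ⟨(LinearMap.ker p.1.1, p.1.2), hmem p⟩) ?_)).symm
  · constructor
    · rintro ⟨⟨f, x⟩, hf, hx⟩ ⟨⟨g, y⟩, hg, hy⟩ h
      simp only [Subtype.mk.injEq, Prod.mk.injEq] at h hx hy
      obtain ⟨h1, rfl⟩ := h
      have : f = g := by
        ext y
        have hz : y - f y • x ∈ LinearMap.ker f := by simp [hx]
        rw [h1] at hz
        have : g y - f y = 0 := by simpa [hy] using hz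
        rw [sub_eq_zero] at this
        exact this.symm
      simp [this]
    · rintro ⟨⟨Q, x⟩, hRQ, hx, hQ⟩
      obtain ⟨f, hf, hker⟩ := exists_dual_ker_eq hx hQ
      exact ⟨⟨(f, x), (Submodule.mem_dualAnnihilator f).2 fun y hy => by
        have : y ∈ LinearMap.ker f := hker ▸ hRQ hy
        exact this, hf⟩, by simp [hker]⟩

theorem card_hyperplane_pairs_of_le {Q' R : Submodule k W} (hRQ : R ≤ Q') {m t : ℕ}
    (hR : finrank k R + (m + 1) = finrank k Q') (ht : finrank k Q' = t + 1) :
    Nat.card {p : Submodule k W × W // R ≤ p.1 ∧ p.2 ∉ p.1 ∧ p.1 ⊔ Submodule.span k {p.2} = Q'} =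
      (Nat.card k ^ (m + 1) - 1) * Nat.card k ^ t := by
  have hfr : finrank k (R.submoduleOf Q') = finrank k R :=
    (Submodule.submoduleOfEquivOfLe hRQ).finrank_eq
  rw [← card_hyperplane_pairs (R.submoduleOf Q') (hfr ▸ hR) ht]
  have hmap : ∀ (A : Submodule k Q') (x : Q'), (A ⊔ Submodule.span k {x}).map Q'.subtype =
      A.map Q'.subtype ⊔ Submodule.span k {(x : W)} := by
    intro A x
    rw [Submodule.map_sup, Submodule.map_span]
    simp
  have hmem : ∀ p : {p : Submodule k Q' × Q' //
      R.submoduleOf Q' ≤ p.1 ∧ p.2 ∉ p.1 ∧ p.1 ⊔ Submodule.span k {p.2} = ⊤},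
      R ≤ p.1.1.map Q'.subtype ∧ (p.1.2 : W) ∉ p.1.1.map Q'.subtype ∧
        p.1.1.map Q'.subtype ⊔ Submodule.span k {(p.1.2 : W)} = Q' := by
    rintro ⟨⟨A, x⟩, h1, h2, h3⟩
    simp only at h1 h2 h3 ⊢
    refine ⟨?_, ?_, ?_⟩
    · have := Submodule.map_mono (f := Q'.subtype) h1
      rwa [Submodule.submoduleOf, Submodule.map_comap_subtype, inf_eq_right.2 hRQ] at this
    · simpa using h2
    · rw [← hmap, h3, Submodule.map_top, Submodule.range_subtype]
  refine (Nat.card_congr (Equiv.ofBijective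
    (fun p => ⟨(p.1.1.map Q'.subtype, (p.1.2 : W)), hmem p⟩) ?_)).symm
  · constructor
    · rintro ⟨⟨A, x⟩, h1⟩ ⟨⟨B, y⟩, h2⟩ h
      simp only [Subtype.mk.injEq, Prod.mk.injEq] at h
      obtain ⟨h3, h4⟩ := h
      have := Submodule.map_injective_of_injective Q'.injective_subtype h3
      simp [this, Subtype.ext h4]
    · rintro ⟨⟨A, x⟩, h1, h2, h3⟩
      simp only at h1 h2 h3
      have hA : A ≤ Q' := h3 ▸ le_sup_left
      have hx : x ∈ Q' := h3 ▸ Submodule.mem_sup_right (Submodule.mem_span_singleton_self x)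
      have hm : (A.submoduleOf Q').map Q'.subtype = A := by
        rw [Submodule.submoduleOf, Submodule.map_comap_subtype, inf_eq_right.2 hA]
      refine ⟨⟨(A.submoduleOf Q', ⟨x, hx⟩), Submodule.comap_mono h1, h2, ?_⟩, ?_⟩
      · apply Submodule.map_injective_of_injective Q'.injective_subtype
        rw [hmap, hm, Submodule.map_top, Submodule.range_subtype]
        exact h3
      · simp [hm]

/-- Double counting of the pairs of a subspace `Q ∈ 𝒬` and a vector `x` with
`Q + k x ∈ 𝒬'`. -/
theorem card_step {𝒬 𝒬' : Set (Submodule k W)} (R : Submodule k W → Submodule k W) {t m : ℕ}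
    {N : ℚ} (h1 : ∀ Q ∈ 𝒬', finrank k Q = t + 1)
    (h2 : ∀ Q ∈ 𝒬', R Q ≤ Q ∧ finrank k (R Q) + (m + 1) = finrank k Q)
    (h3 : ∀ Q' ∈ 𝒬', ∀ Q ≤ Q', finrank k Q = t → (Q ∈ 𝒬 ↔ R Q' ≤ Q))
    (h4 : ∀ Q ∈ 𝒬, (Nat.card {x : W // x ∉ Q ∧ Q ⊔ Submodule.span k {x} ∈ 𝒬'} : ℚ) = N) :
    (Nat.card 𝒬' : ℚ) * (((Nat.card k : ℚ) ^ (m + 1) - 1) * (Nat.card k : ℚ) ^ t) =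
      Nat.card 𝒬 * N := by
  have : Finite W := Module.finite_of_finite k
  have : Fintype 𝒬 := Fintype.ofFinite _
  have : Fintype 𝒬' := Fintype.ofFinite _
  let T := {p : Submodule k W × W // p.1 ∈ 𝒬 ∧ p.2 ∉ p.1 ∧ p.1 ⊔ Submodule.span k {p.2} ∈ 𝒬'}
  have e1 : T ≃ Σ Q : 𝒬, {x : W // x ∉ Q.1 ∧ Q.1 ⊔ Submodule.span k {x} ∈ 𝒬'} :=
    { toFun := fun p => ⟨⟨p.1.1, p.2.1⟩, ⟨p.1.2, p.2.2⟩⟩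
      invFun := fun s => ⟨(s.1.1, s.2.1), s.1.2, s.2.2⟩
      left_inv := fun _ => rfl
      right_inv := fun _ => rfl }
  have e2 : T ≃ Σ Q' : 𝒬', {p : Submodule k W × W //
      R Q'.1 ≤ p.1 ∧ p.2 ∉ p.1 ∧ p.1 ⊔ Submodule.span k {p.2} = Q'.1} := by
    have hfr : ∀ {p : Submodule k W × W} {Q'}, Q' ∈ 𝒬' → p.2 ∉ p.1 →
        p.1 ⊔ Submodule.span k {p.2} = Q' → (p.1 ∈ 𝒬 ↔ R Q' ≤ p.1) := by
      intro p Q' hQ' hx he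
      refine h3 Q' hQ' _ (he ▸ le_sup_left) ?_
      have := Submodule.finrank_sup_span_singleton hx
      rw [he, h1 Q' hQ'] at this
      omega
    exact
    { toFun := fun p => ⟨⟨_, p.2.2.2⟩, ⟨p.1, (hfr p.2.2.2 p.2.2.1 rfl).1 p.2.1, p.2.2.1, rfl⟩⟩
      invFun := fun s => ⟨s.2.1, (hfr s.1.2 s.2.2.2.1 s.2.2.2.2).2 s.2.2.1, s.2.2.2.1,
        s.2.2.2.2.symm ▸ s.1.2⟩
      left_inv := fun _ => rfl
      right_inv := by
        rintro ⟨⟨Q', hQ'⟩, ⟨p, hp1, hp2, hp3⟩⟩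
        dsimp only at hp3
        subst hp3
        rfl }
  have c1 : (Nat.card T : ℚ) = Nat.card 𝒬 * N := by
    rw [Nat.card_congr e1, Nat.card_sigma, Nat.cast_sum,
      Finset.sum_congr rfl (fun Q _ => h4 Q.1 Q.2), Finset.sum_const, Finset.card_univ,
      nsmul_eq_mul, Nat.card_eq_fintype_card (α := 𝒬)]
  have c2 : Nat.card T = Nat.card 𝒬' * ((Nat.card k ^ (m + 1) - 1) * Nat.card k ^ t) := by
    rw [Nat.card_congr e2, Nat.card_sigma, Finset.sum_congr rfl (fun Q _ =>
      card_hyperplane_pairs_of_le (h2 Q.1 Q.2).1 (h2 Q.1 Q.2).2 (h1 Q.1 Q.2)), Finset.sum_const,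
      Finset.card_univ, smul_eq_mul, Nat.card_eq_fintype_card (α := 𝒬')]
  rw [← c1, c2]
  push_cast [Nat.cast_sub (Nat.one_le_pow (m + 1) (Nat.card k) Nat.card_pos)]
  ring

end Step

/-! ### Isotropic subspaces of a filtered space with prescribed graded dimensions -/

/-- Partial sums of a sequence supported on `[-N, N]`. -/
noncomputable def cum {M : Type*} [AddCommMonoid M] (N : ℤ) (u : ℤ → M) (j : ℤ) : M :=
  ∑ l ∈ Finset.Icc (-N) j, u l

theorem cum_of_lt {M : Type*} [AddCommMonoid M] {N : ℤ} (u : ℤ → M) {j : ℤ} (h : j < -N) :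
    cum N u j = 0 := by
  rw [cum, Finset.Icc_eq_empty (by omega), Finset.sum_empty]

theorem cum_eq_add {M : Type*} [AddCommMonoid M] {N : ℤ} (u : ℤ → M) {j : ℤ} (h : -N ≤ j) :
    cum N u j = cum N u (j - 1) + u j := by
  have : Finset.Icc (-N) j = insert j (Finset.Icc (-N) (j - 1)) := by
    ext l
    simp only [Finset.mem_Icc, Finset.mem_insert]
    omega
  rw [cum, cum, this, Finset.sum_insert (by simp), add_comm]

theorem cum_eq_of_vanish {M : Type*} [AddCommMonoid M] {N : ℤ} {u : ℤ → M} {j i : ℤ}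
    (hu : ∀ l, j < l → u l = 0) (hi : j ≤ i) : cum N u i = cum N u j := by
  refine (Finset.sum_subset (Finset.Icc_subset_Icc_right hi) fun l hl hl' => hu l ?_).symm
  simp only [Finset.mem_Icc, not_and, not_le] at hl hl'
  exact hl' hl.1

theorem cum_add {M : Type*} [AddCommMonoid M] (N : ℤ) (u u' : ℤ → M) (j : ℤ) :
    cum N (u + u') j = cum N u j + cum N u' j := by
  simp [cum, Finset.sum_add_distrib]

theorem cum_single {N j : ℤ} (hj : -N ≤ j) (i : ℤ) :
    cum N (Pi.single j 1 : ℤ → ℕ) i = if j ≤ i then 1 else 0 := by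
  simp [cum, Pi.single_apply, hj]

section Flags

variable {k W : Type*} [Field k] [AddCommGroup W] [Module k W]

/-- An increasing filtration with `F j = 0` for `j < -N` and `F j` everything for `j ≥ N`. -/
structure IsFiltration (N : ℤ) (F : ℤ → Submodule k W) : Prop where
  mono : Monotone F
  bot : ∀ j, j < -N → F j = ⊥
  top : ∀ j, N ≤ j → F j = ⊤

/-- The isotropic subspaces with graded dimensions `u`. -/
def flagSet (b : LinearMap.BilinForm k W) (F : ℤ → Submodule k W) (N : ℤ) (u : ℤ → ℕ) :
    Set (Submodule k W) :=
  {Q | (∀ x ∈ Q, ∀ y ∈ Q, b x y = 0) ∧ ∀ j, finrank k ↥(Q ⊓ F j) = cum N u j}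

variable {b : LinearMap.BilinForm k W} {F : ℤ → Submodule k W} {N : ℤ}

theorem finrank_of_mem_flagSet (hF : IsFiltration N F) {u : ℤ → ℕ} {j : ℤ} (hjN : j ≤ N)
    (hu : ∀ l, j < l → u l = 0) {Q : Submodule k W} (hQ : Q ∈ flagSet b F N u) :
    finrank k Q = cum N u j := by
  have := hQ.2 N
  rwa [hF.top N le_rfl, inf_top_eq, cum_eq_of_vanish hu hjN] at this

variable [Finite k] [Module.Finite k W]

theorem le_of_mem_flagSet (hF : IsFiltration N F) {u : ℤ → ℕ} {j : ℤ} (hjN : j ≤ N)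
    (hu : ∀ l, j < l → u l = 0) {Q : Submodule k W} (hQ : Q ∈ flagSet b F N u) : Q ≤ F j := by
  have h := Submodule.eq_of_le_of_finrank_eq (inf_le_left : Q ⊓ F j ≤ Q)
    ((hQ.2 j).trans (finrank_of_mem_flagSet hF hjN hu hQ).symm)
  exact inf_eq_left.1 h

theorem card_mem_notMem {A B : Submodule k W} (h : B ≤ A) :
    (Nat.card {x : W // x ∈ A ∧ x ∉ B} : ℚ) =
      (Nat.card k : ℚ) ^ finrank k A - (Nat.card k : ℚ) ^ finrank k B := by
  have : Finite W := Module.finite_of_finite k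
  have h1 : Set.ncard ((A : Set W) \ B) = Set.ncard (A : Set W) - Set.ncard (B : Set W) :=
    Set.ncard_sdiff h
  have h2 : Set.ncard (B : Set W) ≤ Set.ncard (A : Set W) := Set.ncard_le_ncard h
  have hc : ∀ C : Submodule k W, Set.ncard (C : Set W) = Nat.card k ^ finrank k C :=
    fun C => card_submodule_eq_pow C
  have h3 : Nat.card {x : W // x ∈ A ∧ x ∉ B} = Set.ncard ((A : Set W) \ B) := rfl
  rw [h3, h1, Nat.cast_sub h2, hc, hc]
  push_cast
  rfl

theorem sup_span_mem_flagSet_iff (hF : IsFiltration N F) (hb : b.IsAlt) {u : ℤ → ℕ} {j : ℤ}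
    (hj : -N ≤ j) (hjN : j ≤ N) (hu : ∀ l, j < l → u l = 0) {Q : Submodule k W}
    (hQ : Q ∈ flagSet b F N u) (x : W) :
    (x ∉ Q ∧ Q ⊔ Submodule.span k {x} ∈ flagSet b F N (u + Pi.single j 1)) ↔
      x ∈ F j ⊓ b.orthogonal Q ∧ x ∉ (F (j - 1) ⊓ b.orthogonal Q) ⊔ Q := by
  have hu' : ∀ l, j < l → (u + Pi.single j 1 : ℤ → ℕ) l = 0 := by
    intro l hl
    simp [hu l hl, Pi.single_eq_of_ne (show l ≠ j by omega)]
  have hQF := le_of_mem_flagSet hF hjN hu hQ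
  have hQo : Q ≤ b.orthogonal Q := fun y hy z hz => hQ.1 z hz y hy
  have hxS : x ∈ Q ⊔ Submodule.span k {x} :=
    Submodule.mem_sup_right (Submodule.mem_span_singleton_self x)
  constructor
  · rintro ⟨hx, hS⟩
    have hSF := le_of_mem_flagSet hF hjN hu' hS
    refine ⟨⟨hSF hxS, fun y hy => hS.1 y (Submodule.mem_sup_left hy) x hxS⟩, fun hx' => ?_⟩
    obtain ⟨z, hz, y, hy, rfl⟩ := Submodule.mem_sup.1 hx'
    have hzS : z ∈ Q ⊔ Submodule.span k {z + y} := by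
      have := Submodule.sub_mem _ hxS (Submodule.mem_sup_left hy :
        y ∈ Q ⊔ Submodule.span k {z + y})
      simpa using this
    have hle : Q ⊓ F (j - 1) ≤ (Q ⊔ Submodule.span k {z + y}) ⊓ F (j - 1) :=
      inf_le_inf_right _ le_sup_left
    have heq := Submodule.eq_of_le_of_finrank_eq hle (by
      rw [hQ.2, hS.2, cum_add, cum_single hj, if_neg (by omega), add_zero])
    have : z ∈ Q ⊓ F (j - 1) := heq ▸ ⟨hzS, hz.1⟩
    exact hx (Q.add_mem this.1 hy)
  · rintro ⟨⟨hxF, hxo⟩, hx⟩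
    have hxQ : x ∉ Q := fun h => hx (Submodule.mem_sup_right h)
    refine ⟨hxQ, ?_, fun i => ?_⟩
    · have hxo' : ∀ y ∈ Q, b y x = 0 := hxo
      have hxo'' : ∀ y ∈ Q, b x y = 0 := fun y hy => by
        rw [← neg_eq_zero, hb.neg_eq, hxo' y hy]
      intro y hy z hz
      obtain ⟨y1, hy1, y2, hy2, rfl⟩ := Submodule.mem_sup.1 hy
      obtain ⟨z1, hz1, z2, hz2, rfl⟩ := Submodule.mem_sup.1 hz
      obtain ⟨c, rfl⟩ := Submodule.mem_span_singleton.1 hy2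
      obtain ⟨c', rfl⟩ := Submodule.mem_span_singleton.1 hz2
      simp [hQ.1 y1 hy1 z1 hz1, hxo' y1 hy1, hxo'' z1 hz1, hb.self_eq_zero]
    · rw [cum_add, cum_single hj]
      split_ifs with hi
      · have h1 : Q ⊔ Submodule.span k {x} ≤ F i :=
          (sup_le hQF ((Submodule.span_singleton_le_iff_mem _ _).2 hxF)).trans (hF.mono hi)
        rw [inf_eq_left.2 h1, Submodule.finrank_sup_span_singleton hxQ, ← hQ.2 i,
          inf_eq_left.2 (le_sup_left.trans h1)]
      · rw [add_zero, ← hQ.2 i]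
        suffices h : (Q ⊔ Submodule.span k {x}) ⊓ F i = Q ⊓ F i by rw [h]
        refine le_antisymm (fun y hy => ⟨?_, hy.2⟩) (inf_le_inf_right (F i) le_sup_left)
        obtain ⟨y1, hy1, y2, hy2, rfl⟩ := Submodule.mem_sup.1 hy.1
        obtain ⟨c, rfl⟩ := Submodule.mem_span_singleton.1 hy2
        by_cases hc : c = 0
        · simpa [hc] using hy1
        · exfalso
          apply hx
          have hyj : y1 + c • x ∈ F (j - 1) := hF.mono (by omega) hy.2
          have : x = c⁻¹ • (y1 + c • x) + (-c⁻¹) • y1 := by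
            simp [smul_smul, hc]
          rw [this]
          refine Submodule.add_mem_sup (Submodule.smul_mem _ _ ⟨hyj, ?_⟩) (Q.smul_mem _ hy1)
          exact Submodule.add_mem _ (hQo hy1) (Submodule.smul_mem _ _ hxo)

theorem card_flagSet_step (hF : IsFiltration N F) (hb : b.IsAlt) {u : ℤ → ℕ} {j : ℤ}
    (hj : -N ≤ j) (hjN : j ≤ N) (hu : ∀ l, j < l → u l = 0) {p p' : ℕ}
    (hp : ∀ Q ∈ flagSet b F N u, finrank k ↥(F j ⊓ b.orthogonal Q) = p)
    (hp' : ∀ Q ∈ flagSet b F N u, finrank k ↥((F (j - 1) ⊓ b.orthogonal Q) ⊔ Q) = p') :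
    (Nat.card (flagSet b F N (u + Pi.single j 1)) : ℚ) *
      (((Nat.card k : ℚ) ^ (u j + 1) - 1) * (Nat.card k : ℚ) ^ (cum N u j)) =
      Nat.card (flagSet b F N u) * ((Nat.card k : ℚ) ^ p - (Nat.card k : ℚ) ^ p') := by
  have hu' : ∀ l, j < l → (u + Pi.single j 1 : ℤ → ℕ) l = 0 := by
    intro l hl
    simp [hu l hl, Pi.single_eq_of_ne (show l ≠ j by omega)]
  have hfr : ∀ Q ∈ flagSet b F N (u + Pi.single j 1), finrank k Q = cum N u j + 1 := by
    intro Q hQ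
    rw [finrank_of_mem_flagSet hF hjN hu' hQ, cum_add, cum_single hj, if_pos le_rfl]
  have hR : ∀ Q ∈ flagSet b F N (u + Pi.single j 1),
      finrank k ↥(Q ⊓ F (j - 1)) = cum N u (j - 1) := by
    intro Q hQ
    rw [hQ.2, cum_add, cum_single hj, if_neg (by omega), add_zero]
  refine card_step (fun Q => Q ⊓ F (j - 1)) hfr (fun Q hQ => ⟨inf_le_left, ?_⟩) ?_ ?_
  · rw [hR Q hQ, hfr Q hQ, cum_eq_add u hj, add_assoc]
  · intro Q' hQ' Q hQQ hQ
    constructor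
    · intro h
      have := Submodule.eq_of_le_of_finrank_eq (inf_le_inf_right (F (j - 1)) hQQ)
        (by rw [hR Q' hQ', h.2])
      rw [← this]
      exact inf_le_left
    · intro h
      refine ⟨fun x hx y hy => hQ'.1 x (hQQ hx) y (hQQ hy), fun i => ?_⟩
      by_cases hi : j ≤ i
      · rw [inf_eq_left.2 (hQQ.trans ((le_of_mem_flagSet hF hjN hu' hQ').trans (hF.mono hi))),
          hQ, cum_eq_of_vanish hu hi]
      · have : Q ⊓ F i = Q' ⊓ F i := by
          refine le_antisymm (inf_le_inf_right _ hQQ) (le_inf ?_ inf_le_right)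
          exact (inf_le_inf_left _ (hF.mono (by omega))).trans h
        rw [this, hQ'.2, cum_add, cum_single hj, if_neg hi, add_zero]
  · intro Q hQ
    have hQF := le_of_mem_flagSet hF hjN hu hQ
    have hQo : Q ≤ b.orthogonal Q := fun y hy z hz => hQ.1 z hz y hy
    rw [← hp Q hQ, ← hp' Q hQ, ← card_mem_notMem (sup_le (inf_le_inf_right _
      (hF.mono (by omega))) (le_inf hQF hQo))]
    exact congrArg _ (Nat.card_congr
      (Equiv.subtypeEquivRight (sup_span_mem_flagSet_iff hF hb hj hjN hu hQ)))

theorem finrank_sup_inf_orthogonal {u : ℤ → ℕ} {Q : Submodule k W} (hQ : Q ∈ flagSet b F N u)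
    (i : ℤ) : finrank k ↥((F i ⊓ b.orthogonal Q) ⊔ Q) + cum N u i =
      finrank k ↥(F i ⊓ b.orthogonal Q) + finrank k Q := by
  have hQo : Q ≤ b.orthogonal Q := fun y hy z hz => hQ.1 z hz y hy
  rw [← Submodule.finrank_sup_add_finrank_inf_eq, inf_assoc, inf_eq_right.2 hQo, inf_comm (F i) Q, hQ.2]

theorem flagSet_zero (hF : IsFiltration N F) : flagSet b F N 0 = {⊥} := by
  ext Q
  constructor
  · intro hQ
    have := hQ.2 N
    rw [hF.top N le_rfl, inf_top_eq] at this
    simpa [cum] using this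
  · rintro rfl
    exact ⟨by simp, by simp [cum]⟩

/-- The recursion for plain subspaces. -/
theorem card_flagSet_zero_step (hF : IsFiltration N F) {u : ℤ → ℕ} {j : ℤ}
    (hj : -N ≤ j) (hjN : j ≤ N) (hu : ∀ l, j < l → u l = 0) :
    (Nat.card (flagSet 0 F N (u + Pi.single j 1)) : ℚ) *
      (((Nat.card k : ℚ) ^ (u j + 1) - 1) * (Nat.card k : ℚ) ^ (cum N u j)) =
      Nat.card (flagSet 0 F N u) * ((Nat.card k : ℚ) ^ finrank k (F j) -
        (Nat.card k : ℚ) ^ (finrank k (F (j - 1)) + u j)) := by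
  have ho : ∀ Q : Submodule k W, LinearMap.BilinForm.orthogonal 0 Q = ⊤ := by
    intro Q
    ext x
    simp [LinearMap.BilinForm.mem_orthogonal_iff]
  refine card_flagSet_step hF (fun x => by simp) hj hjN hu (fun Q hQ => ?_) (fun Q hQ => ?_)
  · rw [ho, inf_top_eq]
  · have h := finrank_sup_inf_orthogonal hQ (j - 1)
    rw [finrank_of_mem_flagSet hF hjN hu hQ, cum_eq_add u hj, ho, inf_top_eq] at h
    rw [ho, inf_top_eq]
    omega

theorem finrank_inf_orthogonal (hnd : b.Nondegenerate)
    (ho : ∀ j, b.orthogonal (F j) = F (-j - 1)) {u : ℤ → ℕ} {Q : Submodule k W}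
    (hQ : Q ∈ flagSet b F N u) (i : ℤ) :
    finrank k ↥(F i ⊓ b.orthogonal Q) + finrank k Q = finrank k (F i) + cum N u (-i - 1) := by
  have h1 : F i ⊓ b.orthogonal Q = b.orthogonal (F (-i - 1) ⊔ Q) := by
    rw [← show b.orthogonal (F (-i - 1)) = F i by rw [ho]; congr 1; ring]
    ext x
    simp only [Submodule.mem_inf, LinearMap.BilinForm.mem_orthogonal_iff]
    constructor
    · rintro ⟨h1, h2⟩ y hy
      obtain ⟨y1, hy1, y2, hy2, rfl⟩ := Submodule.mem_sup.1 hy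
      have e1 := h1 y1 hy1
      have e2 := h2 y2 hy2
      simp [e1, e2]
    · exact fun h => ⟨fun y hy => h y (Submodule.mem_sup_left hy),
        fun y hy => h y (Submodule.mem_sup_right hy)⟩
  have h2 := LinearMap.BilinForm.finrank_orthogonal hnd (F (-i - 1) ⊔ Q)
  have h3 := LinearMap.BilinForm.finrank_orthogonal hnd (F i)
  have h4 := Submodule.finrank_sup_add_finrank_inf_eq (F (-i - 1)) Q
  have h5 : finrank k ↥(F (-i - 1) ⊓ Q) = cum N u (-i - 1) := by rw [inf_comm]; exact hQ.2 _
  have h6 := Submodule.finrank_le (F (-i - 1) ⊔ Q)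
  have h7 := Submodule.finrank_le (F i)
  rw [ho] at h3
  rw [h1]
  omega

/-- The recursion for isotropic subspaces of a symplectic space with a self-dual filtration. -/
theorem card_flagSet_symp_step (hF : IsFiltration N F) (hb : b.IsAlt) (hnd : b.Nondegenerate)
    (ho : ∀ j, b.orthogonal (F j) = F (-j - 1)) {u : ℤ → ℕ} {j : ℤ}
    (hj : -N ≤ j) (hjN : j ≤ N) (hu : ∀ l, j < l → u l = 0) :
    (Nat.card (flagSet b F N (u + Pi.single j 1)) : ℚ) *
      (((Nat.card k : ℚ) ^ (u j + 1) - 1) * (Nat.card k : ℚ) ^ (cum N u j)) =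
      Nat.card (flagSet b F N u) *
        ((Nat.card k : ℚ) ^ ((finrank k (F j) : ℤ) + cum N u (-j - 1) - cum N u j) -
        (Nat.card k : ℚ) ^ ((finrank k (F (j - 1)) : ℤ) + cum N u (-j) - cum N u (j - 1))) := by
  by_cases hne : (flagSet b F N u).Nonempty
  · obtain ⟨Q₀, hQ₀⟩ := hne
    have e1 := fun Q hQ => finrank_inf_orthogonal (N := N) hnd ho (Q := Q) (u := u) hQ
    have e2 := fun Q hQ => finrank_sup_inf_orthogonal (b := b) (F := F) (N := N) (Q := Q) (u := u) hQ
    have e3 := fun Q hQ => finrank_of_mem_flagSet (b := b) hF hjN hu (Q := Q) hQ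
    have := card_flagSet_step hF hb hj hjN hu (p := finrank k ↥(F j ⊓ b.orthogonal Q₀))
      (p' := finrank k ↥((F (j - 1) ⊓ b.orthogonal Q₀) ⊔ Q₀)) (fun Q hQ => by
        have := e1 Q hQ j
        have := e1 Q₀ hQ₀ j
        have := e3 Q hQ
        have := e3 Q₀ hQ₀
        omega) (fun Q hQ => by
        have := e1 Q hQ (j - 1)
        have := e1 Q₀ hQ₀ (j - 1)
        have := e2 Q hQ (j - 1)
        have := e2 Q₀ hQ₀ (j - 1)
        have := e3 Q hQ
        have := e3 Q₀ hQ₀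
        omega)
    rw [this, ← zpow_natCast, ← zpow_natCast]
    have h1 := e1 Q₀ hQ₀ j
    have h2 := e1 Q₀ hQ₀ (j - 1)
    have h3 := e2 Q₀ hQ₀ (j - 1)
    have h4 := e3 Q₀ hQ₀
    rw [show -(j - 1) - 1 = -j by ring] at h2
    congr 3 <;> omega
  · have h0 : flagSet b F N u = ∅ := Set.not_nonempty_iff_eq_empty.1 hne
    have := card_flagSet_step hF hb hj hjN hu (p := 0) (p' := 0) (by simp [h0]) (by simp [h0])
    rw [this, h0]
    simp

end Flags

/-! ### Closed formulas for the numbers of subspaces -/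

section QNumbers

variable {K : Type*} [Field K]

/-- The Gaussian binomial coefficient at an element `x` of a field. -/
noncomputable def gaussBinom (x : K) (a : ℤ) (b : ℕ) : K :=
  ∏ i ∈ Finset.Icc 1 b, (x ^ (a - i + 1) - 1) / (x ^ (i : ℤ) - 1)

@[simp] theorem gaussBinom_zero (x : K) (a : ℤ) : gaussBinom x a 0 = 1 := by
  simp [gaussBinom]

theorem gaussBinom_succ {x : K} (a : ℤ) (b : ℕ) (hx : x ^ (b + 1) ≠ 1) :
    gaussBinom x a (b + 1) * (x ^ (b + 1) - 1) = gaussBinom x a b * (x ^ (a - b) - 1) := by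
  have h : x ^ (b + 1) - 1 ≠ 0 := sub_ne_zero.2 hx
  have h2 : x ^ (((b + 1 : ℕ) : ℤ)) - 1 = x ^ (b + 1) - 1 := by rw [zpow_natCast]
  rw [gaussBinom, Finset.prod_Icc_succ_top (by omega), ← gaussBinom, h2,
    show a - ((b + 1 : ℕ) : ℤ) + 1 = a - b by push_cast; ring]
  field_simp

/-- `∑ p_l r_j` over the pairs of indices in `[-N, N]` satisfying `P l j`. -/
noncomputable def pairSum (P : ℤ → ℤ → Prop) [∀ l j, Decidable (P l j)] (N : ℤ) (p r : ℤ → ℤ) :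
    ℤ :=
  ∑ j ∈ Finset.Icc (-N) N, ∑ l ∈ Finset.Icc (-N) N, if P l j then p l * r j else 0

variable {P : ℤ → ℤ → Prop} [∀ l j, Decidable (P l j)] {N : ℤ}

theorem pairSum_add_left (p p' r : ℤ → ℤ) :
    pairSum P N (p + p') r = pairSum P N p r + pairSum P N p' r := by
  simp only [pairSum, ← Finset.sum_add_distrib]
  refine Finset.sum_congr rfl fun j _ => Finset.sum_congr rfl fun l _ => ?_
  split_ifs <;> simp [add_mul]

theorem pairSum_add_right (p r r' : ℤ → ℤ) :
    pairSum P N p (r + r') = pairSum P N p r + pairSum P N p r' := by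
  simp only [pairSum, ← Finset.sum_add_distrib]
  refine Finset.sum_congr rfl fun j _ => Finset.sum_congr rfl fun l _ => ?_
  split_ifs <;> simp [mul_add]

theorem pairSum_sub_left (p p' r : ℤ → ℤ) :
    pairSum P N (p - p') r = pairSum P N p r - pairSum P N p' r := by
  rw [eq_sub_iff_add_eq, ← pairSum_add_left, sub_add_cancel]

theorem pairSum_single_right (p : ℤ → ℤ) {j : ℤ} (hj : j ∈ Finset.Icc (-N) N) :
    pairSum P N p (Pi.single j 1) = ∑ l ∈ Finset.Icc (-N) N, if P l j then p l else 0 := by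
  rw [pairSum, Finset.sum_eq_single j]
  · simp
  · intro i _ hi
    simp [Pi.single_eq_of_ne hi]
  · exact fun h => absurd hj h

theorem pairSum_single_left (r : ℤ → ℤ) {l : ℤ} (hl : l ∈ Finset.Icc (-N) N) :
    pairSum P N (Pi.single l 1) r = ∑ j ∈ Finset.Icc (-N) N, if P l j then r j else 0 := by
  rw [pairSum]
  refine Finset.sum_congr rfl fun j _ => ?_
  rw [Finset.sum_eq_single l]
  · simp
  · intro i _ hi
    simp [Pi.single_eq_of_ne hi]
  · exact fun h => absurd hl h

theorem sum_ite_lt_eq_cum (p : ℤ → ℤ) {j : ℤ} (hj : j ≤ N) :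
    (∑ l ∈ Finset.Icc (-N) N, if l < j then p l else 0) = cum N p (j - 1) := by
  rw [← Finset.sum_filter, cum]
  refine Finset.sum_congr ?_ fun _ _ => rfl
  ext l
  simp only [Finset.mem_filter, Finset.mem_Icc]
  omega

/-- The sequence of integers underlying a sequence of natural numbers. -/
abbrev toZ (u : ℤ → ℕ) : ℤ → ℤ := fun j => u j

theorem toZ_add_single (u : ℤ → ℕ) (j : ℤ) :
    toZ (u + Pi.single j 1) = toZ u + Pi.single j 1 := by
  funext i
  by_cases h : i = j
  · subst h; simp [toZ]
  · simp [toZ, Pi.single_eq_of_ne h]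

theorem cum_toZ (u : ℤ → ℕ) (j : ℤ) : cum N (toZ u) j = (cum N u j : ℕ) := by
  simp [cum, toZ]

/-- The number of subspaces with graded dimensions `u` in a space with graded dimensions `a`. -/
noncomputable def subspaceCount (x : K) (N : ℤ) (a : ℤ → ℤ) (u : ℤ → ℕ) : K :=
  (∏ j ∈ Finset.Icc (-N) N, gaussBinom x (a j) (u j)) *
    x ^ pairSum (· < ·) N (a - toZ u) (toZ u)

/-- The exponent of the leading power in `isotropicCount`. -/
noncomputable def isotropicExp (N : ℤ) (a : ℤ → ℤ) (u : ℤ → ℕ) : ℤ :=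
  pairSum (· < ·) N (a - toZ u) (toZ u) - pairSum (fun l j => |l| < j) N (toZ u) (toZ u) -
    ∑ l ∈ Finset.Icc 1 N, (u l : ℤ) * (u l - 1) / 2

/-- The number of isotropic subspaces with graded dimensions `u` in a symplectic space with
graded dimensions `a`. -/
noncomputable def isotropicCount (x : K) (N : ℤ) (a : ℤ → ℤ) (u : ℤ → ℕ) : K :=
  (∏ j ∈ Finset.Icc 1 N, gaussBinom x (a j) (u j) * gaussBinom x (a j - u j) (u (-j))) *
    (∏ i ∈ Finset.range (u 0), (x ^ (a 0 - 2 * i) - 1) / (x ^ (i + 1) - 1)) *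
    x ^ isotropicExp N a u

theorem prod_update {ι : Type*} [DecidableEq ι] {M : Type*} [CommMonoid M] {s : Finset ι} {j : ι}
    (hj : j ∈ s) {f g : ι → M} {c c' : M} (h : ∀ i ∈ s, i ≠ j → f i = g i)
    (hfg : f j * c = g j * c') : (∏ i ∈ s, f i) * c = (∏ i ∈ s, g i) * c' := by
  rw [← Finset.mul_prod_erase s f hj, ← Finset.mul_prod_erase s g hj,
    Finset.prod_congr rfl (fun i hi => h i (Finset.mem_of_mem_erase hi) (Finset.ne_of_mem_erase hi)),
    mul_right_comm, hfg, mul_right_comm]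

theorem pairSum_lt_step (a : ℤ → ℤ) {u : ℤ → ℕ} {j : ℤ} (hj : -N ≤ j) (hjN : j ≤ N)
    (hu : ∀ l, j < l → u l = 0) :
    pairSum (· < ·) N (a - toZ (u + Pi.single j 1)) (toZ (u + Pi.single j 1)) =
      pairSum (· < ·) N (a - toZ u) (toZ u) + (cum N a (j - 1) - cum N u (j - 1)) := by
  have hjm : j ∈ Finset.Icc (-N) N := Finset.mem_Icc.2 ⟨hj, hjN⟩
  rw [toZ_add_single, ← sub_sub, pairSum_add_right, pairSum_sub_left _ (Pi.single j 1),
    pairSum_sub_left _ (Pi.single j 1), pairSum_single_left _ hjm, pairSum_single_left _ hjm,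
    pairSum_single_right _ hjm, sum_ite_lt_eq_cum _ hjN]
  have h1 : (∑ i ∈ Finset.Icc (-N) N, if j < i then toZ u i else 0) = 0 :=
    Finset.sum_eq_zero fun i _ => by
      split_ifs with h
      · simp [toZ, hu i h]
      · rfl
  have h2 : (∑ i ∈ Finset.Icc (-N) N, if j < i then (Pi.single j 1 : ℤ → ℤ) i else 0) = 0 :=
    Finset.sum_eq_zero fun i _ => by
      split_ifs with h
      · simp [Pi.single_eq_of_ne (show i ≠ j by omega)]
      · rfl
  have h3 : cum N (a - toZ u) (j - 1) = cum N a (j - 1) - cum N u (j - 1) := by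
    rw [eq_sub_iff_add_eq, ← cum_toZ, ← cum_add, sub_add_cancel]
  rw [h1, h2, h3]
  ring

theorem subspaceCount_step {x : K} (hx0 : x ≠ 0) (hx : ∀ m : ℕ, x ^ (m + 1) ≠ 1) (a : ℤ → ℤ)
    {u : ℤ → ℕ} {j : ℤ} (hj : -N ≤ j) (hjN : j ≤ N) (hu : ∀ l, j < l → u l = 0) :
    subspaceCount x N a (u + Pi.single j 1) * ((x ^ (u j + 1) - 1) * x ^ cum N u j) =
      subspaceCount x N a u * (x ^ cum N a j - x ^ (cum N a (j - 1) + u j)) := by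
  have hjm : j ∈ Finset.Icc (-N) N := Finset.mem_Icc.2 ⟨hj, hjN⟩
  have hp : (∏ i ∈ Finset.Icc (-N) N, gaussBinom x (a i) ((u + Pi.single j 1 : ℤ → ℕ) i)) *
      (x ^ (u j + 1) - 1) = (∏ i ∈ Finset.Icc (-N) N, gaussBinom x (a i) (u i)) *
      (x ^ (a j - u j) - 1) := by
    refine prod_update hjm (fun i _ hi => by simp [Pi.single_eq_of_ne hi]) ?_
    simpa using gaussBinom_succ (a j) (u j) (hx _)
  rw [subspaceCount, subspaceCount, pairSum_lt_step a hj hjN hu, zpow_add₀ hx0, cum_eq_add u hj, cum_eq_add a hj, pow_add]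
  have e1 : x ^ (cum N a (j - 1) + a j) - x ^ (cum N a (j - 1) + u j) =
      x ^ (cum N a (j - 1) + u j) * (x ^ (a j - u j) - 1) := by
    rw [mul_sub, ← zpow_add₀ hx0, mul_one]
    congr 2
    ring
  have e2 : x ^ (cum N a (j - 1) - ((cum N u (j - 1) : ℕ) : ℤ)) * (x ^ cum N u (j - 1) * x ^ u j) =
      x ^ (cum N a (j - 1) + u j) := by
    rw [← zpow_natCast, ← zpow_natCast, ← zpow_add₀ hx0, ← zpow_add₀ hx0]
    congr 1
    ring
  rw [e1, ← e2]
  linear_combination (x ^ pairSum (· < ·) N (a - toZ u) (toZ u) *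
    x ^ (cum N a (j - 1) - ((cum N u (j - 1) : ℕ) : ℤ)) * (x ^ cum N u (j - 1) * x ^ u j)) * hp

theorem sum_ite_abs_lt (p : ℤ → ℤ) {j : ℤ} (hjN : j ≤ N) :
    (∑ l ∈ Finset.Icc (-N) N, if |l| < j then p l else 0) =
      if 0 < j then cum N p (j - 1) - cum N p (-j) else 0 := by
  split_ifs with h
  · rw [eq_sub_iff_add_eq', cum, cum, ← Finset.sum_filter, ← Finset.sum_union]
    · refine Finset.sum_congr ?_ fun _ _ => rfl
      ext l
      simp only [Finset.mem_filter, Finset.mem_Icc, Finset.mem_union, abs_lt]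
      omega
    · rw [Finset.disjoint_left]
      intro l
      simp only [Finset.mem_filter, Finset.mem_Icc, abs_lt]
      omega
  · refine Finset.sum_eq_zero fun l _ => if_neg fun h' => h ((abs_nonneg l).trans_lt h')

theorem isotropicExp_step (a : ℤ → ℤ)
    {u : ℤ → ℕ} {j : ℤ} (hj : -N ≤ j) (hjN : j ≤ N) (hu : ∀ l, j < l → u l = 0) :
    isotropicExp N a (u + Pi.single j 1) = isotropicExp N a u +
      (cum N a (j - 1) - cum N u (j - 1)) -
        if 0 < j then (cum N u (j - 1) - cum N u (-j) + u j : ℤ) else 0 := by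
  have hjm : j ∈ Finset.Icc (-N) N := Finset.mem_Icc.2 ⟨hj, hjN⟩
  have h1 : pairSum (fun l j => |l| < j) N (toZ (u + Pi.single j 1)) (toZ (u + Pi.single j 1)) =
      pairSum (fun l j => |l| < j) N (toZ u) (toZ u) +
        if 0 < j then (cum N u (j - 1) - cum N u (-j) : ℤ) else 0 := by
    rw [toZ_add_single, pairSum_add_right, pairSum_add_left, pairSum_add_left,
      pairSum_single_left _ hjm, pairSum_single_left _ hjm, pairSum_single_right _ hjm,
      sum_ite_abs_lt _ hjN, cum_toZ, cum_toZ]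
    have h2 : (∑ i ∈ Finset.Icc (-N) N, if |j| < i then toZ u i else 0) = 0 :=
      Finset.sum_eq_zero fun i _ => by
        split_ifs with h
        · simp [toZ, hu i ((le_abs_self j).trans_lt h)]
        · rfl
    have h3 : (∑ i ∈ Finset.Icc (-N) N, if |j| < i then (Pi.single j 1 : ℤ → ℤ) i else 0) = 0 :=
      Finset.sum_eq_zero fun i _ => by
        split_ifs with h
        · have := (le_abs_self j).trans_lt h
          simp [Pi.single_eq_of_ne (show i ≠ j by omega)]
        · rfl
    rw [h2, h3]
    ring
  have h4 : ∑ l ∈ Finset.Icc 1 N, (((u + Pi.single j 1 : ℤ → ℕ) l : ℕ) : ℤ) *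
      (((u + Pi.single j 1 : ℤ → ℕ) l : ℕ) - 1) / 2 =
      ∑ l ∈ Finset.Icc 1 N, (u l : ℤ) * (u l - 1) / 2 + if 0 < j then (u j : ℤ) else 0 := by
    have h5 : ∀ l ∈ Finset.Icc 1 N, (((u + Pi.single j 1 : ℤ → ℕ) l : ℕ) : ℤ) *
        (((u + Pi.single j 1 : ℤ → ℕ) l : ℕ) - 1) / 2 =
        (u l : ℤ) * (u l - 1) / 2 + if l = j then (u j : ℤ) else 0 := by
      intro l _
      by_cases hl : l = j
      · subst hl
        simp only [Pi.add_apply, Pi.single_eq_same, if_true]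
        rw [← Int.add_mul_ediv_right _ _ two_ne_zero]
        congr 1
        push_cast
        ring
      · simp [hl]
    rw [Finset.sum_congr rfl h5, Finset.sum_add_distrib, Finset.sum_ite_eq']
    congr 1
    simp only [Finset.mem_Icc]
    congr 1
    apply propext
    omega
  rw [isotropicExp, isotropicExp, pairSum_lt_step a hj hjN hu, h1, h4]
  split_ifs <;> ring

theorem gaussBinom_pred {x : K} (hx : ∀ m : ℕ, x ^ (m + 1) ≠ 1) (b : ℤ) (r : ℕ) :
    (x ^ b - 1) * gaussBinom x (b - 1) r = gaussBinom x b r * (x ^ (b - r) - 1) := by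
  induction r with
  | zero => simp
  | succ r ih =>
    have h : x ^ (r + 1) - 1 ≠ 0 := sub_ne_zero.2 (hx r)
    apply mul_right_cancel₀ h
    have h1 := gaussBinom_succ (b - 1) r (hx r)
    have h2 := gaussBinom_succ b r (hx r)
    rw [show b - 1 - (r : ℤ) = b - ((r + 1 : ℕ) : ℤ) by push_cast; ring] at h1
    linear_combination (x ^ b - 1) * h1 - (x ^ (b - ((r + 1 : ℕ) : ℤ)) - 1) * h2 +
      (x ^ (b - ((r + 1 : ℕ) : ℤ)) - 1) * ih

theorem isotropicCount_step {x : K} (hx0 : x ≠ 0) (hx : ∀ m : ℕ, x ^ (m + 1) ≠ 1) {a : ℤ → ℤ}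
    (ha : ∀ j, a (-j) = a j) {u : ℤ → ℕ} {j : ℤ} (hj : -N ≤ j) (hjN : j ≤ N)
    (hu : ∀ l, j < l → u l = 0) :
    isotropicCount x N a (u + Pi.single j 1) * ((x ^ (u j + 1) - 1) * x ^ cum N u j) =
      isotropicCount x N a u * (x ^ (cum N a j + cum N u (-j - 1) - cum N u j) -
        x ^ (cum N a (j - 1) + cum N u (-j) - cum N u (j - 1))) := by
  have hc1 := cum_eq_add u hj
  have hc2 := cum_eq_add a hj
  obtain ⟨e, he, hp⟩ : ∃ e : ℤ, cum N a j + cum N u (-j - 1) - cum N u j -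
        (cum N a (j - 1) + cum N u (-j) - cum N u (j - 1)) = e ∧
      ((∏ i ∈ Finset.Icc 1 N, gaussBinom x (a i) ((u + Pi.single j 1 : ℤ → ℕ) i) *
        gaussBinom x (a i - (u + Pi.single j 1 : ℤ → ℕ) i) ((u + Pi.single j 1 : ℤ → ℕ) (-i))) *
      (∏ i ∈ Finset.range ((u + Pi.single j 1 : ℤ → ℕ) 0),
        (x ^ (a 0 - 2 * i) - 1) / (x ^ (i + 1) - 1))) * (x ^ (u j + 1) - 1) =
      ((∏ j ∈ Finset.Icc 1 N, gaussBinom x (a j) (u j) * gaussBinom x (a j - u j) (u (-j))) *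
      (∏ i ∈ Finset.range (u 0), (x ^ (a 0 - 2 * i) - 1) / (x ^ (i + 1) - 1))) * (x ^ e - 1) := by
    rcases lt_trichotomy j 0 with hj0 | rfl | hj0
    · refine ⟨a j - u j, ?_, ?_⟩
      · rw [cum_eq_of_vanish hu (show j ≤ -j - 1 by omega),
          cum_eq_of_vanish hu (show j ≤ -j by omega)]
        omega
      · rw [Pi.add_apply, Pi.single_eq_of_ne hj0.ne', add_zero, mul_right_comm, mul_right_comm _ _
          (x ^ (a j - u j) - 1)]
        congr 1
        refine prod_update (j := -j) (by simp; omega) (fun i hi hij => ?_) ?_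
        · rw [Finset.mem_Icc] at hi
          simp [show i ≠ j by omega, show -i ≠ j by omega]
        · have h := gaussBinom_succ (a j) (u j) (hx _)
          simp [show -j ≠ j by omega, hu (-j) (by omega), ha, h]
    · refine ⟨a 0 - 2 * u 0, ?_, ?_⟩
      · simp only [neg_zero] at *
        rw [show (0 : ℤ) - 1 = -1 by rfl] at *
        omega
      · rw [mul_assoc, mul_assoc]
        congr 1
        · refine Finset.prod_congr rfl fun i hi => ?_
          rw [Finset.mem_Icc] at hi
          simp [show i ≠ 0 by omega]
        · have h : x ^ (u 0 + 1) - 1 ≠ 0 := sub_ne_zero.2 (hx _)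
          simp only [Pi.add_apply, Pi.single_eq_same, Finset.prod_range_succ]
          field_simp
    · refine ⟨a j - u j - u (-j), ?_, ?_⟩
      · have := cum_eq_add u (show -N ≤ -j by omega)
        omega
      · rw [Pi.add_apply, Pi.single_eq_of_ne hj0.ne, add_zero, mul_right_comm, mul_right_comm _ _
          (x ^ (a j - u j - u (-j)) - 1)]
        congr 1
        refine prod_update (j := j) (by simp; omega) (fun i hi hij => ?_) ?_
        · rw [Finset.mem_Icc] at hi
          simp [hij, show -i ≠ j by omega]
        · have h1 := gaussBinom_succ (a j) (u j) (hx _)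
          have h2 := gaussBinom_pred hx (a j - u j) (u (-j))
          rw [sub_sub] at h2
          simp only [Pi.add_apply, Pi.single_eq_same, Pi.single_eq_of_ne (show -j ≠ j by omega),
            add_zero, Nat.cast_add, Nat.cast_one]
          linear_combination gaussBinom x (a j - (u j + 1)) (u (-j)) * h1 +
            gaussBinom x (a j) (u j) * h2
  have hE := isotropicExp_step a hj hjN hu
  have hexp : isotropicExp N a (u + Pi.single j 1) + cum N u j = isotropicExp N a u +
      (cum N a (j - 1) + cum N u (-j) - cum N u (j - 1)) := by
    rw [hE]
    split_ifs with h
    · omega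
    · rw [cum_eq_of_vanish hu (show j ≤ -j by omega)]
      omega
  have h1 : x ^ isotropicExp N a (u + Pi.single j 1) * x ^ cum N u j = x ^ isotropicExp N a u *
      x ^ (cum N a (j - 1) + cum N u (-j) - cum N u (j - 1)) := by
    rw [← zpow_natCast, ← zpow_add₀ hx0, ← zpow_add₀ hx0, hexp]
  have h2 : x ^ (cum N a j + cum N u (-j - 1) - cum N u j) =
      x ^ (cum N a (j - 1) + cum N u (-j) - cum N u (j - 1)) * x ^ e := by
    rw [← zpow_add₀ hx0]
    congr 1
    omega
  rw [isotropicCount, isotropicCount, h2]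
  linear_combination (x ^ isotropicExp N a (u + Pi.single j 1) * x ^ cum N u j) * hp +
    ((∏ j ∈ Finset.Icc 1 N, gaussBinom x (a j) (u j) * gaussBinom x (a j - u j) (u (-j))) *
      (∏ i ∈ Finset.range (u 0), (x ^ (a 0 - 2 * i) - 1) / (x ^ (i + 1) - 1)) * (x ^ e - 1)) * h1

end QNumbers

/-- Induction on sequences supported on `[-N, N]`, where the new unit is put at the last index. -/
theorem induction_on_last {N : ℤ} {motive : (ℤ → ℕ) → Prop} (zero : motive 0)
    (step : ∀ (u : ℤ → ℕ) (j : ℤ), -N ≤ j → j ≤ N → (∀ l, j < l → u l = 0) →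
      (∀ l, l < -N → u l = 0) → motive u → motive (u + Pi.single j 1))
    (u : ℤ → ℕ) (hu : ∀ l, l ∉ Finset.Icc (-N) N → u l = 0) : motive u := by
  induction h : ∑ l ∈ Finset.Icc (-N) N, u l generalizing u with
  | zero =>
    have : u = 0 := by
      funext l
      by_cases hl : l ∈ Finset.Icc (-N) N
      · exact Finset.sum_eq_zero_iff.1 h l hl
      · exact hu l hl
    exact this ▸ zero
  | succ t ih =>
    have hne : ((Finset.Icc (-N) N).filter fun l => u l ≠ 0).Nonempty := by
      by_contra hne
      rw [Finset.not_nonempty_iff_eq_empty] at hne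
      have : ∑ l ∈ Finset.Icc (-N) N, u l = 0 := Finset.sum_eq_zero fun l hl => by
        by_contra h'
        have : l ∈ (Finset.Icc (-N) N).filter fun l => u l ≠ 0 := Finset.mem_filter.2 ⟨hl, h'⟩
        simp [hne] at this
      omega
    set j := Finset.max' _ hne with hjdef
    have hj := Finset.max'_mem _ hne
    rw [← hjdef, Finset.mem_filter, Finset.mem_Icc] at hj
    obtain ⟨⟨hj1, hj2⟩, hj3⟩ := hj
    have hlast : ∀ l, j < l → u l = 0 := by
      intro l hl
      by_contra hne'
      have hl' : l ∈ Finset.Icc (-N) N := by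
        by_contra h'
        exact hne' (hu l h')
      have := Finset.le_max' _ l (Finset.mem_filter (p := fun l => u l ≠ 0).2 ⟨hl', hne'⟩)
      omega
    have hu' : u = (u - Pi.single j 1) + Pi.single j 1 := by
      funext l
      by_cases hl : l = j
      · subst hl
        simp
        omega
      · simp [Pi.single_eq_of_ne hl]
    have hle : ∀ l, (u - Pi.single j 1 : ℤ → ℕ) l ≤ u l := fun l => Nat.sub_le _ _
    rw [hu']
    refine step _ j hj1 hj2 (fun l hl => ?_) (fun l hl => ?_) (ih _ (fun l hl => ?_) ?_)
    · have := hle l; rw [hlast l hl] at this; omega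
    · have := hle l; rw [hu l (by simp; omega)] at this; omega
    · have := hle l; rw [hu l hl] at this; omega
    · rw [hu'] at h
      simp only [Pi.add_apply, Finset.sum_add_distrib] at h
      have h1 : ∑ l ∈ Finset.Icc (-N) N, (Pi.single j 1 : ℤ → ℕ) l = 1 := by
        simp [Pi.single_apply, hj1, hj2]
      omega

section Count

variable {k W : Type*} [Field k] [AddCommGroup W] [Module k W] [Finite k] [Module.Finite k W]
  {b : LinearMap.BilinForm k W} {F : ℤ → Submodule k W} {N : ℤ}

theorem cum_eq_finrank (hF : IsFiltration N F) {a : ℤ → ℤ}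
    (ha : ∀ j, a j = finrank k (F j) - finrank k (F (j - 1))) {j : ℤ} (hj : -N - 1 ≤ j) :
    cum N a j = finrank k (F j) := by
  induction j, hj using Int.leInduction with
  | base => rw [cum_of_lt _ (by omega), hF.bot _ (by omega)]; simp
  | succ j hj ih => rw [cum_eq_add _ (by omega), ha, add_sub_cancel_right, ih]; ring

theorem natCard_field_pow_ne_one (m : ℕ) : (Nat.card k : ℚ) ^ (m + 1) ≠ 1 := by
  have h : 1 < Nat.card k := Finite.one_lt_card
  have : 1 < (Nat.card k) ^ (m + 1) := Nat.one_lt_pow (by omega) h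
  exact_mod_cast this.ne'

theorem natCard_field_ne_zero : (Nat.card k : ℚ) ≠ 0 := by
  have h : 1 < Nat.card k := Finite.one_lt_card
  positivity

theorem card_flagSet_eq_subspaceCount (hF : IsFiltration N F) {a : ℤ → ℤ}
    (ha : ∀ j, a j = finrank k (F j) - finrank k (F (j - 1))) {u : ℤ → ℕ}
    (hu : ∀ l, l ∉ Finset.Icc (-N) N → u l = 0) :
    (Nat.card (flagSet 0 F N u) : ℚ) = subspaceCount (Nat.card k : ℚ) N a u := by
  refine induction_on_last (motive := fun u => (Nat.card (flagSet 0 F N u) : ℚ) =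
    subspaceCount (Nat.card k : ℚ) N a u) ?_ (fun u j hj hjN hu _ ih => ?_) u hu
  · rw [flagSet_zero hF]
    simp [subspaceCount, pairSum, toZ]
  · have hq := natCard_field_pow_ne_one (k := k)
    have hq0 := natCard_field_ne_zero (k := k)
    have h1 := card_flagSet_zero_step hF hj hjN hu
    have h2 := subspaceCount_step hq0 hq a hj hjN hu
    rw [cum_eq_finrank hF ha (by omega), cum_eq_finrank hF ha (by omega), ← ih] at h2
    refine mul_right_cancel₀ (mul_ne_zero (sub_ne_zero.2 (hq (u j))) (pow_ne_zero _ hq0))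
      (h1.trans (Eq.trans ?_ h2.symm))
    norm_cast

theorem card_flagSet_eq_isotropicCount (hF : IsFiltration N F) (hb : b.IsAlt)
    (hnd : b.Nondegenerate) (ho : ∀ j, b.orthogonal (F j) = F (-j - 1)) {a : ℤ → ℤ}
    (ha : ∀ j, a j = finrank k (F j) - finrank k (F (j - 1))) {u : ℤ → ℕ}
    (hu : ∀ l, l ∉ Finset.Icc (-N) N → u l = 0) :
    (Nat.card (flagSet b F N u) : ℚ) = isotropicCount (Nat.card k : ℚ) N a u := by
  have hfr : ∀ j, finrank k (F (-j - 1)) + finrank k (F j) = finrank k W := by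
    intro j
    have h3 := LinearMap.BilinForm.finrank_orthogonal hnd (F j)
    have h7 := Submodule.finrank_le (F j)
    rw [ho] at h3
    omega
  have hsym : ∀ j, a (-j) = a j := by
    intro j
    have h1 := hfr j
    have h2 := hfr (j - 1)
    rw [show -(j - 1) - 1 = -j by ring] at h2
    rw [ha, ha]
    omega
  refine induction_on_last (motive := fun u => (Nat.card (flagSet b F N u) : ℚ) =
    isotropicCount (Nat.card k : ℚ) N a u) ?_ (fun u j hj hjN hu _ ih => ?_) u hu
  · rw [flagSet_zero hF]
    simp [isotropicCount, isotropicExp, pairSum, toZ]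
  · have hq := natCard_field_pow_ne_one (k := k)
    have hq0 := natCard_field_ne_zero (k := k)
    have h1 := card_flagSet_symp_step hF hb hnd ho hj hjN hu
    have h2 := isotropicCount_step hq0 hq hsym hj hjN hu
    rw [cum_eq_finrank hF ha (by omega), cum_eq_finrank hF ha (by omega), ← ih] at h2
    exact mul_right_cancel₀ (mul_ne_zero (sub_ne_zero.2 (hq (u j))) (pow_ne_zero _ hq0))
      (h1.trans h2.symm)

end Count

/-! ### Subspaces in a given position with respect to two filtrations -/

/-- Partial sums of a matrix over a quadrant. -/
noncomputable def cum₂ (N : ℤ) (σ : ℤ → ℤ → ℕ) (i j : ℤ) : ℕ := cum N (fun i' => cum N (σ i') j) i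

/-- The matrix with a single entry `1`. -/
def cell (i j : ℤ) : ℤ → ℤ → ℕ := Pi.single i (Pi.single j 1)

/-- The entries of `σ` after the position `(i, j)` vanish, in the order by columns. -/
def VanishAfter (σ : ℤ → ℤ → ℕ) (i j : ℤ) : Prop :=
  ∀ i' j', (j < j' ∨ j' = j ∧ i < i') → σ i' j' = 0

section Sums

variable {N : ℤ} {σ : ℤ → ℤ → ℕ} {i j : ℤ}

theorem cell_apply (i j i' j' : ℤ) : cell i j i' j' = if i' = i ∧ j' = j then 1 else 0 := by
  by_cases h : i' = i
  · subst h
    simp [cell, Pi.single_apply]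
  · simp [cell, h]

theorem cum₂_add (σ τ : ℤ → ℤ → ℕ) (i j : ℤ) : cum₂ N (σ + τ) i j = cum₂ N σ i j + cum₂ N τ i j := by
  rw [cum₂, cum₂, cum₂, ← cum_add]
  congr 1
  funext i'
  exact cum_add N (σ i') (τ i') j

theorem cum₂_cell (hi : -N ≤ i) (hj : -N ≤ j) (i' j' : ℤ) :
    cum₂ N (cell i j) i' j' = if i ≤ i' ∧ j ≤ j' then 1 else 0 := by
  have : (fun l => cum N (cell i j l) j') = if j ≤ j' then (Pi.single i 1 : ℤ → ℕ) else 0 := by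
    funext l
    by_cases hl : l = i
    · subst hl
      rw [cell, Pi.single_eq_same, cum_single hj]
      split_ifs <;> simp
    · rw [cell, Pi.single_eq_of_ne hl]
      split_ifs <;> simp [cum, hl]
  rw [cum₂, this]
  split_ifs with h1 h2 h2
  · rw [cum_single hi, if_pos h2.1]
  · rw [cum_single hi, if_neg fun h => h2 ⟨h, h1⟩]
  · exact absurd h2.2 h1
  · simp [cum]

theorem cum₂_eq_add_row (hi : -N ≤ i) : cum₂ N σ i j = cum₂ N σ (i - 1) j + cum N (σ i) j :=
  cum_eq_add _ hi

theorem cum₂_eq_add_col (hj : -N ≤ j) :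
    cum₂ N σ i j = cum₂ N σ i (j - 1) + cum N (fun i' => σ i' j) i := by
  rw [cum₂, cum₂, ← cum_add]
  congr 1
  funext i'
  exact cum_eq_add _ hj

theorem cum₂_of_lt_row (hi : i < -N) : cum₂ N σ i j = 0 := cum_of_lt _ hi

theorem VanishAfter.cum₂_col (h : VanishAfter σ i j) {j' : ℤ} (hj : j ≤ j') (i' : ℤ) :
    cum₂ N σ i' j' = cum₂ N σ i' j := by
  rw [cum₂, cum₂]
  congr 1
  funext l
  exact cum_eq_of_vanish (fun m hm => h _ _ (Or.inl hm)) hj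

theorem VanishAfter.cum_col (h : VanishAfter σ i j) {i' : ℤ} (hi : i ≤ i') :
    cum N (fun l => σ l j) i' = cum N (fun l => σ l j) i :=
  cum_eq_of_vanish (fun _ hm => h _ _ (Or.inr ⟨rfl, hm⟩)) hi

theorem VanishAfter.add_cell (h : VanishAfter σ i j) : VanishAfter (σ + cell i j) i j := by
  intro i' j' h'
  rw [Pi.add_apply, Pi.add_apply, h i' j' h', cell_apply, if_neg (by omega)]

end Sums

section Position

variable {k W : Type*} [Field k] [AddCommGroup W] [Module k W]

/-- The subspaces whose position with respect to `F` and `G` is `σ`. -/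
def positionSet (F G : ℤ → Submodule k W) (N : ℤ) (σ : ℤ → ℤ → ℕ) : Set (Submodule k W) :=
  {Q | ∀ i j, finrank k ↥(Q ⊓ F j ⊓ G i) = cum₂ N σ i j}

variable [Finite k] [Module.Finite k W] {F G : ℤ → Submodule k W} {N : ℤ} {σ : ℤ → ℤ → ℕ}
  {i j : ℤ} {Q : Submodule k W}

theorem inf_sup_span_of_mem {A : Submodule k W} {x : W} (hx : x ∈ A) :
    (Q ⊔ Submodule.span k {x}) ⊓ A = (Q ⊓ A) ⊔ Submodule.span k {x} := by
  rw [sup_comm, sup_inf_assoc_of_le _ ((Submodule.span_singleton_le_iff_mem _ _).2 hx), sup_comm]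

theorem inf_sup_span_of_notMem {A : Submodule k W} {x : W} (hx : x ∉ A ⊔ Q) :
    (Q ⊔ Submodule.span k {x}) ⊓ A = Q ⊓ A := by
  refine le_antisymm (fun y hy => ⟨?_, hy.2⟩) (inf_le_inf_right A le_sup_left)
  obtain ⟨y1, hy1, y2, hy2, rfl⟩ := Submodule.mem_sup.1 hy.1
  obtain ⟨c, rfl⟩ := Submodule.mem_span_singleton.1 hy2
  by_cases hc : c = 0
  · simpa [hc] using hy1
  · refine absurd ?_ hx
    have : x = c⁻¹ • (y1 + c • x) + (-c⁻¹) • y1 := by simp [smul_smul, hc]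
    rw [this]
    exact Submodule.add_mem_sup (Submodule.smul_mem _ _ hy.2) (Q.smul_mem _ hy1)

theorem notMem_sup_of_finrank_eq {A : Submodule k W} {x : W} (hx : x ∉ Q)
    (h : finrank k ↥((Q ⊔ Submodule.span k {x}) ⊓ A) = finrank k ↥(Q ⊓ A)) : x ∉ A ⊔ Q := by
  intro hx'
  obtain ⟨z, hz, y, hy, rfl⟩ := Submodule.mem_sup.1 hx'
  have hle : Q ⊓ A ≤ (Q ⊔ Submodule.span k {z + y}) ⊓ A := inf_le_inf_right A le_sup_left
  have heq := Submodule.eq_of_le_of_finrank_eq hle h.symm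
  have hzS : z ∈ (Q ⊔ Submodule.span k {z + y}) ⊓ A := by
    refine ⟨?_, hz⟩
    have := Submodule.sub_mem _ (Submodule.mem_sup_right (Submodule.mem_span_singleton_self _))
      (Submodule.mem_sup_left hy : y ∈ Q ⊔ Submodule.span k {z + y})
    simpa using this
  rw [← heq] at hzS
  exact hx (Q.add_mem hzS.1 hy)

/-- Two increasing families of subspaces that are everything from the index `N` on. -/
structure IsBiFiltration (N : ℤ) (F G : ℤ → Submodule k W) : Prop where
  monoF : Monotone F
  monoG : Monotone G
  topF : ∀ j, N ≤ j → F j = ⊤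
  topG : ∀ j, N ≤ j → G j = ⊤

variable (h : IsBiFiltration N F G)
include h

theorem finrank_inf_left (hQ : Q ∈ positionSet F G N σ) (j : ℤ) :
    finrank k ↥(Q ⊓ F j) = cum₂ N σ N j := by
  have := hQ N j
  rwa [h.topG N le_rfl, inf_top_eq] at this

theorem finrank_inf_right (hjN : j ≤ N) (hσ : VanishAfter σ i j) (hQ : Q ∈ positionSet F G N σ)
    (l : ℤ) : finrank k ↥(Q ⊓ G l) = cum₂ N σ l j := by
  have := hQ l N
  rwa [h.topF N le_rfl, inf_top_eq, hσ.cum₂_col hjN] at this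

theorem finrank_position (hjN : j ≤ N) (hσ : VanishAfter σ i j) (hQ : Q ∈ positionSet F G N σ) :
    finrank k Q = cum₂ N σ N j := by
  have := finrank_inf_right h hjN hσ hQ N
  rwa [h.topG N le_rfl, inf_top_eq] at this

theorem le_of_mem_positionSet (hjN : j ≤ N) (hσ : VanishAfter σ i j)
    (hQ : Q ∈ positionSet F G N σ) : Q ≤ F j := by
  have h := Submodule.eq_of_le_of_finrank_eq (inf_le_left : Q ⊓ F j ≤ Q)
    ((finrank_inf_left h hQ j).trans (finrank_position h hjN hσ hQ).symm)
  exact inf_eq_left.1 h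

theorem finrank_sup_inf_position (hjN : j ≤ N) (hσ : VanishAfter σ i j)
    (hQ : Q ∈ positionSet F G N σ) (l m : ℤ) :
    finrank k ↥((Q ⊓ F m) ⊔ (Q ⊓ G l)) + cum₂ N σ l m = cum₂ N σ N m + cum₂ N σ l j := by
  have e : Q ⊓ F m ⊓ (Q ⊓ G l) = Q ⊓ F m ⊓ G l := by rw [← inf_inf_distrib_left, inf_assoc]
  rw [← finrank_inf_right h hjN hσ hQ l, ← finrank_inf_left h hQ m,
    ← Submodule.finrank_sup_add_finrank_inf_eq, ← hQ l m, e]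

theorem sup_inf_eq_of_mem_positionSet (hj : -N ≤ j) (hjN : j ≤ N) (hiN : i ≤ N)
    (hσ : VanishAfter σ i j) (hQ : Q ∈ positionSet F G N σ) :
    (Q ⊓ F (j - 1)) ⊔ (Q ⊓ G i) = Q := by
  refine Submodule.eq_of_le_of_finrank_eq (sup_le inf_le_left inf_le_left) ?_
  have h1 := finrank_sup_inf_position h hjN hσ hQ i (j - 1)
  have h2 := finrank_position h hjN hσ hQ
  have h3 := cum₂_eq_add_col (σ := σ) (i := N) hj
  have h4 := cum₂_eq_add_col (σ := σ) (i := i) hj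
  have h5 := hσ.cum_col (N := N) hiN
  omega

theorem sup_span_mem_positionSet_iff (hi : -N ≤ i) (hj : -N ≤ j) (hjN : j ≤ N)
    (hσ : VanishAfter σ i j) (hQ : Q ∈ positionSet F G N σ) (x : W) :
    (x ∉ Q ∧ Q ⊔ Submodule.span k {x} ∈ positionSet F G N (σ + cell i j)) ↔
      x ∈ (F j ⊓ G i) ⊔ Q ∧ x ∉ F (j - 1) ⊔ Q ∧ x ∉ G (i - 1) ⊔ Q := by
  have hσ' := hσ.add_cell
  have hcell := fun i' j' => cum₂_cell (N := N) hi hj i' j'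
  have hQF := le_of_mem_positionSet h hjN hσ hQ
  constructor
  · rintro ⟨hx, hS⟩
    have hSF := le_of_mem_positionSet h hjN hσ' hS
    refine ⟨?_, notMem_sup_of_finrank_eq hx ?_, notMem_sup_of_finrank_eq hx ?_⟩
    · have h1 : ¬ (Q ⊔ Submodule.span k {x}) ⊓ G i ≤ Q ⊓ G i := by
        intro hle
        have := Submodule.finrank_mono hle
        rw [finrank_inf_right h hjN hσ hQ, finrank_inf_right h hjN hσ' hS, cum₂_add, hcell,
          if_pos ⟨le_rfl, le_rfl⟩] at this
        omega
      obtain ⟨y, hy, hyQ⟩ := Set.not_subset.1 h1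
      have hyF := hSF hy.1
      obtain ⟨y1, hy1, y2, hy2, rfl⟩ := Submodule.mem_sup.1 hy.1
      obtain ⟨c, rfl⟩ := Submodule.mem_span_singleton.1 hy2
      have hc : c ≠ 0 := by
        rintro rfl
        exact hyQ ⟨by simpa using hy1, hy.2⟩
      have : x = c⁻¹ • (y1 + c • x) + (-c⁻¹) • y1 := by simp [smul_smul, hc]
      rw [this]
      exact Submodule.add_mem_sup (Submodule.smul_mem _ _ ⟨hyF, hy.2⟩) (Q.smul_mem _ hy1)
    · rw [finrank_inf_left h hQ, finrank_inf_left h hS, cum₂_add, hcell, if_neg (by omega),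
        add_zero]
    · rw [finrank_inf_right h hjN hσ hQ, finrank_inf_right h hjN hσ' hS, cum₂_add, hcell,
        if_neg (by omega), add_zero]
  · rintro ⟨hx, hxF, hxG⟩
    have hxQ : x ∉ Q := fun hx => hxF (Submodule.mem_sup_right hx)
    refine ⟨hxQ, ?_⟩
    obtain ⟨g, hg, y, hy, rfl⟩ := Submodule.mem_sup.1 hx
    have hgF : g ∉ F (j - 1) ⊔ Q :=
      fun h' => hxF (Submodule.add_mem _ h' (Submodule.mem_sup_right hy))
    have hgG : g ∉ G (i - 1) ⊔ Q :=
      fun h' => hxG (Submodule.add_mem _ h' (Submodule.mem_sup_right hy))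
    have hgQ : g ∉ Q := fun h' => hgF (Submodule.mem_sup_right h')
    have hspan : Q ⊔ Submodule.span k {g + y} = Q ⊔ Submodule.span k {g} := by
      have hgm : g ∈ Q ⊔ Submodule.span k {g + y} := by
        have := Submodule.sub_mem _ (Submodule.mem_sup_right
          (Submodule.mem_span_singleton_self _)) (Submodule.mem_sup_left hy :
          y ∈ Q ⊔ Submodule.span k {g + y})
        simpa using this
      refine le_antisymm (sup_le le_sup_left ((Submodule.span_singleton_le_iff_mem _ _).2 ?_))
        (sup_le le_sup_left ((Submodule.span_singleton_le_iff_mem _ _).2 hgm))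
      exact Submodule.add_mem _ (Submodule.mem_sup_right (Submodule.mem_span_singleton_self g))
        (Submodule.mem_sup_left hy)
    rw [hspan]
    intro i' j'
    rw [cum₂_add, hcell, ← hQ i' j']
    by_cases hj' : j ≤ j'
    · have h1 : Q ⊔ Submodule.span k {g} ≤ F j' :=
        (sup_le hQF ((Submodule.span_singleton_le_iff_mem _ _).2 hg.1)).trans (h.monoF hj')
      rw [inf_eq_left.2 h1, inf_eq_left.2 (hQF.trans (h.monoF hj'))]
      by_cases hi' : i ≤ i'
      · rw [inf_sup_span_of_mem (h.monoG hi' hg.2), if_pos ⟨hi', hj'⟩,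
          Submodule.finrank_sup_span_singleton fun h' => hgQ (Submodule.mem_inf.1 h').1]
      · rw [inf_sup_span_of_notMem, if_neg fun h' => hi' h'.1, add_zero]
        exact fun h' => hgG (sup_le_sup_right (h.monoG (by omega)) Q h')
    · rw [inf_sup_span_of_notMem, if_neg fun h' => hj' h'.2, add_zero]
      exact fun h' => hgF (sup_le_sup_right (h.monoF (by omega)) Q h')

theorem card_positionSet_step (hi : -N ≤ i) (hiN : i ≤ N) (hj : -N ≤ j) (hjN : j ≤ N)
    (hσ : VanishAfter σ i j) {M : ℚ}
    (hM : ∀ Q ∈ positionSet F G N σ, (Nat.card {x : W // x ∈ (F j ⊓ G i) ⊔ Q ∧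
      x ∉ F (j - 1) ⊔ Q ∧ x ∉ G (i - 1) ⊔ Q} : ℚ) = M) :
    (Nat.card (positionSet F G N (σ + cell i j)) : ℚ) *
      (((Nat.card k : ℚ) ^ (σ i j + 1) - 1) * (Nat.card k : ℚ) ^ (cum₂ N σ N j)) =
      Nat.card (positionSet F G N σ) * M := by
  have hσ' := hσ.add_cell
  have hcell := fun i' j' => cum₂_cell (N := N) hi hj i' j'
  have hfr : ∀ Q ∈ positionSet F G N (σ + cell i j), finrank k Q = cum₂ N σ N j + 1 := by
    intro Q hQ
    rw [finrank_position h hjN hσ' hQ, cum₂_add, hcell, if_pos ⟨hiN, le_rfl⟩]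
  have hrF : ∀ Q ∈ positionSet F G N (σ + cell i j), ∀ l < j,
      finrank k ↥(Q ⊓ F l) = cum₂ N σ N l := by
    intro Q hQ l hl
    rw [finrank_inf_left h hQ, cum₂_add, hcell, if_neg (by omega), add_zero]
  have hrG : ∀ Q ∈ positionSet F G N (σ + cell i j), ∀ l < i,
      finrank k ↥(Q ⊓ G l) = cum₂ N σ l j := by
    intro Q hQ l hl
    rw [finrank_inf_right h hjN hσ' hQ, cum₂_add, hcell, if_neg (by omega), add_zero]
  refine card_step (fun Q => (Q ⊓ F (j - 1)) ⊔ (Q ⊓ G (i - 1))) hfr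
    (fun Q hQ => ⟨sup_le inf_le_left inf_le_left, ?_⟩) ?_ (fun Q hQ => ?_)
  · have h1 := finrank_sup_inf_position h hjN hσ' hQ (i - 1) (j - 1)
    have h2 := cum₂_eq_add_col (σ := σ) (i := N) hj
    have h3 := cum₂_eq_add_col (σ := σ) (i := i - 1) hj
    have h4 := hσ.cum_col (N := N) hiN
    have h5 := cum_eq_add (fun l => σ l j) hi
    rw [cum₂_add, cum₂_add, cum₂_add, hcell, hcell, hcell, if_neg (by omega), if_neg (by omega),
      if_neg (by omega)] at h1
    rw [hfr Q hQ]
    omega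
  · intro Q' hQ' Q hQQ hQ
    constructor
    · intro hm
      have e1 := Submodule.eq_of_le_of_finrank_eq (inf_le_inf_right (F (j - 1)) hQQ)
        (by rw [hrF Q' hQ' _ (by omega), finrank_inf_left h hm])
      have e2 := Submodule.eq_of_le_of_finrank_eq (inf_le_inf_right (G (i - 1)) hQQ)
        (by rw [hrG Q' hQ' _ (by omega), finrank_inf_right h hjN hσ hm])
      rw [← e1, ← e2]
      exact sup_le inf_le_left inf_le_left
    · intro hR
      have hQF' := le_of_mem_positionSet h hjN hσ' hQ'
      intro i' j'
      by_cases hj' : j ≤ j'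
      · rw [inf_eq_left.2 (hQQ.trans (hQF'.trans (h.monoF hj'))), hσ.cum₂_col hj']
        by_cases hi' : i ≤ i'
        · have h1 : ¬ Q' ⊓ G i ≤ Q := by
            intro h'
            have : Q' ≤ Q := by
              rw [← sup_inf_eq_of_mem_positionSet h hj hjN hiN hσ' hQ']
              exact sup_le (le_sup_left.trans hR) h'
            have := Submodule.finrank_mono this
            rw [hfr Q' hQ', hQ] at this
            omega
          obtain ⟨y, hy, hyQ⟩ := Set.not_subset.1 h1
          have hQ'eq : Q ⊔ Submodule.span k {y} = Q' := by
            refine Submodule.eq_of_le_of_finrank_eq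
              (sup_le hQQ ((Submodule.span_singleton_le_iff_mem _ _).2 hy.1)) ?_
            rw [Submodule.finrank_sup_span_singleton hyQ, hfr Q' hQ', hQ]
          have h2 := finrank_inf_right h hjN hσ' hQ' i'
          rw [cum₂_add, hcell, if_pos ⟨hi', le_rfl⟩, ← hQ'eq,
            inf_sup_span_of_mem (h.monoG hi' hy.2),
            Submodule.finrank_sup_span_singleton fun h' => hyQ (Submodule.mem_inf.1 h').1] at h2
          omega
        · have : Q ⊓ G i' = Q' ⊓ G i' := by
            refine le_antisymm (inf_le_inf_right _ hQQ) (le_inf ?_ inf_le_right)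
            exact (inf_le_inf_left _ (h.monoG (by omega))).trans (le_sup_right.trans hR)
          rw [this, hrG Q' hQ' _ (by omega)]
      · have : Q ⊓ F j' = Q' ⊓ F j' := by
          refine le_antisymm (inf_le_inf_right _ hQQ) (le_inf ?_ inf_le_right)
          exact (inf_le_inf_left _ (h.monoF (by omega))).trans (le_sup_left.trans hR)
        rw [this, hQ' i' j', cum₂_add, hcell, if_neg (by omega), add_zero]
  · rw [← hM Q hQ]
    exact congrArg _ (Nat.card_congr
      (Equiv.subtypeEquivRight (sup_span_mem_positionSet_iff h hi hj hjN hσ hQ)))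

end Position

/-! ### The number of complements in a given position -/

section Term

variable {K : Type*} [Field K] {N : ℤ}

/-- `∑ σ_{kl}` over `k < i`, `l > j`. -/
noncomputable def crossAt (N : ℤ) (σ : ℤ → ℤ → ℕ) (i j : ℤ) : ℕ :=
  ∑ k ∈ Finset.Icc (-N) N, ∑ l ∈ Finset.Icc (-N) N, σ k l * if k < i ∧ j < l then 1 else 0

/-- The sum of `σ_{ij} f_{ij}` over a window. -/
noncomputable def windowSum (N : ℤ) (σ f : ℤ → ℤ → ℕ) : ℕ :=
  ∑ i ∈ Finset.Icc (-N) N, ∑ j ∈ Finset.Icc (-N) N, σ i j * f i j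

theorem windowSum_add_left (σ τ f : ℤ → ℤ → ℕ) :
    windowSum N (σ + τ) f = windowSum N σ f + windowSum N τ f := by
  simp only [windowSum, ← Finset.sum_add_distrib, Pi.add_apply, add_mul]

theorem windowSum_add_right (σ f g : ℤ → ℤ → ℕ) :
    windowSum N σ (f + g) = windowSum N σ f + windowSum N σ g := by
  simp only [windowSum, ← Finset.sum_add_distrib, Pi.add_apply, mul_add]

theorem windowSum_cell {i j : ℤ} (hi : i ∈ Finset.Icc (-N) N) (hj : j ∈ Finset.Icc (-N) N)
    (f : ℤ → ℤ → ℕ) : windowSum N (cell i j) f = f i j := by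
  rw [windowSum, Finset.sum_eq_single i, Finset.sum_eq_single j]
  · simp [cell_apply]
  · intro l _ hl
    simp [cell_apply, hl]
  · exact fun h => absurd hj h
  · intro l _ hl
    simp [cell_apply, hl]
  · exact fun h => absurd hi h

theorem crossAt_add (σ τ : ℤ → ℤ → ℕ) : crossAt N (σ + τ) = crossAt N σ + crossAt N τ := by
  funext i j
  exact windowSum_add_left σ τ _

theorem crossAt_cell {i j : ℤ} (hi : i ∈ Finset.Icc (-N) N) (hj : j ∈ Finset.Icc (-N) N)
    (i' j' : ℤ) : crossAt N (cell i j) i' j' = if i < i' ∧ j' < j then 1 else 0 :=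
  windowSum_cell hi hj fun k l => if k < i' ∧ j' < l then 1 else 0

theorem crossAt_eq_zero {σ : ℤ → ℤ → ℕ} {i j : ℤ} (h : VanishAfter σ i j) (i' : ℤ) :
    crossAt N σ i' j = 0 :=
  Finset.sum_eq_zero fun k _ => Finset.sum_eq_zero fun l _ => by
    split_ifs with h'
    · rw [h k l (Or.inl h'.2), zero_mul]
    · rw [mul_zero]

/-- The row sums of a matrix. -/
noncomputable def rowSum (N : ℤ) (σ : ℤ → ℤ → ℕ) (i : ℤ) : ℕ := ∑ j ∈ Finset.Icc (-N) N, σ i j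

/-- The column sums of a matrix. -/
noncomputable def colSum (N : ℤ) (σ : ℤ → ℤ → ℕ) (j : ℤ) : ℕ := ∑ i ∈ Finset.Icc (-N) N, σ i j

theorem rowSum_add_cell (σ : ℤ → ℤ → ℕ) {i j : ℤ} (hj : j ∈ Finset.Icc (-N) N) :
    rowSum N (σ + cell i j) = rowSum N σ + Pi.single i 1 := by
  funext l
  simp only [rowSum, Pi.add_apply, Finset.sum_add_distrib, cell_apply, Pi.single_apply]
  congr 1
  by_cases hl : l = i
  · rw [if_pos hl, Finset.sum_eq_single j]
    · simp [hl]
    · intro m _ hm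
      simp [hm]
    · exact fun h => absurd hj h
  · simp [hl]

theorem colSum_add_cell (σ : ℤ → ℤ → ℕ) {i j : ℤ} (hi : i ∈ Finset.Icc (-N) N) :
    colSum N (σ + cell i j) = colSum N σ + Pi.single j 1 := by
  funext l
  simp only [colSum, Pi.add_apply, Finset.sum_add_distrib, cell_apply, Pi.single_apply]
  congr 1
  by_cases hl : l = j
  · rw [if_pos hl, Finset.sum_eq_single i]
    · simp [hl]
    · intro m _ hm
      simp [hm]
    · exact fun h => absurd hi h
  · simp [hl]

/-- The exponent of the leading power in `positionCount`. -/
noncomputable def positionExp (N : ℤ) (α β : ℤ → ℕ) (σ : ℤ → ℤ → ℕ) : ℤ :=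
  ((windowSum N σ (fun _ j => cum N α (j - 1)) +
    windowSum N σ (fun i j => if i = j then α i else 0) + windowSum N σ (crossAt N σ) : ℕ) : ℤ) +
    pairSum (· < ·) N (toZ β - toZ (rowSum N σ)) (toZ (rowSum N σ))

/-- The number of subspaces in position `σ`, see `card_positionSet`. -/
noncomputable def positionCount (x : K) (N : ℤ) (α β : ℤ → ℕ) (σ : ℤ → ℤ → ℕ) : K :=
  x ^ positionExp N α β σ *
    ((∏ i ∈ Finset.Icc (-N) N, ∏ m ∈ Finset.range (rowSum N σ i), (x ^ ((β i : ℤ) - m) - 1)) /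
      ∏ i ∈ Finset.Icc (-N) N, ∏ j ∈ Finset.Icc (-N) N, ∏ m ∈ Finset.range (σ i j),
        (x ^ (m + 1) - 1)) *
    ∏ j ∈ Finset.Icc (-N) N, ∏ l ∈ Finset.range (colSum N σ j - σ j j), (x ^ α j - x ^ l)

theorem positionExp_step (α β : ℤ → ℕ) {σ : ℤ → ℤ → ℕ} {i j : ℤ} (hi : -N ≤ i) (hij : i ≤ j)
    (hjN : j ≤ N) (hσ : VanishAfter σ i j) :
    positionExp N α β (σ + cell i j) = positionExp N α β σ + (cum N α (j - 1) +
      (if i = j then α j else 0 : ℕ) + cum N β (i - 1) - cum₂ N σ (i - 1) j) := by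
  have hi' : i ∈ Finset.Icc (-N) N := Finset.mem_Icc.2 ⟨hi, hij.trans hjN⟩
  have hj' : j ∈ Finset.Icc (-N) N := Finset.mem_Icc.2 ⟨hi.trans hij, hjN⟩
  have h1 : windowSum N σ (crossAt N (cell i j)) =
      ∑ l ∈ Finset.Icc (-N) N, if i < l then rowSum N σ l else 0 := by
    refine Finset.sum_congr rfl fun l _ => ?_
    simp only [crossAt_cell hi' hj']
    split_ifs with hl
    · refine Finset.sum_congr rfl fun m _ => ?_
      by_cases hm : m < j
      · simp [hl, hm]
      · rw [hσ l m (by omega), zero_mul]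
    · simp [hl]
  have h2 : pairSum (· < ·) N (toZ β - toZ (rowSum N (σ + cell i j)))
      (toZ (rowSum N (σ + cell i j))) =
      pairSum (· < ·) N (toZ β - toZ (rowSum N σ)) (toZ (rowSum N σ)) +
      (cum N β (i - 1) - cum₂ N σ (i - 1) j) - windowSum N σ (crossAt N (cell i j)) := by
    rw [rowSum_add_cell σ hj', toZ_add_single, ← sub_sub, pairSum_add_right,
      pairSum_sub_left _ (Pi.single i 1), pairSum_sub_left _ (Pi.single i 1),
      pairSum_single_left _ hi', pairSum_single_left _ hi',
      pairSum_single_right _ hi', sum_ite_lt_eq_cum _ (hij.trans hjN), h1]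
    have e2 : (∑ m ∈ Finset.Icc (-N) N, if i < m then (Pi.single i 1 : ℤ → ℤ) m else 0) = 0 :=
      Finset.sum_eq_zero fun m _ => by
        split_ifs with h
        · simp [Pi.single_eq_of_ne (show m ≠ i by omega)]
        · rfl
    have e3 : cum N (toZ β - toZ (rowSum N σ)) (i - 1) = cum N β (i - 1) - cum₂ N σ (i - 1) j := by
      have : cum N (rowSum N σ) (i - 1) = cum₂ N σ (i - 1) N := rfl
      rw [eq_sub_iff_add_eq, ← hσ.cum₂_col hjN, ← this, ← cum_toZ, ← cum_toZ, ← cum_add,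
        sub_add_cancel]
    rw [e2, e3]
    push_cast
    simp only [toZ]
    ring
  have h3 : windowSum N (σ + cell i j) (crossAt N (σ + cell i j)) =
      windowSum N σ (crossAt N σ) + windowSum N σ (crossAt N (cell i j)) := by
    rw [windowSum_add_left, crossAt_add, windowSum_add_right, windowSum_cell hi' hj',
      Pi.add_apply, Pi.add_apply, crossAt_eq_zero hσ, crossAt_cell hi' hj', if_neg (by omega)]
    ring
  rw [positionExp, positionExp, h2, h3, windowSum_add_left, windowSum_add_left,
    windowSum_cell hi' hj', windowSum_cell hi' hj']
  push_cast
  by_cases h : i = j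
  · subst h
    simp
    ring
  · simp [h]
    ring

theorem prod_range_update {f : ℤ → ℕ → K} {s : Finset ℤ} {g : ℤ → ℕ} {i : ℤ} (hi : i ∈ s) :
    ∏ l ∈ s, ∏ m ∈ Finset.range ((g + Pi.single i 1 : ℤ → ℕ) l), f l m =
      (∏ l ∈ s, ∏ m ∈ Finset.range (g l), f l m) * f i (g i) := by
  refine (mul_one _).symm.trans (prod_update hi (fun l _ hl => by simp [Pi.single_eq_of_ne hl]) ?_)
  simp [Finset.prod_range_succ]

theorem positionCount_step {x : K} (hx0 : x ≠ 0) (hx : ∀ m : ℕ, x ^ (m + 1) ≠ 1) (α β : ℤ → ℕ)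
    {σ : ℤ → ℤ → ℕ} {i j : ℤ} (hi : -N ≤ i) (hij : i ≤ j)
    (hjN : j ≤ N) (hσ : VanishAfter σ i j) :
    positionCount x N α β (σ + cell i j) * (x ^ (σ i j + 1) - 1) =
      positionCount x N α β σ * (x ^ (((cum N α (j - 1) : ℕ) : ℤ) + (if i = j then α j else 0 : ℕ) +
        cum N β (i - 1) - cum₂ N σ (i - 1) j) * (x ^ ((β i : ℤ) - rowSum N σ i) - 1) *
        if i < j then x ^ α j - x ^ colSum N σ j else 1) := by
  have hi' : i ∈ Finset.Icc (-N) N := Finset.mem_Icc.2 ⟨hi, hij.trans hjN⟩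
  have hj' : j ∈ Finset.Icc (-N) N := Finset.mem_Icc.2 ⟨hi.trans hij, hjN⟩
  have hne : x ^ (σ i j + 1) - 1 ≠ 0 := sub_ne_zero.2 (hx _)
  have h1 : (∏ l ∈ Finset.Icc (-N) N, ∏ m ∈ Finset.range (rowSum N (σ + cell i j) l),
      (x ^ ((β l : ℤ) - m) - 1)) = (∏ l ∈ Finset.Icc (-N) N, ∏ m ∈ Finset.range (rowSum N σ l),
      (x ^ ((β l : ℤ) - m) - 1)) * (x ^ ((β i : ℤ) - rowSum N σ i) - 1) := by
    rw [rowSum_add_cell σ hj']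
    exact prod_range_update hi'
  have h2 : (∏ l ∈ Finset.Icc (-N) N, ∏ m ∈ Finset.Icc (-N) N,
      ∏ n ∈ Finset.range ((σ + cell i j) l m), (x ^ (n + 1) - 1)) =
      (∏ l ∈ Finset.Icc (-N) N, ∏ m ∈ Finset.Icc (-N) N,
      ∏ n ∈ Finset.range (σ l m), (x ^ (n + 1) - 1)) * (x ^ (σ i j + 1) - 1) := by
    refine (mul_one _).symm.trans (prod_update hi' (fun l _ hl => by simp [cell, hl]) ?_)
    rw [mul_one, Pi.add_apply, cell, Pi.single_eq_same]
    exact prod_range_update (f := fun _ n => x ^ (n + 1) - 1) hj'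
  have h3 : (∏ l ∈ Finset.Icc (-N) N, ∏ m ∈ Finset.range
      (colSum N (σ + cell i j) l - (σ + cell i j) l l), (x ^ α l - x ^ m)) =
      (∏ l ∈ Finset.Icc (-N) N, ∏ m ∈ Finset.range (colSum N σ l - σ l l), (x ^ α l - x ^ m)) *
        if i < j then x ^ α j - x ^ colSum N σ j else 1 := by
    rw [colSum_add_cell σ hi']
    refine (mul_one _).symm.trans
      (prod_update hj' (fun l _ hl => by simp [cell_apply, hl]) ?_)
    rw [Pi.add_apply, Pi.add_apply, Pi.add_apply, Pi.single_eq_same, cell_apply]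
    split_ifs with h4 h5 h5
    · omega
    · simp
    · rw [hσ j j (by omega), add_zero, Nat.sub_zero, Nat.sub_zero, Finset.prod_range_succ, mul_one]
    · omega
  rw [positionCount, positionCount, h1, h2, h3, positionExp_step α β hi hij hjN hσ, zpow_add₀ hx0]
  field_simp

end Term

/-- Induction on upper triangular matrices supported on `[-N, N]²`, where the new unit is put at
the last position. -/
theorem induction_on_last_cell {N : ℤ} {motive : (ℤ → ℤ → ℕ) → Prop} (zero : motive 0)
    (step : ∀ (σ : ℤ → ℤ → ℕ) (i j : ℤ), -N ≤ i → i ≤ j → j ≤ N → VanishAfter σ i j →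
      motive σ → motive (σ + cell i j))
    (σ : ℤ → ℤ → ℕ) (hσ : ∀ i j, ¬ (-N ≤ i ∧ i ≤ j ∧ j ≤ N) → σ i j = 0) : motive σ := by
  induction h : windowSum N σ 1 generalizing σ with
  | zero =>
    have : σ = 0 := by
      funext i j
      by_cases hl : -N ≤ i ∧ i ≤ j ∧ j ≤ N
      · have h1 := Finset.sum_eq_zero_iff.1 h i (Finset.mem_Icc.2 ⟨hl.1, hl.2.1.trans hl.2.2⟩)
        have h2 := Finset.sum_eq_zero_iff.1 h1 j (Finset.mem_Icc.2 ⟨hl.1.trans hl.2.1, hl.2.2⟩)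
        simpa using h2
      · exact hσ i j hl
    exact this ▸ zero
  | succ t ih =>
    let s := (Finset.Icc (-N) N ×ˢ Finset.Icc (-N) N).filter fun p => σ p.1 p.2 ≠ 0
    have hs : ∀ i j, σ i j ≠ 0 → (i, j) ∈ s := by
      intro i j hne
      have : -N ≤ i ∧ i ≤ j ∧ j ≤ N := by
        by_contra h'
        exact hne (hσ i j h')
      simp only [s, Finset.mem_filter, Finset.mem_product, Finset.mem_Icc]
      exact ⟨⟨⟨this.1, this.2.1.trans this.2.2⟩, this.1.trans this.2.1, this.2.2⟩, hne⟩
    have hne : s.Nonempty := by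
      by_contra hne
      rw [Finset.not_nonempty_iff_eq_empty] at hne
      have : windowSum N σ 1 = 0 := Finset.sum_eq_zero fun i _ => Finset.sum_eq_zero fun j _ => by
        by_contra h'
        have := hs i j fun h'' => h' (by rw [h'', zero_mul])
        simp [hne] at this
      omega
    obtain ⟨⟨i, j⟩, hij, hmax⟩ := s.exists_max_image (fun p => p.2 * (2 * N + 1) + p.1) hne
    have hne' : σ i j ≠ 0 := (Finset.mem_filter.1 hij).2
    have hb : -N ≤ i ∧ i ≤ j ∧ j ≤ N := by
      by_contra h'
      exact hne' (hσ i j h')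
    have hlast : VanishAfter σ i j := by
      intro i' j' h'
      by_contra hne''
      have hm := hmax (i', j') (hs i' j' hne'')
      have hb' : -N ≤ i' ∧ i' ≤ j' ∧ j' ≤ N := by
        by_contra h'
        exact hne'' (hσ i' j' h')
      dsimp only at hm
      rcases h' with h' | ⟨rfl, h'⟩
      · nlinarith
      · omega
    have hσ' : σ = (σ - cell i j) + cell i j := by
      funext i' j'
      by_cases hl : i' = i ∧ j' = j
      · obtain ⟨rfl, rfl⟩ := hl
        simp [cell_apply]
        omega
      · simp [cell_apply, hl]
    have hle : ∀ i' j', (σ - cell i j : ℤ → ℤ → ℕ) i' j' ≤ σ i' j' := fun _ _ => Nat.sub_le _ _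
    rw [hσ']
    refine step _ i j hb.1 hb.2.1 hb.2.2 (fun i' j' hl => ?_) (ih _ (fun i' j' hl => ?_) ?_)
    · have := hle i' j'; rw [hlast i' j' hl] at this; omega
    · have := hle i' j'; rw [hσ i' j' hl] at this; omega
    · rw [hσ', windowSum_add_left, windowSum_cell (by simp; omega) (by simp; omega)] at h
      simpa using h

section Count

variable {k W : Type*} [Field k] [AddCommGroup W] [Module k W] [Finite k] [Module.Finite k W]
  {F : ℤ → Submodule k W} {N : ℤ} {U : Submodule k W} {α β : ℤ → ℕ} {σ : ℤ → ℤ → ℕ} {i j : ℤ}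

theorem card_mem_notMem_notMem {A B C : Submodule k W} (hB : B ≤ A) (hC : C ≤ A) :
    (Nat.card {x : W // x ∈ A ∧ x ∉ B ∧ x ∉ C} : ℚ) =
      (Nat.card k : ℚ) ^ finrank k A - (Nat.card k : ℚ) ^ finrank k B -
        (Nat.card k : ℚ) ^ finrank k C + (Nat.card k : ℚ) ^ finrank k ↥(B ⊓ C) := by
  have : Finite W := Module.finite_of_finite k
  have h1 := card_mem_notMem hC
  have h2 := card_mem_notMem (inf_le_left : B ⊓ C ≤ B)
  have h3 : Nat.card {x : W // x ∈ A ∧ x ∉ C} = Nat.card {x : W // x ∈ A ∧ x ∉ B ∧ x ∉ C} +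
      Nat.card {x : W // x ∈ B ∧ x ∉ B ⊓ C} := by
    have := Set.ncard_union_eq (s := {x : W | x ∈ A ∧ x ∉ B ∧ x ∉ C})
      (t := {x : W | x ∈ B ∧ x ∉ B ⊓ C}) (by
        rw [Set.disjoint_left]
        exact fun x hx hx' => hx.2.1 hx'.1) (Set.toFinite _) (Set.toFinite _)
    refine Eq.trans (congrArg Set.ncard ?_) this
    ext x
    simp only [Set.mem_ofPred_eq, Set.mem_union, Submodule.mem_inf]
    constructor
    · rintro ⟨hA, hC⟩
      by_cases hB : x ∈ B
      · exact Or.inr ⟨hB, fun h => hC h.2⟩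
      · exact Or.inl ⟨hA, hB, hC⟩
    · rintro (⟨hA, -, hC⟩ | ⟨h, hC⟩)
      · exact ⟨hA, hC⟩
      · exact ⟨hB h, fun h' => hC ⟨h, h'⟩⟩
  rw [h3] at h1
  push_cast at h1
  linarith

theorem isBiFiltration_sup (hF : IsFiltration N F) : IsBiFiltration N F (fun i => U ⊔ F i) where
  monoF := hF.mono
  monoG := fun _ _ h => sup_le_sup_left (hF.mono h) U
  topF := hF.top
  topG := fun j hj => by rw [hF.top j hj, sup_top_eq]

theorem finrank_inf_sup (hF : IsFiltration N F)
    (hα : ∀ j, finrank k ↥(U ⊓ F j) = cum N α j)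
    (hβ : ∀ i, finrank k ↥(U ⊔ F i) = finrank k U + cum N β i) (hij : i ≤ j) :
    finrank k ↥(F j ⊓ (U ⊔ F i)) = cum N α j + cum N β i := by
  have h1 : F j ⊓ (U ⊔ F i) = (U ⊓ F j) ⊔ F i := by
    rw [inf_comm, sup_comm, sup_inf_assoc_of_le U (hF.mono hij), sup_comm]
  have h2 : U ⊓ F j ⊓ F i = U ⊓ F i := by rw [inf_assoc, inf_eq_right.2 (hF.mono hij)]
  have h3 := Submodule.finrank_sup_add_finrank_inf_eq (U ⊓ F j) (F i)
  have h4 := Submodule.finrank_sup_add_finrank_inf_eq U (F i)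
  have h5 := hβ i
  have h6 := hα j
  rw [h2] at h3
  rw [h1]
  omega

theorem card_positionSet_vectors (hF : IsFiltration N F)
    (hα : ∀ j, finrank k ↥(U ⊓ F j) = cum N α j)
    (hβ : ∀ i, finrank k ↥(U ⊔ F i) = finrank k U + cum N β i)
    (hi : -N ≤ i) (hij : i ≤ j) (hjN : j ≤ N) (hσ : VanishAfter σ i j) {Q : Submodule k W}
    (hQ : Q ∈ positionSet F (fun i => U ⊔ F i) N σ) :
    (Nat.card {x : W // x ∈ (F j ⊓ (U ⊔ F i)) ⊔ Q ∧
      x ∉ F (j - 1) ⊔ Q ∧ x ∉ (U ⊔ F (i - 1)) ⊔ Q} : ℚ) =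
      (Nat.card k : ℚ) ^ cum₂ N σ N j *
      ((Nat.card k : ℚ) ^ (((cum N α (j - 1) : ℕ) : ℤ) + (if i = j then α j else 0 : ℕ) +
        cum N β (i - 1) - cum₂ N σ (i - 1) j) * ((Nat.card k : ℚ) ^ ((β i : ℤ) - rowSum N σ i) - 1) *
        if i < j then (Nat.card k : ℚ) ^ α j - (Nat.card k : ℚ) ^ colSum N σ j else 1) := by
  have hb := isBiFiltration_sup (U := U) hF
  have hQF := le_of_mem_positionSet hb hjN hσ hQ
  have ht := finrank_position hb hjN hσ hQ
  have hq0 := natCard_field_ne_zero (k := k)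
  have hSF : (F j ⊓ (U ⊔ F i)) ⊔ Q ≤ F j := sup_le inf_le_left hQF
  have hBS : (F j ⊓ (U ⊔ F (i - 1))) ⊔ Q ≤ (F j ⊓ (U ⊔ F i)) ⊔ Q :=
    sup_le_sup_right (inf_le_inf_left _ (sup_le_sup_left (hF.mono (by omega)) U)) Q
  have hCS : (F (j - 1) ⊓ (U ⊔ F i)) ⊔ Q ≤ (F j ⊓ (U ⊔ F i)) ⊔ Q :=
    sup_le_sup_right (inf_le_inf_right _ (hF.mono (by omega))) Q
  have hB : ∀ x ∈ (F j ⊓ (U ⊔ F i)) ⊔ Q,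
      x ∈ (U ⊔ F (i - 1)) ⊔ Q ↔ x ∈ (F j ⊓ (U ⊔ F (i - 1))) ⊔ Q := by
    refine fun x hx => ⟨fun h => ?_, fun h => sup_le_sup_right inf_le_right Q h⟩
    obtain ⟨g, hg, y, hy, rfl⟩ := Submodule.mem_sup.1 h
    refine Submodule.add_mem_sup ⟨?_, hg⟩ hy
    simpa using Submodule.sub_mem _ (hSF hx) (hQF hy)
  have hC : ∀ x ∈ (F j ⊓ (U ⊔ F i)) ⊔ Q,
      x ∈ F (j - 1) ⊔ Q ↔ x ∈ (F (j - 1) ⊓ (U ⊔ F i)) ⊔ Q := by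
    refine fun x hx => ⟨fun h => ?_, fun h => sup_le_sup_right inf_le_left Q h⟩
    obtain ⟨f, hf, y, hy, rfl⟩ := Submodule.mem_sup.1 h
    obtain ⟨a, ha, z, hz, haz⟩ := Submodule.mem_sup.1 hx
    have hzy : z - y ∈ (Q ⊓ F (j - 1)) ⊔ (Q ⊓ (U ⊔ F i)) := by
      rw [sup_inf_eq_of_mem_positionSet hb (hi.trans hij) hjN (hij.trans hjN) hσ hQ]
      exact Q.sub_mem hz hy
    obtain ⟨q1, hq1, q2, hq2, hqq⟩ := Submodule.mem_sup.1 hzy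
    have e1 : f - q1 = a + q2 := by
      rw [sub_eq_iff_eq_add, add_assoc, add_comm q2, hqq, add_sub, haz, add_sub_cancel_right]
    have e2 : f + y = (f - q1) + (q1 + y) := by abel
    rw [e2]
    refine Submodule.add_mem_sup ⟨Submodule.sub_mem _ hf hq1.2, ?_⟩ (Q.add_mem hq1.1 hy)
    rw [e1]
    exact Submodule.add_mem _ ha.2 hq2.2
  have hdim : ∀ l m, finrank k ↥((F m ⊓ (U ⊔ F l)) ⊔ Q) + cum₂ N σ l m =
      finrank k ↥(F m ⊓ (U ⊔ F l)) + cum₂ N σ N j := by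
    intro l m
    have e1 := Submodule.finrank_sup_add_finrank_inf_eq (F m ⊓ (U ⊔ F l)) Q
    have e2 : F m ⊓ (U ⊔ F l) ⊓ Q = Q ⊓ F m ⊓ (U ⊔ F l) := by rw [inf_comm, ← inf_assoc]
    have e3 : finrank k ↥(Q ⊓ F m ⊓ (U ⊔ F l)) = cum₂ N σ l m := hQ l m
    rw [e2] at e1
    omega
  have hs := hdim i j
  have hbb := hdim (i - 1) j
  rw [finrank_inf_sup hF hα hβ hij] at hs
  rw [finrank_inf_sup hF hα hβ (by omega)] at hbb
  have h1 := cum₂_eq_add_row (σ := σ) (j := N) hi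
  rw [hσ.cum₂_col hjN, hσ.cum₂_col hjN] at h1
  have h1' : cum N (σ i) N = rowSum N σ i := rfl
  have h2 := cum₂_eq_add_col (σ := σ) (i := i) (hi.trans hij)
  have h2' : cum N (fun i' => σ i' j) i = colSum N σ j := (hσ.cum_col (hij.trans hjN)).symm
  have h3 := cum_eq_add β hi
  have h4 := cum_eq_add α (hi.trans hij)
  rcases hij.lt_or_eq with hlt | rfl
  · have hc := hdim i (j - 1)
    rw [finrank_inf_sup hF hα hβ (by omega)] at hc
    have hBC : ((F j ⊓ (U ⊔ F (i - 1))) ⊔ Q) ⊔ ((F (j - 1) ⊓ (U ⊔ F i)) ⊔ Q) =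
        (F j ⊓ (U ⊔ F i)) ⊔ Q := by
      refine le_antisymm (sup_le hBS hCS) (sup_le ?_ (le_sup_right.trans le_sup_left))
      have : F j ⊓ (U ⊔ F i) = (U ⊓ F j) ⊔ F i := by
        rw [inf_comm, sup_comm, sup_inf_assoc_of_le U (hF.mono hij), sup_comm]
      rw [this]
      refine sup_le ?_ ?_
      · exact (le_inf inf_le_right (inf_le_left.trans le_sup_left)).trans
          (le_sup_left.trans le_sup_left)
      · exact (le_inf (hF.mono (by omega)) le_sup_right).trans (le_sup_left.trans le_sup_right)
    have hd := Submodule.finrank_sup_add_finrank_inf_eq ((F j ⊓ (U ⊔ F (i - 1))) ⊔ Q)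
      ((F (j - 1) ⊓ (U ⊔ F i)) ⊔ Q)
    rw [hBC] at hd
    have hcard := card_mem_notMem_notMem hBS hCS
    have hset : Nat.card {x : W // x ∈ (F j ⊓ (U ⊔ F i)) ⊔ Q ∧
        x ∉ F (j - 1) ⊔ Q ∧ x ∉ (U ⊔ F (i - 1)) ⊔ Q} =
        Nat.card {x : W // x ∈ (F j ⊓ (U ⊔ F i)) ⊔ Q ∧
        x ∉ (F j ⊓ (U ⊔ F (i - 1))) ⊔ Q ∧ x ∉ (F (j - 1) ⊓ (U ⊔ F i)) ⊔ Q} := by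
      refine Nat.card_congr (Equiv.subtypeEquivRight fun x => and_congr_right fun hx => ?_)
      rw [hB x hx, hC x hx, and_comm]
    rw [hset, hcard, if_pos hlt, if_neg hlt.ne]
    simp only [← zpow_natCast]
    set q := (Nat.card k : ℚ)
    set E : ℤ := (cum N α (j - 1) : ℕ) + ((0 : ℕ) : ℤ) + (cum N β (i - 1) : ℕ) -
      (cum₂ N σ (i - 1) j : ℕ) with hE
    have e1 : q ^ (finrank k ↥((F j ⊓ (U ⊔ F i)) ⊔ Q) : ℤ) = q ^ (cum₂ N σ N j : ℤ) *
        (q ^ E * (q ^ ((β i : ℤ) - rowSum N σ i) * q ^ (α j : ℤ))) := by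
      simp only [← zpow_add₀ hq0]
      congr 1
      omega
    have e2 : q ^ (finrank k ↥((F j ⊓ (U ⊔ F (i - 1))) ⊔ Q) : ℤ) = q ^ (cum₂ N σ N j : ℤ) *
        (q ^ E * q ^ (α j : ℤ)) := by
      simp only [← zpow_add₀ hq0]
      congr 1
      omega
    have e3 : q ^ (finrank k ↥((F (j - 1) ⊓ (U ⊔ F i)) ⊔ Q) : ℤ) = q ^ (cum₂ N σ N j : ℤ) *
        (q ^ E * (q ^ ((β i : ℤ) - rowSum N σ i) * q ^ (colSum N σ j : ℤ))) := by
      simp only [← zpow_add₀ hq0]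
      congr 1
      omega
    have e4 : q ^ (finrank k ↥(((F j ⊓ (U ⊔ F (i - 1))) ⊔ Q) ⊓
        ((F (j - 1) ⊓ (U ⊔ F i)) ⊔ Q)) : ℤ) = q ^ (cum₂ N σ N j : ℤ) *
        (q ^ E * q ^ (colSum N σ j : ℤ)) := by
      simp only [← zpow_add₀ hq0]
      congr 1
      omega
    rw [e1, e2, e3, e4]
    ring
  · have hcard := card_mem_notMem hBS
    have hset : Nat.card {x : W // x ∈ (F i ⊓ (U ⊔ F i)) ⊔ Q ∧
        x ∉ F (i - 1) ⊔ Q ∧ x ∉ (U ⊔ F (i - 1)) ⊔ Q} =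
        Nat.card {x : W // x ∈ (F i ⊓ (U ⊔ F i)) ⊔ Q ∧ x ∉ (F i ⊓ (U ⊔ F (i - 1))) ⊔ Q} := by
      refine Nat.card_congr (Equiv.subtypeEquivRight fun x => and_congr_right fun hx => ?_)
      rw [hB x hx]
      refine ⟨fun h => h.2, fun h => ⟨fun h' => h ?_, h⟩⟩
      rw [← hB x hx]
      exact sup_le_sup_right le_sup_right Q h'
    rw [hset, hcard, if_neg (lt_irrefl _), if_pos rfl, mul_one]
    simp only [← zpow_natCast]
    rw [mul_sub, mul_sub, mul_one, ← zpow_add₀ hq0, ← zpow_add₀ hq0, ← zpow_add₀ hq0]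
    congr 2 <;> omega

theorem card_positionSet (hF : IsFiltration N F)
    (hα : ∀ j, finrank k ↥(U ⊓ F j) = cum N α j)
    (hβ : ∀ i, finrank k ↥(U ⊔ F i) = finrank k U + cum N β i)
    (hσ : ∀ i j, ¬ (-N ≤ i ∧ i ≤ j ∧ j ≤ N) → σ i j = 0) :
    (Nat.card (positionSet F (fun i => U ⊔ F i) N σ) : ℚ) =
      positionCount (Nat.card k : ℚ) N α β σ := by
  refine induction_on_last_cell (motive := fun σ =>
    (Nat.card (positionSet F (fun i => U ⊔ F i) N σ) : ℚ) =
    positionCount (Nat.card k : ℚ) N α β σ) ?_ (fun σ i j hi hij hjN hσ ih => ?_) σ hσ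
  · have : positionSet F (fun i => U ⊔ F i) N 0 = {⊥} := by
      ext Q
      constructor
      · intro hQ
        have := hQ N N
        have hN := hF.top N le_rfl
        simpa [cum₂, cum, hN] using this
      · rintro rfl
        simp [positionSet, cum₂, cum]
    rw [this]
    simp [positionCount, positionExp, pairSum, windowSum, toZ, rowSum, colSum]
  · have hq := natCard_field_pow_ne_one (k := k)
    have hq0 := natCard_field_ne_zero (k := k)
    have h1 := card_positionSet_step (isBiFiltration_sup (U := U) hF) hi (hij.trans hjN)
      (hi.trans hij) hjN hσ (fun Q hQ => card_positionSet_vectors hF hα hβ hi hij hjN hσ hQ)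
    have h2 := positionCount_step hq0 hq α β hi hij hjN hσ
    rw [← ih] at h2
    refine mul_right_cancel₀ (mul_ne_zero (sub_ne_zero.2 (hq (σ i j)))
      (pow_ne_zero (cum₂ N σ N j) hq0)) (h1.trans ?_)
    linear_combination -(Nat.card k : ℚ) ^ cum₂ N σ N j * h2

end Count

/-! ### The number of complements with given graded dimensions -/

theorem finsum_eq_sum_Icc {M : Type*} [AddCommMonoid M] {N : ℤ} {f : ℤ → M}
    (h : ∀ i, i ∉ Finset.Icc (-N) N → f i = 0) : ∑ᶠ i, f i = ∑ i ∈ Finset.Icc (-N) N, f i :=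
  finsum_eq_sum_of_support_subset _ fun i hi => by
    by_contra h'
    exact hi (h i h')

theorem finprod_eq_prod_Icc {M : Type*} [CommMonoid M] {N : ℤ} {f : ℤ → M}
    (h : ∀ i, i ∉ Finset.Icc (-N) N → f i = 1) : ∏ᶠ i, f i = ∏ i ∈ Finset.Icc (-N) N, f i :=
  finprod_eq_prod_of_mulSupport_subset _ fun i hi => by
    by_contra h'
    exact hi (h i h')

theorem cum_diff {N : ℤ} {f : ℤ → ℕ} (hf : Monotone f) (h0 : ∀ l, l < -N → f l = 0) (i : ℤ) :
    cum N (fun l => f l - f (l - 1)) i = f i := by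
  by_cases hi : -N - 1 ≤ i
  · induction i, hi using Int.leInduction with
    | base => rw [cum_of_lt _ (by omega), h0 _ (by omega)]
    | succ j hj ih =>
      rw [cum_eq_add _ (by omega), add_sub_cancel_right, ih]
      have := hf (show j ≤ j + 1 by omega)
      omega
  · rw [cum_of_lt _ (by omega), h0 _ (by omega)]

theorem exists_cum₂_eq {N : ℤ} {D : ℤ → ℤ → ℕ} (hD : ∀ j, Monotone fun i => D i j)
    (h0 : ∀ i j, i < -N ∨ j < -N → D i j = 0)
    (hs : ∀ i j, D (i - 1) j + D i (j - 1) ≤ D i j + D (i - 1) (j - 1)) :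
    ∃ σ : ℤ → ℤ → ℕ, (∀ i j, cum₂ N σ i j = D i j) ∧ ∀ i j, σ i j =
      (D i j - D (i - 1) j) - (D i (j - 1) - D (i - 1) (j - 1)) := by
  refine ⟨_, fun i j => ?_, fun i j => rfl⟩
  have h1 : ∀ i, Monotone fun j => D i j - D (i - 1) j := by
    refine fun i => monotone_int_of_le_succ fun j => ?_
    have := hs i (j + 1)
    have h2 := hD j (show i - 1 ≤ i by omega)
    rw [add_sub_cancel_right] at this
    dsimp only at h2 ⊢
    omega
  have h2 : ∀ i, cum N (fun j => (D i j - D (i - 1) j) - (D i (j - 1) - D (i - 1) (j - 1))) j =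
      D i j - D (i - 1) j := fun i => cum_diff (h1 i) (fun l hl => by
    rw [h0 i l (Or.inr hl), Nat.zero_sub]) j
  rw [cum₂]
  simp only [h2]
  exact cum_diff (hD j) (fun l hl => h0 l j (Or.inl hl)) i

theorem eq_of_cum₂_eq {N : ℤ} {σ τ : ℤ → ℤ → ℕ}
    (hσ : ∀ i j, ¬ (-N ≤ i ∧ i ≤ j ∧ j ≤ N) → σ i j = 0)
    (hτ : ∀ i j, ¬ (-N ≤ i ∧ i ≤ j ∧ j ≤ N) → τ i j = 0)
    (h : ∀ i j, cum₂ N σ i j = cum₂ N τ i j) : σ = τ := by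
  funext i j
  by_cases hij : -N ≤ i ∧ i ≤ j ∧ j ≤ N
  · have hj : -N ≤ j := hij.1.trans hij.2.1
    have h1 := cum₂_eq_add_row (σ := σ) (j := j) hij.1
    have h2 := cum₂_eq_add_row (σ := τ) (j := j) hij.1
    have h3 := cum₂_eq_add_row (σ := σ) (j := j - 1) hij.1
    have h4 := cum₂_eq_add_row (σ := τ) (j := j - 1) hij.1
    have h5 := cum_eq_add (σ i) hj
    have h6 := cum_eq_add (τ i) hj
    simp only [h] at h1 h3
    omega
  · rw [hσ i j hij, hτ i j hij]

section Triangular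

variable {N : ℤ} {γ β : ℤ → ℕ} {σ : ℤ → ℤ → ℕ}

theorem eq_zero_of_finsum_eq_zero {f : ℤ → ℕ} (hf : f.support.Finite) (h : ∑ᶠ i, f i = 0)
    (i : ℤ) : f i = 0 := by
  by_contra h'
  have := single_le_finsum i hf fun _ => Nat.zero_le _
  omega

theorem triangular_row_finite (hσ : σ ∈ triangular γ β) (i : ℤ) : (σ i).support.Finite := by
  refine (hσ.2.1.image Prod.snd).subset fun j hj => ⟨(i, j), hj, rfl⟩

theorem triangular_col_finite (hσ : σ ∈ triangular γ β) (j : ℤ) :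
    (fun i => σ i j).support.Finite := by
  refine (hσ.2.1.image Prod.fst).subset fun i hi => ⟨(i, j), hi, rfl⟩

variable (hγ : ∀ l, l ∉ Finset.Icc (-N) N → γ l = 0) (hβ : ∀ l, l ∉ Finset.Icc (-N) N → β l = 0)
include hγ hβ

theorem triangular_eq_zero (hσ : σ ∈ triangular γ β) (i j : ℤ)
    (hij : ¬ (-N ≤ i ∧ i ≤ j ∧ j ≤ N)) : σ i j = 0 := by
  by_cases h1 : j < i
  · exact hσ.1 i j h1
  by_cases h2 : i ∈ Finset.Icc (-N) N
  · have h3 : j ∉ Finset.Icc (-N) N := by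
      simp only [Finset.mem_Icc] at h2 ⊢
      omega
    exact eq_zero_of_finsum_eq_zero (triangular_col_finite hσ j) (by rw [hσ.2.2.2 j, hγ j h3]) i
  · exact eq_zero_of_finsum_eq_zero (triangular_row_finite hσ i) (by rw [hσ.2.2.1 i, hβ i h2]) j

theorem triangular_rowSum (hσ : σ ∈ triangular γ β) : rowSum N σ = β := by
  funext i
  rw [← hσ.2.2.1 i, finsum_eq_sum_Icc (N := N)]
  · rfl
  · intro j hj
    refine triangular_eq_zero hγ hβ hσ i j fun h => hj ?_
    rw [Finset.mem_Icc]
    omega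

theorem triangular_colSum (hσ : σ ∈ triangular γ β) : colSum N σ = γ := by
  funext j
  rw [← hσ.2.2.2 j, finsum_eq_sum_Icc (N := N)]
  · rfl
  · intro i hi
    refine triangular_eq_zero hγ hβ hσ i j fun h => hi ?_
    rw [Finset.mem_Icc]
    omega

theorem mem_triangular (h0 : ∀ i j, ¬ (-N ≤ i ∧ i ≤ j ∧ j ≤ N) → σ i j = 0)
    (hr : ∀ i ∈ Finset.Icc (-N) N, rowSum N σ i = β i)
    (hc : ∀ i ∈ Finset.Icc (-N) N, colSum N σ i = γ i) : σ ∈ triangular γ β := by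
  refine ⟨fun i j hij => h0 i j (by omega), ?_, fun i => ?_, fun j => ?_⟩
  · refine ((Finset.Icc (-N) N ×ˢ Finset.Icc (-N) N).finite_toSet).subset fun p hp => ?_
    by_contra h
    refine hp (h0 _ _ fun h' => h ?_)
    simp only [Finset.coe_product, Set.mem_prod, Finset.mem_coe, Finset.mem_Icc]
    omega
  · rw [finsum_eq_sum_Icc (N := N) fun j hj => h0 i j fun h => hj (by rw [Finset.mem_Icc]; omega)]
    by_cases hi : i ∈ Finset.Icc (-N) N
    · exact hr i hi
    · rw [hβ i hi]
      exact Finset.sum_eq_zero fun j _ => h0 i j fun h => hi (by rw [Finset.mem_Icc]; omega)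
  · rw [finsum_eq_sum_Icc (N := N) fun i hi => h0 i j fun h => hi (by rw [Finset.mem_Icc]; omega)]
    by_cases hj : j ∈ Finset.Icc (-N) N
    · exact hc j hj
    · rw [hγ j hj]
      exact Finset.sum_eq_zero fun i _ => h0 i j fun h => hj (by rw [Finset.mem_Icc]; omega)

theorem triangular_finite : (triangular γ β).Finite := by
  let B := ∑ i ∈ Finset.Icc (-N) N, β i
  let I := Finset.Icc (-N) N
  refine (Set.finite_range fun (f : I → I → Fin (B + 1)) (i j : ℤ) =>
    if h : i ∈ I ∧ j ∈ I then (f ⟨i, h.1⟩ ⟨j, h.2⟩ : ℕ) else 0).subset fun σ hσ => ?_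
  have hle : ∀ i ∈ I, ∀ j ∈ I, σ i j < B + 1 := by
    intro i hi j hj
    have h1 : σ i j ≤ rowSum N σ i :=
      Finset.single_le_sum (f := fun j => σ i j) (fun _ _ => Nat.zero_le _) hj
    have h2 : β i ≤ B := Finset.single_le_sum (f := β) (fun _ _ => Nat.zero_le _) hi
    rw [triangular_rowSum hγ hβ hσ] at h1
    omega
  refine ⟨fun i j => ⟨σ i j, hle i i.2 j j.2⟩, ?_⟩
  funext i j
  dsimp only
  split_ifs with h
  · rfl
  · refine (triangular_eq_zero hγ hβ hσ i j fun h' => h ?_).symm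
    simp only [I, Finset.mem_Icc]
    omega

end Triangular

/-- The value at `x` of the polynomial `n(α, γ, β)`, for sequences supported on `[-N, N]`. -/
noncomputable def complementCount {K : Type*} [Field K] (x : K) (N : ℤ) (α γ β : ℤ → ℕ) : K :=
  ∑ᶠ σ ∈ triangular γ β, positionCount x N α β σ

section Complements

variable {k W : Type*} [Field k] [AddCommGroup W] [Module k W]

/-- The complements of `U` with graded dimensions `γ`. -/
def complementSet (F : ℤ → Submodule k W) (U : Submodule k W) (N : ℤ) (γ : ℤ → ℕ) :
    Set (Submodule k W) :=
  {Q | Q ⊓ U = ⊥ ∧ Q ⊔ U = ⊤ ∧ ∀ j, finrank k ↥(Q ⊓ F j) = cum N γ j}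

variable [Finite k] [Module.Finite k W]
  {F : ℤ → Submodule k W} {N : ℤ} {U : Submodule k W} {α β γ : ℤ → ℕ}

theorem cum₂_eq_cum_colSum (σ : ℤ → ℤ → ℕ) (j : ℤ) :
    cum₂ N σ N j = cum N (colSum N σ) j := by
  rw [cum₂, cum, cum]
  exact Finset.sum_comm

theorem mem_complementSet_of_mem_positionSet (hF : IsFiltration N F)
    (hβ : ∀ i, finrank k ↥(U ⊔ F i) = finrank k U + cum N β i)
    (hγ0 : ∀ l, l ∉ Finset.Icc (-N) N → γ l = 0) (hβ0 : ∀ l, l ∉ Finset.Icc (-N) N → β l = 0)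
    {σ : ℤ → ℤ → ℕ} (hσ : σ ∈ triangular γ β) {Q : Submodule k W}
    (hQ : Q ∈ positionSet F (fun i => U ⊔ F i) N σ) : Q ∈ complementSet F U N γ := by
  have hN := hF.top N le_rfl
  have h1 : Q ⊓ U = ⊥ := by
    have := hQ (-N - 1) N
    rw [cum₂_of_lt_row (by omega)] at this
    simpa [hN, hF.bot (-N - 1) (by omega)] using this
  refine ⟨h1, ?_, fun j => ?_⟩
  · have h2 := hβ N
    have h3 : finrank k Q = cum N β N := by
      have e : Q ⊓ F N ⊓ (U ⊔ F N) = Q := by rw [hN, sup_top_eq, inf_top_eq, inf_top_eq]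
      have : finrank k ↥(Q ⊓ F N ⊓ (U ⊔ F N)) = cum₂ N σ N N := hQ N N
      rw [e] at this
      rw [this, ← triangular_rowSum hγ0 hβ0 hσ]
      rfl
    have h4 := Submodule.finrank_sup_add_finrank_inf_eq Q U
    rw [hN, sup_top_eq, finrank_top] at h2
    rw [h1, finrank_bot] at h4
    exact Submodule.eq_top_of_finrank_eq (by omega)
  · have e : Q ⊓ F j ⊓ (U ⊔ F N) = Q ⊓ F j := by rw [hN, sup_top_eq, inf_top_eq]
    have : finrank k ↥(Q ⊓ F j ⊓ (U ⊔ F N)) = cum₂ N σ N j := hQ N j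
    rwa [e, cum₂_eq_cum_colSum, triangular_colSum hγ0 hβ0 hσ] at this

theorem exists_mem_positionSet (hF : IsFiltration N F)
    (hβ : ∀ i, finrank k ↥(U ⊔ F i) = finrank k U + cum N β i)
    (hγ0 : ∀ l, l ∉ Finset.Icc (-N) N → γ l = 0) (hβ0 : ∀ l, l ∉ Finset.Icc (-N) N → β l = 0)
    {Q : Submodule k W} (hQ : Q ∈ complementSet F U N γ) :
    ∃ σ ∈ triangular γ β, Q ∈ positionSet F (fun i => U ⊔ F i) N σ := by
  have hN := hF.top N le_rfl
  have hb := isBiFiltration_sup (U := U) hF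
  obtain ⟨σ, hσ, hσ'⟩ := exists_cum₂_eq (N := N)
    (D := fun i j => finrank k ↥(Q ⊓ F j ⊓ (U ⊔ F i)))
    (fun j i i' h => Submodule.finrank_mono (inf_le_inf_left _ (hb.monoG h)))
    (fun i j h => by
      rcases h with h | h
      · rw [hF.bot i h, sup_bot_eq, inf_right_comm, hQ.1, bot_inf_eq, finrank_bot]
      · rw [hF.bot j h, inf_bot_eq, bot_inf_eq, finrank_bot])
    (fun i j => by
      have h1 := Submodule.finrank_sup_add_finrank_inf_eq (Q ⊓ F j ⊓ (U ⊔ F (i - 1)))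
        (Q ⊓ F (j - 1) ⊓ (U ⊔ F i))
      have hj : F (j - 1) ≤ F j := hF.mono (by omega)
      have hi : U ⊔ F (i - 1) ≤ U ⊔ F i := hb.monoG (by omega)
      have h2 : Q ⊓ F j ⊓ (U ⊔ F (i - 1)) ⊓ (Q ⊓ F (j - 1) ⊓ (U ⊔ F i)) =
          Q ⊓ F (j - 1) ⊓ (U ⊔ F (i - 1)) := by
        refine le_antisymm ?_ ?_
        · exact le_inf (inf_le_right.trans inf_le_left) (inf_le_left.trans inf_le_right)
        · exact le_inf (inf_le_inf_right _ (inf_le_inf_left _ hj)) (inf_le_inf_left _ hi)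
      have h3 : Q ⊓ F j ⊓ (U ⊔ F (i - 1)) ⊔ (Q ⊓ F (j - 1) ⊓ (U ⊔ F i)) ≤
          Q ⊓ F j ⊓ (U ⊔ F i) :=
        sup_le (inf_le_inf_left _ hi) (inf_le_inf_right _ (inf_le_inf_left _ hj))
      have h4 := Submodule.finrank_mono h3
      rw [h2] at h1
      omega)
  have hG : ∀ i, finrank k ↥(Q ⊓ (U ⊔ F i)) = cum N β i := by
    intro i
    have h1 := Submodule.finrank_sup_add_finrank_inf_eq (Q ⊓ (U ⊔ F i)) U
    have h2 : Q ⊓ (U ⊔ F i) ⊓ U = ⊥ := by rw [inf_right_comm, hQ.1, bot_inf_eq]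
    have h3 : Q ⊓ (U ⊔ F i) ⊔ U = U ⊔ F i := by
      rw [inf_comm, inf_sup_assoc_of_le Q (le_sup_left : U ≤ U ⊔ F i), hQ.2.1, inf_top_eq]
    rw [h2, h3, finrank_bot, hβ] at h1
    omega
  have h0 : ∀ i j, ¬ (-N ≤ i ∧ i ≤ j ∧ j ≤ N) → σ i j = 0 := by
    intro i j hij
    rw [hσ']
    by_cases h1 : j < i
    · have e : ∀ m, m < i → Q ⊓ F m ⊓ (U ⊔ F i) = Q ⊓ F m ⊓ (U ⊔ F (i - 1)) := by
        intro m hm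
        have h1 : Q ⊓ F m ≤ U ⊔ F (i - 1) :=
          inf_le_right.trans ((hF.mono (by omega)).trans le_sup_right)
        rw [inf_eq_left.2 h1, inf_eq_left.2 (h1.trans (hb.monoG (by omega)))]
      rw [e j h1, e (j - 1) (by omega)]
      omega
    · by_cases h2 : i < -N
      · rw [hF.bot i h2, hF.bot (i - 1) (by omega)]
        omega
      · rw [hF.top j (by omega), hF.top (j - 1) (by omega)]
        omega
  refine ⟨σ, mem_triangular hγ0 hβ0 h0 (fun i hi => ?_) (fun j hj => ?_), fun i j => (hσ i j).symm⟩
  · have h1 := cum₂_eq_add_row (σ := σ) (j := N) (Finset.mem_Icc.1 hi).1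
    have h2 := cum_eq_add β (Finset.mem_Icc.1 hi).1
    have h3 : cum N (σ i) N = rowSum N σ i := rfl
    rw [hσ, hσ, hN, inf_top_eq, hG, hG] at h1
    omega
  · have h1 := cum₂_eq_add_col (σ := σ) (i := N) (Finset.mem_Icc.1 hj).1
    have h2 := cum_eq_add γ (Finset.mem_Icc.1 hj).1
    have h3 : cum N (fun i => σ i j) N = colSum N σ j := rfl
    rw [hσ, hσ, hN, sup_top_eq, inf_top_eq, inf_top_eq, hQ.2.2, hQ.2.2] at h1
    omega

theorem card_complementSet (hF : IsFiltration N F)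
    (hα : ∀ j, finrank k ↥(U ⊓ F j) = cum N α j)
    (hβ : ∀ i, finrank k ↥(U ⊔ F i) = finrank k U + cum N β i)
    (hγ0 : ∀ l, l ∉ Finset.Icc (-N) N → γ l = 0) (hβ0 : ∀ l, l ∉ Finset.Icc (-N) N → β l = 0) :
    (Nat.card (complementSet F U N γ) : ℚ) = complementCount (Nat.card k : ℚ) N α γ β := by
  have : Finite W := Module.finite_of_finite k
  have hT := triangular_finite hγ0 hβ0
  have : Fintype (triangular γ β) := hT.fintype
  choose! f hf1 hf2 using fun Q (hQ : Q ∈ complementSet F U N γ) =>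
    exists_mem_positionSet hF hβ hγ0 hβ0 hQ
  have e : complementSet F U N γ ≃
      Σ σ : triangular γ β, positionSet F (fun i => U ⊔ F i) N σ.1 :=
    { toFun := fun Q => ⟨⟨f Q.1, hf1 Q.1 Q.2⟩, ⟨Q.1, hf2 Q.1 Q.2⟩⟩
      invFun := fun s => ⟨s.2.1, mem_complementSet_of_mem_positionSet hF hβ hγ0 hβ0 s.1.2 s.2.2⟩
      left_inv := fun _ => rfl
      right_inv := by
        rintro ⟨⟨σ, hσ⟩, ⟨Q, hQ⟩⟩
        have hQc := mem_complementSet_of_mem_positionSet hF hβ hγ0 hβ0 hσ hQ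
        have : f Q = σ := eq_of_cum₂_eq (triangular_eq_zero hγ0 hβ0 (hf1 Q hQc))
          (triangular_eq_zero hγ0 hβ0 hσ) fun i j => (hf2 Q hQc i j).symm.trans (hQ i j)
        subst this
        rfl }
  rw [Nat.card_congr e, Nat.card_sigma, complementCount, ← finsum_set_coe_eq_finsum_mem,
    finsum_eq_sum_of_fintype, Nat.cast_sum]
  exact Finset.sum_congr rfl fun σ _ =>
    card_positionSet hF hα hβ (triangular_eq_zero hγ0 hβ0 σ.2)

end Complements

/-! ### The polynomial `n(α, γ, β)` counts complements -/

theorem finsum_cond_eq_sum_Icc {M : Type*} [AddCommMonoid M] {N : ℤ} {f : ℤ → M}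
    (h : ∀ i, i ∉ Finset.Icc (-N) N → f i = 0) (p : ℤ → Prop) [DecidablePred p] :
    ∑ᶠ (i : ℤ) (_ : p i), f i = ∑ i ∈ Finset.Icc (-N) N, if p i then f i else 0 := by
  rw [finsum_congr fun i => finsum_eq_if (p := p i)]
  exact finsum_eq_sum_Icc fun i hi => by rw [h i hi, ite_self]

theorem v_sq_pow_ne_one (m : ℕ) : (v ^ 2) ^ (m + 1) ≠ 1 := by
  intro h
  have h1 : (Polynomial.X : Polynomial ℚ) ^ (2 * (m + 1)) = 1 := by
    apply RatFunc.algebraMap_injective ℚ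
    rw [map_pow, RatFunc.algebraMap_X, map_one, pow_mul]
    exact h
  have h2 := congrArg Polynomial.natDegree h1
  simp at h2

theorem v_sq_sub_one_ne_zero : v ^ 2 - 1 ≠ 0 := by
  have := v_sq_pow_ne_one 0
  rw [zero_add, pow_one] at this
  exact sub_ne_zero.2 this

theorem qint_eq (a : ℤ) : qint a = ((v ^ 2) ^ a - 1) / (v ^ 2 - 1) := by
  simp only [qint, qbinom, Finset.Icc_self, Finset.prod_singleton]
  rw [← zpow_natCast v 2, ← zpow_mul]
  norm_num

theorem qbinom_eq_gaussBinom (a : ℤ) (b : ℕ) : qbinom a b = gaussBinom (v ^ 2) a b := by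
  refine Finset.prod_congr rfl fun i _ => ?_
  rw [zpow_mul, zpow_mul]
  norm_cast

/-- The product `∏_{1 ≤ m ≤ b} (x^m - 1)`. -/
noncomputable def powFact {K : Type*} [Field K] (x : K) (b : ℕ) : K :=
  ∏ m ∈ Finset.range b, (x ^ (m + 1) - 1)

theorem qfact_eq (b : ℕ) : qfact b * (v ^ 2 - 1) ^ b = powFact (v ^ 2) b := by
  induction b with
  | zero => simp [qfact, powFact]
  | succ b ih =>
    rw [qfact, Finset.prod_Icc_succ_top (by omega), ← qfact, powFact, Finset.prod_range_succ,
      ← powFact, ← ih, qint_eq, zpow_natCast, pow_succ (v ^ 2 - 1)]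
    have := v_sq_sub_one_ne_zero
    field_simp

theorem nPoly_eq_complementCount {N : ℤ} {α γ β : ℤ → ℕ}
    (hα : ∀ l, l ∉ Finset.Icc (-N) N → α l = 0) (hγ : ∀ l, l ∉ Finset.Icc (-N) N → γ l = 0)
    (hβ : ∀ l, l ∉ Finset.Icc (-N) N → β l = 0) :
    nPoly α γ β = complementCount (v ^ 2) N α γ β := by
  refine finsum_congr fun σ => finsum_congr fun hσ => ?_
  have h0 := triangular_eq_zero hγ hβ hσ
  have hr := triangular_rowSum hγ hβ hσ
  have hc := triangular_colSum hγ hβ hσ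
  have hi0 : ∀ i, i ∉ Finset.Icc (-N) N → ∀ j, σ i j = 0 := fun i hi j =>
    h0 i j fun h => hi (by rw [Finset.mem_Icc]; omega)
  have hj0 : ∀ j, j ∉ Finset.Icc (-N) N → ∀ i, σ i j = 0 := fun j hj i =>
    h0 i j fun h => hj (by rw [Finset.mem_Icc]; omega)
  have e1 : (∑ᶠ (i : ℤ) (j : ℤ) (l : ℤ) (_ : l < j), σ i j * α l) =
      windowSum N σ (fun _ j => cum N α (j - 1)) := by
    rw [finsum_eq_sum_Icc (N := N) fun i hi => by simp [hi0 i hi]]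
    refine Finset.sum_congr rfl fun i _ => ?_
    rw [finsum_eq_sum_Icc (N := N) fun j hj => by simp [hj0 j hj]]
    refine Finset.sum_congr rfl fun j hj => ?_
    rw [finsum_cond_eq_sum_Icc (N := N) (fun l hl => by rw [hα l hl, mul_zero])]
    dsimp only
    rw [cum, ← Finset.sum_filter, Finset.mul_sum]
    refine Finset.sum_congr ?_ fun _ _ => rfl
    ext l
    simp only [Finset.mem_filter, Finset.mem_Icc] at hj ⊢
    omega
  have e2 : (∑ᶠ i : ℤ, σ i i * α i) = windowSum N σ (fun i j => if i = j then α i else 0) := by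
    rw [finsum_eq_sum_Icc (N := N) fun i hi => by simp [hi0 i hi]]
    refine Finset.sum_congr rfl fun i hi => ?_
    rw [Finset.sum_eq_single i]
    · simp
    · intro j _ hj
      simp [Ne.symm hj]
    · exact fun h => absurd hi h
  have e3 : (∑ᶠ (i : ℤ) (k : ℤ) (_ : k < i) (j : ℤ) (l : ℤ) (_ : j < l), σ i j * σ k l) =
      windowSum N σ (crossAt N σ) := by
    rw [finsum_eq_sum_Icc (N := N) fun i hi => by simp [hi0 i hi]]
    refine Finset.sum_congr rfl fun i _ => ?_
    rw [finsum_cond_eq_sum_Icc (N := N) fun k hk => by simp [hi0 k hk]]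
    have : ∀ k, (∑ᶠ (j : ℤ) (l : ℤ) (_ : j < l), σ i j * σ k l) =
        ∑ j ∈ Finset.Icc (-N) N, ∑ l ∈ Finset.Icc (-N) N, if j < l then σ i j * σ k l else 0 := by
      intro k
      rw [finsum_eq_sum_Icc (N := N) fun j hj => by simp [hj0 j hj]]
      refine Finset.sum_congr rfl fun j _ => ?_
      rw [finsum_cond_eq_sum_Icc (N := N) fun l hl => by simp [hj0 l hl]]
    simp only [this, crossAt, Finset.mul_sum]
    rw [Finset.sum_comm (t := Finset.Icc (-N) N)]
    refine Finset.sum_congr rfl fun k _ => ?_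
    split_ifs with h
    · refine Finset.sum_congr rfl fun j _ => Finset.sum_congr rfl fun l _ => ?_
      by_cases h' : j < l <;> simp [h, h']
    · simp [h]
  have e4 : positionExp N α β σ = ((∑ᶠ (i : ℤ) (j : ℤ) (l : ℤ) (_ : l < j), σ i j * α l) +
      (∑ᶠ i : ℤ, σ i i * α i) +
      ∑ᶠ (i : ℤ) (k : ℤ) (_ : k < i) (j : ℤ) (l : ℤ) (_ : j < l), σ i j * σ k l : ℕ) := by
    rw [e1, e2, e3, positionExp, hr, sub_self]
    simp [pairSum]
  have f1 : ∏ᶠ i : ℤ, qfact (β i) = ∏ i ∈ Finset.Icc (-N) N, qfact (β i) :=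
    finprod_eq_prod_Icc fun i hi => by simp [hβ i hi, qfact]
  have f2 : ∏ᶠ p : ℤ × ℤ, qfact (σ p.1 p.2) =
      ∏ i ∈ Finset.Icc (-N) N, ∏ j ∈ Finset.Icc (-N) N, qfact (σ i j) := by
    rw [finprod_eq_prod_of_mulSupport_subset (s := Finset.Icc (-N) N ×ˢ Finset.Icc (-N) N),
      Finset.prod_product]
    intro p hp
    by_contra h
    refine hp ?_
    have : σ p.1 p.2 = 0 := h0 _ _ fun h' => h (by
      simp only [Finset.coe_product, Set.mem_prod, Finset.mem_coe, Finset.mem_Icc]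
      omega)
    simp [this, qfact]
  have f3 : ∏ᶠ j : ℤ, ∏ l ∈ Finset.range (γ j - σ j j), (v ^ (2 * α j) - v ^ (2 * l)) =
      ∏ j ∈ Finset.Icc (-N) N, ∏ l ∈ Finset.range (γ j - σ j j), ((v ^ 2) ^ α j - (v ^ 2) ^ l) := by
    rw [finprod_eq_prod_Icc (N := N) fun i hi => by simp [hγ i hi]]
    simp only [pow_mul]
  have f4 : ∀ b : ℕ, (∏ m ∈ Finset.range b, ((v ^ 2) ^ ((b : ℤ) - m) - 1)) = powFact (v ^ 2) b := by
    intro b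
    rw [← Finset.prod_range_reflect, powFact]
    refine Finset.prod_congr rfl fun m hm => ?_
    rw [Finset.mem_range] at hm
    rw [show (b : ℤ) - ((b - 1 - m : ℕ) : ℤ) = ((m + 1 : ℕ) : ℤ) by omega, zpow_natCast]
  rw [positionCount, e4, zpow_natCast, ← pow_mul, f1, f2, f3, hr, hc]
  congr 2
  have f6 : ∀ b, ∏ m ∈ Finset.range b, ((v ^ 2) ^ (m + 1) - 1) = powFact (v ^ 2) b := fun _ => rfl
  simp only [f4, f6, ← qfact_eq, Finset.prod_mul_distrib, Finset.prod_pow_eq_pow_sum]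
  have hv := v_sq_sub_one_ne_zero
  have f5 : ∑ i ∈ Finset.Icc (-N) N, β i = ∑ i ∈ Finset.Icc (-N) N, ∑ j ∈ Finset.Icc (-N) N, σ i j := by
    rw [← hr]; rfl
  rw [f5, mul_div_mul_right _ _ (pow_ne_zero _ hv)]

/-! ### Relative dimensions of commensurable subspaces -/

section RelDim

variable {k V : Type*} [Field k] [AddCommGroup V] [Module k V]

/-- The dimension of `A / (A ⊓ B)`. -/
noncomputable def rd (A B : Submodule k V) : ℕ := finrank k ↥(A.map B.mkQ)

/-- The space `A / (A ⊓ B)` is finite-dimensional. -/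
def FinRel (A B : Submodule k V) : Prop := Module.Finite k ↥(A.map B.mkQ)

/-- The space `A / (A ⊓ B)` as a subspace of `V / B`. -/
noncomputable def quotEquivMap (A B : Submodule k V) : (A ⧸ B.submoduleOf A) ≃ₗ[k] ↥(A.map B.mkQ) :=
  (Submodule.quotEquivOfEq _ _ (by
    ext x
    simp [Submodule.submoduleOf])).trans
  ((B.mkQ.domRestrict A).quotKerEquivRange.trans
    (LinearEquiv.ofEq _ _ (by rw [LinearMap.domRestrict, LinearMap.range_comp,
      Submodule.range_subtype])))

variable {A B C : Submodule k V}

theorem rd_eq_finrank_quotient : rd A B = finrank k (A ⧸ B.submoduleOf A) :=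
  (quotEquivMap A B).finrank_eq.symm

theorem finRel_iff : FinRel A B ↔ Module.Finite k (A ⧸ B.submoduleOf A) :=
  ⟨fun h => by
    have : Module.Finite k ↥(A.map B.mkQ) := h
    exact Module.Finite.equiv (quotEquivMap A B).symm,
  fun _ => Module.Finite.equiv (quotEquivMap A B)⟩

theorem rd_inf : rd A (A ⊓ B) = rd A B := by
  rw [rd_eq_finrank_quotient, rd_eq_finrank_quotient]
  have : (A ⊓ B).submoduleOf A = B.submoduleOf A := by
    ext x
    simp [Submodule.submoduleOf]
  rw [this]

theorem rd_sup : rd (A ⊔ B) B = rd A B := by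
  rw [rd, Submodule.map_sup, Submodule.mkQ_map_self, sup_bot_eq, rd]

theorem FinRel.mono_left (h : FinRel B C) (hAB : A ≤ B) : FinRel A C := by
  have : Module.Finite k ↥(B.map C.mkQ) := h
  exact Submodule.finiteDimensional_of_le (Submodule.map_mono hAB)

theorem FinRel.mono_right (h : FinRel A C) (hBC : C ≤ B) : FinRel A B := by
  have : Module.Finite k ↥(A.map C.mkQ) := h
  have e : A.map B.mkQ = (A.map C.mkQ).map (Submodule.factor hBC) := by
    rw [← Submodule.map_comp]
    congr 1
  rw [FinRel, e]
  infer_instance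

theorem rd_add (hCB : C ≤ B) (hBA : B ≤ A) (h : FinRel A C) : rd A C = rd A B + rd B C := by
  have : Module.Finite k ↥(A.map C.mkQ) := h
  have h1 := LinearMap.finrank_range_add_finrank_ker ((Submodule.factor hCB).domRestrict (A.map C.mkQ))
  have e1 : LinearMap.range ((Submodule.factor hCB).domRestrict (A.map C.mkQ)) = A.map B.mkQ := by
    rw [LinearMap.domRestrict, LinearMap.range_comp, Submodule.range_subtype, ← Submodule.map_comp]
    congr 1
  have e2 : (LinearMap.ker ((Submodule.factor hCB).domRestrict (A.map C.mkQ))).map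
      (A.map C.mkQ).subtype = B.map C.mkQ := by
    ext x
    constructor
    · rintro ⟨⟨_, y, hy, rfl⟩, hx, rfl⟩
      refine ⟨y, ?_, rfl⟩
      have : (Submodule.factor hCB) (C.mkQ y) = 0 := hx
      simpa using this
    · rintro ⟨y, hy, rfl⟩
      refine ⟨⟨C.mkQ y, y, hBA hy, rfl⟩, ?_, rfl⟩
      change (Submodule.factor hCB) (C.mkQ y) = 0
      simpa using hy
  have e3 := Submodule.finrank_map_subtype_eq (A.map C.mkQ)
    (LinearMap.ker ((Submodule.factor hCB).domRestrict (A.map C.mkQ)))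
  rw [e2] at e3
  rw [e1] at h1
  rw [rd, rd, rd, e3, h1]

theorem le_of_rd_eq_zero (h : FinRel A B) (h0 : rd A B = 0) : A ≤ B := by
  have : Module.Finite k ↥(A.map B.mkQ) := h
  have := Submodule.finrank_eq_zero.1 h0
  rwa [← LinearMap.le_ker_iff_map, Submodule.ker_mkQ] at this

theorem FinRel.trans (hCB : C ≤ B) (h1 : FinRel A B) (h2 : FinRel B C) : FinRel A C := by
  have i1 : Module.Finite k ↥(A.map B.mkQ) := h1
  have i2 : Module.Finite k ↥(B.map C.mkQ) := h2
  refine Module.Finite.iff_fg.2 (Submodule.fg_of_fg_map_of_fg_inf_ker (Submodule.factor hCB) ?_ ?_)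
  · rw [← Submodule.map_comp]
    exact Module.Finite.iff_fg.1 i1
  · have : A.map C.mkQ ⊓ LinearMap.ker (Submodule.factor hCB) ≤ B.map C.mkQ := by
      rintro _ ⟨⟨y, hy, rfl⟩, hx⟩
      refine ⟨y, ?_, rfl⟩
      have : (Submodule.factor hCB) (C.mkQ y) = 0 := hx
      simpa using this
    exact Module.Finite.iff_fg.1 (Submodule.finiteDimensional_of_le this)

theorem rd_map_equiv (φ : V ≃ₗ[k] V) : rd (A.map (φ : V →ₗ[k] V)) (B.map (φ : V →ₗ[k] V)) = rd A B := by
  have e : (A.map (φ : V →ₗ[k] V)).map (B.map (φ : V →ₗ[k] V)).mkQ =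
      (A.map B.mkQ).map (Submodule.Quotient.equiv B (B.map (φ : V →ₗ[k] V)) φ rfl : _ →ₗ[k] _) := by
    rw [← Submodule.map_comp, ← Submodule.map_comp]
    congr 1
  rw [rd, e, LinearEquiv.finrank_map_eq]
  rfl

/-! ### The dimension function of a filtration -/

/-- A monotone family with finite-dimensional subquotients. -/
structure IsLadder (F : ℤ → Submodule k V) : Prop where
  mono : Monotone F
  fin : ∀ i j, FinRel (F j) (F i)

/-- Subspaces commensurable with the terms of a filtration. -/
def Comm (F : ℤ → Submodule k V) (A : Submodule k V) : Prop := ∃ i j, F i ≤ A ∧ A ≤ F j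

/-- The dimension of a commensurable subspace, relative to `F 0`. -/
noncomputable def idx (F : ℤ → Submodule k V) (A : Submodule k V) : ℤ := rd A (F 0) - rd (F 0) A

variable {F : ℤ → Submodule k V}

theorem Comm.of_le {D : Submodule k V} (hA : Comm F A) (hD : Comm F D) (h1 : A ≤ B) (h2 : B ≤ D) :
    Comm F B := by
  obtain ⟨i, _, hi, _⟩ := hA
  obtain ⟨_, j, _, hj⟩ := hD
  exact ⟨i, j, hi.trans h1, h2.trans hj⟩

theorem comm_self (F : ℤ → Submodule k V) (j : ℤ) : Comm F (F j) := ⟨j, j, le_rfl, le_rfl⟩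

variable (hF : IsLadder F)
include hF

theorem Comm.inf (hA : Comm F A) (hB : Comm F B) : Comm F (A ⊓ B) := by
  obtain ⟨i, j, hi, hj⟩ := hA
  obtain ⟨i', _, hi', _⟩ := hB
  exact ⟨min i i', j, le_inf ((hF.mono (min_le_left _ _)).trans hi)
    ((hF.mono (min_le_right _ _)).trans hi'), inf_le_left.trans hj⟩

theorem Comm.sup (hA : Comm F A) (hB : Comm F B) : Comm F (A ⊔ B) := by
  obtain ⟨i, j, hi, hj⟩ := hA
  obtain ⟨_, j', _, hj'⟩ := hB
  exact ⟨i, max j j', hi.trans le_sup_left, sup_le (hj.trans (hF.mono (le_max_left _ _)))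
    (hj'.trans (hF.mono (le_max_right _ _)))⟩

theorem Comm.finRel (hA : Comm F A) (hB : Comm F B) : FinRel A B := by
  obtain ⟨_, j, _, hj⟩ := hA
  obtain ⟨i, _, hi, _⟩ := hB
  exact ((hF.fin i j).mono_left hj).mono_right hi

theorem idx_sub (hA : Comm F A) (hB : Comm F B) (h : A ≤ B) : idx F B - idx F A = rd B A := by
  have h0 := comm_self F 0
  have hAi := hA.inf hF h0
  have hBi := hB.inf hF h0
  have h1 := rd_add (inf_le_inf_right (F 0) h) inf_le_right (h0.finRel hF hAi)
  have h2 := rd_add (inf_le_left : A ⊓ F 0 ≤ A) h (hB.finRel hF hAi)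
  have h3 := rd_add (inf_le_inf_right (F 0) h) inf_le_left (hB.finRel hF hAi)
  have e1 : rd (F 0) A = rd (F 0) (A ⊓ F 0) := by rw [inf_comm, rd_inf]
  have e2 : rd (F 0) B = rd (F 0) (B ⊓ F 0) := by rw [inf_comm, rd_inf]
  have e3 : rd A (F 0) = rd A (A ⊓ F 0) := rd_inf.symm
  have e4 : rd B (F 0) = rd B (B ⊓ F 0) := rd_inf.symm
  rw [idx, idx, e1, e2, e3, e4]
  omega

theorem idx_sup_add_idx_inf (hA : Comm F A) (hB : Comm F B) :
    idx F (A ⊔ B) + idx F (A ⊓ B) = idx F A + idx F B := by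
  have h1 := idx_sub hF hB (hA.sup hF hB) le_sup_right
  have h2 := idx_sub hF (hA.inf hF hB) hA inf_le_left
  rw [rd_sup] at h1
  rw [rd_inf] at h2
  omega

theorem idx_mono (hA : Comm F A) (hB : Comm F B) (h : A ≤ B) : idx F A ≤ idx F B := by
  have := idx_sub hF hA hB h
  omega

theorem eq_of_idx_le (hA : Comm F A) (hB : Comm F B) (h : A ≤ B) (h' : idx F B ≤ idx F A) :
    A = B := by
  have := idx_sub hF hA hB h
  exact le_antisymm h (le_of_rd_eq_zero (hB.finRel hF hA) (by omega))

end RelDim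

/-! ### Duality for commensurable subspaces -/

section Duality

variable {k V : Type*} [Field k] [AddCommGroup V] [Module k V]
  {β : LinearMap.BilinForm k V} {φ : V ≃ₗ[k] V} {n : ℤ} {F : ℤ → Submodule k V}
  {A B C : Submodule k V}

theorem finRel_orthogonal (h : FinRel B A) :
    FinRel (β.orthogonal A) (β.orthogonal B) ∧ rd (β.orthogonal A) (β.orthogonal B) ≤ rd B A := by
  have : Module.Finite k ↥(B.map A.mkQ) := h
  let g : ↥(β.orthogonal A) →ₗ[k] A.dualAnnihilator :=
    LinearMap.codRestrict _ ((LinearMap.flip β).domRestrict (β.orthogonal A)) (fun y => by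
      rw [Submodule.mem_dualAnnihilator]
      exact fun x hx => y.2 x hx)
  let ψ : ↥(β.orthogonal A) →ₗ[k] Module.Dual k ↥(B.map A.mkQ) :=
    (B.map A.mkQ).dualRestrict ∘ₗ A.dualQuotEquivDualAnnihilator.symm.toLinearMap ∘ₗ g
  have hψ : ∀ (y : ↥(β.orthogonal A)) (x : V) (hx : x ∈ B),
      ψ y ⟨A.mkQ x, x, hx, rfl⟩ = β x y := by
    intro y x hx
    change (A.dualQuotEquivDualAnnihilator.symm (g y)) (A.mkQ x) = _
    have h1 := congrArg Subtype.val (A.dualQuotEquivDualAnnihilator.apply_symm_apply (g y))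
    have h2 := LinearMap.congr_fun h1 x
    exact h2
  have hker : LinearMap.ker ψ = (β.orthogonal B).submoduleOf (β.orthogonal A) := by
    ext y
    constructor
    · intro hy x hx
      have := hψ y x hx
      rw [LinearMap.mem_ker.1 hy] at this
      exact this.symm
    · intro hy
      refine LinearMap.ext ?_
      rintro ⟨_, x, hx, rfl⟩
      exact (hψ y x hx).trans (hy x hx)
  rw [finRel_iff, rd_eq_finrank_quotient, ← hker]
  have e := ψ.quotKerEquivRange
  refine ⟨Module.Finite.equiv e.symm, ?_⟩
  rw [e.finrank_eq, rd, ← Subspace.dual_finrank_eq]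
  exact Submodule.finrank_le _

theorem orthogonal_sup : β.orthogonal (A ⊔ B) = β.orthogonal A ⊓ β.orthogonal B := by
  refine le_antisymm (le_inf (LinearMap.BilinForm.orthogonal_le le_sup_left)
    (LinearMap.BilinForm.orthogonal_le le_sup_right)) ?_
  rintro y ⟨h1, h2⟩ x hx
  obtain ⟨a, ha, b, hb, rfl⟩ := Submodule.mem_sup.1 hx
  have e1 : β a y = 0 := h1 a ha
  have e2 : β b y = 0 := h2 b hb
  change β (a + b) y = 0
  rw [map_add, LinearMap.add_apply, e1, e2, add_zero]

/-- A periodic self-dual chain of subspaces with finite-dimensional subquotients. -/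
structure IsChain (β : LinearMap.BilinForm k V) (φ : V ≃ₗ[k] V) (n : ℤ)
    (F : ℤ → Submodule k V) : Prop extends IsLadder F where
  periodic : ∀ z, (F (z + n)).map (φ : V →ₗ[k] V) = F z
  dual : ∀ z, β.orthogonal (F z) = F (-z - 1)

variable (hβ : β.IsAlt) (hF : IsChain β φ n F)
include hβ hF

theorem IsChain.le_orthogonal_orthogonal : A ≤ β.orthogonal (β.orthogonal A) :=
  LinearMap.BilinForm.le_orthogonal_orthogonal hβ.isRefl

omit hβ in
theorem Comm.orthogonal (hA : Comm F A) : Comm F (β.orthogonal A) := by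
  obtain ⟨i, j, hi, hj⟩ := hA
  refine ⟨-j - 1, -i - 1, ?_, ?_⟩
  · rw [← hF.dual]
    exact LinearMap.BilinForm.orthogonal_le hj
  · rw [← hF.dual]
    exact LinearMap.BilinForm.orthogonal_le hi

omit hβ in
theorem idx_orthogonal_aux (hA : Comm F A) (hB : Comm F B) (h : A ≤ B) :
    idx F (β.orthogonal A) - idx F (β.orthogonal B) ≤ idx F B - idx F A := by
  rw [idx_sub hF.toIsLadder (hB.orthogonal hF) (hA.orthogonal hF)
    (LinearMap.BilinForm.orthogonal_le h), idx_sub hF.toIsLadder hA hB h]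
  exact_mod_cast (finRel_orthogonal (hB.finRel hF.toIsLadder hA)).2

omit hβ in
theorem idx_orthogonal_of_le {z : ℤ} (hA : Comm F A) (h1 : F (-z - 1) ≤ A) (h2 : A ≤ F z) :
    idx F (β.orthogonal A) = idx F (F z) + idx F (F (-z - 1)) - idx F A := by
  have e1 := idx_orthogonal_aux hF hA (comm_self F z) h2
  have e2 := idx_orthogonal_aux hF (comm_self F _) hA h1
  rw [hF.dual] at e1 e2
  rw [show -(-z - 1) - 1 = z by ring] at e2
  omega

omit hβ in
theorem idx_self_add (z : ℤ) : idx F (F z) + idx F (F (-z - 1)) = idx F (F 0) + idx F (F (-1)) := by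
  have h : ∀ z, 0 ≤ z → idx F (F z) + idx F (F (-z - 1)) = idx F (F 0) + idx F (F (-1)) := by
    intro z hz
    have := idx_orthogonal_of_le hF (comm_self F 0) (z := z) (hF.mono (by omega)) (hF.mono hz)
    rw [hF.dual] at this
    simp only [neg_zero, zero_sub] at this
    omega
  by_cases hz : 0 ≤ z
  · exact h z hz
  · have := h (-z - 1) (by omega)
    rw [show -(-z - 1) - 1 = z by ring] at this
    omega

omit hβ in
theorem idx_orthogonal (hA : Comm F A) :
    idx F (β.orthogonal A) = idx F (F 0) + idx F (F (-1)) - idx F A := by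
  obtain ⟨i, j, hi, hj⟩ := id hA
  let z := max j (-i - 1)
  rw [idx_orthogonal_of_le hF hA (z := z) ((hF.mono (by omega)).trans hi)
    (hj.trans (hF.mono (by omega))), idx_self_add hF]

theorem orthogonal_orthogonal (hA : Comm F A) : β.orthogonal (β.orthogonal A) = A := by
  refine (eq_of_idx_le hF.toIsLadder hA ((hA.orthogonal hF).orthogonal hF)
    (IsChain.le_orthogonal_orthogonal hβ hF) ?_).symm
  rw [idx_orthogonal hF (hA.orthogonal hF), idx_orthogonal hF hA]
  omega

theorem orthogonal_inf (hA : Comm F A) (hB : Comm F B) :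
    β.orthogonal (A ⊓ B) = β.orthogonal A ⊔ β.orthogonal B := by
  have hA' := hA.orthogonal hF
  have hB' := hB.orthogonal hF
  rw [← orthogonal_orthogonal hβ hF (hA'.sup hF.toIsLadder hB'), orthogonal_sup,
    orthogonal_orthogonal hβ hF hA, orthogonal_orthogonal hβ hF hB]

omit hβ in
theorem map_self (z : ℤ) : (F z).map (φ : V →ₗ[k] V) = F (z - n) := by
  rw [← hF.periodic (z - n), sub_add_cancel]

omit hβ in
theorem map_symm_self (z : ℤ) : (F z).map (φ.symm : V →ₗ[k] V) = F (z + n) := by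
  rw [← hF.periodic z, ← Submodule.map_comp]
  simp

omit hβ in
theorem Comm.map (hA : Comm F A) : Comm F (A.map (φ : V →ₗ[k] V)) := by
  obtain ⟨i, j, hi, hj⟩ := hA
  refine ⟨i - n, j - n, ?_, ?_⟩ <;> rw [← map_self hF]
  · exact Submodule.map_mono hi
  · exact Submodule.map_mono hj

omit hβ in
theorem idx_map_sub (hA : Comm F A) (hB : Comm F B) (h : A ≤ B) :
    idx F (B.map (φ : V →ₗ[k] V)) - idx F (A.map (φ : V →ₗ[k] V)) = idx F B - idx F A := by
  rw [idx_sub hF.toIsLadder (hA.map hF) (hB.map hF) (Submodule.map_mono h),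
    idx_sub hF.toIsLadder hA hB h, rd_map_equiv]

/-! ### Graded dimensions -/

/-- The graded dimensions of `B / A` with respect to `F` are `u`. -/
def HasGr (F : ℤ → Submodule k V) (A B : Submodule k V) (u : ℤ → ℤ) : Prop :=
  ∀ j, (idx F (B ⊓ F j) - idx F (A ⊓ F j)) -
    (idx F (B ⊓ F (j - 1)) - idx F (A ⊓ F (j - 1))) = u j

omit hβ hF in
theorem HasGr.trans {u w : ℤ → ℤ} (h1 : HasGr F A B u) (h2 : HasGr F B C w) :
    HasGr F A C (fun j => u j + w j) := fun j => by
  have e1 := h1 j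
  have e2 := h2 j
  dsimp only
  omega

omit hβ in
theorem idx_orthogonal_inf (hA : Comm F A) (j : ℤ) : idx F (β.orthogonal A ⊓ F j) =
    idx F (F 0) + idx F (F (-1)) - idx F A - idx F (F (-j - 1)) + idx F (A ⊓ F (-j - 1)) := by
  have e : β.orthogonal A ⊓ F j = β.orthogonal (A ⊔ F (-j - 1)) := by
    rw [orthogonal_sup, hF.dual, show -(-j - 1) - 1 = j by ring]
  have h1 := idx_sup_add_idx_inf hF.toIsLadder hA (comm_self F (-j - 1))
  rw [e, idx_orthogonal hF (hA.sup hF.toIsLadder (comm_self F _))]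
  omega

omit hβ in
theorem HasGr.orthogonal {u : ℤ → ℤ} (hA : Comm F A) (hB : Comm F B) (h : HasGr F A B u) :
    HasGr F (β.orthogonal B) (β.orthogonal A) (fun j => u (-j)) := fun j => by
  have e1 := h (-j)
  rw [idx_orthogonal_inf hF hA, idx_orthogonal_inf hF hA, idx_orthogonal_inf hF hB,
    idx_orthogonal_inf hF hB, show -(j - 1) - 1 = -j by ring]
  dsimp only
  omega

omit hβ in
theorem HasGr.map {u : ℤ → ℤ} (hA : Comm F A) (hB : Comm F B) (hAB : A ≤ B) (h : HasGr F A B u) :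
    HasGr F (A.map (φ : V →ₗ[k] V)) (B.map (φ : V →ₗ[k] V)) (fun j => u (j + n)) := by
  have key : ∀ j, idx F (B.map (φ : V →ₗ[k] V) ⊓ F j) - idx F (A.map (φ : V →ₗ[k] V) ⊓ F j) =
      idx F (B ⊓ F (j + n)) - idx F (A ⊓ F (j + n)) := by
    intro j
    rw [← hF.periodic j, ← Submodule.map_inf _ φ.injective, ← Submodule.map_inf _ φ.injective]
    exact idx_map_sub hF (hA.inf hF.toIsLadder (comm_self F _)) (hB.inf hF.toIsLadder (comm_self F _))
      (inf_le_inf_right _ hAB)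
  intro j
  rw [key, key, show j - 1 + n = j + n - 1 by ring]
  exact h (j + n)

end Duality

/-! ### Counting subspaces of subquotients -/

section Pull

variable {k V : Type*} [Field k] [AddCommGroup V] [Module k V]
  {F : ℤ → Submodule k V} {A B C : Submodule k V}

/-- The subspace between `A` and `B` corresponding to a subspace of `B / A`. -/
noncomputable def pull (A B : Submodule k V) (S : Submodule k (B ⧸ A.submoduleOf B)) :
    Submodule k V :=
  (S.comap (A.submoduleOf B).mkQ).map B.subtype

/-- The image of `F ⊓ B` in `B / A`. -/
noncomputable def push (A B F : Submodule k V) : Submodule k (B ⧸ A.submoduleOf B) :=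
  (F.submoduleOf B).map (A.submoduleOf B).mkQ

variable {S S' : Submodule k (B ⧸ A.submoduleOf B)}

theorem mem_pull {x : V} : x ∈ pull A B S ↔ ∃ h : x ∈ B, (A.submoduleOf B).mkQ ⟨x, h⟩ ∈ S := by
  constructor
  · rintro ⟨y, hy, rfl⟩
    exact ⟨y.2, hy⟩
  · rintro ⟨h, hx⟩
    exact ⟨⟨x, h⟩, hx, rfl⟩

theorem pull_le : pull A B S ≤ B := fun _ hx => (mem_pull.1 hx).1

theorem le_pull (h : A ≤ B) : A ≤ pull A B S := fun x hx => mem_pull.2 ⟨h hx, by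
  rw [Submodule.mkQ_apply, (Submodule.Quotient.mk_eq_zero _).2 (by exact hx)]
  exact S.zero_mem⟩

theorem pull_le_pull_iff : pull A B S ≤ pull A B S' ↔ S ≤ S' := by
  constructor
  · intro h x hx
    obtain ⟨y, rfl⟩ := (A.submoduleOf B).mkQ_surjective x
    exact (mem_pull.1 (h (mem_pull.2 ⟨y.2, hx⟩))).2
  · intro h x hx
    obtain ⟨h1, h2⟩ := mem_pull.1 hx
    exact mem_pull.2 ⟨h1, h h2⟩

theorem pull_injective : Function.Injective (pull A B) := fun _ _ h =>
  le_antisymm (pull_le_pull_iff.1 h.le) (pull_le_pull_iff.1 h.ge)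

theorem pull_push {P : Submodule k V} (hA : A ≤ B) : pull A B (push A B P) = A ⊔ (B ⊓ P) := by
  apply le_antisymm
  · intro x hx
    obtain ⟨h1, y, hy, hyx⟩ := mem_pull.1 hx
    have h2 : (⟨x, h1⟩ : B) - y ∈ A.submoduleOf B := (Submodule.Quotient.eq _).1 hyx.symm
    exact Submodule.mem_sup.2 ⟨x - y, h2, y, ⟨y.2, hy⟩, by simp⟩
  · refine sup_le (le_pull hA) fun x hx => mem_pull.2 ⟨hx.1, ⟨x, hx.1⟩, hx.2, rfl⟩

theorem exists_pull_eq {P : Submodule k V} (h1 : A ≤ P) (h2 : P ≤ B) : ∃ S, pull A B S = P :=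
  ⟨push A B P, by rw [pull_push (h1.trans h2), inf_eq_right.2 h2, sup_eq_right.2 h1]⟩

theorem pull_inf : pull A B (S ⊓ S') = pull A B S ⊓ pull A B S' := by
  ext x
  simp only [mem_pull, Submodule.mem_inf]
  exact ⟨fun ⟨h, h1, h2⟩ => ⟨⟨h, h1⟩, ⟨h, h2⟩⟩, fun ⟨⟨h, h1⟩, ⟨_, h2⟩⟩ => ⟨h, h1, h2⟩⟩

theorem pull_top : pull A B ⊤ = B := le_antisymm pull_le fun _ hx => mem_pull.2 ⟨hx, trivial⟩

theorem pull_bot (h : A ≤ B) : pull A B ⊥ = A := by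
  refine le_antisymm (fun x hx => ?_) (le_pull h)
  obtain ⟨h1, h2⟩ := mem_pull.1 hx
  have h3 : Submodule.Quotient.mk (p := A.submoduleOf B) ⟨x, h1⟩ = 0 := h2
  exact ((Submodule.Quotient.mk_eq_zero (A.submoduleOf B)).1 h3 : (⟨x, h1⟩ : B) ∈ A.submoduleOf B)

theorem pull_sup (h : A ≤ B) : pull A B (S ⊔ S') = pull A B S ⊔ pull A B S' := by
  apply le_antisymm
  · obtain ⟨T, hT⟩ := exists_pull_eq (A := A) (B := B) (P := pull A B S ⊔ pull A B S')
      ((le_pull h).trans le_sup_left) (sup_le pull_le pull_le)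
    rw [← hT, pull_le_pull_iff, sup_le_iff, ← pull_le_pull_iff, ← pull_le_pull_iff, hT]
    exact ⟨le_sup_left, le_sup_right⟩
  · exact sup_le (pull_le_pull_iff.2 le_sup_left) (pull_le_pull_iff.2 le_sup_right)

theorem pull_inf_push (hA : A ≤ B) {P : Submodule k V} :
    pull A B (S ⊓ push A B P) = A ⊔ (pull A B S ⊓ P) := by
  rw [pull_inf, pull_push hA, inf_comm, sup_inf_assoc_of_le _ (le_pull hA), inf_comm B, inf_assoc,
    inf_eq_right.2 (pull_le : pull A B S ≤ B), inf_comm]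

theorem card_pull {X : Set (Submodule k (B ⧸ A.submoduleOf B))} {Y : Set (Submodule k V)}
    (h : ∀ S, pull A B S ∈ Y ↔ S ∈ X) (hY : ∀ P ∈ Y, A ≤ P ∧ P ≤ B) : Nat.card Y = Nat.card X := by
  have e : Y = pull A B '' X := by
    ext P
    constructor
    · intro hP
      obtain ⟨S, rfl⟩ := exists_pull_eq (hY P hP).1 (hY P hP).2
      exact ⟨S, (h S).1 hP, rfl⟩
    · rintro ⟨S, hS, rfl⟩
      exact (h S).2 hS
  rw [e]
  exact Nat.card_image_of_injective pull_injective X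

theorem rd_pull : rd (pull A B S) A = finrank k S := by
  let ι : (B ⧸ A.submoduleOf B) →ₗ[k] V ⧸ A :=
    (A.submoduleOf B).liftQ (A.mkQ ∘ₗ B.subtype) (by
      rw [LinearMap.ker_comp, Submodule.ker_mkQ]
      exact le_rfl)
  have hι : Function.Injective ι := by
    rw [← LinearMap.ker_eq_bot]
    refine Submodule.ker_liftQ_eq_bot _ _ _ ?_
    rw [LinearMap.ker_comp, Submodule.ker_mkQ]
    exact le_rfl
  have e : (pull A B S).map A.mkQ = S.map ι := by
    ext x
    constructor
    · rintro ⟨y, hy, rfl⟩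
      obtain ⟨h1, h2⟩ := mem_pull.1 hy
      exact ⟨_, h2, rfl⟩
    · rintro ⟨y, hy, rfl⟩
      obtain ⟨z, rfl⟩ := (A.submoduleOf B).mkQ_surjective y
      exact ⟨z, mem_pull.2 ⟨z.2, hy⟩, rfl⟩
  rw [rd, e]
  exact (Submodule.equivMapOfInjective ι hι S).finrank_eq.symm

variable (hF : IsLadder F) (hA : Comm F A) (hB : Comm F B) (hAB : A ≤ B)
include hF hA hB hAB

theorem comm_pull : Comm F (pull A B S) := hA.of_le hB (le_pull hAB) pull_le

theorem finrank_inf_push (j : ℤ) : (finrank k ↥(S ⊓ push A B (F j)) : ℤ) =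
    idx F (pull A B S ⊓ F j) - idx F (A ⊓ F j) := by
  have hP := comm_pull (S := S) hF hA hB hAB
  have hPj := hP.inf hF (comm_self F j)
  rw [← rd_pull, pull_inf_push hAB, ← idx_sub hF hA (hA.sup hF hPj) le_sup_left]
  have h1 := idx_sup_add_idx_inf hF hA hPj
  rw [← inf_assoc, inf_eq_left.2 (le_pull hAB)] at h1
  omega

variable {N : ℤ} (hN1 : ∀ j, j < -N → F j ≤ A) (hN2 : ∀ j, N ≤ j → B ≤ F j)
include hN1

theorem hasGr_pull_iff {u : ℤ → ℕ} (hu : ∀ l, l ∉ Finset.Icc (-N) N → u l = 0) :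
    HasGr F A (pull A B S) (toZ u) ↔ ∀ j, finrank k ↥(S ⊓ push A B (F j)) = cum N u j := by
  have key := fun j => finrank_inf_push (S := S) hF hA hB hAB j
  have h0 : ∀ j, j < -N → finrank k ↥(S ⊓ push A B (F j)) = 0 := by
    intro j hj
    have := key j
    rw [inf_eq_right.2 (hN1 j hj), inf_eq_right.2 ((hN1 j hj).trans (le_pull hAB))] at this
    omega
  constructor
  · intro h j
    by_cases hj : -N - 1 ≤ j
    · induction j, hj using Int.leInduction with
      | base => rw [cum_of_lt _ (by omega), h0 _ (by omega)]
      | succ j hj ih =>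
        have h1 := h (j + 1)
        rw [← key, ← key, add_sub_cancel_right, ih] at h1
        rw [cum_eq_add _ (by omega), add_sub_cancel_right]
        change _ = ((u (j + 1) : ℕ) : ℤ) at h1
        omega
    · rw [cum_of_lt _ (by omega), h0 _ (by omega)]
  · intro h j
    rw [← key, ← key, h, h]
    by_cases hj : -N ≤ j
    · rw [cum_eq_add u hj]
      push_cast
      ring
    · rw [cum_of_lt _ (by omega), cum_of_lt _ (by omega), toZ, hu j (by rw [Finset.mem_Icc]; omega)]
      simp

include hN2

theorem isFiltration_push : IsFiltration N fun j => push A B (F j) where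
  mono i j h := Submodule.map_mono (Submodule.comap_mono (hF.mono h))
  bot j hj := by
    apply pull_injective
    rw [pull_push hAB, pull_bot hAB, sup_eq_left]
    exact inf_le_right.trans (hN1 j hj)
  top j hj := by
    apply pull_injective
    rw [pull_push hAB, pull_top, inf_eq_left.2 (hN2 j hj), sup_eq_right.2 hAB]

omit hN1 hN2 in
theorem sub_finrank_push {c : ℤ → ℤ} (hc : HasGr F A B c) (j : ℤ) :
    c j = finrank k ↥(push A B (F j)) - finrank k ↥(push A B (F (j - 1))) := by
  have e1 := finrank_inf_push (S := ⊤) hF hA hB hAB j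
  have e2 := finrank_inf_push (S := ⊤) hF hA hB hAB (j - 1)
  rw [top_inf_eq, pull_top] at e1 e2
  rw [e1, e2, hc j]

variable [Finite k]

omit hN1 hN2 in
theorem finite_quotient : Module.Finite k (B ⧸ A.submoduleOf B) :=
  finRel_iff.1 (hB.finRel hF hA)

theorem card_hasGr {c : ℤ → ℤ} (hc : HasGr F A B c) {u : ℤ → ℕ}
    (hu : ∀ l, l ∉ Finset.Icc (-N) N → u l = 0) :
    (Nat.card {P : Submodule k V | A ≤ P ∧ P ≤ B ∧ HasGr F A P (toZ u)} : ℚ) =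
      subspaceCount (Nat.card k : ℚ) N c u := by
  have := finite_quotient hF hA hB hAB
  rw [← card_flagSet_eq_subspaceCount (isFiltration_push hF hA hB hAB hN1 hN2)
    (sub_finrank_push hF hA hB hAB hc) hu]
  congr 1
  refine card_pull (fun S => ?_) fun P hP => ⟨hP.1, hP.2.1⟩
  constructor
  · rintro ⟨_, _, h⟩
    exact ⟨fun _ _ _ _ => rfl, (hasGr_pull_iff hF hA hB hAB hN1 hu).1 h⟩
  · rintro ⟨_, h⟩
    exact ⟨le_pull hAB, pull_le, (hasGr_pull_iff hF hA hB hAB hN1 hu).2 h⟩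

/-- The number of complements with given graded dimensions of a subquotient. -/
theorem card_complement {L : Submodule k V} (hAL : A ≤ L) (hLB : L ≤ B) {s t s' : ℤ → ℕ}
    (hs : HasGr F A L (toZ s)) (hs' : HasGr F L B (toZ s'))
    (hs0 : ∀ l, l ∉ Finset.Icc (-N) N → s l = 0) (ht0 : ∀ l, l ∉ Finset.Icc (-N) N → t l = 0)
    (hs0' : ∀ l, l ∉ Finset.Icc (-N) N → s' l = 0) :
    (Nat.card {M : Submodule k V | M ⊓ L = A ∧ M ⊔ L = B ∧ HasGr F A M (toZ t)} : ℚ) =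
      complementCount (Nat.card k : ℚ) N s t s' := by
  have := finite_quotient hF hA hB hAB
  obtain ⟨U, rfl⟩ := exists_pull_eq hAL hLB
  have hU := (hasGr_pull_iff hF hA hB hAB hN1 hs0).1 hs
  have hT : HasGr F A (pull A B ⊤) (toZ (s + s')) := by
    rw [pull_top]
    convert hs.trans hs' using 2
    simp [toZ]
  have hT' := (hasGr_pull_iff hF hA hB hAB hN1 (fun l hl => by simp [hs0 l hl, hs0' l hl])).1 hT
  rw [← card_complementSet (isFiltration_push hF hA hB hAB hN1 hN2) hU (fun i => ?_) ht0 hs0']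
  · congr 1
    refine card_pull (fun S => ?_) fun P hP =>
      ⟨hP.1.symm.le.trans inf_le_left, le_sup_left.trans hP.2.1.le⟩
    refine and_congr ?_ (and_congr ?_ (hasGr_pull_iff hF hA hB hAB hN1 ht0))
    · rw [← pull_inf, ← pull_injective.eq_iff (b := ⊥), pull_bot hAB]
    · rw [← pull_sup hAB, ← pull_injective.eq_iff (b := ⊤), pull_top]
  · have h1 := Submodule.finrank_sup_add_finrank_inf_eq U (push A B (F i))
    have h2 := hT' i
    rw [top_inf_eq, cum_add] at h2
    have h3 := hU i
    omega

end Pull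

section Isotropic

variable {k V : Type*} [Field k] [AddCommGroup V] [Module k V]
  {β : LinearMap.BilinForm k V} {φ : V ≃ₗ[k] V} {n : ℤ} {F : ℤ → Submodule k V}
  {A B : Submodule k V}

theorem exists_form_quotient (hAB : ∀ x ∈ A, ∀ y ∈ B, β x y = 0) (hBA : ∀ x ∈ B, ∀ y ∈ A, β x y = 0) :
    ∃ b : LinearMap.BilinForm k (B ⧸ A.submoduleOf B), ∀ x y : B,
      b ((A.submoduleOf B).mkQ x) ((A.submoduleOf B).mkQ y) = β x y := by
  let g : B →ₗ[k] (A.submoduleOf B).dualAnnihilator :=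
    LinearMap.codRestrict _ (B.subtype.dualMap ∘ₗ β ∘ₗ B.subtype) (fun x => by
      rw [Submodule.mem_dualAnnihilator]
      exact fun y hy => hBA x x.2 y hy)
  let e := (A.submoduleOf B).dualQuotEquivDualAnnihilator
  have hg : ∀ x y, (e.symm (g x)) ((A.submoduleOf B).mkQ y) = β x y := fun x y =>
    LinearMap.congr_fun (congrArg Subtype.val (e.apply_symm_apply (g x))) y
  refine ⟨(A.submoduleOf B).liftQ (e.symm.toLinearMap ∘ₗ g) fun x hx => ?_, hg⟩
  refine LinearMap.mem_ker.2 (LinearMap.ext fun y => ?_)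
  obtain ⟨y, rfl⟩ := (A.submoduleOf B).mkQ_surjective y
  exact (hg x y).trans (hAB x hx y y.2)

theorem card_isotropic [Finite k] (hβ : β.IsAlt) (hF : IsChain β φ n F) (hB : Comm F B)
    (hBA : β.orthogonal B = A) (hAB : A ≤ B) {N : ℤ} (hN1 : ∀ j, j < -N → F j ≤ A)
    (hN2 : ∀ j, N ≤ j → B ≤ F j) {c : ℤ → ℤ} (hc : HasGr F A B c) {u : ℤ → ℕ}
    (hu : ∀ l, l ∉ Finset.Icc (-N) N → u l = 0) :
    (Nat.card {Q : Submodule k V | A ≤ Q ∧ Q ≤ β.orthogonal Q ∧ HasGr F A Q (toZ u)} : ℚ) =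
      isotropicCount (Nat.card k : ℚ) N c u := by
  have hA : Comm F A := hBA ▸ hB.orthogonal hF
  have hBA' : β.orthogonal A = B := by rw [← hBA, orthogonal_orthogonal hβ hF hB]
  have h1 : ∀ x ∈ B, ∀ y ∈ A, β x y = 0 := fun x hx y hy => (hBA ▸ hy : y ∈ β.orthogonal B) x hx
  have h2 : ∀ x ∈ A, ∀ y ∈ B, β x y = 0 := fun x hx y hy => hβ.isRefl _ _ (h1 y hy x hx)
  have hfin := finite_quotient hF.toIsLadder hA hB hAB
  obtain ⟨b, hb⟩ := exists_form_quotient h2 h1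
  have hbalt : b.IsAlt := fun x => by
    obtain ⟨x, rfl⟩ := (A.submoduleOf B).mkQ_surjective x
    rw [hb]
    exact hβ x
  have horth : ∀ S, pull A B (b.orthogonal S) = B ⊓ β.orthogonal (pull A B S) := by
    intro S
    ext y
    rw [mem_pull]
    constructor
    · rintro ⟨hy, h⟩
      refine ⟨hy, fun x hx => ?_⟩
      obtain ⟨hx1, hx2⟩ := mem_pull.1 hx
      exact (hb ⟨x, hx1⟩ ⟨y, hy⟩).symm.trans (h _ hx2)
    · rintro ⟨hy, h⟩
      refine ⟨hy, fun x hx => ?_⟩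
      obtain ⟨x, rfl⟩ := (A.submoduleOf B).mkQ_surjective x
      exact (hb _ _).trans (h x (mem_pull.2 ⟨x.2, hx⟩))
  have hnd : b.Nondegenerate := by
    rw [LinearMap.BilinForm.nondegenerate_iff_ker_eq_bot, eq_bot_iff]
    intro x hx
    obtain ⟨x, rfl⟩ := (A.submoduleOf B).mkQ_surjective x
    have : (x : V) ∈ β.orthogonal B := fun y hy => by
      have := LinearMap.congr_fun (LinearMap.mem_ker.1 hx) ((A.submoduleOf B).mkQ ⟨y, hy⟩)
      rw [hb] at this
      exact hβ.isRefl _ _ this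
    rw [hBA] at this
    exact (Submodule.mem_bot k).2 ((Submodule.Quotient.mk_eq_zero _).2 this)
  rw [← card_flagSet_eq_isotropicCount (isFiltration_push hF.toIsLadder hA hB hAB hN1 hN2) hbalt hnd
    (fun j => ?_) (sub_finrank_push hF.toIsLadder hA hB hAB hc) hu]
  · congr 1
    refine card_pull (fun S => ?_) fun P hP =>
      ⟨hP.1, hP.2.1.trans ((LinearMap.BilinForm.orthogonal_le hP.1).trans hBA'.le)⟩
    constructor
    · rintro ⟨_, h, h'⟩
      have h5 : S ≤ b.orthogonal S := by
        rw [← pull_le_pull_iff, horth]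
        exact le_inf pull_le h
      exact ⟨fun x hx y hy => h5 hy x hx, (hasGr_pull_iff hF.toIsLadder hA hB hAB hN1 hu).1 h'⟩
    · rintro ⟨h, h'⟩
      have h5 : S ≤ b.orthogonal S := fun y hy x hx => h x hx y hy
      rw [← pull_le_pull_iff, horth] at h5
      exact ⟨le_pull hAB, h5.trans inf_le_right,
        (hasGr_pull_iff hF.toIsLadder hA hB hAB hN1 hu).2 h'⟩
  · apply pull_injective
    rw [horth, pull_push hAB, pull_push hAB, orthogonal_sup, hBA', ← inf_assoc, inf_idem,
      orthogonal_inf hβ hF hB (comm_self F j), hF.dual, hBA, inf_comm, sup_inf_assoc_of_le _ hAB,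
      inf_comm B]

end Isotropic

/-! ### Self-dual periodic chains -/

section SelfDual

variable {k V : Type*} [Field k] [AddCommGroup V] [Module k V]
  {β : LinearMap.BilinForm k V} {φ : V ≃ₗ[k] V} {n : ℤ} {F L M : ℤ → Submodule k V}
  {A B : Submodule k V}

/-- The image of a subspace under a power of `φ`. -/
noncomputable def twist (φ : V ≃ₗ[k] V) (e : ℤ) (A : Submodule k V) : Submodule k V :=
  A.map ((φ ^ e : V ≃ₗ[k] V) : V →ₗ[k] V)

theorem twist_zero : twist φ 0 A = A := by
  rw [twist, zpow_zero]
  exact Submodule.map_id A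

theorem twist_one : twist φ 1 A = A.map (φ : V →ₗ[k] V) := by
  rw [twist, zpow_one]

theorem twist_twist (e f : ℤ) : twist φ e (twist φ f A) = twist φ (e + f) A := by
  rw [twist, twist, twist, ← Submodule.map_comp, zpow_add]
  rfl

theorem twist_neg_one : twist φ (-1) A = A.map (φ.symm : V →ₗ[k] V) := by
  rw [twist, zpow_neg_one]
  rfl

theorem twist_mono (e : ℤ) (h : A ≤ B) : twist φ e A ≤ twist φ e B := Submodule.map_mono h

/-- Monotone periodic self-dual families of subspaces. -/
structure IsSelfDual (β : LinearMap.BilinForm k V) (φ : V ≃ₗ[k] V) (n : ℤ)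
    (M : ℤ → Submodule k V) : Prop where
  mono : Monotone M
  periodic : ∀ z, (M (z + n)).map (φ : V →ₗ[k] V) = M z
  dual : ∀ z, β.orthogonal (M z) = M (-z - 1)

theorem IsChain.symm (h : IsChain β φ n F) : IsChain β φ.symm (-n) F :=
  { h with
    periodic := fun z => by
      rw [map_symm_self h]
      congr 1
      ring }

variable (hφ : ∀ x y, β (φ x) y = β x (φ y))

include hφ in
theorem form_zpow (e : ℤ) (x y : V) : β ((φ ^ e : V ≃ₗ[k] V) x) y = β x ((φ ^ e : V ≃ₗ[k] V) y) := by
  induction e generalizing x y with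
  | zero => rfl
  | succ m ih =>
    rw [zpow_add_one, LinearEquiv.mul_apply, ih, hφ, ← LinearEquiv.mul_apply, ← zpow_one_add,
      ← zpow_add_one, add_comm]
  | pred m ih =>
    have h : ∀ x y, β (φ⁻¹ x) y = β x (φ⁻¹ y) := by
      intro x y
      have := hφ (φ⁻¹ x) (φ⁻¹ y)
      rw [← LinearEquiv.mul_apply, ← LinearEquiv.mul_apply, mul_inv_cancel] at this
      exact this.symm
    rw [sub_eq_add_neg, zpow_add, zpow_neg_one, LinearEquiv.mul_apply, ih, h,
      ← LinearEquiv.mul_apply, ← zpow_neg_one, ← zpow_add, ← zpow_add, add_comm]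

include hφ in
theorem orthogonal_twist (e : ℤ) :
    β.orthogonal (twist φ e A) = twist φ (-e) (β.orthogonal A) := by
  ext y
  constructor
  · intro h
    refine ⟨(φ ^ e : V ≃ₗ[k] V) y, fun x hx => ?_, ?_⟩
    · exact (form_zpow hφ e x y).symm.trans (h _ ⟨x, hx, rfl⟩)
    · change (φ ^ (-e) : V ≃ₗ[k] V) ((φ ^ e : V ≃ₗ[k] V) y) = y
      rw [← LinearEquiv.mul_apply, ← zpow_add, neg_add_cancel, zpow_zero]
      rfl
  · rintro ⟨y, hy, rfl⟩ _ ⟨x, hx, rfl⟩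
    change β ((φ ^ e : V ≃ₗ[k] V) x) ((φ ^ (-e) : V ≃ₗ[k] V) y) = 0
    rw [form_zpow hφ, ← LinearEquiv.mul_apply, ← zpow_add, add_neg_cancel, zpow_zero]
    exact hy x hx

theorem IsSelfDual.apply_add_mul (h : IsSelfDual β φ n M) (e z : ℤ) :
    M (e * n + z) = twist φ (-e) (M z) := by
  have key : ∀ z, M (z + n) = twist φ (-1) (M z) := fun z => by
    rw [twist_neg_one, ← h.periodic z, ← Submodule.map_comp]
    simp
  have key' : ∀ z, M (z - n) = twist φ 1 (M z) := fun z => by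
    rw [twist_one, ← h.periodic (z - n), sub_add_cancel]
  induction e with
  | zero => rw [zero_mul, zero_add, neg_zero, twist_zero]
  | succ m ih =>
    rw [show ((m : ℤ) + 1) * n + z = m * n + z + n by ring, key, ih, twist_twist]
    congr 1
    ring
  | pred m ih =>
    rw [show (-(m : ℤ) - 1) * n + z = -m * n + z - n by ring, key', ih, twist_twist]
    congr 1
    ring

theorem exists_row (r : ℕ) (z : ℤ) : ∃ e i : ℤ, 0 ≤ i ∧ i ≤ r ∧
    (z = e * per r + i ∨ z = e * per r + (-i - 1)) := by
  have h1 := Int.emod_add_mul_ediv z (per r)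
  have h2 := Int.emod_nonneg z (show per r ≠ 0 by rw [per]; omega)
  have h3 := Int.emod_lt_of_pos z (show 0 < per r by rw [per]; omega)
  rw [mul_comm] at h1
  by_cases h : z % per r ≤ r
  · exact ⟨z / per r, z % per r, h2, h, Or.inl (by linarith)⟩
  · refine ⟨z / per r + 1, per r - 1 - z % per r, by omega, ?_, Or.inr ?_⟩
    · rw [per] at h h3 ⊢
      omega
    · rw [add_mul, one_mul]
      linarith

/-- The periodic self-dual extension of a family of subspaces indexed by `[0, r]`. -/
noncomputable def extendChain (β : LinearMap.BilinForm k V) (φ : V ≃ₗ[k] V) (r : ℕ)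
    (m : ℤ → Submodule k V) (z : ℤ) : Submodule k V :=
  if z % per r ≤ r then twist φ (-(z / per r)) (m (z % per r))
  else twist φ (-(z / per r) - 1) (β.orthogonal (m (per r - 1 - z % per r)))

variable {r : ℕ} {m : ℤ → Submodule k V}

theorem extendChain_pos (e : ℤ) {i : ℤ} (h0 : 0 ≤ i) (hr : i ≤ r) :
    extendChain β φ r m (e * per r + i) = twist φ (-e) (m i) := by
  have h1 : (e * per r + i) % per r = i := by
    rw [add_comm, Int.add_mul_emod_self_right]
    exact Int.emod_eq_of_lt h0 (by rw [per]; omega)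
  have h2 : (e * per r + i) / per r = e := by
    rw [add_comm, Int.add_mul_ediv_right _ _ (by rw [per]; omega),
      Int.ediv_eq_zero_of_lt h0 (by rw [per]; omega), zero_add]
  rw [extendChain, h1, h2, if_pos hr]

theorem extendChain_neg (e : ℤ) {i : ℤ} (h0 : 0 ≤ i) (hr : i ≤ r) :
    extendChain β φ r m (e * per r + (-i - 1)) = twist φ (-e) (β.orthogonal (m i)) := by
  have e0 : e * per r + (-i - 1) = (per r - 1 - i) + (e - 1) * per r := by ring
  have h1 : (e * per r + (-i - 1)) % per r = per r - 1 - i := by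
    rw [e0, Int.add_mul_emod_self_right]
    exact Int.emod_eq_of_lt (by rw [per]; omega) (by omega)
  have h2 : (e * per r + (-i - 1)) / per r = e - 1 := by
    rw [e0, Int.add_mul_ediv_right _ _ (by rw [per]; omega),
      Int.ediv_eq_zero_of_lt (by rw [per]; omega) (by omega), zero_add]
  rw [extendChain, h1, h2, if_neg (by rw [per]; omega)]
  congr 1
  · ring
  · congr 2
    ring

theorem IsSelfDual.eq_extendChain (h : IsSelfDual β φ (per r) M) (hm : ∀ i : ℤ, 0 ≤ i → i ≤ r → m i = M i) :
    M = extendChain β φ r m := by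
  funext z
  obtain ⟨e, i, h0, hr, rfl | rfl⟩ := exists_row r z
  · rw [extendChain_pos e h0 hr, h.apply_add_mul, hm i h0 hr]
  · rw [extendChain_neg e h0 hr, h.apply_add_mul, hm i h0 hr, h.dual]

include hφ in
theorem isSelfDual_extendChain
    (h1 : ∀ i : ℤ, 0 ≤ i → i < r → m i ≤ m (i + 1)) (h2 : β.orthogonal (m 0) ≤ m 0)
    (h3 : m r ≤ (β.orthogonal (m r)).map (φ.symm : V →ₗ[k] V))
    (h4 : ∀ i : ℤ, 0 ≤ i → i ≤ r → β.orthogonal (β.orthogonal (m i)) = m i) :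
    IsSelfDual β φ (per r) (extendChain β φ r m) where
  mono := by
    refine monotone_int_of_le_succ fun z => ?_
    obtain ⟨e, i, h0, hr, rfl | rfl⟩ := exists_row r z
    · rw [extendChain_pos e h0 hr]
      by_cases hi : i = r
      · subst hi
        rw [show e * per r + r + 1 = (e + 1) * per r + (-r - 1) by rw [per]; ring,
          extendChain_neg _ (by omega) le_rfl, show -(e + 1) = -e + -1 by ring, ← twist_twist,
          twist_neg_one]
        exact twist_mono _ h3
      · rw [add_assoc, extendChain_pos e (by omega) (by omega)]
        exact twist_mono _ (h1 i h0 (by omega))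
    · rw [extendChain_neg e h0 hr]
      by_cases hi : i = 0
      · subst hi
        rw [show e * per r + (-0 - 1) + 1 = e * per r + 0 by ring, extendChain_pos e le_rfl (by omega)]
        exact twist_mono _ h2
      · rw [show e * per r + (-i - 1) + 1 = e * per r + (-(i - 1) - 1) by ring,
          extendChain_neg e (by omega) (by omega)]
        refine twist_mono _ (LinearMap.BilinForm.orthogonal_le ?_)
        have := h1 (i - 1) (by omega) (by omega)
        rwa [sub_add_cancel] at this
  periodic z := by
    rw [← twist_one]
    obtain ⟨e, i, h0, hr, rfl | rfl⟩ := exists_row r z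
    · rw [show e * per r + i + per r = (e + 1) * per r + i by ring, extendChain_pos _ h0 hr,
        extendChain_pos _ h0 hr, twist_twist]
      congr 1
      ring
    · rw [show e * per r + (-i - 1) + per r = (e + 1) * per r + (-i - 1) by ring,
        extendChain_neg _ h0 hr, extendChain_neg _ h0 hr, twist_twist]
      congr 1
      ring
  dual z := by
    obtain ⟨e, i, h0, hr, rfl | rfl⟩ := exists_row r z
    · rw [show -(e * per r + i) - 1 = -e * per r + (-i - 1) by ring, extendChain_pos _ h0 hr,
        extendChain_neg _ h0 hr, orthogonal_twist hφ]
    · rw [show -(e * per r + (-i - 1)) - 1 = -e * per r + i by ring, extendChain_pos _ h0 hr,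
        extendChain_neg _ h0 hr, orthogonal_twist hφ, h4 i h0 hr]

end SelfDual

/-! ### Chains in a given position relative to two fixed chains -/

theorem periodic_add_mul {n : ℤ} {S : ZMat} (h : ∀ i j, S (i + n) (j + n) = S i j) (e i j : ℤ) :
    S (i + e * n) (j + e * n) = S i j := by
  induction e with
  | zero => simp
  | succ m ih => rw [add_mul, one_mul, ← add_assoc, ← add_assoc, h, ih]
  | pred m ih =>
    rw [← h, ← ih]
    congr 1 <;> ring

section Neighbors

variable {k V : Type*} [Field k] [AddCommGroup V] [Module k V]
  {β : LinearMap.BilinForm k V} {φ : V ≃ₗ[k] V} {F L M : ℤ → Submodule k V}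
  {A B : Submodule k V} {r : ℕ} {S T : ZMat}

/-- The conditions on the `i`-th member of a chain. -/
structure RowCond (F L : ℤ → Submodule k V) (S T : ZMat) (i : ℤ) (A : Submodule k V) : Prop where
  lower : L (i - 1) ≤ A
  upper : A ≤ L (i + 1)
  gr₁ : HasGr F (L i ⊓ A) (L i) (S i)
  gr₂ : HasGr F (L i ⊓ A) A (T i)
  gr₃ : HasGr F (L i) (L i ⊔ A) (fun j => S (-i - 1) (-j))
  gr₄ : HasGr F A (L i ⊔ A) (fun j => T (-i - 1) (-j))

/-- The self-dual chains `M` with `L_{i-1} ≤ M_i ≤ L_{i+1}` such that `L_i / (L_i ⊓ M_i)` and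
`M_i / (L_i ⊓ M_i)` have the graded dimensions given by the rows of `S` and `T`. -/
def neighborSet (β : LinearMap.BilinForm k V) (φ : V ≃ₗ[k] V) (r : ℕ) (F L : ℤ → Submodule k V)
    (S T : ZMat) : Set (ℤ → Submodule k V) :=
  {M | IsSelfDual β φ (per r) M ∧ ∀ i, RowCond F L S T i (M i)}

/-- The pairs `(L_{i-1} ⊔ M_{i-1}, L_i ⊓ M_i)` that arise from the chains in `neighborSet`. -/
def stepSet (β : LinearMap.BilinForm k V) (φ : V ≃ₗ[k] V) (r : ℕ) (F L : ℤ → Submodule k V)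
    (S : ZMat) (i : ℤ) : Set (Submodule k V × Submodule k V) :=
  {D | L (i - 1) ≤ D.1 ∧ D.1 ≤ D.2 ∧ D.2 ≤ L i ∧ HasGr F (L (i - 1)) D.1 (fun j => S (-i) (-j)) ∧
    HasGr F D.2 (L i) (S i) ∧ (i = 0 → D.1 = β.orthogonal D.2) ∧
    (i = r + 1 → D.2 = (β.orthogonal D.1).map (φ.symm : V →ₗ[k] V))}

/-- The complements of `L / P` in `Q / P` with graded dimensions `t`. -/
def middleSet (F : ℤ → Submodule k V) (L : Submodule k V) (t : ℤ → ℤ) (P Q : Submodule k V) :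
    Set (Submodule k V) :=
  {A | A ⊓ L = P ∧ A ⊔ L = Q ∧ HasGr F P A t}

variable (hβ : β.IsAlt) (hφ : ∀ x y, β (φ x) y = β x (φ y)) (hF : IsChain β φ (per r) F)
  (hL : IsSelfDual β φ (per r) L) (hLF : ∀ i, Comm F (L i))
  (hS : ∀ i j, S (i + per r) (j + per r) = S i j) (hT : ∀ i j, T (i + per r) (j + per r) = T i j)
  (hST : ∀ i j, S i j + S (-i - 1) (-j) = T i j + T (-i - 1) (-j))

include hLF in
theorem RowCond.comm {i : ℤ} (h : RowCond F L S T i A) : Comm F A :=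
  (hLF _).of_le (hLF _) h.lower h.upper

include hF in
theorem HasGr.twist {u : ℤ → ℤ} (hA : Comm F A) (hB : Comm F B) (hAB : A ≤ B) (h : HasGr F A B u)
    (e : ℤ) : Comm F (twist φ e A) ∧ Comm F (twist φ e B) ∧
      HasGr F (twist φ e A) (twist φ e B) (fun j => u (j + e * per r)) := by
  induction e with
  | zero => simpa [twist_zero] using ⟨hA, hB, h⟩
  | succ m ih =>
    obtain ⟨h1, h2, h3⟩ := ih
    rw [add_comm, ← twist_twist, ← twist_twist, twist_one, twist_one]
    refine ⟨h1.map hF, h2.map hF, ?_⟩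
    convert h3.map hF h1 h2 (twist_mono _ hAB) using 3
    ring
  | pred m ih =>
    obtain ⟨h1, h2, h3⟩ := ih
    rw [show -(m : ℤ) - 1 = -1 + -m by ring, ← twist_twist, ← twist_twist, twist_neg_one,
      twist_neg_one]
    refine ⟨h1.map hF.symm, h2.map hF.symm, ?_⟩
    convert h3.map hF.symm h1 h2 (twist_mono _ hAB) using 3
    ring

theorem twist_inf (e : ℤ) : twist φ e (A ⊓ B) = twist φ e A ⊓ twist φ e B :=
  Submodule.map_inf _ (φ ^ e : V ≃ₗ[k] V).injective

theorem twist_sup (e : ℤ) : twist φ e (A ⊔ B) = twist φ e A ⊔ twist φ e B :=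
  Submodule.map_sup _ _ _

include hF hL hLF hS hT in
theorem RowCond.twist {i : ℤ} (h : RowCond F L S T i A) (e : ℤ) :
    RowCond F L S T (e * per r + i) (twist φ (-e) A) := by
  have hA := h.comm hLF
  have hinf := (hLF i).inf hF.toIsLadder hA
  have hsup := (hLF i).sup hF.toIsLadder hA
  have key : ∀ {S : ZMat}, (∀ i j, S (i + per r) (j + per r) = S i j) →
      (fun j => S i (j + -e * per r)) = S (e * per r + i) := by
    intro S hS
    funext j
    rw [← periodic_add_mul hS e, add_comm i]
    congr 1
    ring
  have key' : ∀ {S : ZMat}, (∀ i j, S (i + per r) (j + per r) = S i j) →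
      (fun j => S (-i - 1) (-(j + -e * per r))) = fun j => S (-(e * per r + i) - 1) (-j) := by
    intro S hS
    funext j
    rw [← periodic_add_mul hS (-e)]
    congr 1 <;> ring
  refine ⟨?_, ?_, ?_, ?_, ?_, ?_⟩
  · rw [add_sub_assoc, hL.apply_add_mul]
    exact twist_mono _ h.lower
  · rw [add_assoc, hL.apply_add_mul]
    exact twist_mono _ h.upper
  · rw [hL.apply_add_mul, ← twist_inf, ← key hS]
    exact (h.gr₁.twist hF hinf (hLF i) inf_le_left (-e)).2.2
  · rw [hL.apply_add_mul, ← twist_inf, ← key hT]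
    exact (h.gr₂.twist hF hinf hA inf_le_right (-e)).2.2
  · rw [hL.apply_add_mul, ← twist_sup, ← key' hS]
    exact (h.gr₃.twist hF (hLF i) hsup le_sup_left (-e)).2.2
  · rw [hL.apply_add_mul, ← twist_sup, ← key' hT]
    exact (h.gr₄.twist hF hA hsup le_sup_right (-e)).2.2

include hβ hF hL hLF in
theorem RowCond.orthogonal {i : ℤ} (h : RowCond F L S T i A) :
    RowCond F L S T (-i - 1) (β.orthogonal A) := by
  have hA := h.comm hLF
  have hinf := (hLF i).inf hF.toIsLadder hA
  have hsup := (hLF i).sup hF.toIsLadder hA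
  have e1 : L (-i - 1) ⊓ β.orthogonal A = β.orthogonal (L i ⊔ A) := by rw [orthogonal_sup, hL.dual]
  have e2 : L (-i - 1) ⊔ β.orthogonal A = β.orthogonal (L i ⊓ A) := by
    rw [orthogonal_inf hβ hF (hLF i) hA, hL.dual]
  refine ⟨?_, ?_, ?_, ?_, ?_, ?_⟩
  · rw [show -i - 1 - 1 = -(i + 1) - 1 by ring, ← hL.dual]
    exact LinearMap.BilinForm.orthogonal_le h.upper
  · rw [show -i - 1 + 1 = -(i - 1) - 1 by ring, ← hL.dual]
    exact LinearMap.BilinForm.orthogonal_le h.lower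
  · rw [e1, ← hL.dual]
    convert h.gr₃.orthogonal hF (hLF i) hsup using 2
    rw [neg_neg]
  · rw [e1]
    convert h.gr₄.orthogonal hF hA hsup using 2
    rw [neg_neg]
  · rw [e2, ← hL.dual]
    convert h.gr₁.orthogonal hF hinf (hLF i) using 3
    ring
  · rw [e2]
    convert h.gr₂.orthogonal hF hinf hA using 3
    ring

include hβ hF hL hLF hS hT in
theorem rowCond_extendChain {m : ℤ → Submodule k V}
    (h : ∀ i : ℤ, 0 ≤ i → i ≤ r → RowCond F L S T i (m i)) (z : ℤ) :
    RowCond F L S T z (extendChain β φ r m z) := by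
  obtain ⟨e, i, h0, hr, rfl | rfl⟩ := exists_row r z
  · rw [extendChain_pos e h0 hr]
    exact (h i h0 hr).twist hF hL hLF hS hT e
  · rw [extendChain_neg e h0 hr]
    exact ((h i h0 hr).orthogonal hβ hF hL hLF).twist hF hL hLF hS hT e

include hST in
theorem rowCond_of_mem {i : ℤ} {P Q : Submodule k V} (h1 : L (i - 1) ≤ P) (h2 : Q ≤ L (i + 1))
    (hP : HasGr F P (L i) (S i)) (hQ : HasGr F (L i) Q (fun j => S (-i - 1) (-j)))
    (hA : A ∈ middleSet F (L i) (T i) P Q) : RowCond F L S T i A := by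
  obtain ⟨rfl, rfl, h3⟩ := hA
  rw [inf_comm] at h1 hP h3
  rw [sup_comm] at h2 hQ
  refine ⟨h1.trans inf_le_right, le_sup_right.trans h2, hP, h3, hQ, fun j => ?_⟩
  have e1 := hP j
  have e2 := hQ j
  have e3 := h3 j
  have e4 := hST i j
  dsimp only at e2 ⊢
  omega

include hβ hφ hF hL hLF in
theorem mem_stepSet (hM : M ∈ neighborSet β φ r F L S T) (i : ℤ) :
    (L (i - 1) ⊔ M (i - 1), L i ⊓ M i) ∈ stepSet β φ r F L S i := by
  have hMF : ∀ i, Comm F (M i) := fun i => (hM.2 i).comm hLF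
  refine ⟨le_sup_left, sup_le (le_inf (hL.mono (by omega)) (hM.2 i).lower)
    (le_inf ?_ (hM.1.mono (by omega))), inf_le_left, ?_, (hM.2 i).gr₁, ?_, ?_⟩
  · have := (hM.2 (i - 1)).upper
    rwa [sub_add_cancel] at this
  · convert (hM.2 (i - 1)).gr₃ using 3
    ring
  · rintro rfl
    rw [orthogonal_inf hβ hF (hLF 0) (hMF 0), hL.dual, hM.1.dual]
    rfl
  · rintro rfl
    have e : -((r : ℤ) + 1 - 1) - 1 = r + 1 - per r := by rw [per]; ring
    rw [orthogonal_sup, hL.dual, hM.1.dual, Submodule.map_inf _ φ.symm.injective, ← twist_neg_one,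
      ← twist_neg_one, ← hL.apply_add_mul 1, ← hM.1.apply_add_mul 1, e,
      show 1 * per r + ((r : ℤ) + 1 - per r) = r + 1 by ring]

/-- The decompositions of the chains in `neighborSet`. -/
def decompSet (β : LinearMap.BilinForm k V) (φ : V ≃ₗ[k] V) (r : ℕ) (F L : ℤ → Submodule k V)
    (S T : ZMat) :
    Set ((Fin (r + 2) → Submodule k V × Submodule k V) × (Fin (r + 1) → Submodule k V)) :=
  {X | (∀ i : Fin (r + 2), X.1 i ∈ stepSet β φ r F L S (i : ℕ)) ∧ ∀ i : Fin (r + 1),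
    X.2 i ∈ middleSet F (L (i : ℕ)) (T (i : ℕ)) (X.1 i.castSucc).2 (X.1 i.succ).1}

/-- The decomposition of a chain. -/
def decompose (r : ℕ) (L M : ℤ → Submodule k V) :
    (Fin (r + 2) → Submodule k V × Submodule k V) × (Fin (r + 1) → Submodule k V) :=
  (fun i => (L ((i : ℕ) - 1) ⊔ M ((i : ℕ) - 1), L (i : ℕ) ⊓ M (i : ℕ)), fun i => M (i : ℕ))

include hβ hφ hF hL hLF hS hT hST in
theorem bijOn_decompose : Set.BijOn (decompose r L) (neighborSet β φ r F L S T)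
    (decompSet β φ r F L S T) := by
  refine ⟨fun M hM => ⟨fun i => mem_stepSet hβ hφ hF hL hLF hM _, fun i => ⟨?_, ?_, ?_⟩⟩,
    fun M hM M' hM' h => ?_, ?_⟩
  · exact inf_comm _ _
  · simp [decompose, sup_comm]
  · exact (hM.2 _).gr₂
  · have hm : ∀ i : ℤ, 0 ≤ i → i ≤ r → M' i = M i := by
      intro i h0 hr
      have := congrFun (congrArg Prod.snd h) ⟨i.toNat, by omega⟩
      simpa [decompose, h0] using this.symm
    rw [hM.1.eq_extendChain hm, ← hM'.1.eq_extendChain fun _ _ _ => rfl]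
  · rintro ⟨D, m⟩ ⟨hD, hm⟩
    dsimp only at hD hm
    let m' : ℤ → Submodule k V := fun i => m (Fin.ofNat (r + 1) i.toNat)
    have hm' : ∀ i : Fin (r + 1), m' (i : ℕ) = m i := fun i => by
      simp only [m', Int.toNat_natCast]
      congr 1
      ext
      simp
    have hrow : ∀ i : Fin (r + 1), RowCond F L S T (i : ℕ) (m i) := by
      intro i
      have h1 := hD i.castSucc
      have h2 := hD i.succ
      simp only [Fin.val_castSucc, Fin.val_succ, Nat.cast_add, Nat.cast_one] at h1 h2
      refine rowCond_of_mem hST (h1.1.trans h1.2.1) (h2.2.1.trans h2.2.2.1) h1.2.2.2.2.1 ?_ (hm i)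
      have := h2.2.2.2.1
      rw [add_sub_cancel_right] at this
      convert this using 3
      ring
    have hrow' : ∀ i : ℤ, 0 ≤ i → i ≤ r → RowCond F L S T i (m' i) := by
      intro i h0 hr
      obtain ⟨i, rfl⟩ := Int.eq_ofNat_of_zero_le h0
      have := hrow ⟨i, by omega⟩
      rw [← hm'] at this
      exact this
    have hperp : ∀ i : ℤ, 0 ≤ i → i ≤ r → β.orthogonal (β.orthogonal (m' i)) = m' i :=
      fun i h0 hr => orthogonal_orthogonal hβ hF ((hrow' i h0 hr).comm hLF)
    have hsd : IsSelfDual β φ (per r) (extendChain β φ r m') := by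
      refine isSelfDual_extendChain hφ ?_ ?_ ?_ hperp
      · intro i h0 hr
        obtain ⟨i, rfl⟩ := Int.eq_ofNat_of_zero_le h0
        have h1 := (hD (Fin.succ ⟨i, by omega⟩)).2.1
        have h2 := hm ⟨i, by omega⟩
        have h3 := hm ⟨i + 1, by omega⟩
        have e1 := hm' ⟨i, by omega⟩
        have e2 := hm' ⟨i + 1, by omega⟩
        simp only [Nat.cast_add, Nat.cast_one] at e1 e2
        rw [e1, e2]
        exact (le_sup_left.trans h2.2.1.le).trans (h1.trans (h3.1.symm.le.trans inf_le_left))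
      · have h1 := hD (Fin.castSucc 0)
        have h2 := hm 0
        have e1 := hm' 0
        simp only [Fin.val_zero, Nat.cast_zero, Fin.castSucc_zero] at e1 h1
        rw [e1]
        have h3 : (D 0).2 ≤ m 0 := h2.1.symm.le.trans inf_le_left
        exact (LinearMap.BilinForm.orthogonal_le h3).trans
          ((h1.2.2.2.2.2.1 rfl).symm.le.trans (h1.2.1.trans h3))
      · have h1 := hD (Fin.succ (Fin.last r))
        have h2 := hm (Fin.last r)
        have e1 := hm' (Fin.last r)
        simp only [Fin.val_last, Fin.val_succ, Nat.cast_add, Nat.cast_one] at e1 h1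
        rw [e1]
        have h3 : m (Fin.last r) ≤ (D (Fin.succ (Fin.last r))).1 := le_sup_left.trans h2.2.1.le
        refine h3.trans (h1.2.1.trans ((h1.2.2.2.2.2.2 rfl).le.trans (Submodule.map_mono ?_)))
        exact LinearMap.BilinForm.orthogonal_le h3
    have hval : ∀ i : ℤ, 0 ≤ i → i ≤ r → extendChain β φ r m' i = m' i := by
      intro i h0 hr
      have := extendChain_pos (β := β) (φ := φ) (m := m') 0 h0 hr
      rwa [zero_mul, zero_add, neg_zero, twist_zero] at this
    have hmem : extendChain β φ r m' ∈ neighborSet β φ r F L S T :=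
      ⟨hsd, rowCond_extendChain hβ hF hL hLF hS hT hrow'⟩
    refine ⟨_, hmem, ?_⟩
    have hsnd : ∀ i : Fin (r + 1), extendChain β φ r m' (i : ℕ) = m i := fun i => by
      rw [hval _ (by omega) (by omega), hm']
    refine Prod.ext (funext fun i => ?_) (funext hsnd)
    have hP : ∀ i : Fin (r + 1), L (i : ℕ) ⊓ extendChain β φ r m' (i : ℕ) = (D i.castSucc).2 :=
      fun i => by rw [hsnd, inf_comm, (hm i).1]
    have hQ : ∀ i : Fin (r + 1), L (i : ℕ) ⊔ extendChain β φ r m' (i : ℕ) = (D i.succ).1 :=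
      fun i => by rw [hsnd, sup_comm, (hm i).2.1]
    have hX := mem_stepSet hβ hφ hF hL hLF hmem
    refine Prod.ext ?_ ?_
    · change L ((i : ℕ) - 1) ⊔ extendChain β φ r m' ((i : ℕ) - 1) = (D i).1
      induction i using Fin.cases with
      | zero =>
        have h1 := (hX 0).2.2.2.2.2.1 rfl
        have h2 := (hD 0).2.2.2.2.2.1 rfl
        have h3 := hP 0
        simp only [Fin.val_zero, Nat.cast_zero, Fin.castSucc_zero] at h1 h2 h3 ⊢
        rw [h1, h2, h3]
      | succ i =>
        rw [← hQ i]
        simp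
    · change L (i : ℕ) ⊓ extendChain β φ r m' (i : ℕ) = (D i).2
      induction i using Fin.lastCases with
      | last =>
        have h1 := (hX (r + 1)).2.2.2.2.2.2 rfl
        have h2 := (hD (Fin.last (r + 1))).2.2.2.2.2.2 (by simp)
        have h3 := hQ (Fin.last r)
        rw [Fin.succ_last] at h3
        simp only [Fin.val_last, Nat.cast_add, Nat.cast_one, add_sub_cancel_right] at h1 h2 h3 ⊢
        rw [h1, h2, h3]
      | cast i => exact hP i

end Neighbors

/-! ### The number of chains in a given position -/

section GaussBinom

variable {K : Type*} [Field K]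

theorem gaussBinom_mul_powFact {x : K} (hx : ∀ m : ℕ, x ^ (m + 1) ≠ 1) {a b : ℕ} (h : b ≤ a) :
    gaussBinom x a b * (powFact x b * powFact x (a - b)) = powFact x a := by
  induction b with
  | zero => simp [powFact]
  | succ b ih =>
    have h1 := ih (by omega)
    have h2 := gaussBinom_succ (a : ℤ) b (hx b)
    have e1 : powFact x (b + 1) = powFact x b * (x ^ (b + 1) - 1) := Finset.prod_range_succ _ _
    have e2 : powFact x (a - b) = powFact x (a - (b + 1)) * (x ^ (a - b) - 1) := by
      rw [show a - b = (a - (b + 1)) + 1 by omega, powFact, Finset.prod_range_succ, powFact]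
    have e3 : x ^ ((a : ℤ) - b) = x ^ (a - b) := by
      rw [← zpow_natCast, Nat.cast_sub (by omega)]
    rw [e3] at h2
    rw [e1, ← h1, e2]
    linear_combination (powFact x b * powFact x (a - (b + 1))) * h2

theorem powFact_ne_zero {x : K} (hx : ∀ m : ℕ, x ^ (m + 1) ≠ 1) (b : ℕ) : powFact x b ≠ 0 :=
  Finset.prod_ne_zero_iff.2 fun m _ => sub_ne_zero.2 (hx m)

theorem gaussBinom_symm {x : K} (hx : ∀ m : ℕ, x ^ (m + 1) ≠ 1) {a b : ℕ} (h : b ≤ a) :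
    gaussBinom x a (a - b) = gaussBinom x a b := by
  have h1 := gaussBinom_mul_powFact hx h
  have h2 := gaussBinom_mul_powFact hx (Nat.sub_le a b)
  rw [Nat.sub_sub_self h, mul_comm (powFact x (a - b))] at h2
  exact mul_right_cancel₀ (mul_ne_zero (powFact_ne_zero hx b) (powFact_ne_zero hx (a - b)))
    (h2.trans h1.symm)

theorem gaussBinom_eq_zero {x : K} {a b : ℕ} (h : a < b) : gaussBinom x a b = 0 :=
  Finset.prod_eq_zero (i := a + 1) (Finset.mem_Icc.2 (by omega)) (by simp)

theorem gaussBinom_mul_gaussBinom_eq_zero {x : K} {a : ℤ} (ha : 0 ≤ a) {b c : ℕ}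
    (h : a < b + c) : gaussBinom x a b * gaussBinom x (a - b) c = 0 := by
  obtain ⟨a, rfl⟩ := Int.eq_ofNat_of_zero_le ha
  by_cases hb : a < b
  · rw [gaussBinom_eq_zero hb, zero_mul]
  · rw [← Nat.cast_sub (by omega), gaussBinom_eq_zero (by omega : a - b < c), mul_zero]

/-- The number of two-step flags with given graded dimensions, see `card_stepSet`. -/
noncomputable def stepCount (x : K) (N : ℤ) (c : ℤ → ℤ) (s' s : ℤ → ℕ) : K :=
  (∏ j ∈ Finset.Icc (-N) N, gaussBinom x (c j) (s' j) * gaussBinom x (c j - s' j) (s j)) *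
    x ^ (pairSum (· < ·) N (c - toZ s') (toZ s') +
      pairSum (· < ·) N (toZ s) (c - toZ s' - toZ s))

/-- The number of elements of `neighborSet`, see `card_neighborSet`. -/
noncomputable def neighborCount (x : K) (N : ℤ) (r : ℕ) (C S T : ZMat) : K :=
  isotropicCount x N (C 0) (fun j => (S 0 (-j)).toNat) *
    isotropicCount x N (fun j => C (r + 1) (j + (r + 1)))
      (fun j => (S (-(r + 1)) (-(j + (r + 1)))).toNat) *
    (∏ i ∈ Finset.range r, stepCount x N (C ((i : ℤ) + 1))
      (fun j => (S (-((i : ℤ) + 1)) (-j)).toNat) (fun j => (S ((i : ℤ) + 1) j).toNat)) *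
    ∏ i ∈ Finset.range (r + 1), complementCount x N (fun j => (S i j).toNat)
      (fun j => (T i j).toNat) (fun j => (S (-i - 1) (-j)).toNat)

end GaussBinom

theorem card_sigma_set {α β : Type*} {A : Set α} {B : α → Set β} (hA : A.Finite)
    (hB : ∀ a ∈ A, (B a).Finite) {c : ℚ} (hc : ∀ a ∈ A, (Nat.card (B a) : ℚ) = c) :
    (Nat.card {p : α × β | p.1 ∈ A ∧ p.2 ∈ B p.1} : ℚ) = Nat.card A * c := by
  have := hA.fintype
  have : ∀ a : A, Finite (B a) := fun a => (hB a.1 a.2).to_subtype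
  let e : {p : α × β | p.1 ∈ A ∧ p.2 ∈ B p.1} ≃ Σ a : A, B a :=
    { toFun := fun p => ⟨⟨p.1.1, p.2.1⟩, ⟨p.1.2, p.2.2⟩⟩
      invFun := fun s => ⟨(s.1, s.2), s.1.2, s.2.2⟩
      left_inv := fun _ => rfl
      right_inv := fun _ => rfl }
  rw [Nat.card_congr e, Nat.card_sigma, Nat.cast_sum, Finset.sum_congr rfl fun a _ => hc a.1 a.2,
    Finset.sum_const, nsmul_eq_mul, Finset.card_univ, Nat.card_eq_fintype_card]

theorem card_pi_set {ι : Type*} [Fintype ι] {α : Type*} (A : ι → Set α) :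
    Nat.card {f : ι → α | ∀ i, f i ∈ A i} = ∏ i, Nat.card (A i) := by
  rw [← Nat.card_pi]
  exact Nat.card_congr Equiv.subtypePiEquivPi

section Count

variable {k V : Type*} [Field k] [AddCommGroup V] [Module k V]
  {β : LinearMap.BilinForm k V} {φ : V ≃ₗ[k] V} {F L M : ℤ → Submodule k V}
  {A B : Submodule k V} {r : ℕ} {S T C : ZMat} {N : ℤ}

theorem HasGr.nonneg {u : ℤ → ℤ} (hF : IsLadder F) (hA : Comm F A) (hB : Comm F B) (hAB : A ≤ B)
    (h : HasGr F A B u) (j : ℤ) : 0 ≤ u j := by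
  have hj := comm_self F j
  have hj' := comm_self F (j - 1)
  have hle : F (j - 1) ≤ F j := hF.mono (by omega)
  have h1 := idx_sup_add_idx_inf hF (hA.inf hF hj) (hB.inf hF hj')
  have e : A ⊓ F j ⊓ (B ⊓ F (j - 1)) = A ⊓ F (j - 1) := by
    rw [inf_inf_inf_comm, inf_eq_left.2 hAB, inf_eq_right.2 hle]
  have h2 := idx_mono hF ((hA.inf hF hj).sup hF (hB.inf hF hj')) (hB.inf hF hj)
    (sup_le (inf_le_inf_right _ hAB) (inf_le_inf_left _ hle))
  rw [e] at h1
  rw [← h j]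
  omega

theorem finite_between [Finite k] (hF : IsLadder F) (hA : Comm F A) (hB : Comm F B) :
    {P | A ≤ P ∧ P ≤ B}.Finite := by
  by_cases hAB : A ≤ B
  · have := finite_quotient hF hA hB hAB
    have : Finite (B ⧸ A.submoduleOf B) := Module.finite_of_finite k
    refine (Set.finite_range (pull A B)).subset fun P hP => exists_pull_eq hP.1 hP.2
  · convert Set.finite_empty
    ext P
    exact ⟨fun h => hAB (h.1.trans h.2), fun h => h.elim⟩

/-- The graded dimensions with respect to a shifted filtration. -/
theorem hasGr_shift_iff (hF : IsLadder F) {c : ℤ} (hF' : IsLadder fun j => F (j + c))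
    (hA : Comm F A) (hB : Comm F B) (hAB : A ≤ B) {u : ℤ → ℤ} :
    HasGr (fun j => F (j + c)) A B (fun j => u (j + c)) ↔ HasGr F A B u := by
  have hcomm : ∀ {A}, Comm F A → Comm (fun j => F (j + c)) A := by
    rintro A ⟨i, j, hi, hj⟩
    exact ⟨i - c, j - c, by simpa using hi, by simpa using hj⟩
  have key : ∀ j, idx (fun j => F (j + c)) (B ⊓ F j) - idx (fun j => F (j + c)) (A ⊓ F j) =
      idx F (B ⊓ F j) - idx F (A ⊓ F j) := by
    intro j
    have h1 := hA.inf hF (comm_self F j)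
    have h2 := hB.inf hF (comm_self F j)
    rw [idx_sub hF' (hcomm h1) (hcomm h2) (inf_le_inf_right _ hAB),
      idx_sub hF h1 h2 (inf_le_inf_right _ hAB)]
  constructor
  · intro h j
    have := h (j - c)
    dsimp only at this
    rwa [show j - c - 1 + c = j - 1 by ring, sub_add_cancel, key, key] at this
  · intro h j
    rw [key, key, show j - 1 + c = j + c - 1 by ring]
    exact h (j + c)

variable (hβ : β.IsAlt) (hφ : ∀ x y, β (φ x) y = β x (φ y)) (hF : IsChain β φ (per r) F)
  (hL : IsSelfDual β φ (per r) L) (hLF : ∀ i, Comm F (L i))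
  (hS : ∀ i j, S (i + per r) (j + per r) = S i j) (hT : ∀ i j, T (i + per r) (j + per r) = T i j)
  (hST : ∀ i j, S i j + S (-i - 1) (-j) = T i j + T (-i - 1) (-j))
  (hS0 : ∀ i j, 0 ≤ S i j) (hT0 : ∀ i j, 0 ≤ T i j) (hC : ∀ i, HasGr F (L (i - 1)) (L i) (C i))
  (hN1 : ∀ j, j < -N + per r → F j ≤ L (-1)) (hN2 : ∀ j, N - per r ≤ j → L (r + 1) ≤ F j)
  (hSN : ∀ i j : ℤ, -(r : ℤ) - 1 ≤ i → i ≤ r → (j ≤ -N + per r ∨ N - per r ≤ j) → S i j = 0)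
  (hTN : ∀ i j : ℤ, -(r : ℤ) - 1 ≤ i → i ≤ r → (j ≤ -N + per r ∨ N - per r ≤ j) → T i j = 0)

include hF hLF in
theorem finite_stepSet [Finite k] (i : ℤ) : (stepSet β φ r F L S i).Finite := by
  have h := finite_between hF.toIsLadder (hLF (i - 1)) (hLF i)
  refine (h.prod h).subset fun D hD => ⟨⟨hD.1, hD.2.1.trans hD.2.2.1⟩, hD.1.trans hD.2.1, hD.2.2.1⟩

variable [Finite k]

include hβ hF hL hLF hS0 hC hN1 hN2 hSN in
theorem card_stepSet_zero : (Nat.card (stepSet β φ r F L S 0) : ℚ) =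
    isotropicCount (Nat.card k : ℚ) N (C 0) (fun j => (S 0 (-j)).toNat) := by
  have hp : 0 < per r := by rw [per]; omega
  have h0 : β.orthogonal (L 0) = L (-1) := hL.dual 0
  have hz : toZ (fun j => (S 0 (-j)).toNat) = fun j => S 0 (-j) :=
    funext fun j => Int.toNat_of_nonneg (hS0 _ _)
  rw [← card_isotropic hβ hF (hLF 0) h0 (hL.mono (by omega)) (fun j hj => hN1 j (by omega))
    (fun j hj => (hL.mono (by omega)).trans (hN2 j (by omega))) (hC 0)
    (fun j hj => by
      rw [Finset.mem_Icc] at hj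
      rw [hSN 0 (-j) (by omega) (by omega) (by omega)]
      rfl), hz]
  congr 1
  have e : stepSet β φ r F L S 0 = (fun Q => (Q, β.orthogonal Q)) '' {Q : Submodule k V |
      L (-1) ≤ Q ∧ Q ≤ β.orthogonal Q ∧ HasGr F (L (-1)) Q (fun j => S 0 (-j))} := by
    ext ⟨Q, P⟩
    constructor
    · rintro ⟨h1, h2, h3, h4, h5, h6, -⟩
      have hQ : Q = β.orthogonal P := h6 rfl
      have hP : Comm F P := (hLF (-1)).of_le (hLF 0) (LE.le.trans h1 h2) h3
      have hQP : β.orthogonal Q = P := by rw [hQ, orthogonal_orthogonal hβ hF hP]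
      exact ⟨Q, ⟨h1, h2.trans hQP.ge, h4⟩, Prod.ext rfl hQP⟩
    · rintro ⟨Q, ⟨h1, h2, h3⟩, h⟩
      obtain ⟨rfl, rfl⟩ := Prod.mk.inj h
      have h4 : β.orthogonal Q ≤ L 0 := by
        have := LinearMap.BilinForm.orthogonal_le (B := β) h1
        rwa [hL.dual] at this
      have hQ : Comm F Q := (hLF (-1)).of_le (hLF 0) h1 (h2.trans h4)
      refine ⟨h1, h2, h4, h3, ?_, fun _ => (orthogonal_orthogonal hβ hF hQ).symm, fun h => by omega⟩
      have := h3.orthogonal hF (hLF (-1)) hQ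
      rw [hL.dual] at this
      convert this using 2
      · norm_num
      · rw [neg_neg]
  rw [e]
  exact Nat.card_image_of_injective (fun Q Q' h => congrArg Prod.fst h) _

include hφ hF in
theorem isChain_shift : IsChain (β ∘ₗ (φ : V →ₗ[k] V)) φ (per r) (fun j => F (j + (r + 1))) := by
  refine ⟨⟨fun i j h => hF.mono (by omega), fun i j => hF.fin _ _⟩, fun z => ?_, fun z => ?_⟩
  · rw [add_right_comm]
    exact hF.periodic _
  · have e : (-z - 1 + ((r : ℤ) + 1)) = -(z + (r + 1) - per r) - 1 := by rw [per]; ring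
    rw [e, ← hF.dual, ← hF.periodic (z + (r + 1) - per r), sub_add_cancel]
    ext y
    constructor
    · rintro h _ ⟨x, hx, rfl⟩
      exact h x hx
    · intro h x hx
      exact h _ ⟨x, hx, rfl⟩

include hβ hφ hF hL hLF hS0 hC hN1 hN2 hSN hS in
theorem card_stepSet_last (hφβ : ∀ x, β (φ x) x = 0) :
    (Nat.card (stepSet β φ r F L S (r + 1)) : ℚ) =
      isotropicCount (Nat.card k : ℚ) N (fun j => C (r + 1) (j + (r + 1)))
        (fun j => (S (-(r + 1)) (-(j + (r + 1)))).toNat) := by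
  have hp : per r = 2 * r + 2 := rfl
  have hF' := isChain_shift hφ hF
  have hcomm : ∀ {A}, Comm F A → Comm (fun j => F (j + (r + 1))) A := by
    rintro A ⟨i, j, hi, hj⟩
    exact ⟨i - (r + 1), j - (r + 1), by simpa using hi, by simpa using hj⟩
  have horth : ∀ Q, LinearMap.BilinForm.orthogonal (β ∘ₗ (φ : V →ₗ[k] V)) Q =
      (β.orthogonal Q).map (φ.symm : V →ₗ[k] V) := by
    intro Q
    rw [← twist_neg_one, ← orthogonal_twist hφ, twist_one]
    ext y
    constructor
    · rintro h _ ⟨x, hx, rfl⟩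
      exact h x hx
    · intro h x hx
      exact h _ ⟨x, hx, rfl⟩
  have hdual : ∀ z, (L (-z - 1)).map (φ.symm : V →ₗ[k] V) = L (per r - z - 1) := by
    intro z
    rw [← twist_neg_one, ← hL.apply_add_mul 1]
    congr 1
    ring
  have hperp : ∀ Q, Comm F Q →
      (β.orthogonal ((β.orthogonal Q).map (φ.symm : V →ₗ[k] V))).map (φ.symm : V →ₗ[k] V) = Q := by
    intro Q hQ
    rw [← twist_neg_one, ← twist_neg_one, orthogonal_twist hφ, twist_twist,
      orthogonal_orthogonal hβ hF hQ]
    exact twist_zero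
  have h0 : LinearMap.BilinForm.orthogonal (β ∘ₗ (φ : V →ₗ[k] V)) (L (r + 1)) = L r := by
    rw [horth, hL.dual, hdual, hp]
    congr 1
    ring
  have hz : toZ (fun j => (S (-(r + 1)) (-(j + (r + 1)))).toNat) =
      fun j => (fun j => S (-(r + 1)) (-j)) (j + (r + 1)) :=
    funext fun j => Int.toNat_of_nonneg (hS0 _ _)
  have hc := hC (r + 1)
  rw [add_sub_cancel_right] at hc
  have hle : L r ≤ L (r + 1) := hL.mono (by omega)
  rw [← card_isotropic (fun x => hφβ x) hF' (hcomm (hLF (r + 1))) h0 hle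
    (fun j hj => (hN1 _ (by omega)).trans (hL.mono (by omega)))
    (fun j hj => hN2 _ (by omega))
    ((hasGr_shift_iff hF.toIsLadder hF'.toIsLadder (hLF _) (hLF _) hle).2 hc)
    (fun j hj => by
      rw [Finset.mem_Icc] at hj
      rw [hSN _ _ (by omega) (by omega) (by omega)]
      rfl), hz]
  congr 1
  have hgr : ∀ {Q}, Comm F Q → L r ≤ Q → (HasGr (fun j => F (j + (r + 1))) (L r) Q
      (fun j => (fun j => S (-(r + 1)) (-j)) (j + (r + 1))) ↔
        HasGr F (L r) Q (fun j => S (-(r + 1)) (-j))) := fun hQ h =>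
    hasGr_shift_iff (u := fun j => S (-(r + 1)) (-j)) hF.toIsLadder hF'.toIsLadder (hLF _) hQ h
  have e : stepSet β φ r F L S (r + 1) =
      (fun Q => (Q, (β.orthogonal Q).map (φ.symm : V →ₗ[k] V))) '' {Q : Submodule k V |
        L r ≤ Q ∧ Q ≤ LinearMap.BilinForm.orthogonal (β ∘ₗ (φ : V →ₗ[k] V)) Q ∧
        HasGr (fun j => F (j + (r + 1))) (L r) Q
          (fun j => (fun j => S (-(r + 1)) (-j)) (j + (r + 1)))} := by
    ext ⟨Q, P⟩
    constructor
    · rintro ⟨h1, h2, h3, h4, h5, -, h6⟩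
      rw [add_sub_cancel_right] at h1 h4
      have hP : P = (β.orthogonal Q).map (φ.symm : V →ₗ[k] V) := h6 rfl
      have hQ : Comm F Q := (hLF r).of_le (hLF (r + 1)) h1 (LE.le.trans h2 h3)
      exact ⟨Q, ⟨h1, by rw [horth, ← hP]; exact h2, (hgr hQ h1).2 h4⟩, Prod.ext rfl hP.symm⟩
    · rintro ⟨Q, ⟨h1, h2, h3⟩, h⟩
      obtain ⟨rfl, rfl⟩ := Prod.mk.inj h
      rw [horth] at h2
      have h4 : (β.orthogonal Q).map (φ.symm : V →ₗ[k] V) ≤ L (r + 1) := by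
        have := Submodule.map_mono (f := (φ.symm : V →ₗ[k] V))
          (LinearMap.BilinForm.orthogonal_le (B := β) h1)
        rw [hL.dual, hdual, hp] at this
        exact this.trans (hL.mono (by omega))
      have hQ : Comm F Q := (hLF r).of_le (hLF (r + 1)) h1 (h2.trans h4)
      rw [hgr hQ h1] at h3
      refine ⟨by rwa [add_sub_cancel_right], h2, h4, by rwa [add_sub_cancel_right], ?_,
        fun h => by omega, fun _ => rfl⟩
      have h5 := (h3.orthogonal hF (hLF r) hQ).map hF.symm (hQ.orthogonal hF) ((hLF r).orthogonal hF)
        (LinearMap.BilinForm.orthogonal_le h1)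
      rw [hL.dual, hdual, hp, show (2 * (r : ℤ) + 2 - r - 1) = r + 1 by ring] at h5
      convert h5 using 2
      rename_i j
      rw [← hS (-(r + 1)), hp]
      congr 1 <;> ring
  rw [e]
  exact Nat.card_image_of_injective (fun Q Q' h => congrArg Prod.fst h) _

open Classical in
include hF hL hLF hS0 hC hN1 hN2 hSN in
theorem card_stepSet {i : ℤ} (hi : 1 ≤ i) (hir : i ≤ r) :
    (Nat.card (stepSet β φ r F L S i) : ℚ) = stepCount (Nat.card k : ℚ) N (C i)
      (fun j => (S (-i) (-j)).toNat) (fun j => (S i j).toNat) := by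
  have hp : 0 < per r := by rw [per]; omega
  have hq := natCard_field_pow_ne_one (k := k)
  have hle : L (i - 1) ≤ L i := hL.mono (by omega)
  have w1 : ∀ {A}, L (i - 1) ≤ A → ∀ j, j < -N → F j ≤ A := fun hA j hj =>
    (hN1 j (by omega)).trans ((hL.mono (by omega)).trans hA)
  have w2 : ∀ j, N ≤ j → L i ≤ F j := fun j hj => (hL.mono (by omega)).trans (hN2 j (by omega))
  have hs' : ∀ l, l ∉ Finset.Icc (-N) N → (S (-i) (-l)).toNat = 0 := fun l hl => by
    rw [Finset.mem_Icc] at hl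
    rw [hSN (-i) (-l) (by omega) (by omega) (by omega)]
    rfl
  have hs : ∀ l, l ∉ Finset.Icc (-N) N → (S i l).toNat = 0 := fun l hl => by
    rw [Finset.mem_Icc] at hl
    rw [hSN i l (by omega) (by omega) (by omega)]
    rfl
  have hz' : toZ (fun j => (S (-i) (-j)).toNat) = fun j => S (-i) (-j) :=
    funext fun j => Int.toNat_of_nonneg (hS0 _ _)
  have hz : toZ (fun j => (S i j).toNat) = S i :=
    funext fun j => Int.toNat_of_nonneg (hS0 _ _)
  have hc0 := (hC i).nonneg hF.toIsLadder (hLF _) (hLF _) hle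
  have hcN : ∀ l, l ∉ Finset.Icc (-N) N → C i l = 0 := by
    intro l hl
    have e1 := hC i l
    rw [Finset.mem_Icc] at hl
    by_cases h : l < -N
    · rw [inf_eq_right.2 (w1 le_rfl l h), inf_eq_right.2 (w1 le_rfl (l - 1) (by omega)),
        inf_eq_right.2 ((w1 le_rfl l h).trans hle),
        inf_eq_right.2 ((w1 le_rfl (l - 1) (by omega)).trans hle)] at e1
      omega
    · rw [inf_eq_left.2 (w2 l (by omega)), inf_eq_left.2 (w2 (l - 1) (by omega)),
        inf_eq_left.2 (hle.trans (w2 l (by omega))),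
        inf_eq_left.2 (hle.trans (w2 (l - 1) (by omega)))] at e1
      omega
  let X : Set (Submodule k V) := {Q | L (i - 1) ≤ Q ∧ Q ≤ L i ∧
    HasGr F (L (i - 1)) Q (toZ fun j => (S (-i) (-j)).toNat)}
  let Y : Submodule k V → Set (Submodule k V) := fun Q => {P | Q ≤ P ∧ P ≤ L i ∧
    HasGr F Q P (fun j => C i j - S (-i) (-j) - S i j)}
  have hX : X.Finite := (finite_between hF.toIsLadder (hLF (i - 1)) (hLF i)).subset
    fun Q hQ => ⟨hQ.1, hQ.2.1⟩
  have hXc : ∀ Q ∈ X, Comm F Q := fun Q hQ => (hLF _).of_le (hLF _) hQ.1 hQ.2.1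
  have hXgr : ∀ Q ∈ X, HasGr F Q (L i) (fun j => C i j - S (-i) (-j)) := fun Q hQ j => by
    have e1 := hQ.2.2 j
    have e2 := hC i j
    have e3 := congrFun hz' j
    dsimp only at e3 ⊢
    omega
  have hstep : stepSet β φ r F L S i = {p | p.1 ∈ X ∧ p.2 ∈ Y p.1} := by
    ext ⟨Q, P⟩
    constructor
    · rintro ⟨h1, h2, h3, h4, h5, -⟩
      have hQ : Q ∈ X := ⟨h1, LE.le.trans h2 h3, by rw [hz']; exact h4⟩
      refine ⟨hQ, h2, h3, fun j => ?_⟩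
      have e1 := hXgr Q hQ j
      have e2 := h5 j
      dsimp only at e1 e2 ⊢
      omega
    · rintro ⟨hQ, h2, h3, h4⟩
      refine ⟨hQ.1, h2, h3, by rw [← hz']; exact hQ.2.2, fun j => ?_, fun h => by omega,
        fun h => by omega⟩
      have e1 := hXgr Q hQ j
      have e2 := h4 j
      dsimp only at e1 e2 ⊢
      omega
  have hcard := card_hasGr hF.toIsLadder (hLF _) (hLF _) hle (w1 le_rfl) w2 (hC i) hs'
  rw [hstep, card_sigma_set hX (fun Q hQ => (finite_between hF.toIsLadder (hXc Q hQ) (hLF i)).subset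
    fun P hP => ⟨hP.1, hP.2.1⟩) (c := if ∀ j, 0 ≤ C i j - S (-i) (-j) - S i j then
      subspaceCount (Nat.card k : ℚ) N (fun j => C i j - S (-i) (-j))
        (fun j => (C i j - S (-i) (-j) - S i j).toNat) else 0) fun Q hQ => ?_]
  · rw [show (Nat.card X : ℚ) = _ from hcard]
    split_ifs with h
    · have hzu : toZ (fun j => (C i j - S (-i) (-j) - S i j).toNat) =
          fun j => C i j - S (-i) (-j) - S i j := funext fun j => Int.toNat_of_nonneg (h j)
      have e : ∀ j, gaussBinom (Nat.card k : ℚ) (C i j - S (-i) (-j))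
          (C i j - S (-i) (-j) - S i j).toNat =
          gaussBinom (Nat.card k : ℚ) (C i j - (S (-i) (-j)).toNat) (S i j).toNat := by
        intro j
        have h1 := h j
        have h2 := hS0 i j
        rw [Int.toNat_of_nonneg (hS0 (-i) (-j))]
        obtain ⟨a, ha⟩ := Int.eq_ofNat_of_zero_le (show 0 ≤ C i j - S (-i) (-j) by omega)
        obtain ⟨b, hb⟩ := Int.eq_ofNat_of_zero_le h2
        rw [ha, hb, show ((a : ℤ) - b).toNat = a - b by omega, Int.toNat_natCast]
        exact gaussBinom_symm hq (by omega)
      rw [subspaceCount, subspaceCount, stepCount, hz', hzu, hz, Finset.prod_congr rfl fun j _ => e j,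
        Finset.prod_mul_distrib, zpow_add₀ natCard_field_ne_zero]
      have e1 : (fun j => C i j - S (-i) (-j)) - (fun j => C i j - S (-i) (-j) - S i j) = S i := by
        funext j
        simp
      have e2 : (C i - fun j => S (-i) (-j)) - S i = fun j => C i j - S (-i) (-j) - S i j := rfl
      rw [e1, e2]
      ring
    · push Not at h
      obtain ⟨j, hj⟩ := h
      have hjm : j ∈ Finset.Icc (-N) N := by
        by_contra h'
        have h1 := hs' j h'
        have h2 := hs j h'
        have h3 := hS0 i j
        have h4 := hS0 (-i) (-j)
        have h5 := hc0 j
        omega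
      rw [mul_zero, stepCount, Finset.prod_eq_zero hjm, zero_mul]
      refine gaussBinom_mul_gaussBinom_eq_zero (hc0 j) ?_
      have h3 := hS0 i j
      have h4 := hS0 (-i) (-j)
      omega
  · split_ifs with h
    · have hzu : toZ (fun j => (C i j - S (-i) (-j) - S i j).toNat) =
          fun j => C i j - S (-i) (-j) - S i j := funext fun j => Int.toNat_of_nonneg (h j)
      rw [← card_hasGr hF.toIsLadder (hXc Q hQ) (hLF i) hQ.2.1 (w1 hQ.1) w2 (hXgr Q hQ)
        (fun j hj => by
          have h1 := hcN j hj
          have h3 := hS0 i j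
          have h4 := hS0 (-i) (-j)
          omega), hzu]
    · have : Y Q = ∅ := by
        by_contra h'
        obtain ⟨P, hP⟩ := Set.nonempty_iff_ne_empty.2 h'
        refine h (hP.2.2.nonneg hF.toIsLadder (hXc Q hQ) ?_ hP.1)
        exact (hXc Q hQ).of_le (hLF i) hP.1 hP.2.1
      rw [this]
      simp

include hF hLF hS0 hT0 hN1 hN2 hSN hTN hL in
theorem card_middleSet {D D' : Submodule k V × Submodule k V} {i : ℤ} (h0 : 0 ≤ i) (hr : i ≤ r)
    (hD : D ∈ stepSet β φ r F L S i) (hD' : D' ∈ stepSet β φ r F L S (i + 1)) :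
    (middleSet F (L i) (T i) D.2 D'.1).Finite ∧
    (Nat.card (middleSet F (L i) (T i) D.2 D'.1) : ℚ) = complementCount (Nat.card k : ℚ) N
      (fun j => (S i j).toNat) (fun j => (T i j).toNat) (fun j => (S (-i - 1) (-j)).toNat) := by
  have hp : 0 < per r := by rw [per]; omega
  obtain ⟨d1, d2, d3, d4, d5, -⟩ := hD
  obtain ⟨d1', d2', d3', d4', d5', -⟩ := hD'
  rw [add_sub_cancel_right] at d1' d4'
  have h1 : L (i - 1) ≤ D.2 := d1.trans d2
  have h2 : D'.1 ≤ L (i + 1) := d2'.trans d3'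
  have hcA : Comm F D.2 := (hLF _).of_le (hLF _) h1 d3
  have hcB : Comm F D'.1 := (hLF _).of_le (hLF _) d1' h2
  refine ⟨(finite_between hF.toIsLadder hcA hcB).subset fun A hA =>
    ⟨hA.1.symm.le.trans inf_le_left, le_sup_left.trans hA.2.1.le⟩, ?_⟩
  have hz : ∀ {S : ZMat}, (∀ i j, 0 ≤ S i j) → ∀ i, toZ (fun j => (S i j).toNat) = S i :=
    fun h i => funext fun j => Int.toNat_of_nonneg (h _ _)
  have hz' : toZ (fun j => (S (-i - 1) (-j)).toNat) = fun j => S (-i - 1) (-j) :=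
    funext fun j => Int.toNat_of_nonneg (hS0 _ _)
  have e : -(i + 1) = -i - 1 := by ring
  rw [e] at d4'
  rw [← card_complement hF.toIsLadder hcA hcB (d3.trans d1')
    (fun j hj => (hN1 j (by omega)).trans ((hL.mono (by omega)).trans h1))
    (fun j hj => h2.trans ((hL.mono (by omega)).trans (hN2 j (by omega)))) d3 d1'
    ((hz hS0 i).symm ▸ d5) (hz'.symm ▸ d4')]
  · rw [hz hT0]
    rfl
  · intro l hl
    rw [Finset.mem_Icc] at hl
    rw [hSN i l (by omega) (by omega) (by omega)]
    rfl
  · intro l hl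
    rw [Finset.mem_Icc] at hl
    rw [hTN i l (by omega) (by omega) (by omega)]
    rfl
  · intro l hl
    rw [Finset.mem_Icc] at hl
    rw [hSN (-i - 1) (-l) (by omega) (by omega) (by omega)]
    rfl

include hβ hφ hF hL hLF hS hT hST hS0 hT0 hC hN1 hN2 hSN hTN in
theorem card_neighborSet (hφβ : ∀ x, β (φ x) x = 0) :
    (neighborSet β φ r F L S T).Finite ∧ (Nat.card (neighborSet β φ r F L S T) : ℚ) =
      neighborCount (Nat.card k : ℚ) N r C S T := by
  have hbij := bijOn_decompose hβ hφ hF hL hLF hS hT hST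
  let A : Set (Fin (r + 2) → Submodule k V × Submodule k V) :=
    {f | ∀ i : Fin (r + 2), f i ∈ stepSet β φ r F L S (i : ℕ)}
  let B : (Fin (r + 2) → Submodule k V × Submodule k V) → Set (Fin (r + 1) → Submodule k V) :=
    fun D => {f | ∀ i : Fin (r + 1),
      f i ∈ middleSet F (L (i : ℕ)) (T (i : ℕ)) (D i.castSucc).2 (D i.succ).1}
  have hdec : decompSet β φ r F L S T = {p | p.1 ∈ A ∧ p.2 ∈ B p.1} := rfl
  have hA : A.Finite := Set.Finite.pi' fun i => finite_stepSet hF hLF _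
  have hmid : ∀ D ∈ A, ∀ i : Fin (r + 1), _ := fun D hD (i : Fin (r + 1)) =>
    card_middleSet (T := T) hF hL hLF hS0 hT0 hN1 hN2 hSN hTN (i := (i : ℕ)) (by omega) (by omega)
      (by simpa using hD i.castSucc) (by simpa using hD i.succ)
  have hB : ∀ D ∈ A, (B D).Finite := fun D hD => Set.Finite.pi' fun i => (hmid D hD i).1
  have hfin : (decompSet β φ r F L S T).Finite := by
    rw [hdec]
    refine (hA.biUnion fun D hD => (hB D hD).image (Prod.mk D)).subset ?_
    rintro ⟨D, m⟩ ⟨hD, hm⟩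
    exact Set.mem_biUnion hD ⟨m, hm, rfl⟩
  refine ⟨hfin.of_injOn hbij.mapsTo hbij.injOn, ?_⟩
  rw [Nat.card_congr hbij.equiv, hdec, card_sigma_set hA hB
    (c := ∏ i ∈ Finset.range (r + 1), complementCount (Nat.card k : ℚ) N (fun j => (S i j).toNat)
      (fun j => (T i j).toNat) (fun j => (S (-i - 1) (-j)).toNat)) (fun D hD => ?_), neighborCount]
  · congr 1
    rw [card_pi_set (fun i : Fin (r + 2) => stepSet β φ r F L S (i : ℕ)), Nat.cast_prod,
      Fin.prod_univ_succ, Fin.prod_univ_castSucc]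
    have e0 := card_stepSet_zero (φ := φ) hβ hF hL hLF hS0 hC hN1 hN2 hSN
    have e1 := card_stepSet_last hβ hφ hF hL hLF hS hS0 hC hN1 hN2 hSN hφβ
    simp only [Fin.val_zero, Nat.cast_zero, Fin.val_succ, Fin.val_castSucc, Fin.val_last,
      Nat.cast_add, Nat.cast_one]
    rw [e0, e1, Finset.prod_range, mul_assoc]
    congr 1
    rw [mul_comm]
    congr 1
    exact Finset.prod_congr rfl fun i _ =>
      card_stepSet hF hL hLF hS0 hC hN1 hN2 hSN (by omega) (by omega)
  · rw [card_pi_set (fun i : Fin (r + 1) => middleSet F (L (i : ℕ)) (T (i : ℕ)) (D i.castSucc).2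
      (D i.succ).1), Nat.cast_prod, Finset.prod_range]
    exact Finset.prod_congr rfl fun i _ => (hmid D hD i).2

end Count

/-! ### Relative positions -/

section Position

variable {k V : Type*} [Field k] [AddCommGroup V] [Module k V]
  {β : LinearMap.BilinForm k V} {φ : V ≃ₗ[k] V} {F L M : ℤ → Submodule k V}
  {A B : Submodule k V} {r : ℕ} {S T : ZMat} {α : ℤ → ℕ} {u : ℤ → ℤ}

/-- The matrix of second differences of the dimensions of `L_i ⊓ M_j`. -/
noncomputable def posMat (F L M : ℤ → Submodule k V) : ZMat := fun i j =>
  (idx F (L i ⊓ M j) - idx F (L (i - 1) ⊓ M j)) -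
    (idx F (L i ⊓ M (j - 1)) - idx F (L (i - 1) ⊓ M (j - 1)))

/-- The graded dimensions of `B / A`. -/
noncomputable def grDim (F : ℤ → Submodule k V) (A B : Submodule k V) (j : ℤ) : ℤ :=
  (idx F (B ⊓ F j) - idx F (A ⊓ F j)) - (idx F (B ⊓ F (j - 1)) - idx F (A ⊓ F (j - 1)))

theorem hasGr_iff_grDim_eq : HasGr F A B u ↔ grDim F A B = u := funext_iff.symm

theorem exists_window (hF : IsLadder F) (hA : Comm F A) (hB : Comm F B) (c : ℤ) :
    ∃ N : ℤ, c ≤ N ∧ (∀ j, j < -N + c → F j ≤ A) ∧ ∀ j, N - c ≤ j → B ≤ F j := by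
  obtain ⟨i, _, hi, _⟩ := hA
  obtain ⟨_, j, _, hj⟩ := hB
  exact ⟨max c (max (c - i) (c + j)), le_max_left _ _, fun l hl => (hF.mono (by omega)).trans hi,
    fun l hl => hj.trans (hF.mono (by omega))⟩

theorem HasGr.eq_zero {N : ℤ} (h : HasGr F A B u) (hAB : A ≤ B) (h1 : ∀ j, j < -N → F j ≤ A)
    (h2 : ∀ j, N ≤ j → B ≤ F j) (l : ℤ) (hl : l < -N ∨ N < l) : u l = 0 := by
  rw [← h l]
  rcases hl with hl | hl
  · rw [inf_eq_right.2 (h1 l hl), inf_eq_right.2 (h1 (l - 1) (by omega)),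
      inf_eq_right.2 ((h1 l hl).trans hAB), inf_eq_right.2 ((h1 (l - 1) (by omega)).trans hAB)]
    ring
  · rw [inf_eq_left.2 (h2 l (by omega)), inf_eq_left.2 (h2 (l - 1) (by omega)),
      inf_eq_left.2 (hAB.trans (h2 l (by omega))),
      inf_eq_left.2 (hAB.trans (h2 (l - 1) (by omega)))]
    ring

theorem HasGr.cum_eq {N : ℤ} (h : HasGr F A B u) (hAB : A ≤ B) (h1 : ∀ j, j < -N → F j ≤ A)
    {j : ℤ} (hj : -N - 1 ≤ j) : cum N u j = idx F (B ⊓ F j) - idx F (A ⊓ F j) := by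
  induction j, hj using Int.leInduction with
  | base =>
    rw [cum_of_lt _ (by omega), inf_eq_right.2 (h1 _ (by omega)),
      inf_eq_right.2 ((h1 _ (by omega)).trans hAB), sub_self]
  | succ j hj ih =>
    rw [cum_eq_add _ (by omega), add_sub_cancel_right, ih, ← h (j + 1), add_sub_cancel_right]
    ring

theorem HasGr.finsum_eq (hF : IsLadder F) (h : HasGr F A B u) (hA : Comm F A) (hB : Comm F B)
    (hAB : A ≤ B) : u.support.Finite ∧ ∑ᶠ j, u j = idx F B - idx F A := by
  obtain ⟨N, hN, h1, h2⟩ := exists_window hF hA hB 0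
  simp only [add_zero, sub_zero] at h1 h2
  have h0 : ∀ l, l ∉ Finset.Icc (-N) N → u l = 0 := fun l hl => by
    rw [Finset.mem_Icc] at hl
    exact h.eq_zero hAB h1 h2 l (by omega)
  refine ⟨(Finset.Icc (-N) N).finite_toSet.subset fun l hl => ?_, ?_⟩
  · by_contra h'
    exact hl (h0 l h')
  · rw [finsum_eq_sum_Icc h0]
    have := h.cum_eq hAB h1 (j := N) (by omega)
    rwa [inf_eq_left.2 (h2 N le_rfl), inf_eq_left.2 (hAB.trans (h2 N le_rfl))] at this

/-- The conditions on a matrix with entries in three diagonals. -/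
structure IsTridiagonal (α : ℤ → ℕ) (B : ZMat) : Prop where
  far : ∀ i j, (j < i - 1 ∨ i + 1 < j) → B i j = 0
  upper : ∀ i, B i (i + 1) = α i
  lower : ∀ i, B (i + 1) i = α (-i - 1)

variable (hβ : β.IsAlt) (hφ : ∀ x y, β (φ x) y = β x (φ y)) (hF : IsChain β φ (per r) F)
  (hL : IsSelfDual β φ (per r) L) (hLF : ∀ i, Comm F (L i))
  (hM : IsSelfDual β φ (per r) M) (hMF : ∀ i, Comm F (M i))

include hF hL hLF hM hMF in
theorem le_of_posMat {B : ZMat} (hB : ∀ i j, i + 1 < j → B i j = 0) (h : posMat F L M = B)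
    (h1 : ∀ i, ∃ j, L i ≤ M j) (h2 : ∀ j, ∃ i, L i ≤ M j) (i : ℤ) : L (i - 1) ≤ M i := by
  have hD : ∀ i j, i + 1 < j → idx F (L i ⊓ M j) - idx F (L (i - 1) ⊓ M j) =
      idx F (L i ⊓ M (j - 1)) - idx F (L (i - 1) ⊓ M (j - 1)) := by
    intro i j hij
    have := congrFun (congrFun h i) j
    rw [hB i j hij, posMat] at this
    omega
  have key : ∀ i j, i + 1 ≤ j → idx F (L i) - idx F (L i ⊓ M j) =
      idx F (L (i - 1)) - idx F (L (i - 1) ⊓ M j) := by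
    intro i j hij
    obtain ⟨j', hj'⟩ := h1 i
    have hle : L (i - 1) ≤ L i := hL.mono (by omega)
    have : ∀ m, j ≤ m → idx F (L i ⊓ M m) - idx F (L (i - 1) ⊓ M m) =
        idx F (L i ⊓ M j) - idx F (L (i - 1) ⊓ M j) := by
      intro m hm
      induction m, hm using Int.leInduction with
      | base => rfl
      | succ m hm ih => rw [hD i (m + 1) (by omega), add_sub_cancel_right, ih]
    have h3 := this (max j j') (le_max_left _ _)
    have h4 : L i ≤ M (max j j') := hj'.trans (hM.mono (le_max_right _ _))
    rw [inf_eq_left.2 h4, inf_eq_left.2 (hle.trans h4)] at h3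
    omega
  obtain ⟨i', hi'⟩ := h2 i
  have h3 : ∀ l, l ≤ i - 1 → idx F (L (i - 1)) - idx F (L (i - 1) ⊓ M i) =
      idx F (L l) - idx F (L l ⊓ M i) := by
    intro l hl
    induction l, hl using Int.leInductionDown with
    | base => rfl
    | pred l hl ih => rw [ih, key l i (by omega)]
  have h4 := h3 (min (i - 1) i') (min_le_left _ _)
  have h5 : L (min (i - 1) i') ≤ M i := (hL.mono (min_le_right _ _)).trans hi'
  rw [inf_eq_left.2 h5, sub_self] at h4
  have := eq_of_idx_le hF.toIsLadder ((hLF (i - 1)).inf hF.toIsLadder (hMF i)) (hLF (i - 1))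
    inf_le_left (by omega)
  exact inf_eq_left.1 this

include hL hM in
theorem le_succ_of_le (h : ∀ i, L (i - 1) ≤ M i) (i : ℤ) : M i ≤ L (i + 1) := by
  have := LinearMap.BilinForm.orthogonal_le (B := β) (h (-i - 1))
  rw [hL.dual, hM.dual] at this
  rwa [show -(-i - 1) - 1 = i by ring, show -(-i - 1 - 1) - 1 = i + 1 by ring] at this

include hL hM in
theorem posMat_of_between (h : ∀ i, L (i - 1) ≤ M i) :
    (∀ i j, (j < i - 1 ∨ i + 1 < j) → posMat F L M i j = 0) ∧
    (∀ i, posMat F L M i (i + 1) = idx F (L i) - idx F (L i ⊓ M i)) ∧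
    (∀ i, posMat F L M (i + 1) i = idx F (M i) - idx F (L i ⊓ M i)) ∧
    ∀ i, posMat F L M (i - 1) i + posMat F L M i i + posMat F L M (i + 1) i =
      idx F (M i) - idx F (M (i - 1)) := by
  have h' := le_succ_of_le hL hM h
  have e1 : ∀ i j, i < j → L i ⊓ M j = L i := fun i j hij =>
    inf_eq_left.2 ((hL.mono (by omega)).trans (h j))
  have e2 : ∀ i j, j < i → L i ⊓ M j = M j := fun i j hij =>
    inf_eq_right.2 ((h' j).trans (hL.mono (by omega)))
  refine ⟨fun i j hij => ?_, fun i => ?_, fun i => ?_, fun i => ?_⟩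
  · rw [posMat]
    rcases hij with hij | hij
    · rw [e2 i j (by omega), e2 i (j - 1) (by omega), e2 (i - 1) j (by omega),
        e2 (i - 1) (j - 1) (by omega)]
      ring
    · rw [e1 i j (by omega), e1 i (j - 1) (by omega), e1 (i - 1) j (by omega),
        e1 (i - 1) (j - 1) (by omega)]
      ring
  · rw [posMat, add_sub_cancel_right, e1 i (i + 1) (by omega), e1 (i - 1) (i + 1) (by omega),
      e1 (i - 1) i (by omega)]
    ring
  · rw [posMat, add_sub_cancel_right, e2 (i + 1) i (by omega), e2 (i + 1) (i - 1) (by omega),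
      e2 i (i - 1) (by omega)]
    ring
  · rw [posMat, posMat, posMat, add_sub_cancel_right, e1 (i - 1) i (by omega),
      e1 (i - 1 - 1) i (by omega), e1 (i - 1 - 1) (i - 1) (by omega), e2 i (i - 1) (by omega),
      e2 (i + 1) i (by omega), e2 (i + 1) (i - 1) (by omega)]
    ring

theorem hasGr_posMat (i : ℤ) : HasGr F (L (i - 1)) (L i) (posMat F L F i) := fun _ => rfl

include hF hM hMF in
theorem ro_posMat (i : ℤ) : ro (posMat F M F) i = idx F (M i) - idx F (M (i - 1)) :=
  ((hasGr_posMat i).finsum_eq hF.toIsLadder (hMF _) (hMF _) (hM.mono (by omega))).2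

include hβ hF hL hLF hM hMF in
/-- A chain between the shifts of `L` lies in `neighborSet` for its own graded dimensions. -/
theorem mem_neighborSet_grDim (h : ∀ i, L (i - 1) ≤ M i) :
    M ∈ neighborSet β φ r F L (fun i => grDim F (L i ⊓ M i) (L i))
      (fun i => grDim F (L i ⊓ M i) (M i)) := by
  have h' := le_succ_of_le hL hM h
  refine ⟨hM, fun i => ⟨h i, h' i, fun _ => rfl, fun _ => rfl, ?_, ?_⟩⟩
  · have hinf := (hLF (-i - 1)).inf hF.toIsLadder (hMF (-i - 1))
    have h1 : HasGr F (L (-i - 1) ⊓ M (-i - 1)) (L (-i - 1)) _ := fun _ => rfl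
    have h2 := h1.orthogonal hF hinf (hLF _)
    rw [orthogonal_inf hβ hF (hLF _) (hMF _), hL.dual, hM.dual, show -(-i - 1) - 1 = i by ring] at h2
    exact h2
  · have hinf := (hLF (-i - 1)).inf hF.toIsLadder (hMF (-i - 1))
    have h1 : HasGr F (L (-i - 1) ⊓ M (-i - 1)) (M (-i - 1)) _ := fun _ => rfl
    have h2 := h1.orthogonal hF hinf (hMF _)
    rw [orthogonal_inf hβ hF (hLF _) (hMF _), hL.dual, hM.dual, show -(-i - 1) - 1 = i by ring] at h2
    exact h2

include hF hLF in
theorem facts_of_mem_neighborSet (hL : IsSelfDual β φ (per r) L)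
    (hM : M ∈ neighborSet β φ r F L S T) :
    (∀ i j, 0 ≤ S i j) ∧ (∀ i j, 0 ≤ T i j) ∧ (∀ i, (S i).support.Finite) ∧
    (∀ i, (T i).support.Finite) ∧ (∀ i, ro S i = idx F (L i) - idx F (L i ⊓ M i)) ∧
    (∀ i, ro T i = idx F (M i) - idx F (L i ⊓ M i)) ∧
    (∀ i j, S i j + S (-i - 1) (-j) = T i j + T (-i - 1) (-j)) ∧
    (∀ i j, 0 ≤ posMat F M F i j - T i j + T (i - 1) j) ∧
    AST (posMat F M F) S T = posMat F L F := by
  have hMF : ∀ i, Comm F (M i) := fun i => (hM.2 i).comm hLF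
  have hinf := fun i => (hLF i).inf hF.toIsLadder (hMF i)
  have hSs := fun i => (hM.2 i).gr₁.finsum_eq hF.toIsLadder (hinf i) (hLF i) inf_le_left
  have hTs := fun i => (hM.2 i).gr₂.finsum_eq hF.toIsLadder (hinf i) (hMF i) inf_le_right
  refine ⟨fun i => (hM.2 i).gr₁.nonneg hF.toIsLadder (hinf i) (hLF i) inf_le_left,
    fun i => (hM.2 i).gr₂.nonneg hF.toIsLadder (hinf i) (hMF i) inf_le_right,
    fun i => (hSs i).1, fun i => (hTs i).1, fun i => (hSs i).2, fun i => (hTs i).2,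
    fun i j => ?_, fun i j => ?_, ?_⟩
  · have e1 := (hM.2 i).gr₁ j
    have e2 := (hM.2 i).gr₂ j
    have e3 := (hM.2 i).gr₃ j
    have e4 := (hM.2 i).gr₄ j
    dsimp only at e3 e4
    omega
  · have h1 : HasGr F (L (i - 1) ⊓ M (i - 1)) (L i ⊓ M i)
        (fun j => posMat F M F i j - T i j + T (i - 1) j) := fun j => by
      have e2 := (hM.2 i).gr₂ j
      have e3 := (hM.2 (i - 1)).gr₂ j
      dsimp only [posMat]
      omega
    exact h1.nonneg hF.toIsLadder (hinf _) (hinf _)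
      (inf_le_inf (hL.mono (by omega)) (hM.1.mono (by omega))) j
  · funext i j
    have e1 := (hM.2 i).gr₁ j
    have e2 := (hM.2 i).gr₂ j
    have e3 := (hM.2 (i - 1)).gr₁ j
    have e4 := (hM.2 (i - 1)).gr₂ j
    simp only [AST, rowShift, posMat, Matrix.sub_apply, Matrix.add_apply]
    omega

theorem eq_grDim_of_mem_neighborSet (hM : M ∈ neighborSet β φ r F L S T) :
    S = (fun i => grDim F (L i ⊓ M i) (L i)) ∧ T = fun i => grDim F (L i ⊓ M i) (M i) :=
  ⟨funext fun i => (hasGr_iff_grDim_eq.1 (hM.2 i).gr₁).symm,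
    funext fun i => (hasGr_iff_grDim_eq.1 (hM.2 i).gr₂).symm⟩

include hF hLF in
theorem grDim_periodic {A B : ℤ → Submodule k V} (hA : ∀ z, (A (z + per r)).map (φ : V →ₗ[k] V) = A z)
    (hB : ∀ z, (B (z + per r)).map (φ : V →ₗ[k] V) = B z) (hAc : ∀ z, Comm F (A z))
    (hBc : ∀ z, Comm F (B z)) (hAB : ∀ z, A z ≤ B z) (i j : ℤ) :
    grDim F (A (i + per r)) (B (i + per r)) (j + per r) = grDim F (A i) (B i) j := by
  have h1 : HasGr F (A (i + per r)) (B (i + per r)) (grDim F (A (i + per r)) (B (i + per r))) :=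
    fun _ => rfl
  have h2 := h1.map hF (hAc _) (hBc _) (hAB _)
  rw [hA, hB, hasGr_iff_grDim_eq] at h2
  rw [h2]

end Position

/-! ### Chains with two given relative positions -/

theorem E_apply_of_ne {r : ℕ} {i j a b : ℤ} (h : b - a ≠ j - i) : E r i j a b = 0 :=
  if_neg fun ⟨m, h1, h2⟩ => h (by omega)

theorem exists_unique_residue (r : ℕ) (a : ℤ) :
    ∃ i ∈ Finset.Icc 1 (per r), (∃ m : ℤ, a = i + m * per r) ∧
      ∀ i' ∈ Finset.Icc 1 (per r), (∃ m : ℤ, a = i' + m * per r) → i' = i := by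
  have hp : 0 < per r := by rw [per]; omega
  have h1 := Int.emod_add_mul_ediv (a - 1) (per r)
  have h2 := Int.emod_nonneg (a - 1) hp.ne'
  have h3 := Int.emod_lt_of_pos (a - 1) hp
  refine ⟨(a - 1) % per r + 1, Finset.mem_Icc.2 (by omega), ⟨(a - 1) / per r, ?_⟩, ?_⟩
  · rw [mul_comm] at h1
    omega
  · rintro i hi ⟨m, rfl⟩
    rw [Finset.mem_Icc] at hi
    rw [show i + m * per r - 1 = i - 1 + m * per r by ring, Int.add_mul_emod_self_right,
      Int.emod_eq_of_lt (by omega) (by omega)]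
    ring

theorem apply_add_mul_per {r : ℕ} {α : ℤ → ℕ} (hα : ∀ i : ℤ, α (i + per r) = α i) (i m : ℤ) :
    α (i + m * per r) = α i := by
  have h : Function.Periodic α (per r) := hα
  exact h.int_mul m i

theorem isTridiagonal_of_isDiag {r : ℕ} {α : ℤ → ℕ} (hα : ∀ i : ℤ, α (i + per r) = α i) {B : ZMat}
    (h : (B - ∑ i ∈ Finset.Icc 1 (per r), (α i : ℤ) • Etheta r i (i + 1)).IsDiag) :
    IsTridiagonal α B := by
  have hB : ∀ a b, a ≠ b →
      B a b = ∑ i ∈ Finset.Icc 1 (per r), (α i : ℤ) * (E r i (i + 1) a b + E r (-i) (-(i + 1)) a b) := by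
    intro a b hab
    have : (B - ∑ i ∈ Finset.Icc 1 (per r), (α i : ℤ) • Etheta r i (i + 1)) a b = 0 := h hab
    rw [Matrix.sub_apply, Matrix.sum_apply, sub_eq_zero] at this
    exact this
  refine ⟨fun i j hij => ?_, fun i => ?_, fun i => ?_⟩
  · rw [hB i j (by omega)]
    refine Finset.sum_eq_zero fun l _ => ?_
    rw [E_apply_of_ne (by omega), E_apply_of_ne (by omega), add_zero, mul_zero]
  · rw [hB i (i + 1) (by omega)]
    obtain ⟨l, hl, ⟨m, hm⟩, hu⟩ := exists_unique_residue r i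
    rw [Finset.sum_eq_single_of_mem l hl fun l' hl' hne => ?_]
    · rw [E_apply_of_ne (i := -l) (by omega), E, if_pos ⟨m, hm, by omega⟩, hm,
        apply_add_mul_per hα]
      ring
    · rw [E_apply_of_ne (i := -l') (by omega), E, if_neg fun ⟨m, h1, _⟩ => hne (hu l' hl' ⟨m, h1⟩)]
      ring
  · rw [hB (i + 1) i (by omega)]
    obtain ⟨l, hl, ⟨m, hm⟩, hu⟩ := exists_unique_residue r (-i - 1)
    rw [Finset.sum_eq_single_of_mem l hl fun l' hl' hne => ?_]
    · rw [E_apply_of_ne (i := l) (by omega), E, if_pos ⟨-m, by rw [neg_mul]; omega,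
        by rw [neg_mul]; omega⟩, hm, apply_add_mul_per hα]
      ring
    · rw [E_apply_of_ne (i := l') (by omega), E, if_neg fun ⟨m, h1, _⟩ => hne (hu l' hl'
        ⟨-m, by rw [neg_mul]; omega⟩)]
      ring

theorem IsTridiagonal.co_eq {α : ℤ → ℕ} {B : ZMat} (h : IsTridiagonal α B) (j : ℤ) :
    co B j = B (j - 1) j + B j j + B (j + 1) j := by
  rw [co, finsum_eq_sum_of_support_subset (s := {j - 1, j, j + 1}),
    Finset.sum_insert (by simp; omega), Finset.sum_insert (by simp), Finset.sum_singleton, add_assoc]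
  intro i hi
  by_contra h'
  simp only [Finset.coe_insert, Finset.coe_singleton, Set.mem_insert_iff,
    Set.mem_singleton_iff] at h'
  exact hi (h.far i j (by omega))

/-- The entries in the rows `-r-1, …, r+1` vanish outside of a window. -/
def Window (r : ℕ) (N : ℤ) (S : ZMat) : Prop :=
  ∀ i j : ℤ, -(r : ℤ) - 1 ≤ i → i ≤ r + 1 → (j ≤ -N + per r ∨ N - per r ≤ j) → S i j = 0

theorem exists_forall_window {r : ℕ} {S : ZMat} (hS : S ∈ Theta r) :
    ∃ N₀, ∀ N, N₀ ≤ N → Window r N S := by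
  have h : (⋃ i ∈ Finset.Icc (-(r : ℤ) - 1) (r + 1), {j | S i j ≠ 0}).Finite :=
    Set.Finite.biUnion (Finset.finite_toSet _) fun i _ => hS.2.2 i
  obtain ⟨b, hb⟩ := h.bddAbove
  obtain ⟨a, ha⟩ := h.bddBelow
  refine ⟨max (b + per r + 1) (-a + per r + 1), fun N hN i j h1 h2 hj => ?_⟩
  by_contra h'
  have hm : j ∈ ⋃ i ∈ Finset.Icc (-(r : ℤ) - 1) (r + 1), {j | S i j ≠ 0} :=
    Set.mem_biUnion (Finset.mem_coe.2 (Finset.mem_Icc.2 ⟨h1, h2⟩)) h'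
  have h3 := hb hm
  have h4 := ha hm
  omega

theorem ncard_biUnion_finset {ι X : Type*} {s : Finset ι} {f : ι → Set X}
    (hf : ∀ i ∈ s, (f i).Finite) (hd : (s : Set ι).PairwiseDisjoint f) :
    (⋃ i ∈ s, f i).ncard = ∑ i ∈ s, (f i).ncard := by
  classical
  induction s using Finset.induction_on with
  | empty => simp
  | insert a s ha ih =>
    have h1 : ∀ i ∈ s, (f i).Finite := fun i hi => hf i (Finset.mem_insert_of_mem hi)
    have h2 : Disjoint (f a) (⋃ i ∈ s, f i) := by
      simp only [Set.disjoint_iUnion_right]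
      exact fun i hi => hd (by simp) (by simp [hi]) fun h => ha (h ▸ hi)
    rw [Finset.set_biUnion_insert, Finset.sum_insert ha, Set.ncard_union_eq h2
      (hf a (Finset.mem_insert_self a s)) (s.finite_toSet.biUnion h1), ih h1
      (hd.subset fun i hi => by simp [Finset.mem_coe.1 hi])]

section Position

variable {k V : Type*} [Field k] [AddCommGroup V] [Module k V]
  {β : LinearMap.BilinForm k V} {φ : V ≃ₗ[k] V} {F L M : ℤ → Submodule k V}
  {r d : ℕ} {A B C : ZMat} {α : ℤ → ℕ}

/-- The chains `M` such that `(L, M)` and `(M, F)` have positions `B` and `A`. -/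
def positionedSet (β : LinearMap.BilinForm k V) (φ : V ≃ₗ[k] V) (r : ℕ) (F L : ℤ → Submodule k V)
    (B A : ZMat) : Set (ℤ → Submodule k V) :=
  {M | IsSelfDual β φ (per r) M ∧ (∀ i, Comm F (M i)) ∧ (∀ i, ∃ j, L i ≤ M j) ∧
    (∀ j, ∃ i, L i ≤ M j) ∧ posMat F L M = B ∧ posMat F M F = A}

variable (hβ : β.IsAlt) (hφ : ∀ x y, β (φ x) y = β x (φ y)) (hF : IsChain β φ (per r) F)
  (hL : IsSelfDual β φ (per r) L) (hLF : ∀ i, Comm F (L i))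
  (hB : IsTridiagonal α B) (hco : co B = ro A) (hA : A ∈ Theta r) (hC : C ∈ cXi r d)
  (hLC : posMat F L F = C)

include hβ hF hL hLF hB hco hA hC hLC

theorem positionedSet_eq : positionedSet β φ r F L B A =
    ⋃ p ∈ {p | p ∈ pairs r (cXi r d) α A ∧ AST A p.1 p.2 = C}, neighborSet β φ r F L p.1 p.2 := by
  ext M
  simp only [Set.mem_iUnion, exists_prop, Set.mem_ofPred_eq]
  constructor
  · rintro ⟨hM, hMF, h1, h2, h3, h4⟩
    have hle := le_of_posMat hF hL hLF hM hMF (fun i j h => hB.far i j (Or.inr h)) h3 h1 h2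
    have hinf := fun i => (hLF i).inf hF.toIsLadder (hMF i)
    have hinfp : ∀ z, (L (z + per r) ⊓ M (z + per r)).map (φ : V →ₗ[k] V) = L z ⊓ M z := fun z => by
      rw [Submodule.map_inf _ φ.injective, hL.periodic, hM.periodic]
    obtain ⟨S, T, hSp, hTp, hmem⟩ : ∃ S T : ZMat, (∀ i j, S (i + per r) (j + per r) = S i j) ∧
        (∀ i j, T (i + per r) (j + per r) = T i j) ∧ M ∈ neighborSet β φ r F L S T :=
      ⟨_, _, grDim_periodic hF hLF hinfp hL.periodic hinf hLF fun _ => inf_le_left,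
        grDim_periodic hF hLF hinfp hM.periodic hinf hMF fun _ => inf_le_right,
        mem_neighborSet_grDim hβ hF hL hLF hM hMF hle⟩
    obtain ⟨f1, f2, f3, f4, f5, f6, f7, f8, f9⟩ := facts_of_mem_neighborSet hF hLF hL hmem
    obtain ⟨-, g2, g3, -⟩ := posMat_of_between (F := F) hL hM hle
    rw [h4, hLC] at f9
    rw [h4] at f8
    refine ⟨⟨S, T⟩, ⟨⟨⟨f1, hSp, f3⟩, ⟨f2, hTp, f4⟩, f7, fun i => ?_, fun i => ?_, ⟨f8, fun i j => ?_,
      fun i => ?_⟩, f9 ▸ hC⟩, f9⟩, hmem⟩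
    · rw [f5, ← g2, h3, hB.upper]
    · rw [f6, ← g3, h3, hB.lower]
    · have e2 := hTp (i - 1) j
      rw [show i - 1 + per r = i + per r - 1 by ring] at e2
      simp only [Matrix.add_apply, Matrix.sub_apply, rowShift, hA.2.1, hTp, e2]
    · refine ((hA.2.2 i).union ((f4 i).union (f4 (i - 1)))).subset fun j hj => ?_
      by_contra h'
      simp only [Set.mem_union, Set.mem_ofPred_eq, Function.mem_support, not_or, not_not] at h'
      refine hj ?_
      simp only [Matrix.add_apply, Matrix.sub_apply, rowShift]
      rw [h'.1, h'.2.1, h'.2.2]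
      rfl
  · rintro ⟨⟨S, T⟩, ⟨⟨hS, hT, hST, hSr, hTr, -, -⟩, hAST⟩, hM⟩
    obtain ⟨f1, f2, f3, f4, f5, f6, f7, f8, f9⟩ := facts_of_mem_neighborSet hF hLF hL hM
    have hMF : ∀ i, Comm F (M i) := fun i => (hM.2 i).comm hLF
    have hMA : posMat F M F = A := by
      have : AST (posMat F M F) S T = AST A S T := by rw [f9, hLC, hAST]
      simpa [AST] using this
    obtain ⟨g1, g2, g3, g4⟩ := posMat_of_between (F := F) hL hM.1 fun i => (hM.2 i).lower
    have e1 : ∀ i, posMat F L M i (i + 1) = B i (i + 1) := fun i => by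
      rw [g2, ← f5, hSr, hB.upper]
    have e2 : ∀ i, posMat F L M (i + 1) i = B (i + 1) i := fun i => by
      rw [g3, ← f6, hTr, hB.lower]
    refine ⟨hM.1, hMF, fun i => ⟨i + 1, ?_⟩, fun j => ⟨j - 1, (hM.2 j).lower⟩, ?_, hMA⟩
    · have := (hM.2 (i + 1)).lower
      rwa [add_sub_cancel_right] at this
    · funext i j
      by_cases h1 : j < i - 1 ∨ i + 1 < j
      · rw [g1 i j h1, hB.far i j h1]
      · obtain rfl | rfl | rfl : j = i + 1 ∨ i = j + 1 ∨ i = j := by omega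
        · exact e1 i
        · exact e2 j
        · have h2 := g4 i
          have h3 := congrFun hco i
          rw [hB.co_eq, ← hMA, ro_posMat hF hM.1 hMF] at h3
          have h4 := e1 (i - 1)
          rw [sub_add_cancel] at h4
          have h5 := e2 i
          omega

include hφ

theorem card_positionedSet [Finite k] (hφβ : ∀ x, β (φ x) x = 0)
    (hfin : {p | p ∈ pairs r (cXi r d) α A ∧ AST A p.1 p.2 = C}.Finite) :
    (positionedSet β φ r F L B A).Finite ∧ ∃ N : ZMat × ZMat → ℤ,
      (∀ p ∈ {p | p ∈ pairs r (cXi r d) α A ∧ AST A p.1 p.2 = C},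
        Window r (N p) p.1 ∧ Window r (N p) p.2 ∧ Window r (N p) C) ∧
      (Nat.card (positionedSet β φ r F L B A) : ℚ) =
        ∑ p ∈ hfin.toFinset, neighborCount (Nat.card k : ℚ) (N p) r C p.1 p.2 := by
  obtain ⟨N₀, -, hN1, hN2⟩ := exists_window hF.toIsLadder (hLF (-1)) (hLF (r + 1)) (per r)
  obtain ⟨N₁, hN₁⟩ := exists_forall_window hC.1.1
  have hN : ∀ p ∈ {p | p ∈ pairs r (cXi r d) α A ∧ AST A p.1 p.2 = C}, ∃ N : ℤ, N₀ ≤ N ∧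
      Window r N p.1 ∧ Window r N p.2 ∧ Window r N C := by
    intro p hp
    obtain ⟨N₂, hN₂⟩ := exists_forall_window hp.1.1
    obtain ⟨N₃, hN₃⟩ := exists_forall_window hp.1.2.1
    exact ⟨max (max N₀ N₁) (max N₂ N₃), by omega, hN₂ _ (by omega), hN₃ _ (by omega),
      hN₁ _ (by omega)⟩
  choose! N hN using hN
  have hcard : ∀ p ∈ {p | p ∈ pairs r (cXi r d) α A ∧ AST A p.1 p.2 = C},
      (neighborSet β φ r F L p.1 p.2).Finite ∧ (Nat.card (neighborSet β φ r F L p.1 p.2) : ℚ) =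
        neighborCount (Nat.card k : ℚ) (N p) r C p.1 p.2 := by
    intro p hp
    obtain ⟨h0, h1, h2, -⟩ := hN p hp
    obtain ⟨⟨hS, hT, hST, -⟩, -⟩ := id hp
    exact card_neighborSet hβ hφ hF hL hLF hS.2.1 hT.2.1 hST hS.1 hT.1
      (fun i => hLC ▸ hasGr_posMat i) (fun j hj => hN1 j (by omega)) (fun j hj => hN2 j (by omega))
      (fun i j hi hj => h1 i j hi (by omega)) (fun i j hi hj => h2 i j hi (by omega)) hφβ
  have heq := positionedSet_eq (φ := φ) hβ hF hL hLF hB hco hA hC hLC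
  have hdis : ((hfin.toFinset : Finset (ZMat × ZMat)) : Set (ZMat × ZMat)).PairwiseDisjoint
      fun p => neighborSet β φ r F L p.1 p.2 := by
    intro p _ p' _ hne
    refine Set.disjoint_left.2 fun M hM hM' => hne ?_
    obtain ⟨e1, e2⟩ := eq_grDim_of_mem_neighborSet hM
    obtain ⟨e3, e4⟩ := eq_grDim_of_mem_neighborSet hM'
    exact Prod.ext (e1.trans e3.symm) (e2.trans e4.symm)
  refine ⟨heq ▸ hfin.biUnion fun p hp => (hcard p hp).1, N, fun p hp => (hN p hp).2, ?_⟩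
  rw [heq]
  have e : (⋃ p ∈ {p | p ∈ pairs r (cXi r d) α A ∧ AST A p.1 p.2 = C},
      neighborSet β φ r F L p.1 p.2) = ⋃ p ∈ hfin.toFinset, neighborSet β φ r F L p.1 p.2 := by
    simp only [Set.Finite.mem_toFinset]
  rw [e, Nat.card_coe_set_eq]
  rw [ncard_biUnion_finset (fun p hp => (hcard p (hfin.mem_toFinset.1 hp)).1) hdis, Nat.cast_sum]
  refine Finset.sum_congr rfl fun p hp => ?_
  rw [← (hcard p (hfin.mem_toFinset.1 hp)).2, Nat.card_coe_set_eq]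

end Position

/-! ### Lattices as vector spaces over the residue field -/

section Bridge

variable {k : Type} [Field k] {V : Type} [AddCommGroup V] [Module k⸨X⸩ V]
  [Module k⟦X⟧ V] [IsScalarTower k⟦X⟧ k⸨X⸩ V] [Module k V] [IsScalarTower k k⟦X⟧ V]

theorem powerSeries_smul_eq (f : k⟦X⟧) (x : V) : f • x = (f : k⸨X⸩) • x :=
  (algebraMap_smul k⸨X⸩ f x).symm

theorem C_smul_eq (c : k) (x : V) : (PowerSeries.C c : k⟦X⟧) • x = c • x := by
  rw [← smul_one_smul k⟦X⟧ c x, PowerSeries.smul_eq_C_mul, mul_one]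

theorem scalar_smul_eq (c : k) (x : V) : c • x = (HahnSeries.C c : k⸨X⸩) • x := by
  rw [← C_smul_eq, powerSeries_smul_eq, PowerSeries.coe_C]

theorem X_smul_eq (x : V) :
    (PowerSeries.X : k⟦X⟧) • x = (HahnSeries.single (1 : ℤ) (1 : k) : k⸨X⸩) • x := by
  rw [powerSeries_smul_eq, PowerSeries.coe_X]

theorem C_mul_coeff (c : k) (f : k⸨X⸩) (i : ℤ) :
    ((HahnSeries.C c : k⸨X⸩) * f).coeff i = c * f.coeff i := by
  rw [HahnSeries.C_mul_eq_smul, HahnSeries.coeff_smul, smul_eq_mul]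

theorem mem_one_iff_coeff (f : k⸨X⸩) :
    f ∈ (1 : Submodule k⟦X⟧ k⸨X⸩) ↔ ∀ i < 0, f.coeff i = 0 := by
  rw [Submodule.mem_one]
  constructor
  · rintro ⟨g, rfl⟩ i hi
    exact (PowerSeries.coeff_coe g i).trans (if_pos hi)
  · intro h
    refine ⟨PowerSeries.mk fun n => f.coeff n, ?_⟩
    ext i
    refine (PowerSeries.coeff_coe _ i).trans ?_
    split_ifs with hi
    · exact (h i hi).symm
    · rw [PowerSeries.coeff_mk]
      congr 1
      omega

/-- The residue of a form over `k((ε))`, that is, its coefficient at `ε⁻¹`. -/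
noncomputable def residueForm (ω : LinearMap.BilinForm k⸨X⸩ V) : LinearMap.BilinForm k V :=
  LinearMap.mk₂ k (fun x y => (ω x y).coeff (-1))
    (fun x y z => by rw [map_add, LinearMap.add_apply, HahnSeries.coeff_add])
    (fun c x y => by
      rw [scalar_smul_eq, map_smul, LinearMap.smul_apply, smul_eq_mul, C_mul_coeff, smul_eq_mul])
    (fun x y z => by rw [map_add, HahnSeries.coeff_add])
    (fun c x y => by rw [scalar_smul_eq, map_smul, smul_eq_mul, C_mul_coeff, smul_eq_mul])

/-- Multiplication by the uniformizer. -/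
noncomputable def shiftEquiv (k V : Type) [Field k] [AddCommGroup V] [Module k⸨X⸩ V]
    [Module k⟦X⟧ V] [IsScalarTower k⟦X⟧ k⸨X⸩ V] [Module k V] [IsScalarTower k k⟦X⟧ V] : V ≃ₗ[k] V where
  toFun x := (HahnSeries.single (1 : ℤ) (1 : k) : k⸨X⸩) • x
  invFun x := (HahnSeries.single (-1 : ℤ) (1 : k) : k⸨X⸩) • x
  map_add' := smul_add _
  map_smul' c x := by simp only [scalar_smul_eq, RingHom.id_apply, smul_smul, mul_comm]
  left_inv x := by simp [smul_smul]
  right_inv x := by simp [smul_smul]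

theorem shiftEquiv_apply (x : V) : shiftEquiv k V x = (PowerSeries.X : k⟦X⟧) • x :=
  (X_smul_eq x).symm

variable (ω : LinearMap.BilinForm k⸨X⸩ V)

theorem residueForm_apply (x y : V) : residueForm ω x y = (ω x y).coeff (-1) := rfl

theorem residueForm_shiftEquiv (x y : V) :
    residueForm ω (shiftEquiv k V x) y = residueForm ω x (shiftEquiv k V y) := by
  simp only [residueForm_apply, shiftEquiv_apply, X_smul_eq, map_smul, LinearMap.smul_apply]

variable {ω}

theorem residueForm_shiftEquiv_self (hω : ω.IsAlt) (x : V) :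
    residueForm ω (shiftEquiv k V x) x = 0 := by
  simp only [residueForm_apply, shiftEquiv_apply, X_smul_eq, map_smul, LinearMap.smul_apply,
    hω.self_eq_zero, smul_zero, HahnSeries.coeff_zero]

theorem residueForm_isAlt (hω : ω.IsAlt) : (residueForm ω).IsAlt := fun x => by
  rw [residueForm_apply, hω.self_eq_zero, HahnSeries.coeff_zero]

theorem orthogonal_restrictScalars (hω : ω.IsAlt) (N : Submodule k⟦X⟧ V) :
    (residueForm ω).orthogonal (N.restrictScalars k) = (ω.dualSubmodule N).restrictScalars k := by
  ext y
  rw [Submodule.restrictScalars_mem, LinearMap.BilinForm.mem_dualSubmodule]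
  constructor
  · intro h x hx
    rw [← hω.neg_eq, Submodule.neg_mem_iff, mem_one_iff_coeff]
    intro i hi
    have h1 : residueForm ω ((PowerSeries.X ^ (-1 - i).toNat : k⟦X⟧) • x) y = 0 :=
      h _ (N.smul_mem _ hx)
    rw [residueForm_apply, powerSeries_smul_eq, map_smul, LinearMap.smul_apply, smul_eq_mul,
      PowerSeries.coe_pow, PowerSeries.coe_X, HahnSeries.single_pow, one_pow] at h1
    have h2 := HahnSeries.coeff_single_mul_add (r := (1 : k)) (x := ω x y) (a := i)
      (b := (-1 - i).toNat • (1 : ℤ))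
    rw [one_mul] at h2
    rw [← h2, ← h1]
    congr 1
    simp
    omega
  · intro h x hx
    change (ω x y).coeff (-1) = 0
    rw [← hω.neg_eq, HahnSeries.coeff_neg, (mem_one_iff_coeff _).1 (h x hx) (-1) (by norm_num),
      neg_zero]

theorem map_shiftEquiv_restrictScalars (N : Submodule k⟦X⟧ V) :
    (N.restrictScalars k).map (shiftEquiv k V : V →ₗ[k] V) =
      ((PowerSeries.X : k⟦X⟧) • N).restrictScalars k := by
  ext x
  rw [Submodule.restrictScalars_mem, Submodule.mem_smul_pointwise_iff_exists, Submodule.mem_map]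
  simp only [LinearEquiv.coe_coe, shiftEquiv_apply, Submodule.restrictScalars_mem]

theorem powerSeries_smul_eq_add (f : k⟦X⟧) (x : V) : ∃ g : k⟦X⟧,
    f • x = PowerSeries.constantCoeff f • x + (PowerSeries.X : k⟦X⟧) • g • x := by
  obtain ⟨g, hg⟩ := PowerSeries.X_dvd_iff.2
    (show PowerSeries.constantCoeff (f - PowerSeries.C (PowerSeries.constantCoeff f)) = 0 by simp)
  refine ⟨g, ?_⟩
  rw [← C_smul_eq, smul_smul, ← hg, ← add_smul]
  congr 1
  ring

theorem finRel_map_shiftEquiv {N : Submodule k⟦X⟧ V} (hN : N.FG) :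
    FinRel (N.restrictScalars k) ((N.restrictScalars k).map (shiftEquiv k V : V →ₗ[k] V)) := by
  obtain ⟨s, hs⟩ := hN
  have h : N.restrictScalars k ≤ Submodule.span k (s : Set V) ⊔
      (N.restrictScalars k).map (shiftEquiv k V : V →ₗ[k] V) := by
    intro x hx
    have hx' : x ∈ Submodule.span k⟦X⟧ (s : Set V) := hs ▸ hx
    clear hx
    induction hx' using Submodule.span_induction with
    | mem x hx => exact Submodule.mem_sup_left (Submodule.subset_span hx)
    | zero => exact zero_mem _
    | add x y _ _ h1 h2 => exact add_mem h1 h2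
    | smul f x hx h1 =>
      obtain ⟨g, hg⟩ := powerSeries_smul_eq_add f x
      rw [hg]
      refine add_mem (Submodule.smul_mem _ _ h1) (Submodule.mem_sup_right ⟨g • x, ?_, ?_⟩)
      · exact N.smul_mem _ (hs ▸ hx)
      · exact shiftEquiv_apply _
  have hfin : Module.Finite k ↥(Submodule.span k (s : Set V)) := FiniteDimensional.span_finset k s
  refine FinRel.mono_left (B := _) ?_ h
  rw [FinRel, Submodule.map_sup, Submodule.mkQ_map_self, sup_bot_eq]
  infer_instance

variable {r : ℕ}

/-- The lattices of a chain as vector spaces over `k`. -/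
noncomputable def LatticeChain.toSeq (L : LatticeChain r ω) (z : ℤ) : Submodule k V :=
  (L.L z).restrictScalars k

theorem LatticeChain.toSeq_injective : Function.Injective (LatticeChain.toSeq (r := r) (ω := ω)) := by
  intro L M h
  have : L.L = M.L := funext fun z => Submodule.restrictScalars_injective k _ _ (congrFun h z)
  cases L
  cases M
  cases this
  rfl

theorem LatticeChain.isSelfDual (hω : ω.IsAlt) (L : LatticeChain r ω) :
    IsSelfDual (residueForm ω) (shiftEquiv k V) (per r) L.toSeq where
  mono := monotone_int_of_le_succ L.mono
  periodic z := by rw [toSeq, map_shiftEquiv_restrictScalars, ← L.periodic, toSeq]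
  dual z := by rw [toSeq, orthogonal_restrictScalars hω, L.dual, toSeq]

theorem LatticeChain.isChain (hω : ω.IsAlt) (L : LatticeChain r ω) :
    IsChain (residueForm ω) (shiftEquiv k V) (per r) L.toSeq where
  toIsLadder := by
    refine ⟨(L.isSelfDual hω).mono, fun i j => ?_⟩
    have h1 : ∀ z, FinRel (L.toSeq z) (L.toSeq (z - per r)) := fun z => by
      have := finRel_map_shiftEquiv (k := k) (L.isLattice z).fg
      change FinRel (L.toSeq z) ((L.toSeq z).map _) at this
      rw [← (L.isSelfDual hω).periodic (z - per r), sub_add_cancel]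
      exact this
    have h2 : ∀ m : ℕ, FinRel (L.toSeq j) (L.toSeq (j - (m + 1 : ℕ) * per r)) := fun m => by
      induction m with
      | zero => simpa using h1 j
      | succ m ih =>
        have h3 := h1 (j - (m + 1 : ℕ) * per r)
        have e : j - (m + 1 : ℕ) * per r - per r = j - (m + 1 + 1 : ℕ) * per r := by
          push_cast
          ring
        rw [e] at h3
        refine FinRel.trans ((L.isSelfDual hω).mono ?_) ih h3
        rw [← e, per]
        omega
    refine (h2 (j - i).toNat).mono_right ((L.isSelfDual hω).mono ?_)
    have h3 : (0 : ℤ) ≤ (j - i).toNat := by omega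
    have h4 : j - i ≤ (j - i).toNat := by omega
    rw [per]
    push_cast
    nlinarith
  periodic := (L.isSelfDual hω).periodic
  dual := (L.isSelfDual hω).dual

theorem LatticeChain.exists_eq_X_pow_smul (L : LatticeChain r ω) {m : ℕ} {z : ℤ} {x : V}
    (hx : x ∈ L.L (z - m * per r)) : ∃ y ∈ L.L z, x = (PowerSeries.X ^ m : k⟦X⟧) • y := by
  induction m generalizing x with
  | zero => exact ⟨x, by simpa using hx, by simp⟩
  | succ m ih =>
    rw [L.periodic, show z - (m + 1 : ℕ) * per r + per r = z - m * per r by push_cast; ring] at hx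
    obtain ⟨y, hy, rfl⟩ := Submodule.mem_smul_pointwise_iff_exists _ _ _ |>.1 hx
    obtain ⟨y', hy', rfl⟩ := ih hy
    exact ⟨y', hy', by rw [pow_succ', mul_smul]⟩

theorem mem_of_X_pow_smul_mem (L : LatticeChain r ω) {m : ℕ} {z : ℤ} {x : V}
    (hx : (PowerSeries.X ^ m : k⟦X⟧) • x ∈ L.L z) : x ∈ L.L (z + m * per r) := by
  induction m generalizing z with
  | zero => simpa using hx
  | succ m ih =>
    rw [L.periodic, pow_succ', mul_smul] at hx
    obtain ⟨y, hy, hxy⟩ := Submodule.mem_smul_pointwise_iff_exists _ _ _ |>.1 hx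
    rw [← shiftEquiv_apply, ← shiftEquiv_apply] at hxy
    rw [(shiftEquiv k V).injective hxy] at hy
    have := ih hy
    rwa [show z + per r + m * per r = z + (m + 1 : ℕ) * per r by push_cast; ring] at this

theorem exists_X_pow_smul_mem {N : Submodule k⟦X⟧ V} (hN : Submodule.IsLattice k⸨X⸩ N) (x : V) :
    ∃ m₀ : ℕ, ∀ m, m₀ ≤ m → (PowerSeries.X ^ m : k⟦X⟧) • x ∈ N := by
  have hx : x ∈ Submodule.span k⸨X⸩ (N : Set V) := hN.span_eq_top ▸ Submodule.mem_top
  have up : ∀ {x : V} {m₀ : ℕ}, (PowerSeries.X ^ m₀ : k⟦X⟧) • x ∈ N →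
      ∀ m, m₀ ≤ m → (PowerSeries.X ^ m : k⟦X⟧) • x ∈ N := fun h m hm => by
    rw [← Nat.sub_add_cancel hm, pow_add, mul_smul]
    exact N.smul_mem _ h
  induction hx using Submodule.span_induction with
  | mem x hx => exact ⟨0, up (by simpa using hx)⟩
  | zero => exact ⟨0, up (by simp)⟩
  | add x y _ _ h1 h2 =>
    obtain ⟨a, ha⟩ := h1
    obtain ⟨b, hb⟩ := h2
    refine ⟨max a b, fun m hm => ?_⟩
    rw [smul_add]
    exact N.add_mem (ha m (by omega)) (hb m (by omega))
  | smul f x _ h =>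
    obtain ⟨a, ha⟩ := h
    refine ⟨a + (-f.order).toNat, up ?_⟩
    have hc : ∃ c : k⟦X⟧, (PowerSeries.X ^ (-f.order).toNat : k⟦X⟧) • f • x = c • x := by
      refine ⟨PowerSeries.X ^ f.order.toNat * f.powerSeriesPart, ?_⟩
      have hf := LaurentSeries.single_order_mul_powerSeriesPart f
      generalize f.order = o, f.powerSeriesPart = p at hf ⊢
      have e : (-o).toNat • (1 : ℤ) + o = o.toNat • 1 := by
        rw [nsmul_eq_mul, nsmul_eq_mul, mul_one, mul_one]
        omega
      rw [← hf, powerSeries_smul_eq, powerSeries_smul_eq, smul_smul, PowerSeries.coe_mul,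
        PowerSeries.coe_pow, PowerSeries.coe_pow, PowerSeries.coe_X, HahnSeries.single_pow,
        HahnSeries.single_pow, ← mul_assoc, HahnSeries.single_mul_single, e, one_pow, one_pow, one_mul]
    obtain ⟨c, hc⟩ := hc
    rw [pow_add, mul_smul, hc, smul_comm]
    exact N.smul_mem _ (ha a le_rfl)

theorem LatticeChain.exists_le (L M : LatticeChain r ω) (i j : ℤ) :
    ∃ m : ℕ, L.toSeq i ≤ M.toSeq (j + m * per r) := by
  obtain ⟨s, hs⟩ := (L.isLattice i).fg
  choose m hm using exists_X_pow_smul_mem (M.isLattice j)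
  refine ⟨s.sup m, ?_⟩
  change L.L i ≤ M.L _
  rw [← hs, Submodule.span_le]
  exact fun x hx => mem_of_X_pow_smul_mem M (hm x _ (Finset.le_sup hx))

theorem LatticeChain.exists_ge (L M : LatticeChain r ω) (i j : ℤ) :
    ∃ m : ℕ, L.toSeq (i - m * per r) ≤ M.toSeq j := by
  obtain ⟨s, hs⟩ := (L.isLattice i).fg
  choose m hm using exists_X_pow_smul_mem (M.isLattice j)
  refine ⟨s.sup m, fun x hx => ?_⟩
  obtain ⟨y, hy, rfl⟩ := L.exists_eq_X_pow_smul hx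
  have h : L.L i ≤ (M.L j).comap (LinearMap.lsmul k⟦X⟧ V (PowerSeries.X ^ s.sup m)) := by
    rw [← hs, Submodule.span_le]
    exact fun x hx => hm x _ (Finset.le_sup hx)
  exact h hy

theorem LatticeChain.comm (L M : LatticeChain r ω) (i : ℤ) : Comm M.toSeq (L.toSeq i) := by
  obtain ⟨m, hm⟩ := M.exists_ge L 0 i
  obtain ⟨m', hm'⟩ := L.exists_le M i 0
  exact ⟨_, _, hm, hm'⟩

theorem finrank_quotient_restrictScalars (A B : Submodule k⟦X⟧ V) :
    finrank k (A ⧸ B.submoduleOf A) = rd (A.restrictScalars k) (B.restrictScalars k) := by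
  rw [rd_eq_finrank_quotient]
  exact (Submodule.Quotient.restrictScalarsEquiv k (B.submoduleOf A)).symm.finrank_eq

theorem relPos_eq_posMat (hω : ω.IsAlt) (L M N : LatticeChain r ω) :
    relPos L M = posMat N.toSeq L.toSeq M.toSeq := by
  have hN := (N.isChain hω).toIsLadder
  have hc : ∀ i j, Comm N.toSeq (L.toSeq i ⊓ M.toSeq j) := fun i j => (L.comm N i).inf hN (M.comm N j)
  funext i j
  have h1 := (L.isSelfDual hω).mono (show i - 1 ≤ i by omega)
  have h2 := (M.isSelfDual hω).mono (show j - 1 ≤ j by omega)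
  have h3 := idx_sup_add_idx_inf hN (hc (i - 1) j) (hc i (j - 1))
  have h4 := idx_sub hN ((hc (i - 1) j).sup hN (hc i (j - 1))) (hc i j)
    (sup_le (inf_le_inf_right _ h1) (inf_le_inf_left _ h2))
  rw [inf_inf_inf_comm, inf_eq_left.2 h1, inf_eq_right.2 h2] at h3
  rw [relPos, finrank_quotient_restrictScalars, posMat]
  have e : ((L.L (i - 1) ⊓ M.L j) ⊔ (L.L i ⊓ M.L (j - 1))).restrictScalars k =
      (L.toSeq (i - 1) ⊓ M.toSeq j) ⊔ (L.toSeq i ⊓ M.toSeq (j - 1)) := by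
    rw [Submodule.restrictScalars_sup]
    rfl
  rw [e]
  change (rd (L.toSeq i ⊓ M.toSeq j) _ : ℤ) = _
  omega

theorem exists_toSeq_eq (hω : ω.IsAlt) {L L' : LatticeChain r ω} {B : ZMat} {α : ℤ → ℕ}
    (hB : IsTridiagonal α B) {M : ℤ → Submodule k V}
    (hM : IsSelfDual (residueForm ω) (shiftEquiv k V) (per r) M) (hMF : ∀ i, Comm L'.toSeq (M i))
    (h1 : ∀ i, ∃ j, L.toSeq i ≤ M j) (h2 : ∀ j, ∃ i, L.toSeq i ≤ M j)
    (h3 : posMat L'.toSeq L.toSeq M = B) : ∃ M' : LatticeChain r ω, M'.toSeq = M := by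
  have hlow := le_of_posMat (L'.isChain hω) (L.isSelfDual hω) (fun i => L.comm L' i) hM hMF
    (fun i j h => hB.far i j (Or.inr h)) h3 h1 h2
  have hup := le_succ_of_le (L.isSelfDual hω) hM hlow
  have hX : ∀ i x, x ∈ M i → ∀ g : k⟦X⟧, (PowerSeries.X : k⟦X⟧) • g • x ∈ M i := by
    intro i x hx g
    have h4 : g • x ∈ L.L (i + 1) := (L.L (i + 1)).smul_mem g (hup i hx)
    have h5 : (PowerSeries.X : k⟦X⟧) • g • x ∈ L.L (i + 1 - per r) := by
      rw [L.periodic, sub_add_cancel]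
      exact Submodule.smul_mem_pointwise_smul _ _ _ h4
    exact hlow i ((L.isSelfDual hω).mono (by rw [per]; omega) h5)
  let N : ℤ → Submodule k⟦X⟧ V := fun i =>
    { M i with
      smul_mem' := fun f x hx => by
        obtain ⟨g, hg⟩ := powerSeries_smul_eq_add f x
        rw [hg]
        exact (M i).add_mem ((M i).smul_mem _ hx) (hX i x hx g) }
  have hN : ∀ i, (N i).restrictScalars k = M i := fun i => rfl
  have hNL : ∀ i, L.L (i - 1) ≤ N i := hlow
  have hLN : ∀ i, N i ≤ L.L (i + 1) := hup
  refine ⟨⟨N, fun z => ?_, fun z => hM.mono (by omega), fun z => ?_, fun z => ?_⟩, funext hN⟩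
  · have := L.isLattice (z - 1)
    exact Submodule.IsLattice.of_le_of_isLattice_of_fg _ (hNL z)
      (Submodule.FG.of_le (L.isLattice (z + 1)).fg (hLN z))
  · refine Submodule.restrictScalars_injective k _ _ ?_
    rw [← map_shiftEquiv_restrictScalars, hN, hN, hM.periodic]
  · refine Submodule.restrictScalars_injective k _ _ ?_
    rw [← orthogonal_restrictScalars hω, hN, hN, hM.dual]

theorem image_toSeq_eq (hω : ω.IsAlt) (L L' : LatticeChain r ω) {A B : ZMat} {α : ℤ → ℕ}
    (hB : IsTridiagonal α B) :
    LatticeChain.toSeq '' {M : LatticeChain r ω | relPos L M = B ∧ relPos M L' = A} =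
      positionedSet (residueForm ω) (shiftEquiv k V) r L'.toSeq L.toSeq B A := by
  ext M
  constructor
  · rintro ⟨M, ⟨h1, h2⟩, rfl⟩
    refine ⟨M.isSelfDual hω, fun i => M.comm L' i, fun i => ?_, fun j => ?_, ?_, ?_⟩
    · exact ⟨_, (L.exists_le M i 0).choose_spec⟩
    · exact ⟨_, (L.exists_ge M 0 j).choose_spec⟩
    · rw [← relPos_eq_posMat hω, h1]
    · rw [← relPos_eq_posMat hω, h2]
  · rintro ⟨h1, h2, h3, h4, h5, h6⟩
    obtain ⟨M, rfl⟩ := exists_toSeq_eq hω hB h1 h2 h3 h4 h5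
    refine ⟨M, ⟨?_, ?_⟩, rfl⟩
    · rw [relPos_eq_posMat hω L M L', h5]
    · rw [relPos_eq_posMat hω M L' L', h6]

theorem ncard_relPos [Finite k] {d : ℕ} (hω : ω.IsAlt) (L L' : LatticeChain r ω) {A B C : ZMat}
    {α : ℤ → ℕ} (hB : IsTridiagonal α B) (hco : co B = ro A) (hA : A ∈ Theta r) (hC : C ∈ cXi r d)
    (hLC : relPos L L' = C)
    (hfin : {p | p ∈ pairs r (cXi r d) α A ∧ AST A p.1 p.2 = C}.Finite) :
    {M : LatticeChain r ω | relPos L M = B ∧ relPos M L' = A}.Finite ∧ ∃ N : ZMat × ZMat → ℤ,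
      (∀ p ∈ {p | p ∈ pairs r (cXi r d) α A ∧ AST A p.1 p.2 = C},
        Window r (N p) p.1 ∧ Window r (N p) p.2 ∧ Window r (N p) C) ∧
      (Set.ncard {M : LatticeChain r ω | relPos L M = B ∧ relPos M L' = A} : ℚ) =
        ∑ p ∈ hfin.toFinset, neighborCount (Nat.card k : ℚ) (N p) r C p.1 p.2 := by
  have h := card_positionedSet (residueForm_isAlt hω) (residueForm_shiftEquiv ω) (L'.isChain hω)
    (L.isSelfDual hω) (fun i => L.comm L' i) hB hco hA hC
    (by rw [← relPos_eq_posMat hω, hLC]) (residueForm_shiftEquiv_self hω) hfin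
  rw [← image_toSeq_eq hω L L' hB, Nat.card_coe_set_eq,
    Set.ncard_image_of_injective _ LatticeChain.toSeq_injective] at h
  exact ⟨h.1.of_finite_image LatticeChain.toSeq_injective.injOn, h.2⟩

end Bridge

/-! ### The coefficients as counting polynomials -/

section Reindex

@[to_additive]
theorem prod_Icc_zero_eq {M : Type*} [CommMonoid M] (r : ℕ) (g : ℤ → M) :
    ∏ i ∈ Finset.Icc (0 : ℤ) r, g i = ∏ i ∈ Finset.range (r + 1), g i :=
  Finset.prod_nbij' Int.toNat (fun i => (i : ℤ)) (by intro i; simp only [Finset.mem_Icc, Finset.mem_range]; omega)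
    (by intro i; simp only [Finset.mem_Icc, Finset.mem_range]; omega)
    (by intro i; rw [Finset.mem_Icc]; omega)
    (by intro i; rw [Finset.mem_range]; omega) (fun i hi => by rw [Int.toNat_of_nonneg (Finset.mem_Icc.1 hi).1])

@[to_additive]
theorem prod_Icc_neg_eq {M : Type*} [CommMonoid M] (r : ℕ) (g : ℤ → M) :
    ∏ i ∈ Finset.Icc (-(r : ℤ)) (-1), g i = ∏ i ∈ Finset.range r, g (-((i : ℤ) + 1)) :=
  Finset.prod_nbij' (fun i => (-i - 1).toNat) (fun i => -((i : ℤ) + 1))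
    (by intro i; simp only [Finset.mem_Icc, Finset.mem_range]; omega)
    (by intro i; simp only [Finset.mem_Icc, Finset.mem_range]; omega)
    (by intro i; rw [Finset.mem_Icc]; omega)
    (by intro i; rw [Finset.mem_range]; omega) (fun i hi => by
      have := Finset.mem_Icc.1 hi
      congr 1
      omega)

@[to_additive]
theorem prod_Icc_rows {M : Type*} [CommMonoid M] (r : ℕ) (g : ℤ → M) :
    ∏ i ∈ Finset.Icc (-(r : ℤ) - 1) 0, g i =
      g (-(r : ℤ) - 1) * (∏ i ∈ Finset.range r, g (-((i : ℤ) + 1))) * g 0 := by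
  have e : Finset.Icc (-(r : ℤ) - 1) 0 = insert (-(r : ℤ) - 1) (insert 0 (Finset.Icc (-(r : ℤ)) (-1))) := by
    ext i
    simp only [Finset.mem_Icc, Finset.mem_insert]
    omega
  rw [e, Finset.prod_insert (by simp; omega), Finset.prod_insert (by simp), prod_Icc_neg_eq,
    mul_assoc, mul_comm (g 0)]

theorem sum_Icc_all_rows (r : ℕ) (g : ℤ → ℤ) : ∑ i ∈ Finset.Icc (-(r : ℤ) - 1) r, g i =
    g (-(r : ℤ) - 1) + g 0 + ∑ i ∈ Finset.range r, (g (-((i : ℤ) + 1)) + g ((i : ℤ) + 1)) := by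
  have e : Finset.Icc (-(r : ℤ) - 1) r = Finset.Icc (-(r : ℤ) - 1) 0 ∪ (Finset.Icc 0 (r : ℤ)).erase 0 := by
    ext i
    simp only [Finset.mem_Icc, Finset.mem_union, Finset.mem_erase]
    omega
  have h := Finset.add_sum_erase (Finset.Icc 0 (r : ℤ)) g (a := 0) (by simp)
  rw [sum_Icc_zero_eq, Finset.sum_range_succ'] at h
  push_cast at h
  rw [e, Finset.sum_union, sum_Icc_rows, Finset.sum_add_distrib]
  · linarith
  · rw [Finset.disjoint_left]
    intro i hi hi'
    rw [Finset.mem_erase, Finset.mem_Icc] at hi'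
    rw [Finset.mem_Icc] at hi
    omega

theorem finsum_cond_pair_eq {N : ℤ} (e e' : ℤ ≃ ℤ) {f : ℤ → ℤ → ℤ} (P : ℤ → ℤ → Prop)
    [∀ l j, Decidable (P l j)]
    (h : ∀ j l, j ∉ Finset.Icc (-N) N ∨ l ∉ Finset.Icc (-N) N → f (e j) (e' l) = 0) :
    ∑ᶠ (j : ℤ) (l : ℤ) (_ : P l j), f j l = ∑ j ∈ Finset.Icc (-N) N, ∑ l ∈ Finset.Icc (-N) N,
      if P (e' l) (e j) then f (e j) (e' l) else 0 := by
  rw [← finsum_comp_equiv e]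
  have h1 : ∀ j, ∑ᶠ (l : ℤ) (_ : P l (e j)), f (e j) l =
      ∑ l ∈ Finset.Icc (-N) N, if P (e' l) (e j) then f (e j) (e' l) else 0 := fun j => by
    rw [← finsum_comp_equiv e']
    exact finsum_cond_eq_sum_Icc (fun l hl => h j l (Or.inr hl)) (fun l => P (e' l) (e j))
  simp only [h1]
  refine finsum_eq_sum_Icc fun j hj => Finset.sum_eq_zero fun l _ => ?_
  rw [h j l (Or.inl hj), ite_self]

end Reindex

section Rows

variable {N c : ℤ} {a s s' t : ℤ → ℤ} {u : ℤ → ℕ}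

/-- The exponent of `isotropicCount` from the entries of the rows `-c` and `c`. -/
theorem isotropicExp_eq (ha0 : ∀ j, j ∉ Finset.Icc (-N) N → a j = 0)
    (hu0 : ∀ j, j ∉ Finset.Icc (-N) N → u j = 0) (ha : ∀ j, t (-j - c) = a j)
    (hs : ∀ j, s (-j - c) = u j) (hs' : ∀ j, s' (-(j - c)) = u j) :
    (∑ᶠ (j : ℤ) (l : ℤ) (_ : l < j), (t j - s j) * s l) -
      (∑ᶠ (j : ℤ) (l : ℤ) (_ : l < j ∧ j < 2 * (-c) - l), s' (-j) * s l) -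
      (∑ᶠ (j : ℤ) (_ : j < -c), s j * (s j - 1) / 2) = isotropicExp N a u := by
  let e : ℤ ≃ ℤ := (Equiv.neg ℤ).trans (Equiv.subRight c)
  have he : ∀ j, e j = -j - c := fun j => rfl
  have he' : ∀ j, Equiv.subRight c j = j - c := fun j => rfl
  rw [isotropicExp]
  congr 1
  · congr 1
    · rw [finsum_cond_pair_eq (N := N) e e, Finset.sum_comm, pairSum]
      · refine Finset.sum_congr rfl fun j _ => Finset.sum_congr rfl fun l _ => if_congr ?_ ?_ rfl
        · rw [he, he]
          omega
        · rw [he, he, ha, hs, hs]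
          rfl
      · intro j l h
        rw [he, he, ha, hs, hs]
        rcases h with h | h
        · rw [ha0 j h, hu0 j h]
          simp
        · rw [hu0 l h]
          simp
    · rw [finsum_cond_pair_eq (N := N) (Equiv.subRight c) e, Finset.sum_comm, pairSum]
      · refine Finset.sum_congr rfl fun j _ => Finset.sum_congr rfl fun l _ => if_congr ?_ ?_ rfl
        · rw [he, he', abs_lt]
          omega
        · rw [he, he', hs, hs']
      · intro j l h
        rw [he, he', hs, hs']
        rcases h with h | h
        · rw [hu0 j h]
          simp
        · rw [hu0 l h]
          simp
  · rw [← finsum_comp_equiv e]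
    simp only [he, hs]
    rw [finsum_cond_eq_sum_Icc (N := N) fun j hj => by rw [hu0 j hj]; rfl, ← Finset.sum_filter]
    refine Finset.sum_congr ?_ fun _ _ => rfl
    ext j
    simp only [Finset.mem_filter, Finset.mem_Icc]
    omega

theorem gaussBinom_swap {K : Type*} [Field K] {x : K} (hx : ∀ m : ℕ, x ^ (m + 1) ≠ 1) {a : ℤ}
    (ha : 0 ≤ a) (b c : ℕ) : gaussBinom x a b * gaussBinom x (a - b) c =
      gaussBinom x a c * gaussBinom x (a - c) b := by
  by_cases h : a < b + c
  · rw [gaussBinom_mul_gaussBinom_eq_zero ha h, gaussBinom_mul_gaussBinom_eq_zero ha (by omega)]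
  obtain ⟨a, rfl⟩ := Int.eq_ofNat_of_zero_le ha
  rw [← Nat.cast_sub (by omega), ← Nat.cast_sub (by omega)]
  have h1 := gaussBinom_mul_powFact hx (show b ≤ a by omega)
  have h2 := gaussBinom_mul_powFact hx (show c ≤ a - b by omega)
  have h3 := gaussBinom_mul_powFact hx (show c ≤ a by omega)
  have h4 := gaussBinom_mul_powFact hx (show b ≤ a - c by omega)
  rw [show a - b - c = a - c - b by omega] at h2
  have n1 := powFact_ne_zero hx b
  have n2 := powFact_ne_zero hx c
  have n3 := powFact_ne_zero hx (a - c - b)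
  refine mul_right_cancel₀ (mul_ne_zero (mul_ne_zero n1 n2) n3) ?_
  calc _ = gaussBinom x a b * (powFact x b * (gaussBinom x ↑(a - b) c *
        (powFact x c * powFact x (a - c - b)))) := by ring
    _ = gaussBinom x a c * (powFact x c * (gaussBinom x ↑(a - c) b *
        (powFact x b * powFact x (a - c - b)))) := by rw [h2, h4, h1, h3]
    _ = _ := by ring

theorem qint_div_qint (a : ℤ) (m : ℕ) : qint a / qint (m + 1) =
    ((v ^ 2) ^ a - 1) / ((v ^ 2) ^ (m + 1) - 1) := by
  have h := v_sq_sub_one_ne_zero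
  rw [qint_eq, qint_eq, div_div_div_cancel_right₀ h]
  norm_cast

theorem finprod_cond_eq_prod {e : ℤ ≃ ℤ} {P : ℤ → Prop} [DecidablePred P] {f g : ℤ → Qv}
    (hP : ∀ j, P (e j) ↔ 1 ≤ j) (hf : ∀ j, 1 ≤ j → f (e j) = g j) (hg : ∀ j, N < j → g j = 1) :
    (∏ᶠ j, if P j then f j else 1) = ∏ j ∈ Finset.Icc 1 N, g j := by
  rw [← finprod_comp_equiv e, finprod_eq_prod_of_mulSupport_subset (s := Finset.Icc 1 N)]
  · refine Finset.prod_congr rfl fun j hj => ?_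
    have := (Finset.mem_Icc.1 hj).1
    rw [if_pos ((hP j).2 this), hf j this]
  · intro j hj
    by_contra h'
    refine hj ?_
    dsimp only
    split_ifs with h
    · rw [Finset.coe_Icc, Set.mem_Icc] at h'
      rw [hP] at h
      rw [hf j h, hg j (by omega)]
    · rfl

theorem pairSum_eq_finsum {p q : ℤ → ℤ} (hp : ∀ j, j ∉ Finset.Icc (-N) N → p j = 0)
    (hq : ∀ j, j ∉ Finset.Icc (-N) N → q j = 0) :
    pairSum (· < ·) N p q = ∑ᶠ (j : ℤ) (l : ℤ) (_ : l < j), q j * p l := by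
  rw [finsum_cond_pair_eq (N := N) (Equiv.refl ℤ) (Equiv.refl ℤ), pairSum]
  · refine Finset.sum_congr rfl fun j _ => Finset.sum_congr rfl fun l _ => if_congr Iff.rfl ?_ rfl
    exact mul_comm _ _
  · rintro j l (h | h)
    · exact mul_eq_zero_of_left (hq j h) _
    · exact mul_eq_zero_of_right _ (hp l h)

theorem pairSum_eq_finsum_neg {p q p' q' : ℤ → ℤ} (hp : ∀ j, j ∉ Finset.Icc (-N) N → p j = 0)
    (hq : ∀ j, j ∉ Finset.Icc (-N) N → q j = 0) (hpp : ∀ j, p' (-j) = p j)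
    (hqq : ∀ j, q' (-j) = q j) :
    pairSum (· < ·) N p q = ∑ᶠ (j : ℤ) (l : ℤ) (_ : l < j), p' j * q' l := by
  rw [finsum_cond_pair_eq (N := N) (Equiv.neg ℤ) (Equiv.neg ℤ), Finset.sum_comm, pairSum]
  · refine Finset.sum_congr rfl fun j _ => Finset.sum_congr rfl fun l _ => if_congr ?_ ?_ rfl
    · simp
    · simp only [Equiv.neg_apply, hpp, hqq]
  · intro j l h
    simp only [Equiv.neg_apply, hpp, hqq]
    rcases h with h | h
    · exact mul_eq_zero_of_left (hp j h) _
    · exact mul_eq_zero_of_right _ (hq l h)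

end Rows

section Matching

variable {r d : ℕ} {N : ℤ} {C S T : ZMat}

open Classical in
theorem finprod_mem_J_eq {f : ℤ → ℤ → Qv} (hf : ∀ i j, -(r : ℤ) - 1 ≤ i → i ≤ 0 →
    j ∉ Finset.Icc (-N) N → f i j = 1) :
    ∏ᶠ p ∈ J r, f p.1 p.2 =
      ∏ i ∈ Finset.Icc (-(r : ℤ) - 1) 0, ∏ᶠ j, if (i, j) ∈ J r then f i j else 1 := by
  have hJ : ∀ p ∈ J r, -(r : ℤ) - 1 ≤ p.1 ∧ p.1 ≤ 0 := by
    rintro p (⟨h1, h2⟩ | ⟨h1, h2⟩ | ⟨h1, h2⟩) <;> omega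
  have hsub : (Function.mulSupport fun p : ℤ × ℤ => if p ∈ J r then f p.1 p.2 else 1) ⊆
      (Finset.Icc (-(r : ℤ) - 1) 0 ×ˢ Finset.Icc (-N) N : Finset (ℤ × ℤ)) := by
    intro p hp
    by_contra h'
    refine hp ?_
    dsimp only
    split_ifs with h
    · refine hf _ _ (hJ p h).1 (hJ p h).2 fun h2 => h' ?_
      exact Finset.mem_coe.2 (Finset.mem_product.2 ⟨Finset.mem_Icc.2 (hJ p h), h2⟩)
    · rfl
  rw [finprod_congr fun p => finprod_eq_if (p := p ∈ J r), finprod_eq_prod_of_mulSupport_subset _ hsub,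
    Finset.prod_product]
  refine Finset.prod_congr rfl fun i hi => ?_
  rw [finprod_eq_prod_Icc (N := N)]
  intro j hj
  rw [Finset.mem_Icc] at hi
  split_ifs
  · exact hf i j hi.1 hi.2 hj
  · rfl

theorem cXi.neg_neg (hC : C ∈ cXi r d) (i j : ℤ) : C (-i) (-j) = C i j := (hC.2.1 i j).symm

variable (hC : C ∈ cXi r d) (hS : S ∈ Theta r) (hT : T ∈ Theta r)
  (hNS : Window r N S) (hNT : Window r N T) (hNC : Window r N C)

include hT hNS hNT in
theorem nST_eq : nST r S T = ∏ i ∈ Finset.range (r + 1), complementCount (v ^ 2) N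
    (fun j => (S i j).toNat) (fun j => (T i j).toNat) (fun j => (S (-i - 1) (-j)).toNat) := by
  rw [nST, prod_Icc_zero_eq]
  refine Finset.prod_congr rfl fun i hi => ?_
  have hi' := Finset.mem_range.1 hi
  have hp : per r = 2 * (r : ℤ) + 2 := rfl
  refine nPoly_eq_complementCount ?_ ?_ ?_ <;> intro l hl <;> rw [Finset.mem_Icc] at hl
  · rw [hNS i l (by omega) (by omega) (by omega)]
    rfl
  · rw [hNT i l (by omega) (by omega) (by omega)]
    rfl
  · rw [hNS (-i - 1) (-l) (by omega) (by omega) (by omega)]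
    rfl

/-- The part of `bracketC` belonging to the row `i`. -/
noncomputable def rowBracket (r : ℕ) (C S : ZMat) (i : ℤ) : Qv :=
  open Classical in ∏ᶠ j, if (i, j) ∈ J r then qbinom (C i j) (S i j).toNat *
    qbinom (C i j - S i j) (S (-i) (-j)).toNat else 1

/-- The part of `xiC` belonging to the row `i`. -/
noncomputable def rowExp (C S : ZMat) (i : ℤ) : ℤ :=
  ∑ᶠ (j : ℤ) (l : ℤ) (_ : l < j), (C i j - S i j) * S i l

include hC hS hNS hNC in
theorem step_row_eq {i : ℕ} (hi : i ∈ Finset.range r) :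
    (v ^ 2) ^ (rowExp C S (-((i : ℤ) + 1)) + rowExp C S ((i : ℤ) + 1) -
      ∑ᶠ (j : ℤ) (l : ℤ) (_ : l < j), S ((i : ℤ) + 1) (-j) * S (-((i : ℤ) + 1)) l) *
      rowBracket r C S (-((i : ℤ) + 1)) =
    stepCount (v ^ 2) N (C ((i : ℤ) + 1)) (fun j => (S (-((i : ℤ) + 1)) (-j)).toNat)
      (fun j => (S ((i : ℤ) + 1) j).toNat) := by
  have hi' := Finset.mem_range.1 hi
  have hp : per r = 2 * (r : ℤ) + 2 := rfl
  generalize hκ : (i : ℤ) + 1 = κ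
  have hs : toZ (fun j => (S κ j).toNat) = S κ := funext fun j => Int.toNat_of_nonneg (hS.1 _ _)
  have hs' : toZ (fun j => (S (-κ) (-j)).toNat) = fun j => S (-κ) (-j) :=
    funext fun j => Int.toNat_of_nonneg (hS.1 _ _)
  have s0 : ∀ j, j ∉ Finset.Icc (-N) N → S κ j = 0 := fun j hj => by
    rw [Finset.mem_Icc] at hj
    exact hNS _ _ (by omega) (by omega) (by omega)
  have s0' : ∀ j, j ∉ Finset.Icc (-N) N → S (-κ) (-j) = 0 := fun j hj => by
    rw [Finset.mem_Icc] at hj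
    exact hNS _ _ (by omega) (by omega) (by omega)
  have c0 : ∀ j, j ∉ Finset.Icc (-N) N → C κ j = 0 := fun j hj => by
    rw [Finset.mem_Icc] at hj
    exact hNC _ _ (by omega) (by omega) (by omega)
  rw [stepCount, mul_comm, hs, hs', rowBracket]
  congr 1
  · rw [← finprod_comp_equiv (Equiv.neg ℤ), finprod_eq_prod_Icc (N := N)]
    · refine Finset.prod_congr rfl fun j _ => ?_
      have hm : (-κ, -j) ∈ J r := Or.inr (Or.inl ⟨by dsimp only; omega, by dsimp only; omega⟩)
      rw [Equiv.neg_apply, if_pos hm, qbinom_eq_gaussBinom,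
        qbinom_eq_gaussBinom, cXi.neg_neg hC, neg_neg, neg_neg, Int.toNat_of_nonneg (hS.1 _ _)]
    · intro j hj
      split_ifs
      · rw [Equiv.neg_apply, s0' j hj, neg_neg, neg_neg, s0 j hj]
        simp [qbinom]
      · rfl
  · congr 1
    have e1 := pairSum_add_right (P := (· < ·)) (N := N) (S κ) (C κ - (fun j => S (-κ) (-j)) - S κ)
      (fun j => S (-κ) (-j))
    rw [show C κ - (fun j => S (-κ) (-j)) - S κ + (fun j => S (-κ) (-j)) = C κ - S κ by abel,
      pairSum_eq_finsum s0 (fun j hj => by rw [Pi.sub_apply, c0 j hj, s0 j hj, sub_zero]),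
      pairSum_eq_finsum_neg (p := S κ) (p' := fun j => S κ (-j)) (q' := S (-κ)) s0 s0'
        (fun j => congrArg (S κ) (neg_neg j)) (fun _ => rfl)] at e1
    rw [pairSum_eq_finsum_neg (p' := fun j => C (-κ) j - S (-κ) j) (q' := S (-κ)) _ s0'
      (fun j => by rw [cXi.neg_neg hC]; rfl) (fun _ => rfl)]
    · simp only [rowExp]
      simp only [Pi.sub_apply] at e1
      linarith
    · exact fun j hj => by rw [Pi.sub_apply, c0 j hj, s0' j hj, sub_zero]

include hS in
theorem Theta.apply_center (j : ℤ) :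
    S ((r : ℤ) + 1) (-(j - (r + 1))) = S (-((r : ℤ) + 1)) (-(j + (r + 1))) := by
  rw [← hS.2.1 (-((r : ℤ) + 1)), per]
  congr 1 <;> ring

include hC hS hNS hNC in
theorem row_exp_eq {c : ℤ} (hc : c = 0 ∨ c = r + 1) :
    rowExp C S (-c) - (∑ᶠ (j : ℤ) (l : ℤ) (_ : l < j ∧ j < 2 * (-c) - l), S c (-j) * S (-c) l) -
      (∑ᶠ (j : ℤ) (_ : j < -c), S (-c) j * (S (-c) j - 1) / 2) =
    isotropicExp N (fun j => C c (j + c)) (fun j => (S (-c) (-(j + c))).toNat) := by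
  have hp : per r = 2 * (r : ℤ) + 2 := rfl
  refine isotropicExp_eq (fun j hj => ?_) (fun j hj => ?_) (fun j => ?_) (fun j => ?_) fun j => ?_
  · rw [Finset.mem_Icc] at hj
    exact hNC _ _ (by omega) (by omega) (by omega)
  · rw [Finset.mem_Icc] at hj
    rw [hNS _ _ (by omega) (by omega) (by omega)]
    rfl
  · rw [← cXi.neg_neg hC c]
    congr 1
    ring
  · rw [Int.toNat_of_nonneg (hS.1 _ _)]
    congr 1
    ring
  · rw [Int.toNat_of_nonneg (hS.1 _ _)]
    rcases hc with rfl | rfl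
    · simp
    · exact Theta.apply_center hS j

include hC hS hNS hNC in
open Classical in
theorem row_bracket_eq {c : ℤ} (hc : c = 0 ∨ c = r + 1) :
    rowBracket r C S (-c) = ∏ j ∈ Finset.Icc 1 N,
      gaussBinom (v ^ 2) (C c (j + c)) (S (-c) (-(j + c))).toNat *
      gaussBinom (v ^ 2) (C c (j + c) - (S (-c) (-(j + c))).toNat) (S (-c) (-(-j + c))).toNat := by
  have hp : per r = 2 * (r : ℤ) + 2 := rfl
  have h0 : ∀ j, N < j → gaussBinom (v ^ 2) (C c (j + c)) (S (-c) (-(j + c))).toNat *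
      gaussBinom (v ^ 2) (C c (j + c) - (S (-c) (-(j + c))).toNat) (S (-c) (-(-j + c))).toNat = 1 := by
    intro j hj
    rw [hNS (-c) (-(j + c)) (by omega) (by omega) (by omega),
      hNS (-c) (-(-j + c)) (by omega) (by omega) (by omega)]
    simp
  rw [rowBracket]
  rcases hc with rfl | rfl
  · refine finprod_cond_eq_prod (e := Equiv.neg ℤ) (fun j => ?_) (fun j _ => ?_) h0
    · simp only [J, Set.mem_ofPred_eq, Equiv.neg_apply]
      omega
    · rw [Equiv.neg_apply, qbinom_eq_gaussBinom, qbinom_eq_gaussBinom, cXi.neg_neg hC,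
        Int.toNat_of_nonneg (hS.1 _ _)]
      simp only [neg_zero, add_zero, neg_neg]
  · refine finprod_cond_eq_prod (e := Equiv.subRight ((r : ℤ) + 1)) (fun j => ?_) (fun j _ => ?_) h0
    · simp only [J, Set.mem_ofPred_eq, Equiv.subRight_apply]
      omega
    · have e1 : C (-((r : ℤ) + 1)) (j - (r + 1)) = C (r + 1) (j + (r + 1)) := by
        rw [← hC.1.1.2.1]
        congr 1 <;> rw [hp] <;> ring
      have e2 : S (-((r : ℤ) + 1)) (j - (r + 1)) = S (-((r : ℤ) + 1)) (-(-j + (r + 1))) := by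
        congr 1
        ring
      have h := gaussBinom_swap v_sq_pow_ne_one (hC.1.1.1 (r + 1) (j + (r + 1)))
        (S (-((r : ℤ) + 1)) (-(-j + (r + 1)))).toNat (S (-((r : ℤ) + 1)) (-(j + (r + 1)))).toNat
      rw [Int.toNat_of_nonneg (hS.1 _ (-(-j + ((r : ℤ) + 1))))] at h
      rw [Equiv.subRight_apply, qbinom_eq_gaussBinom, qbinom_eq_gaussBinom, e1, neg_neg,
        Theta.apply_center hS, e2, h]

/-- The coefficient attached to the pair `(S, T)` in the multiplication formula. -/
noncomputable def coeffC (r : ℕ) (C S T : ZMat) : Qv :=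
  v ^ (2 * xiC r C S) * nST r S T * bracketC r C S

include hC hS hNS hNC in
theorem center_eq {c : ℤ} (hc : c = 0 ∨ c = r + 1) :
    (v ^ 2) ^ (rowExp C S (-c) -
      (∑ᶠ (j : ℤ) (l : ℤ) (_ : l < j ∧ j < 2 * (-c) - l), S c (-j) * S (-c) l) -
      (∑ᶠ (j : ℤ) (_ : j < -c), S (-c) j * (S (-c) j - 1) / 2)) *
    (rowBracket r C S (-c) * ∏ k ∈ Finset.range (S (-c) (-c)).toNat,
      qint (C (-c) (-c) - 2 * k) / qint (k + 1)) =
    isotropicCount (v ^ 2) N (fun j => C c (j + c)) (fun j => (S (-c) (-(j + c))).toNat) := by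
  rw [row_exp_eq hC hS hNS hNC hc, row_bracket_eq hC hS hNS hNC hc, isotropicCount, mul_comm]
  simp only [qint_div_qint, zero_add, cXi.neg_neg hC]

theorem zpow_sum {ι K : Type*} [Field K] {x : K} (hx : x ≠ 0) (s : Finset ι) (f : ι → ℤ) :
    x ^ (∑ i ∈ s, f i) = ∏ i ∈ s, x ^ f i := by
  classical
  induction s using Finset.induction_on with
  | empty => simp
  | insert a s ha ih => rw [Finset.sum_insert ha, Finset.prod_insert ha, zpow_add₀ hx, ih]

include hC hS hT hNS hNT hNC in
theorem coeffC_eq_neighborCount : coeffC r C S T = neighborCount (v ^ 2) N r C S T := by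
  have e0 := center_eq hC hS hNS hNC (Or.inl rfl)
  have e1 := center_eq hC hS hNS hNC (Or.inr rfl)
  simp only [neg_zero, add_zero] at e0
  have hr : -(r : ℤ) - 1 ≠ 0 := by omega
  have hr' : -(r : ℤ) - 1 = -(r + 1) := by ring
  have hx : v ^ 2 ≠ 0 := pow_ne_zero 2 RatFunc.X_ne_zero
  have e2 : v ^ (2 * xiC r C S) = (v ^ 2) ^ xiC r C S := by
    rw [zpow_mul]
    norm_cast
  have hxi := sum_Icc_all_rows r (rowExp C S)
  have hxi' : xiC r C S = (∑ i ∈ Finset.Icc (-(r : ℤ) - 1) r, rowExp C S i) - crossSum r S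
    - ∑ i ∈ ({-(r : ℤ) - 1, 0} : Finset ℤ), ∑ᶠ (j : ℤ) (_ : j < i), S i j * (S i j - 1) / 2 := rfl
  rw [crossSum, sum_Icc_neg_eq, Finset.sum_pair hr, Finset.sum_pair hr, hxi, hr'] at hxi'
  simp only [neg_neg, neg_zero] at hxi'
  have hbr : bracketC r C S = (rowBracket r C S (-(r + 1)) *
      (∏ i ∈ Finset.range r, rowBracket r C S (-((i : ℤ) + 1))) * rowBracket r C S 0) *
      ((∏ k ∈ Finset.range (S 0 0).toNat, qint (C 0 0 - 2 * k) / qint (k + 1)) *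
      ∏ k ∈ Finset.range (S (-((r : ℤ) + 1)) (-((r : ℤ) + 1))).toNat,
        qint (C (-((r : ℤ) + 1)) (-((r : ℤ) + 1)) - 2 * k) / qint (k + 1)) := by
    rw [bracketC, finprod_mem_J_eq (N := N) (f := fun i j => qbinom (C i j) (S i j).toNat *
      qbinom (C i j - S i j) (S (-i) (-j)).toNat), prod_Icc_rows, Finset.prod_pair hr.symm, hr']
    · rfl
    · intro i j h1 h2 hj
      have hp : per r = 2 * (r : ℤ) + 2 := rfl
      rw [Finset.mem_Icc] at hj
      change qbinom (C i j) (S i j).toNat * qbinom (C i j - S i j) (S (-i) (-j)).toNat = 1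
      rw [hNS i j (by omega) (by omega) (by omega), hNS (-i) (-j) (by omega) (by omega) (by omega)]
      simp [qbinom]
  have hsum := Finset.prod_congr rfl fun i hi => step_row_eq hC hS hNS hNC hi
  rw [Finset.prod_mul_distrib, ← zpow_sum hx, Finset.sum_sub_distrib] at hsum
  rw [neighborCount, ← e0, ← e1, ← hsum, ← nST_eq hT hNS hNT, coeffC, hbr, e2, hxi']
  have hz : ∀ A B D A' B' A'' B'' D'' : ℤ, (v ^ 2) ^ (A'' + A + D - (D'' + (B'' + B)) - (B' + A')) =
      (v ^ 2) ^ (A - B - A') * (v ^ 2) ^ (A'' - B'' - B') * (v ^ 2) ^ (D - D'') := by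
    intros
    rw [← zpow_add₀ hx, ← zpow_add₀ hx]
    congr 1
    ring
  rw [hz]
  ring

end Matching

end AffineSchurC

namespace AffineSchurC

open Module

set_option linter.unusedSectionVars false

/-! ### Integrality of the coefficients -/

section Integrality

open Polynomial

/-- The element `f` of `ℚ(v)` is a quotient of integral polynomials in `v²` with monic denominator,
whose value at `v² = q` is `φ q` for `q ≥ 2`. -/
def Specializes (f : Qv) (φ : ℕ → ℚ) : Prop :=
  ∃ P D : ℤ[X], D.Monic ∧ f * aeval (v ^ 2) D = aeval (v ^ 2) P ∧
    ∀ q : ℕ, 2 ≤ q → aeval (q : ℚ) D ≠ 0 ∧ φ q * aeval (q : ℚ) D = aeval (q : ℚ) P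

theorem aeval_v_sq_injective : Function.Injective (aeval (R := ℤ) (v ^ 2)) := by
  rw [injective_iff_map_eq_zero]
  intro P hP
  have h1 : algebraMap ℚ[X] Qv (expand ℚ 2 (P.map (Int.castRingHom ℚ))) = 0 := by
    rw [← hP, expand_eq_comp_X_pow, comp, eval₂_map, hom_eval₂, map_pow, RatFunc.algebraMap_X,
      aeval_def]
    congr 1
  rw [map_eq_zero_iff _ (RatFunc.algebraMap_injective ℚ), expand_eq_zero (by norm_num),
    Polynomial.map_eq_zero_iff (RingHom.injective_int _)] at h1
  exact h1

variable {f g : Qv} {φ ψ : ℕ → ℚ}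

theorem Specializes.of_aeval (P : ℤ[X]) :
    Specializes (aeval (v ^ 2) P) (fun q => aeval (q : ℚ) P) :=
  ⟨P, 1, monic_one, by simp, by simp⟩

theorem Specializes.intCast (n : ℤ) : Specializes n (fun _ => n) := by
  simpa using Specializes.of_aeval (C n)

theorem Specializes.one : Specializes 1 (fun _ => 1) := by
  simpa using Specializes.of_aeval 1

theorem Specializes.mul (hf : Specializes f φ) (hg : Specializes g ψ) :
    Specializes (f * g) (fun q => φ q * ψ q) := by
  obtain ⟨P, D, h1, h2, h3⟩ := hf
  obtain ⟨P', D', h1', h2', h3'⟩ := hg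
  refine ⟨P * P', D * D', h1.mul h1', ?_, fun q hq => ⟨?_, ?_⟩⟩
  · rw [map_mul, map_mul, ← h2, ← h2']
    ring
  · rw [map_mul]
    exact mul_ne_zero (h3 q hq).1 (h3' q hq).1
  · rw [map_mul, map_mul, ← (h3 q hq).2, ← (h3' q hq).2]
    ring

theorem Specializes.add (hf : Specializes f φ) (hg : Specializes g ψ) :
    Specializes (f + g) (fun q => φ q + ψ q) := by
  obtain ⟨P, D, h1, h2, h3⟩ := hf
  obtain ⟨P', D', h1', h2', h3'⟩ := hg
  refine ⟨P * D' + P' * D, D * D', h1.mul h1', ?_, fun q hq => ⟨?_, ?_⟩⟩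
  · rw [map_mul, map_add, map_mul, map_mul, ← h2, ← h2']
    ring
  · rw [map_mul]
    exact mul_ne_zero (h3 q hq).1 (h3' q hq).1
  · rw [map_mul, map_add, map_mul, map_mul, ← (h3 q hq).2, ← (h3' q hq).2]
    ring

theorem Specializes.sub (hf : Specializes f φ) (hg : Specializes g ψ) :
    Specializes (f - g) (fun q => φ q - ψ q) := by
  have := hf.add ((Specializes.intCast (-1)).mul hg)
  simpa [sub_eq_add_neg] using this

theorem Specializes.prod {ι : Type*} {s : Finset ι} {f : ι → Qv} {φ : ι → ℕ → ℚ}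
    (h : ∀ i ∈ s, Specializes (f i) (φ i)) :
    Specializes (∏ i ∈ s, f i) (fun q => ∏ i ∈ s, φ i q) := by
  classical
  induction s using Finset.induction_on with
  | empty => simpa using Specializes.one
  | insert a s ha ih =>
    simp only [Finset.prod_insert ha]
    exact (h a (Finset.mem_insert_self a s)).mul (ih fun i hi => h i (Finset.mem_insert_of_mem hi))

theorem Specializes.sum {ι : Type*} {s : Finset ι} {f : ι → Qv} {φ : ι → ℕ → ℚ}
    (h : ∀ i ∈ s, Specializes (f i) (φ i)) :
    Specializes (∑ i ∈ s, f i) (fun q => ∑ i ∈ s, φ i q) := by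
  classical
  induction s using Finset.induction_on with
  | empty => simpa using Specializes.intCast 0
  | insert a s ha ih =>
    simp only [Finset.sum_insert ha]
    exact (h a (Finset.mem_insert_self a s)).add (ih fun i hi => h i (Finset.mem_insert_of_mem hi))

theorem Specializes.zpow (e : ℤ) : Specializes ((v ^ 2) ^ e) (fun q => (q : ℚ) ^ e) := by
  have hx : v ^ 2 ≠ 0 := pow_ne_zero 2 RatFunc.X_ne_zero
  obtain ⟨m, rfl | rfl⟩ := e.eq_nat_or_neg
  · simpa using Specializes.of_aeval (X ^ m)
  · refine ⟨1, X ^ m, monic_X_pow m, ?_, fun q hq => ?_⟩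
    · simp [hx]
    · have : (q : ℚ) ≠ 0 := by positivity
      simp [this]

theorem Specializes.pow (m : ℕ) : Specializes ((v ^ 2) ^ m) (fun q => (q : ℚ) ^ m) :=
  mod_cast Specializes.zpow m

theorem Specializes.inv_pow_sub_one (m : ℕ) :
    Specializes (((v ^ 2) ^ (m + 1) - 1)⁻¹) (fun q => ((q : ℚ) ^ (m + 1) - 1)⁻¹) := by
  refine ⟨1, X ^ (m + 1) - C 1, monic_X_pow_sub_C 1 (by omega), ?_, fun q hq => ?_⟩
  · have := sub_ne_zero.2 (v_sq_pow_ne_one m)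
    simp [this]
  · have h2 : (1 : ℚ) < (q : ℚ) ^ (m + 1) := one_lt_pow₀ (by exact_mod_cast hq) (by omega)
    have : (q : ℚ) ^ (m + 1) - 1 ≠ 0 := by linarith
    simp [this]

theorem Specializes.unique (hf : Specializes f φ) (hg : Specializes f ψ) {q : ℕ} (hq : 2 ≤ q) :
    φ q = ψ q := by
  obtain ⟨P, D, h1, h2, h3⟩ := hf
  obtain ⟨P', D', h1', h2', h3'⟩ := hg
  have h : P * D' = P' * D := by
    apply aeval_v_sq_injective
    rw [map_mul, map_mul, ← h2, ← h2']
    ring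
  have h4 := congrArg (aeval (q : ℚ)) h
  rw [map_mul, map_mul, ← (h3 q hq).2, ← (h3' q hq).2] at h4
  refine mul_right_cancel₀ (mul_ne_zero (h3 q hq).1 (h3' q hq).1) ?_
  linear_combination h4

theorem Specializes.exists_aeval_eq (hf : Specializes f φ)
    (h : {q : ℕ | 2 ≤ q ∧ ∃ n : ℤ, φ q = n}.Infinite) : ∃ Q : ℤ[X], f = aeval (v ^ 2) Q := by
  obtain ⟨P, D, h1, h2, h3⟩ := hf
  have hdiv := modByMonic_add_div P D
  set R := P %ₘ D with hR
  set Q := P /ₘ D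
  have hD0 : aeval (v ^ 2) D ≠ 0 := by
    rw [Ne, map_eq_zero_iff _ aeval_v_sq_injective]
    exact h1.ne_zero
  suffices h0 : R = 0 by
    refine ⟨Q, mul_right_cancel₀ hD0 ?_⟩
    rw [h2, ← hdiv, h0, zero_add, map_mul, mul_comm]
  have hdeg : R.degree < D.degree := degree_modByMonic_lt P h1
  have hinj : Function.Injective (Int.castRingHom ℝ) := RingHom.injective_int _
  have hlim := div_tendsto_atTop_zero_of_degree_lt (R.map (Int.castRingHom ℝ))
    (D.map (Int.castRingHom ℝ)) (by
      rwa [degree_map_eq_of_injective hinj, degree_map_eq_of_injective hinj])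
  have hlim' := (hlim.comp tendsto_natCast_atTop_atTop).eventually
    (Metric.ball_mem_nhds (0 : ℝ) one_pos)
  obtain ⟨q₀, hq₀⟩ := Filter.eventually_atTop.1 hlim'
  have hinf : ({q : ℕ | 2 ≤ q ∧ ∃ n : ℤ, φ q = n} \ {q | q < q₀}).Infinite :=
    h.sdiff (Set.finite_lt_nat q₀)
  refine eq_zero_of_infinite_isRoot R
    ((hinf.image (f := fun q : ℕ => (q : ℤ)) (fun _ _ _ _ h => Nat.cast_injective h)).mono ?_)
  rintro _ ⟨q, ⟨⟨hq2, n, hn⟩, hq⟩, rfl⟩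
  have hq' : q₀ ≤ q := not_lt.1 hq
  obtain ⟨h4, h5⟩ := h3 q hq2
  have ev : ∀ F : ℤ[X], aeval (q : ℚ) F = ((F.eval (q : ℤ) : ℤ) : ℚ) := fun F => by
    have := aeval_algebraMap_apply ℚ (q : ℤ) F
    simpa using this
  have ev' : ∀ F : ℤ[X], (F.map (Int.castRingHom ℝ)).eval (q : ℝ) = ((F.eval (q : ℤ) : ℤ) : ℝ) :=
    fun F => by
      simp
  rw [ev] at h4 h5
  rw [ev, hn] at h5
  have h6 : n * D.eval (q : ℤ) = P.eval (q : ℤ) := by exact_mod_cast h5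
  have h4' : D.eval (q : ℤ) ≠ 0 := by exact_mod_cast h4
  have h7 : R.eval (q : ℤ) = (n - Q.eval (q : ℤ)) * D.eval (q : ℤ) := by
    rw [← hdiv, eval_add, eval_mul] at h6
    linear_combination -h6
  have h8 := hq₀ q hq'
  rw [Function.comp_apply, ev', ev', h7] at h8
  push_cast at h8
  rw [mul_div_cancel_right₀ _ (by exact_mod_cast h4'), Real.dist_eq, sub_zero] at h8
  have h9 : |n - Q.eval (q : ℤ)| < 1 := by exact_mod_cast h8
  rw [Int.abs_lt_one_iff] at h9
  rw [Set.mem_ofPred_eq, IsRoot, h7, h9, zero_mul]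

theorem specializes_gaussBinom (a : ℤ) (b : ℕ) :
    Specializes (gaussBinom (v ^ 2) a b) (fun q => gaussBinom (q : ℚ) a b) := by
  refine Specializes.prod fun i hi => ?_
  obtain ⟨m, rfl⟩ := Nat.exists_eq_add_of_le' (Finset.mem_Icc.1 hi).1
  simp only [div_eq_mul_inv, zpow_natCast]
  exact ((Specializes.zpow _).sub Specializes.one).mul (Specializes.inv_pow_sub_one m)

theorem specializes_isotropicCount (N : ℤ) (a : ℤ → ℤ) (u : ℤ → ℕ) :
    Specializes (isotropicCount (v ^ 2) N a u) (fun q => isotropicCount (q : ℚ) N a u) := by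
  refine ((Specializes.prod fun j _ => (specializes_gaussBinom _ _).mul
    (specializes_gaussBinom _ _)).mul (Specializes.prod fun i _ => ?_)).mul (Specializes.zpow _)
  simp only [div_eq_mul_inv]
  exact ((Specializes.zpow _).sub Specializes.one).mul (Specializes.inv_pow_sub_one _)

theorem specializes_stepCount (N : ℤ) (c : ℤ → ℤ) (s' s : ℤ → ℕ) :
    Specializes (stepCount (v ^ 2) N c s' s) (fun q => stepCount (q : ℚ) N c s' s) :=
  (Specializes.prod fun _ _ => (specializes_gaussBinom _ _).mul
    (specializes_gaussBinom _ _)).mul (Specializes.zpow _)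

theorem specializes_positionCount (N : ℤ) (α β : ℤ → ℕ) (σ : ℤ → ℤ → ℕ) :
    Specializes (positionCount (v ^ 2) N α β σ) (fun q => positionCount (q : ℚ) N α β σ) := by
  simp only [positionCount, div_eq_mul_inv, ← Finset.prod_inv_distrib]
  refine ((Specializes.zpow _).mul ((Specializes.prod fun i _ => Specializes.prod fun m _ => ?_).mul
    (Specializes.prod fun i _ => Specializes.prod fun j _ => Specializes.prod fun m _ =>
      Specializes.inv_pow_sub_one m))).mul (Specializes.prod fun j _ => Specializes.prod fun l _ =>
        (Specializes.pow _).sub (Specializes.pow _))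
  exact (Specializes.zpow _).sub Specializes.one

theorem specializes_complementCount {N : ℤ} {α γ β : ℤ → ℕ}
    (hγ : ∀ l, l ∉ Finset.Icc (-N) N → γ l = 0) (hβ : ∀ l, l ∉ Finset.Icc (-N) N → β l = 0) :
    Specializes (complementCount (v ^ 2) N α γ β) (fun q => complementCount (q : ℚ) N α γ β) := by
  simp only [complementCount, finsum_mem_eq_finite_toFinset_sum _ (triangular_finite hγ hβ)]
  exact Specializes.sum fun σ _ => specializes_positionCount N α β σ

theorem specializes_coeffC {r d : ℕ} {N : ℤ} {C S T : ZMat} (hC : C ∈ cXi r d) (hS : S ∈ Theta r)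
    (hT : T ∈ Theta r) (hNS : Window r N S) (hNT : Window r N T) (hNC : Window r N C) :
    Specializes (coeffC r C S T) (fun q => neighborCount (q : ℚ) N r C S T) := by
  rw [coeffC_eq_neighborCount hC hS hT hNS hNT hNC]
  refine (((specializes_isotropicCount _ _ _).mul (specializes_isotropicCount _ _ _)).mul
    (Specializes.prod fun i _ => specializes_stepCount _ _ _ _)).mul
    (Specializes.prod fun i hi => specializes_complementCount ?_ ?_)
  all_goals
    have hi' := Finset.mem_range.1 hi
    have hp : per r = 2 * (r : ℤ) + 2 := rfl
    intro l hl
    rw [Finset.mem_Icc] at hl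
  · rw [hNT i l (by omega) (by omega) (by omega)]
    rfl
  · rw [hNS (-i - 1) (-l) (by omega) (by omega) (by omega)]
    rfl

end Integrality

end AffineSchurC

namespace AffineSchurC

open Module

set_option linter.unusedSectionVars false

/-! ### Decomposition into the matrices `E_θ` -/

section Decomposition

variable {r d : ℕ} {A B C : ZMat} {a b : ℤ}

theorem per_pos (r : ℕ) : 0 < per r := by
  rw [per]
  omega

theorem E_nonneg (r : ℕ) (a b i j : ℤ) : 0 ≤ E r a b i j := by
  rw [E]
  split_ifs <;> norm_num

open Classical in
theorem E_periodic (r : ℕ) (a b i j : ℤ) : E r a b (i + per r) (j + per r) = E r a b i j := by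
  rw [E, E]
  refine if_congr ⟨fun ⟨m, h1, h2⟩ => ⟨m - 1, ?_, ?_⟩, fun ⟨m, h1, h2⟩ => ⟨m + 1, ?_, ?_⟩⟩ rfl rfl <;>
    linarith

open Classical in
theorem E_neg (r : ℕ) (a b i j : ℤ) : E r (-a) (-b) i j = E r a b (-i) (-j) := by
  rw [E, E]
  refine if_congr ⟨fun ⟨m, h1, h2⟩ => ⟨-m, ?_, ?_⟩, fun ⟨m, h1, h2⟩ => ⟨-m, ?_, ?_⟩⟩ rfl rfl <;>
    linarith

theorem E_support_finite (r : ℕ) (a b i : ℤ) : (E r a b i).support.Finite := by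
  refine Set.Subsingleton.finite fun j hj j' hj' => ?_
  simp only [Function.mem_support, E, ne_eq, ite_eq_right_iff, one_ne_zero, imp_false, not_not] at hj hj'
  obtain ⟨m, h1, h2⟩ := hj
  obtain ⟨m', h1', h2'⟩ := hj'
  linarith

theorem ro_E (r : ℕ) (a b i : ℤ) : ro (E r a b) i = if per r ∣ i - a then 1 else 0 := by
  rw [ro]
  split_ifs with h
  · obtain ⟨m, hm⟩ := h
    rw [finsum_eq_single _ (b + m * per r)]
    · exact if_pos ⟨m, by linarith, rfl⟩
    · rintro j hj
      refine if_neg fun ⟨m', h1, h2⟩ => hj ?_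
      rw [h2, mul_right_cancel₀ (per_pos r).ne' (show m' * per r = m * per r by linarith)]
  · refine finsum_eq_zero_of_forall_eq_zero fun j => if_neg fun ⟨m, h1, h2⟩ => h ⟨m, by linarith⟩

theorem sum_ro_E (r : ℕ) (a b i₀ : ℤ) : ∑ i ∈ Finset.Ico i₀ (i₀ + per r), ro (E r a b) i = 1 := by
  have h1 := Int.emod_nonneg (a - i₀) (per_pos r).ne'
  have h2 := Int.emod_lt_of_pos (a - i₀) (per_pos r)
  have h3 := Int.emod_add_mul_ediv (a - i₀) (per r)
  rw [Finset.sum_eq_single_of_mem (i₀ + (a - i₀) % per r) (Finset.mem_Ico.2 ⟨by omega, by omega⟩)]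
  · rw [ro_E, if_pos ⟨-((a - i₀) / per r), by linarith⟩]
  · intro i hi hne
    rw [Finset.mem_Ico] at hi
    rw [ro_E, if_neg]
    intro h
    refine hne ?_
    have h4 : (i - i₀) % per r = (a - i₀) % per r := (Int.modEq_iff_dvd.2 (by
      rwa [show i - i₀ - (a - i₀) = i - a by ring]) : a - i₀ ≡ i - i₀ [ZMOD per r]).symm
    rw [Int.emod_eq_of_lt (by omega) (by omega)] at h4
    omega

theorem ro_sub (hA : ∀ i, (A i).support.Finite) (hB : ∀ i, (B i).support.Finite) (i : ℤ) :
    ro (A - B) i = ro A i - ro B i :=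
  finsum_sub_distrib (hA i) (hB i)

theorem ro_add (hA : ∀ i, (A i).support.Finite) (hB : ∀ i, (B i).support.Finite) (i : ℤ) :
    ro (A + B) i = ro A i + ro B i :=
  finsum_add_distrib (hA i) (hB i)

theorem Etheta_apply (r : ℕ) (a b i j : ℤ) :
    Etheta r a b i j = E r a b i j + E r a b (-i) (-j) := by
  rw [Etheta, Matrix.add_apply, E_neg]

theorem Etheta_support_finite (r : ℕ) (a b i : ℤ) : (Etheta r a b i).support.Finite :=
  ((E_support_finite r a b i).union (E_support_finite r (-a) (-b) i)).subset
    (Function.support_add _ _)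

theorem sum_ro_Etheta (r : ℕ) (a b i₀ : ℤ) :
    ∑ i ∈ Finset.Ico i₀ (i₀ + per r), ro (Etheta r a b) i = 2 := by
  rw [Etheta, Finset.sum_congr rfl fun i _ => ro_add (E_support_finite r a b)
    (E_support_finite r (-a) (-b)) i, Finset.sum_add_distrib, sum_ro_E, sum_ro_E]
  rfl

theorem apply_add_mul_per₂ (hA : ∀ i j, A (i + per r) (j + per r) = A i j) (i j m : ℤ) :
    A (i + m * per r) (j + m * per r) = A i j := by
  induction m with
  | zero => simp
  | succ m ih =>
    rw [← ih, ← hA (i + m * per r)]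
    congr 1 <;> ring
  | pred m ih =>
    rw [← ih, ← hA (i + (-m - 1) * per r)]
    congr 1 <;> ring

theorem Etheta_le (hC : C ∈ cXi r d) (hab : 0 < C a b) (i j : ℤ) : Etheta r a b i j ≤ C i j := by
  have hper := fun i j m => apply_add_mul_per₂ hC.1.1.2.1 i j m
  have h1 : ∀ i j m, i = a + m * per r → j = b + m * per r → C i j = C a b := by
    rintro _ _ m rfl rfl
    exact hper a b m
  rw [Etheta_apply, E, E]
  split_ifs with hp hn hn
  · obtain ⟨m, h2, h3⟩ := hp
    obtain ⟨m', h2', h3'⟩ := hn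
    have hij : i = j := by linarith
    subst hij
    have h4 : 2 * i = 2 * ((m - m') * (r + 1)) := by
      rw [per] at *
      linarith
    have h5 : i = (m - m') * (r + 1) := by linarith
    have h6 : 0 < C i i := (h1 i i m h2 h3).symm ▸ hab
    have h7 : Even (C i i) := by
      obtain ⟨t, ht | ht⟩ := Int.even_or_odd' (m - m')
      · have := hper 0 0 t
        rw [show 0 + t * per r = i by rw [h5, ht, per]; ring] at this
        rw [this]
        exact hC.2.2.1
      · have := hper (r + 1) (r + 1) t
        rw [show r + 1 + t * per r = i by rw [h5, ht, per]; ring] at this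
        rw [this]
        exact hC.2.2.2
    obtain ⟨t, ht⟩ := h7
    omega
  · obtain ⟨m, h2, h3⟩ := hp
    rw [h1 i j m h2 h3]
    omega
  · obtain ⟨m, h2, h3⟩ := hn
    rw [← cXi.neg_neg hC, h1 _ _ m h2 h3]
    omega
  · exact (add_zero (0 : ℤ)).trans_le (hC.1.1.1 i j)

theorem even_Etheta_center (r : ℕ) (a b : ℤ) :
    Even (Etheta r a b 0 0) ∧ Even (Etheta r a b (r + 1) (r + 1)) := by
  rw [Etheta_apply, Etheta_apply]
  refine ⟨⟨E r a b 0 0, by rw [neg_zero]⟩, ⟨E r a b (r + 1) (r + 1), ?_⟩⟩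
  rw [← E_periodic r a b (-(r + 1))]
  congr 2 <;> rw [per] <;> ring

theorem sub_Etheta_mem (hC : C ∈ cXi r (d + 1)) (hab : 0 < C a b) : C - Etheta r a b ∈ cXi r d := by
  refine ⟨⟨⟨fun i j => ?_, fun i j => ?_, fun i => ?_⟩, fun i₀ => ?_⟩, fun i j => ?_, ?_, ?_⟩
  · exact sub_nonneg.2 (Etheta_le hC hab i j)
  · rw [Matrix.sub_apply, Matrix.sub_apply, hC.1.1.2.1, Etheta, Matrix.add_apply, Matrix.add_apply,
      E_periodic, E_periodic]
  · exact ((hC.1.1.2.2 i).union (Etheta_support_finite r a b i)).subset (Function.support_sub _ _)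
  · rw [Finset.sum_congr rfl fun i _ => ro_sub hC.1.1.2.2 (Etheta_support_finite r a b) i,
      Finset.sum_sub_distrib, hC.1.2, sum_ro_Etheta]
    push_cast
    ring
  · rw [Matrix.sub_apply, Matrix.sub_apply, cXi.neg_neg hC, Etheta_apply, Etheta_apply, neg_neg,
      neg_neg, add_comm]
  · exact hC.2.2.1.sub (even_Etheta_center r a b).1
  · exact hC.2.2.2.sub (even_Etheta_center r a b).2

theorem ro_nonneg (hA : A ∈ Theta r) (i : ℤ) : 0 ≤ ro A i := finsum_nonneg fun j => hA.1 i j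

theorem le_ro (hA : A ∈ Theta r) (i j : ℤ) : A i j ≤ ro A i :=
  single_le_finsum j (hA.2.2 i) fun j => hA.1 i j

theorem exists_eq_sum_Etheta (hC : C ∈ cXi r d) :
    ∃ a b : Fin d → ℤ, C = ∑ h, Etheta r (a h) (b h) := by
  induction d generalizing C with
  | zero =>
    refine ⟨0, 0, ?_⟩
    ext i j
    have h1 := hC.1.2 i
    have h2 := (Finset.sum_eq_zero_iff_of_nonneg fun i _ => ro_nonneg hC.1.1 i).1 h1 i
      (Finset.mem_Ico.2 ⟨le_rfl, by linarith [per_pos r]⟩)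
    have h3 := le_ro hC.1.1 i j
    have h4 := hC.1.1.1 i j
    rw [Finset.univ_eq_empty, Finset.sum_empty, Matrix.zero_apply]
    omega
  | succ d ih =>
    obtain ⟨a, b, hab⟩ : ∃ a b, 0 < C a b := by
      by_contra! h
      have h1 : ∀ i, ro C i = 0 := fun i =>
        finsum_eq_zero_of_forall_eq_zero fun j => le_antisymm (h i j) (hC.1.1.1 i j)
      have h2 := hC.1.2 0
      simp only [h1, Finset.sum_const_zero] at h2
      push_cast at h2
      omega
    obtain ⟨a', b', h⟩ := ih (sub_Etheta_mem hC hab)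
    refine ⟨Fin.cons a a', Fin.cons b b', ?_⟩
    rw [Fin.sum_univ_succ]
    simp only [Fin.cons_zero, Fin.cons_succ]
    rw [← h, add_sub_cancel]

end Decomposition

/-! ### Standard lattice chains -/

section Standard

variable {k : Type} [Field k]

instance : IsScalarTower k k⟦X⟧ k⸨X⸩ := ⟨fun c f x => by
  rw [PowerSeries.smul_eq_C_mul, mul_smul, Algebra.smul_def (PowerSeries.C c)]
  exact (congrArg (· * (f • x)) (PowerSeries.coe_C c)).trans HahnSeries.C_mul_eq_smul⟩

/-- The fractional ideal generated by `ε^e`. -/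
noncomputable def ordIdeal (k : Type) [Field k] (e : ℤ) : Submodule k⟦X⟧ k⸨X⸩ :=
  Submodule.span k⟦X⟧ {HahnSeries.single e 1}

theorem mem_one_iff_mul_mem {e : ℤ} {x : k⸨X⸩} :
    HahnSeries.single e 1 * x ∈ ordIdeal k e ↔ x ∈ (1 : Submodule k⟦X⟧ k⸨X⸩) := by
  rw [ordIdeal, Submodule.mem_span_singleton, Submodule.mem_one]
  have h : ∀ f : k⟦X⟧, f • (HahnSeries.single e 1 : k⸨X⸩) =
      HahnSeries.single e 1 * algebraMap k⟦X⟧ k⸨X⸩ f := fun f => by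
    rw [Algebra.smul_def, mul_comm]
  simp only [h]
  have h0 : (HahnSeries.single e 1 : k⸨X⸩) ≠ 0 := HahnSeries.single_ne_zero one_ne_zero
  exact exists_congr fun f => mul_right_inj' h0

theorem ordIdeal_zero : ordIdeal k 0 = 1 := by
  ext x
  rw [← mem_one_iff_mul_mem (e := 0), HahnSeries.single_zero_one, one_mul]

theorem single_mul_mem_iff {e f : ℤ} {x : k⸨X⸩} :
    HahnSeries.single e 1 * x ∈ ordIdeal k (e + f) ↔ x ∈ ordIdeal k f := by
  have h : (HahnSeries.single e 1 : k⸨X⸩) * x =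
      HahnSeries.single (e + f) 1 * (HahnSeries.single (-f) 1 * x) := by
    rw [← mul_assoc, HahnSeries.single_mul_single, add_neg_cancel_right, one_mul]
  have h' : x = HahnSeries.single f 1 * (HahnSeries.single (-f) 1 * x) := by
    rw [← mul_assoc, HahnSeries.single_mul_single, add_neg_cancel, one_mul,
      HahnSeries.single_zero_one, one_mul]
  rw [h, mem_one_iff_mul_mem]
  conv_rhs => rw [h']
  rw [mem_one_iff_mul_mem]

theorem mem_ordIdeal_iff {e : ℤ} {x : k⸨X⸩} : x ∈ ordIdeal k e ↔ ∀ i < e, x.coeff i = 0 := by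
  rw [← single_mul_mem_iff (e := -e), neg_add_cancel, ordIdeal_zero, mem_one_iff_coeff]
  have h : ∀ i, ((HahnSeries.single (-e) 1 : k⸨X⸩) * x).coeff i = x.coeff (i + e) := fun i => by
    have := HahnSeries.coeff_single_mul_add (r := (1 : k)) (x := x) (a := i + e) (b := -e)
    rwa [add_neg_cancel_right, one_mul] at this
  simp only [h]
  exact ⟨fun h i hi => by simpa using h (i - e) (by omega), fun h i hi => h _ (by omega)⟩

theorem mul_mem_ordIdeal {e f : ℤ} {x y : k⸨X⸩} (hx : x ∈ ordIdeal k e) (hy : y ∈ ordIdeal k f) :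
    x * y ∈ ordIdeal k (e + f) := by
  obtain ⟨g, rfl⟩ := Submodule.mem_span_singleton.1 hx
  rw [smul_mul_assoc]
  exact Submodule.smul_mem _ _ (single_mul_mem_iff.2 hy)

variable {ι : Type} [Fintype ι] [DecidableEq ι]

/-- The lattice of vectors whose coordinates have orders at least `e`. -/
noncomputable def boxLattice (k : Type) [Field k] (e : ι → ℤ) : Submodule k⟦X⟧ (ι → k⸨X⸩) :=
  Submodule.pi Set.univ fun c => ordIdeal k (e c)

theorem mem_boxLattice {e : ι → ℤ} {x : ι → k⸨X⸩} :
    x ∈ boxLattice k e ↔ ∀ c, x c ∈ ordIdeal k (e c) := by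
  simp [boxLattice]

theorem ordIdeal_mono {e f : ℤ} (h : f ≤ e) : ordIdeal k e ≤ ordIdeal k f := fun x hx => by
  rw [mem_ordIdeal_iff] at hx ⊢
  exact fun i hi => hx i (by omega)

theorem boxLattice_mono {e f : ι → ℤ} (h : f ≤ e) : boxLattice k e ≤ boxLattice k f := fun x hx => by
  rw [mem_boxLattice] at hx ⊢
  exact fun c => ordIdeal_mono (h c) (hx c)

theorem boxLattice_inf (e f : ι → ℤ) : boxLattice k e ⊓ boxLattice k f = boxLattice k (e ⊔ f) := by
  refine le_antisymm (fun x hx => ?_) (le_inf (boxLattice_mono le_sup_left)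
    (boxLattice_mono le_sup_right))
  obtain ⟨h1, h2⟩ := hx
  rw [SetLike.mem_coe, mem_boxLattice] at h1 h2
  rw [mem_boxLattice]
  intro c
  rw [Pi.sup_apply]
  rcases le_total (e c) (f c) with h | h
  · rw [sup_eq_right.2 h]
    exact h2 c
  · rw [sup_eq_left.2 h]
    exact h1 c

theorem isLattice_boxLattice (e : ι → ℤ) : Submodule.IsLattice k⸨X⸩ (boxLattice k e) where
  fg := Submodule.fg_pi fun c => Submodule.fg_span_singleton _
  span_eq_top := by
    rw [eq_top_iff]
    intro x _
    rw [← Finset.univ_sum_single x]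
    refine Submodule.sum_mem _ fun c _ => ?_
    have h : Pi.single c (x c) = (x c * HahnSeries.single (-e c) 1 : k⸨X⸩) •
        (Pi.single c (HahnSeries.single (e c) 1) : ι → k⸨X⸩) := by
      rw [← Pi.single_smul, smul_eq_mul, mul_assoc, HahnSeries.single_mul_single, neg_add_cancel,
        one_mul, HahnSeries.single_zero_one, mul_one]
    rw [h]
    refine Submodule.smul_mem _ _ (Submodule.subset_span (mem_boxLattice.2 fun c' => ?_))
    by_cases hc : c' = c
    · subst hc
      rw [Pi.single_eq_same]
      exact Submodule.mem_span_singleton_self _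
    · rw [Pi.single_eq_of_ne hc]
      exact zero_mem _

theorem X_smul_boxLattice (e : ι → ℤ) :
    (PowerSeries.X : k⟦X⟧) • boxLattice k e = boxLattice k (fun c => 1 + e c) := by
  ext x
  rw [Submodule.mem_smul_pointwise_iff_exists, mem_boxLattice]
  constructor
  · rintro ⟨y, hy, rfl⟩ c
    rw [mem_boxLattice] at hy
    rw [X_smul_eq, Pi.smul_apply, smul_eq_mul]
    exact single_mul_mem_iff.2 (hy c)
  · intro h
    refine ⟨(HahnSeries.single (-1 : ℤ) (1 : k) : k⸨X⸩) • x, mem_boxLattice.2 fun c => ?_, ?_⟩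
    · rw [Pi.smul_apply, smul_eq_mul]
      have := single_mul_mem_iff (e := -1) |>.2 (h c)
      rwa [neg_add_cancel_left] at this
    · rw [X_smul_eq, smul_smul, HahnSeries.single_mul_single, add_neg_cancel, one_mul,
        HahnSeries.single_zero_one, one_smul]

theorem rd_boxLattice {e f : ι → ℤ} (h : e ≤ f) :
    (rd ((boxLattice k e).restrictScalars k) ((boxLattice k f).restrictScalars k) : ℤ) =
      ∑ c, (f c - e c) := by
  let W := (c : ι) → Fin (f c - e c).toNat → k
  let T : (ι → k⸨X⸩) →ₗ[k] W :=
    { toFun := fun x c t => (x c).coeff (e c + t)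
      map_add' := fun x y => rfl
      map_smul' := fun a x => rfl }
  have hker : LinearMap.ker (T.domRestrict ((boxLattice k e).restrictScalars k)) =
      ((boxLattice k f).restrictScalars k).submoduleOf ((boxLattice k e).restrictScalars k) := by
    ext ⟨x, hx⟩
    have hx' := mem_boxLattice.1 hx
    rw [LinearMap.mem_ker, Submodule.submoduleOf, Submodule.mem_comap]
    change T x = 0 ↔ x ∈ boxLattice k f
    rw [mem_boxLattice]
    constructor
    · intro h0 c
      rw [mem_ordIdeal_iff]
      intro i hi
      by_cases hie : i < e c
      · exact mem_ordIdeal_iff.1 (hx' c) i hie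
      · have h2 := congrFun (congrFun h0 c) ⟨(i - e c).toNat, by omega⟩
        change (x c).coeff (e c + (i - e c).toNat) = 0 at h2
        rwa [Int.toNat_of_nonneg (by omega), add_sub_cancel] at h2
    · intro h0
      funext c t
      exact mem_ordIdeal_iff.1 (h0 c) _ (by have := t.2; have := h c; omega)
  have hsurj : Function.Surjective (T.domRestrict ((boxLattice k e).restrictScalars k)) := by
    intro w
    refine ⟨⟨fun c => HahnSeries.single (e c) 1 * ((PowerSeries.mk fun m =>
      if hm : m < (f c - e c).toNat then w c ⟨m, hm⟩ else 0 : k⟦X⟧) : k⸨X⸩), ?_⟩, ?_⟩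
    · refine mem_boxLattice.2 fun c => mem_one_iff_mul_mem.2 (Submodule.mem_one.2 ⟨_, rfl⟩)
    · funext c t
      change (HahnSeries.single (e c) 1 * _ : k⸨X⸩).coeff (e c + t) = _
      rw [add_comm, HahnSeries.coeff_single_mul_add, one_mul, LaurentSeries.coeff_coe_powerSeries,
        PowerSeries.coeff_mk, dif_pos t.2]
  have e1 := ((Submodule.quotEquivOfEq _ _ hker.symm).trans
    (LinearMap.quotKerEquivOfSurjective _ hsurj)).finrank_eq
  rw [rd_eq_finrank_quotient, e1, Module.finrank_pi_fintype]
  push_cast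
  refine Finset.sum_congr rfl fun c _ => ?_
  rw [Module.finrank_fin_fun, Int.toNat_of_nonneg (sub_nonneg.2 (h c))]

end Standard

section StandardChain

variable {k : Type} [Field k] {r d : ℕ}

/-- The standard symplectic form, scaled by `ε⁻¹`. -/
noncomputable def stdForm (k : Type) [Field k] (d : ℕ) :
    LinearMap.BilinForm k⸨X⸩ (Fin d ⊕ Fin d → k⸨X⸩) :=
  LinearMap.mk₂ k⸨X⸩ (fun x y => ∑ h, HahnSeries.single (-1 : ℤ) (1 : k) *
      (x (Sum.inl h) * y (Sum.inr h) - x (Sum.inr h) * y (Sum.inl h)))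
    (fun x y z => by
      rw [← Finset.sum_add_distrib]
      exact Finset.sum_congr rfl fun h _ => by simp only [Pi.add_apply]; ring)
    (fun c x y => by
      rw [Finset.smul_sum]
      exact Finset.sum_congr rfl fun h _ => by simp only [Pi.smul_apply, smul_eq_mul]; ring)
    (fun x y z => by
      rw [← Finset.sum_add_distrib]
      exact Finset.sum_congr rfl fun h _ => by simp only [Pi.add_apply]; ring)
    (fun c x y => by
      rw [Finset.smul_sum]
      exact Finset.sum_congr rfl fun h _ => by simp only [Pi.smul_apply, smul_eq_mul]; ring)

theorem stdForm_apply (x y : Fin d ⊕ Fin d → k⸨X⸩) : stdForm k d x y =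
    ∑ h, HahnSeries.single (-1 : ℤ) (1 : k) *
      (x (Sum.inl h) * y (Sum.inr h) - x (Sum.inr h) * y (Sum.inl h)) := rfl

theorem stdForm_isAlt : (stdForm k d).IsAlt := fun x => by
  rw [stdForm_apply]
  exact Finset.sum_eq_zero fun h _ => by ring

theorem stdForm_single_inl (x : Fin d ⊕ Fin d → k⸨X⸩) (h : Fin d) (c : k⸨X⸩) :
    stdForm k d x (Pi.single (Sum.inl h) c) = -(HahnSeries.single (-1 : ℤ) 1 * (x (Sum.inr h) * c)) := by
  rw [stdForm_apply, Finset.sum_eq_single_of_mem h (Finset.mem_univ h)]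
  · simp
  · intro h' _ hne
    simp [hne]

theorem stdForm_single_inr (x : Fin d ⊕ Fin d → k⸨X⸩) (h : Fin d) (c : k⸨X⸩) :
    stdForm k d x (Pi.single (Sum.inr h) c) = HahnSeries.single (-1 : ℤ) 1 * (x (Sum.inl h) * c) := by
  rw [stdForm_apply, Finset.sum_eq_single_of_mem h (Finset.mem_univ h)]
  · simp
  · intro h' _ hne
    simp [hne]

theorem stdForm_nondegenerate : (stdForm k d).Nondegenerate := by
  have h0 : (HahnSeries.single (-1 : ℤ) 1 : k⸨X⸩) ≠ 0 := HahnSeries.single_ne_zero one_ne_zero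
  refine (LinearMap.IsRefl.nondegenerate_iff_separatingLeft (B := stdForm k d)
    (LinearMap.BilinForm.IsAlt.isRefl stdForm_isAlt)).2 fun x hx => ?_
  funext c
  rcases c with h | h
  · have := hx (Pi.single (Sum.inr h) 1)
    rw [stdForm_single_inr, mul_one] at this
    exact (mul_eq_zero.1 this).resolve_left h0
  · have := hx (Pi.single (Sum.inl h) 1)
    rw [stdForm_single_inl, mul_one, neg_eq_zero] at this
    exact (mul_eq_zero.1 this).resolve_left h0

theorem dualSubmodule_boxLattice (e f : Fin d → ℤ) :
    (stdForm k d).dualSubmodule (boxLattice k (Sum.elim e f)) =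
      boxLattice k (Sum.elim (fun h => 1 - f h) (fun h => 1 - e h)) := by
  ext x
  rw [LinearMap.BilinForm.mem_dualSubmodule, mem_boxLattice]
  have hsingle : ∀ (c : Fin d ⊕ Fin d) (t : ℤ), Sum.elim e f c = t →
      (Pi.single c (HahnSeries.single t 1) : Fin d ⊕ Fin d → k⸨X⸩) ∈ boxLattice k (Sum.elim e f) := by
    rintro c _ rfl
    refine mem_boxLattice.2 fun c' => ?_
    by_cases hc : c' = c
    · subst hc
      rw [Pi.single_eq_same]
      exact Submodule.mem_span_singleton_self _
    · rw [Pi.single_eq_of_ne hc]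
      exact zero_mem _
  have key : ∀ (y : k⸨X⸩) (t : ℤ), HahnSeries.single (-1 : ℤ) 1 * (y * HahnSeries.single t 1) ∈
      (1 : Submodule k⟦X⟧ k⸨X⸩) → y ∈ ordIdeal k (1 - t) := by
    intro y t h
    rwa [mul_comm y, ← mul_assoc, HahnSeries.single_mul_single, one_mul, ← ordIdeal_zero,
      show (0 : ℤ) = -1 + t + (1 - t) by ring, single_mul_mem_iff] at h
  constructor
  · rintro h (c | c)
    · have := h _ (hsingle (Sum.inr c) _ rfl)
      rw [stdForm_single_inr] at this
      exact key _ _ this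
    · have := h _ (hsingle (Sum.inl c) _ rfl)
      rw [stdForm_single_inl, Submodule.neg_mem_iff] at this
      exact key _ _ this
  · intro h y hy
    rw [mem_boxLattice] at hy
    rw [stdForm_apply, ← ordIdeal_zero]
    refine Submodule.sum_mem _ fun c _ => ?_
    rw [show (0 : ℤ) = -1 + 1 by norm_num, single_mul_mem_iff]
    refine Submodule.sub_mem _ ?_ ?_
    · have := mul_mem_ordIdeal (h (Sum.inl c)) (hy (Sum.inr c))
      simpa using this
    · have := mul_mem_ordIdeal (h (Sum.inr c)) (hy (Sum.inl c))
      simpa using this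

/-- The orders defining the lattices of `stdChain`. -/
def stdOrd (r : ℕ) (a : Fin d → ℤ) (z : ℤ) : Fin d ⊕ Fin d → ℤ :=
  Sum.elim (fun h => -((z - a h) / per r)) (fun h => -((z + a h) / per r))

/-- The lattice chain that jumps at `a h` and `-a h`. -/
noncomputable def stdChain (k : Type) [Field k] (r : ℕ) (a : Fin d → ℤ) :
    LatticeChain r (stdForm k d) where
  L z := boxLattice k (stdOrd r a z)
  isLattice z := isLattice_boxLattice _
  mono z := boxLattice_mono (by
    rintro (h | h) <;> exact neg_le_neg (Int.ediv_le_ediv (per_pos r) (by omega)))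
  periodic z := by
    rw [X_smul_boxLattice]
    congr 1
    funext c
    rcases c with h | h <;> simp only [stdOrd, Sum.elim_inl, Sum.elim_inr]
    · rw [show z + per r - a h = z - a h + 1 * per r by ring,
        Int.add_mul_ediv_right _ _ (per_pos r).ne']
      ring
    · rw [show z + per r + a h = z + a h + 1 * per r by ring,
        Int.add_mul_ediv_right _ _ (per_pos r).ne']
      ring
  dual z := by
    rw [stdOrd, dualSubmodule_boxLattice, stdOrd]
    have key : ∀ t : ℤ, (-t - 1) / per r = -(t / per r) - 1 := fun t => by
      have := per_pos r
      have h1 := Int.emod_add_mul_ediv t (per r)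
      have h2 := Int.emod_nonneg t this.ne'
      have h3 := Int.emod_lt_of_pos t this
      rw [Int.ediv_eq_iff_of_pos this]
      constructor <;> nlinarith
    congr 2 <;> funext h
    · rw [show -z - 1 - a h = -(z + a h) - 1 by ring, key]
      ring
    · rw [show -z - 1 + a h = -(z - a h) - 1 by ring, key]
      ring

theorem idx_boxLattice_sub {F : ℤ → Submodule k (Fin d ⊕ Fin d → k⸨X⸩)} (hF : IsLadder F)
    {e f : Fin d ⊕ Fin d → ℤ} (h : e ≤ f) (he : Comm F ((boxLattice k e).restrictScalars k))
    (hf : Comm F ((boxLattice k f).restrictScalars k)) :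
    idx F ((boxLattice k e).restrictScalars k) - idx F ((boxLattice k f).restrictScalars k) =
      ∑ c, (f c - e c) := by
  rw [idx_sub hF hf he (boxLattice_mono h), rd_boxLattice h]

theorem E_eq_second_difference (r : ℕ) (a b i j : ℤ) :
    E r a b i j =
      (max (-((i - 1 - a) / per r)) (-((j - b) / per r)) - max (-((i - a) / per r)) (-((j - b) / per r))) -
      (max (-((i - 1 - a) / per r)) (-((j - 1 - b) / per r)) -
        max (-((i - a) / per r)) (-((j - 1 - b) / per r))) := by
  have hp := per_pos r
  have key : ∀ t : ℤ, (per r * (t / per r) = t ∧ (t - 1) / per r = t / per r - 1) ∨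
      (¬ per r ∣ t ∧ (t - 1) / per r = t / per r) := fun t => by
    have h1 := Int.emod_add_mul_ediv t (per r)
    have h2 := Int.emod_nonneg t hp.ne'
    have h3 := Int.emod_lt_of_pos t hp
    by_cases h : per r ∣ t
    · rw [Int.emod_eq_zero_of_dvd h] at h1
      refine Or.inl ⟨by linarith, ?_⟩
      rw [Int.ediv_eq_iff_of_pos hp]
      constructor <;> nlinarith
    · have h4 : t % per r ≠ 0 := fun h' => h (Int.dvd_of_emod_eq_zero h')
      refine Or.inr ⟨h, ?_⟩
      rw [Int.ediv_eq_iff_of_pos hp]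
      have : 1 ≤ t % per r := by omega
      constructor <;> nlinarith
  rw [show i - 1 - a = i - a - 1 by ring, show j - 1 - b = j - b - 1 by ring]
  have hE : (per r * ((i - a) / per r) = i - a ∧ per r * ((j - b) / per r) = j - b ∧
      (i - a) / per r = (j - b) / per r) → E r a b i j = 1 := fun ⟨h1, h2, h3⟩ =>
    if_pos ⟨(i - a) / per r, by linarith, by rw [h3]; linarith⟩
  have hE' : ¬ (per r ∣ i - a ∧ per r ∣ j - b ∧ (i - a) / per r = (j - b) / per r) →
      E r a b i j = 0 := fun h => if_neg fun ⟨m, h1, h2⟩ => h (by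
    rw [h1, h2, add_sub_cancel_left, add_sub_cancel_left]
    exact ⟨dvd_mul_left _ _, dvd_mul_left _ _, rfl⟩)
  rcases key (i - a) with ⟨h1, h1'⟩ | ⟨h1, h1'⟩
  · rcases key (j - b) with ⟨h2, h2'⟩ | ⟨h2, h2'⟩
    · by_cases h3 : (i - a) / per r = (j - b) / per r
      · rw [hE ⟨h1, h2, h3⟩]
        omega
      · rw [hE' fun h => h3 h.2.2]
        omega
    · rw [hE' fun h => h2 h.2.1]
      omega
  · rw [hE' fun h => h1 h.1]
    omega

theorem relPos_stdChain (a b : Fin d → ℤ) :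
    relPos (stdChain k r a) (stdChain k r b) = ∑ h, Etheta r (a h) (b h) := by
  have hF := ((stdChain k r b).isChain stdForm_isAlt).toIsLadder
  have hc : ∀ i j, Comm (stdChain k r b).toSeq
      ((boxLattice k (stdOrd r a i ⊔ stdOrd r b j)).restrictScalars k) := fun i j => by
    rw [← boxLattice_inf]
    exact ((stdChain k r a).comm (stdChain k r b) i).inf hF (comm_self _ j)
  rw [relPos_eq_posMat stdForm_isAlt _ _ (stdChain k r b)]
  ext i j
  have hmono : stdOrd r a i ≤ stdOrd r a (i - 1) := by
    rintro (h | h) <;> exact neg_le_neg (Int.ediv_le_ediv (per_pos r) (by omega))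
  have hinf : ∀ i j, (stdChain k r a).toSeq i ⊓ (stdChain k r b).toSeq j =
      (boxLattice k (stdOrd r a i ⊔ stdOrd r b j)).restrictScalars k := fun i j => by
    rw [← boxLattice_inf]
    rfl
  rw [posMat, hinf, hinf, hinf, hinf, idx_boxLattice_sub hF (sup_le_sup_right hmono _) (hc _ _) (hc _ _),
    idx_boxLattice_sub hF (sup_le_sup_right hmono _) (hc _ _) (hc _ _), ← Finset.sum_sub_distrib,
    Matrix.sum_apply, Fintype.sum_sum_type, ← Finset.sum_add_distrib]
  refine Finset.sum_congr rfl fun h _ => ?_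
  rw [Etheta, Matrix.add_apply, E_eq_second_difference, E_eq_second_difference]
  simp only [stdOrd, Pi.sup_apply, Sum.elim_inl, Sum.elim_inr, sub_neg_eq_add]

theorem exists_relPos_eq {C : ZMat} (hC : C ∈ cXi r d) :
    ∃ L L' : LatticeChain r (stdForm k d), relPos L L' = C := by
  obtain ⟨a, b, h⟩ := exists_eq_sum_Etheta hC
  exact ⟨stdChain k r a, stdChain k r b, by rw [relPos_stdChain, h]⟩

theorem finrank_std : finrank k⸨X⸩ (Fin d ⊕ Fin d → k⸨X⸩) = 2 * d := by
  rw [Module.finrank_fintype_fun_eq_card, Fintype.card_sum, Fintype.card_fin, two_mul]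

end StandardChain

/-! ### Finiteness of the index set -/

section Finiteness

variable {r d : ℕ} {A S T : ZMat}

theorem exists_band (hA : A ∈ Theta r) : ∃ w : ℤ, 0 ≤ w ∧ ∀ i j, A i j ≠ 0 → |i - j| ≤ w := by
  obtain ⟨N, hN⟩ := exists_forall_window hA
  refine ⟨max N 0 + per r, by have := per_pos r; omega, fun i j hij => ?_⟩
  have hp := per_pos r
  have h1 := Int.emod_add_mul_ediv (i + r + 1) (per r)
  have h2 := Int.emod_nonneg (i + r + 1) hp.ne'
  have h3 := Int.emod_lt_of_pos (i + r + 1) hp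
  have h4 := apply_add_mul_per₂ hA.2.1 i j (-((i + r + 1) / per r))
  have h5 := hN (max N 0) (le_max_left _ _) (i + -((i + r + 1) / per r) * per r)
    (j + -((i + r + 1) / per r) * per r)
  rw [mul_comm (per r)] at h1
  rw [neg_mul] at h4 h5
  generalize (i + r + 1) / per r * per r = t at *
  have hper : per r = 2 * (r : ℤ) + 2 := rfl
  by_contra h
  refine hij (h4.symm.trans (h5 (by omega) (by omega) ?_))
  rw [abs_le] at h
  omega

theorem finite_bounded_band (r : ℕ) (w M : ℤ) : {S : ZMat | (∀ i j, S (i + per r) (j + per r) = S i j) ∧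
    (∀ i j, 0 ≤ S i j ∧ S i j ≤ M) ∧ ∀ i j, S i j ≠ 0 → |i - j| ≤ w}.Finite := by
  let I := Finset.Ico 0 (per r)
  let J := Finset.Icc (-w) (per r + w)
  let V := Finset.Icc 0 M
  refine (Set.finite_range fun (f : I × J → V) (i j : ℤ) =>
    if h : j - i / per r * per r ∈ J then
      (f (⟨i % per r, Finset.mem_Ico.2 ⟨Int.emod_nonneg i (per_pos r).ne',
        Int.emod_lt_of_pos i (per_pos r)⟩⟩, ⟨_, h⟩) : ℤ) else 0).subset ?_
  rintro S ⟨h1, h2, h3⟩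
  refine ⟨fun p => ⟨S p.1 p.2, Finset.mem_Icc.2 (h2 _ _)⟩, ?_⟩
  funext i j
  have h4 := apply_add_mul_per₂ h1 i j (-(i / per r))
  have h5 := Int.emod_add_mul_ediv i (per r)
  rw [mul_comm] at h5
  rw [neg_mul] at h4
  dsimp only
  split_ifs with h
  · rw [← h4]
    congr 1
    linarith
  · by_contra h'
    have h6 := h3 i j (Ne.symm h')
    have h7 := Int.emod_nonneg i (per_pos r).ne'
    have h8 := Int.emod_lt_of_pos i (per_pos r)
    refine h (Finset.mem_Icc.2 ?_)
    rw [abs_le] at h6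
    omega

theorem exists_pos_of_le (hT : T ∈ Theta r) (h : ∀ i j, T i j ≤ A i j + T (i - 1) j) {i j : ℤ}
    (hij : T i j ≠ 0) {M : ℕ} (hM : ro T i ≤ M) : ∃ k, i - M * per r ≤ k ∧ k ≤ i ∧ A k j ≠ 0 := by
  by_contra! h0
  have hpos : ∀ m : ℕ, (m : ℤ) ≤ M * per r → 0 < T (i - m) j := fun m => by
    induction m with
    | zero =>
      intro _
      have := hT.1 i j
      push_cast
      rw [sub_zero]
      omega
    | succ m ih =>
      intro hm
      push_cast at hm
      have h1 := ih (by omega)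
      have h2 := h (i - m) j
      rw [h0 (i - m) (by omega) (by omega), sub_sub] at h2
      push_cast
      omega
  have hrow : ∀ m ∈ Finset.range (M + 1), 1 ≤ T i (j + m * per r) := fun m hm => by
    have hm' : (m : ℤ) ≤ M := by
      have := Finset.mem_range.1 hm
      omega
    have h1 := hpos (m * per r).toNat
    have h2 : 0 ≤ (m : ℤ) * per r := mul_nonneg (by omega) (per_pos r).le
    rw [Int.toNat_of_nonneg h2] at h1
    have h3 := h1 (mul_le_mul_of_nonneg_right hm' (per_pos r).le)
    have h4 := apply_add_mul_per₂ hT.2.1 (i - m * per r) j m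
    rw [sub_add_cancel] at h4
    omega
  have hinj : Set.InjOn (fun m : ℕ => j + m * per r) (Finset.range (M + 1)) := fun m _ m' _ hmm => by
    have : (m : ℤ) * per r = m' * per r := by simpa using hmm
    exact_mod_cast mul_right_cancel₀ (per_pos r).ne' this
  have h5 : ∑ j' ∈ (Finset.range (M + 1)).image (fun m : ℕ => j + m * per r), T i j' ≤ ro T i := by
    rw [ro, finsum_eq_sum_of_support_subset (s := (hT.2.2 i).toFinset ∪
      (Finset.range (M + 1)).image (fun m : ℕ => j + m * per r))]
    · exact Finset.sum_le_sum_of_subset_of_nonneg Finset.subset_union_right fun _ _ _ => hT.1 _ _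
    · intro j' hj'
      exact Finset.mem_coe.2 (Finset.mem_union_left _ ((hT.2.2 i).mem_toFinset.2 hj'))
  rw [Finset.sum_image hinj] at h5
  have h6 := Finset.sum_le_sum hrow
  simp at h6
  omega

theorem exists_bound {α : ℤ → ℕ} (hα : ∀ i : ℤ, α (i + per r) = α i) : ∃ M : ℕ, ∀ i, α i ≤ M := by
  refine ⟨∑ i ∈ Finset.Ico 0 (per r), α i, fun i => ?_⟩
  have h := apply_add_mul_per hα (i % per r) (i / per r)
  rw [show i % per r + i / per r * per r = i by rw [mul_comm]; exact Int.emod_add_mul_ediv i _] at h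
  rw [h]
  exact Finset.single_le_sum (fun _ _ => Nat.zero_le _) (Finset.mem_Ico.2
    ⟨Int.emod_nonneg i (per_pos r).ne', Int.emod_lt_of_pos i (per_pos r)⟩)

theorem finite_pairs {α : ℤ → ℕ} (hα : ∀ i : ℤ, α (i + per r) = α i) (hA : A ∈ Theta r) (Ω : Set ZMat) :
    (pairs r Ω α A).Finite := by
  obtain ⟨w, hw0, hw⟩ := exists_band hA
  obtain ⟨M, hM⟩ := exists_bound hα
  have hMp : 0 ≤ M * per r := mul_nonneg (by omega) (per_pos r).le
  let W := w + M * per r + 1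
  refine ((finite_bounded_band r W M).prod (finite_bounded_band r W M)).subset ?_
  rintro ⟨S, T⟩ ⟨hS, hT, hST, hSr, hTr, hAT, -⟩
  have hM' : ∀ i, (α i : ℤ) ≤ M := fun i => by exact_mod_cast hM i
  have hTb : ∀ i j, T i j ≠ 0 → |i - j| ≤ w + M * per r := fun i j hij => by
    obtain ⟨k, h1, h2, h3⟩ := exists_pos_of_le (A := A) (M := M) hT (fun i j => by
      have := hAT.1 i j
      rw [Matrix.add_apply, Matrix.sub_apply, rowShift] at this
      linarith) hij (by rw [hTr i]; exact hM' _)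
    have h4 := hw k j h3
    rw [abs_le] at h4 ⊢
    omega
  refine ⟨⟨hS.2.1, fun i j => ⟨hS.1 i j, ?_⟩, fun i j hij => ?_⟩,
    ⟨hT.2.1, fun i j => ⟨hT.1 i j, ?_⟩, fun i j hij => (hTb i j hij).trans (by omega)⟩⟩
  · exact (le_ro hS i j).trans ((hSr i).trans_le (hM' i))
  · have h1 := hST i j
    have h2 := hS.1 i j
    have h3 := hS.1 (-i - 1) (-j)
    by_cases h : T i j = 0
    · have h4 := hTb (-i - 1) (-j) (by dsimp only at *; omega)
      rw [abs_le] at h4 ⊢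
      omega
    · exact (hTb i j h).trans (by omega)
  · exact (le_ro hT i j).trans ((hTr i).trans_le (hM' _))

end Finiteness

end AffineSchurC

namespace AffineSchurC

open Module

set_option linter.unusedSectionVars false

/-! ### The structure constants -/

section StructureConstants

open Polynomial

variable {r d : ℕ} {α : ℤ → ℕ} {A B C : ZMat}

/-- The sum of the coefficients attached to the pairs `(S, T)` with `A_{S,T} = C`. -/
noncomputable def coeffSum (r d : ℕ) (α : ℤ → ℕ) (A C : ZMat) : Qv :=
  ∑ᶠ p ∈ {p | p ∈ pairs r (cXi r d) α A ∧ AST A p.1 p.2 = C}, coeffC r C p.1 p.2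

variable (hα : ∀ i : ℤ, α (i + per r) = α i) (hA : A ∈ cXi r d) (hAB : Compatible r α A B)
  (hC : C ∈ cXi r d)

include hα hA hAB hC in
theorem exists_isStructureConst : ∃ Q : ℤ[X], aeval (v ^ 2) Q = coeffSum r d α A C ∧
    IsStructureConst r d B A C (toLaurent (expand ℤ 2 Q)) := by
  have hfin : {p | p ∈ pairs r (cXi r d) α A ∧ AST A p.1 p.2 = C}.Finite :=
    (finite_pairs hα hA.1.1 (cXi r d)).subset fun p hp => hp.1
  have hwin : ∀ p ∈ hfin.toFinset, ∃ N : ℤ, Window r N p.1 ∧ Window r N p.2 ∧ Window r N C := by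
    intro p hp
    obtain ⟨⟨hS, hT, -⟩, -⟩ := hfin.mem_toFinset.1 hp
    obtain ⟨a, ha⟩ := exists_forall_window hS
    obtain ⟨b, hb⟩ := exists_forall_window hT
    obtain ⟨c, hc⟩ := exists_forall_window hC.1.1
    exact ⟨max a (max b c), ha _ (by omega), hb _ (by omega), hc _ (by omega)⟩
  choose! N₀ hN₀ using hwin
  have hspec : ∀ p ∈ hfin.toFinset, ∀ N, Window r N p.1 ∧ Window r N p.2 ∧ Window r N C →
      Specializes (coeffC r C p.1 p.2) (fun q => neighborCount (q : ℚ) N r C p.1 p.2) := by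
    intro p hp N hN
    obtain ⟨⟨hS, hT, -⟩, -⟩ := hfin.mem_toFinset.1 hp
    exact specializes_coeffC hC hS hT hN.1 hN.2.1 hN.2.2
  have hsum := Specializes.sum fun p hp => hspec p hp (N₀ p) (hN₀ p hp)
  rw [← finsum_mem_eq_finite_toFinset_sum _ hfin] at hsum
  change Specializes (coeffSum r d α A C) _ at hsum
  have hcount : ∀ (k : Type) [Field k] [Finite k] (V : Type) [AddCommGroup V] [Module k⸨X⸩ V]
      [Module k⟦X⟧ V] [IsScalarTower k⟦X⟧ k⸨X⸩ V] [Module k V] [IsScalarTower k k⟦X⟧ V]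
      (ω : LinearMap.BilinForm k⸨X⸩ V), ω.IsAlt → ∀ L L' : LatticeChain r ω, relPos L L' = C →
      {M : LatticeChain r ω | relPos L M = B ∧ relPos M L' = A}.Finite ∧
      (Set.ncard {M : LatticeChain r ω | relPos L M = B ∧ relPos M L' = A} : ℚ) =
        ∑ p ∈ hfin.toFinset, neighborCount (Nat.card k : ℚ) (N₀ p) r C p.1 p.2 := by
    intro k _ _ V _ _ _ _ _ _ ω hω L L' hLC
    obtain ⟨h1, N, hN, h2⟩ := ncard_relPos hω L L' (isTridiagonal_of_isDiag hα hAB.2) hAB.1 hA.1.1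
      hC hLC hfin
    refine ⟨h1, h2.trans (Finset.sum_congr rfl fun p hp => ?_)⟩
    exact (hspec p hp _ (hN p (hfin.mem_toFinset.1 hp))).unique (hspec p hp _ (hN₀ p hp))
      Finite.one_lt_card
  obtain ⟨Q, hQ⟩ := hsum.exists_aeval_eq (Nat.infinite_setOfPred_prime.mono fun p hp => by
    have : Fact p.Prime := ⟨hp⟩
    obtain ⟨L, L', hLC⟩ := exists_relPos_eq (k := ZMod p) hC
    have h := (hcount (ZMod p) _ _ stdForm_isAlt L L' hLC).2
    rw [Nat.card_zmod] at h
    exact ⟨hp.two_le, _, h.symm⟩)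
  refine ⟨Q, hQ.symm, fun k _ _ V _ _ _ _ _ _ _ ω hω _ _ L L' hLC => ?_⟩
  obtain ⟨h1, h2⟩ := hcount k V ω hω L L' hLC
  refine ⟨h1, fun x hx => ?_⟩
  have h3 := (hQ ▸ hsum).unique (Specializes.of_aeval Q) (q := Nat.card k) Finite.one_lt_card
  rw [← h2] at h3
  have hx2 : (x : ℝ) ^ 2 = (Nat.card k : ℝ) := by rw [hx, Real.sq_sqrt (Nat.cast_nonneg _)]
  rw [LaurentPolynomial.eval₂_toLaurent, expand_eq_comp_X_pow, eval₂_comp, eval₂_X_pow, hx2]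
  have h4 := congrArg (fun t : ℚ => (t : ℝ)) h3
  simp only [Rat.cast_natCast] at h4
  rw [h4, aeval_def, ← Rat.coe_castHom (α := ℝ), hom_eval₂]
  congr 1

include hC in
theorem IsStructureConst.unique {g g' : ℤ[T;T⁻¹]} (hg : IsStructureConst r d A B C g)
    (hg' : IsStructureConst r d A B C g') : g = g' := by
  obtain ⟨n, f, hf⟩ := LaurentPolynomial.exists_T_pow (g - g')
  suffices h0 : f = 0 by
    rw [h0, map_zero] at hf
    have := congrArg (· * LaurentPolynomial.T (-(n : ℤ))) hf
    simp only [zero_mul, mul_assoc, ← LaurentPolynomial.T_add, add_neg_cancel,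
      LaurentPolynomial.T_zero, mul_one] at this
    exact sub_eq_zero.1 this.symm
  have hinj : Function.Injective (Int.castRingHom ℝ) := RingHom.injective_int _
  rw [← Polynomial.map_eq_zero_iff hinj]
  refine eq_zero_of_infinite_isRoot _ ((Nat.infinite_setOfPred_prime.image (f := fun p : ℕ => √(p : ℝ))
    fun p _ p' _ h => by simpa using h).mono ?_)
  rintro _ ⟨p, hp, rfl⟩
  have : Fact p.Prime := ⟨hp⟩
  obtain ⟨L, L', hLC⟩ := exists_relPos_eq (k := ZMod p) hC
  have hp0 : √(p : ℝ) ≠ 0 := (Real.sqrt_pos.2 (by exact_mod_cast hp.pos)).ne'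
  have h1 := (hg (ZMod p) _ _ stdForm_isAlt stdForm_nondegenerate finrank_std L L' hLC).2
    (Units.mk0 _ hp0) (by rw [Nat.card_zmod]; rfl)
  have h2 := (hg' (ZMod p) _ _ stdForm_isAlt stdForm_nondegenerate finrank_std L L' hLC).2
    (Units.mk0 _ hp0) (by rw [Nat.card_zmod]; rfl)
  have h3 := congrArg (LaurentPolynomial.eval₂ (Int.castRingHom ℝ) (Units.mk0 _ hp0)) hf
  rw [map_mul, map_sub, h1, h2, sub_self, zero_mul, LaurentPolynomial.eval₂_toLaurent] at h3
  rw [Set.mem_ofPred_eq, IsRoot, eval_map]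
  exact h3

include hα hA hAB hC in
theorem existsUnique_isStructureConst : ∃! g, IsStructureConst r d B A C g := by
  obtain ⟨Q, -, hQ⟩ := exists_isStructureConst hα hA hAB hC
  exact ⟨_, hQ, fun g hg => hg.unique hC hQ⟩

include hα hA hAB hC in
theorem structureConst_eq : ∃ Q : ℤ[X], aeval (v ^ 2) Q = coeffSum r d α A C ∧
    structureConst r d B A C = toLaurent (expand ℤ 2 Q) := by
  obtain ⟨Q, h1, hQ⟩ := exists_isStructureConst hα hA hAB hC
  refine ⟨Q, h1, ?_⟩
  have h : ∃ g, IsStructureConst r d B A C g := ⟨_, hQ⟩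
  rw [structureConst, dif_pos h]
  exact h.choose_spec.unique hC hQ

include hα hA hAB hC in
theorem toQv_structureConst : toQv (structureConst r d B A C) = coeffSum r d α A C := by
  obtain ⟨Q, h1, h2⟩ := structureConst_eq hα hA hAB hC
  rw [h2, toQv, LaurentPolynomial.eval₂_toLaurent, expand_eq_comp_X_pow, eval₂_comp, eval₂_X_pow, ← h1, aeval_def]
  congr 1
  exact RingHom.ext_int _ _

include hα hA hAB in
theorem finite_structureConst_ne_zero :
    {C | C ∈ cXi r d ∧ structureConst r d B A C ≠ 0}.Finite := by
  refine ((finite_pairs hα hA.1.1 (cXi r d)).image fun p => AST A p.1 p.2).subset ?_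
  rintro C ⟨hC, h0⟩
  by_contra h
  obtain ⟨Q, h1, h2⟩ := structureConst_eq hα hA hAB hC
  have h3 : coeffSum r d α A C = 0 := by
    refine finsum_mem_of_eqOn_zero fun p hp => ?_
    exact absurd ⟨p, hp.1, hp.2⟩ h
  rw [h3, map_eq_zero_iff _ aeval_v_sq_injective] at h1
  rw [h2, h1, map_zero, map_zero] at h0
  exact h0 rfl

include hα hA hAB in
theorem conv_eC (hB : B ∈ cXi r d) : conv r d (eC r d B) (eC r d A) =
    ∑ᶠ p ∈ pairs r (cXi r d) α A,
      coeffC r (AST A p.1 p.2) p.1 p.2 • eC r d (AST A p.1 p.2) := by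
  classical
  have hP := finite_pairs hα hA.1.1 (cXi r d)
  have hs : (Function.support fun C : ↥(cXi r d) =>
      toQv (structureConst r d B A C.1)).Finite := by
    refine Set.Finite.of_finite_image ((finite_structureConst_ne_zero hα hA hAB).subset ?_)
      Subtype.val_injective.injOn
    rintro _ ⟨C, hC, rfl⟩
    exact ⟨C.2, fun h => hC (by dsimp only; rw [h, toQv, map_zero])⟩
  rw [eC, eC, dif_pos hB, dif_pos hA, conv, Finsupp.sum_single_index (by simp),
    Finsupp.sum_single_index (by simp), mul_one, one_smul, basisMul, dif_pos hs,
    finsum_mem_eq_finite_toFinset_sum _ hP]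
  ext C
  rw [Finsupp.ofSupportFinite_coe, toQv_structureConst hα hA hAB C.2, Finsupp.finsetSum_apply,
    coeffSum, finsum_mem_eq_finite_toFinset_sum _ (hP.subset fun p hp => hp.1)]
  rw [← Finset.sum_filter_add_sum_filter_not hP.toFinset (fun p => AST A p.1 p.2 = C)]
  rw [Finset.sum_eq_zero (s := {p ∈ hP.toFinset | ¬AST A p.1 p.2 = C}), add_zero]
  · refine Finset.sum_congr ?_ fun p hp => ?_
    · ext p
      simp
    · have h := (Finset.mem_filter.1 hp).2
      rw [h, eC, dif_pos C.2, Finsupp.smul_single, smul_eq_mul, mul_one, Finsupp.single_eq_same]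
  · intro p hp
    obtain ⟨h1, h2⟩ := Finset.mem_filter.1 hp
    have h3 : AST A p.1 p.2 ∈ cXi r d := (hP.mem_toFinset.1 h1).2.2.2.2.2.2
    rw [eC, dif_pos h3, Finsupp.smul_apply, Finsupp.single_eq_of_ne fun h => h2 (by rw [h]), smul_zero]

end StructureConstants

end AffineSchurC

namespace AffineSchurC

open Module

set_option linter.unusedSectionVars false

/-! ### Matrices in `Ξ_{n,d}` -/

section Shifted

variable {r d : ℕ} {α : ℤ → ℕ} {A B C S T : ZMat}

open Classical in
theorem Efix_apply (r : ℕ) (i j : ℤ) :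
    Efix r i j = if i = j ∧ (r : ℤ) + 1 ∣ i then 1 else 0 := by
  have hp : per r = 2 * ((r : ℤ) + 1) := by rw [per]; ring
  have hr : (r : ℤ) + 1 ≠ 0 := by omega
  rw [Efix, Matrix.add_apply, E, E]
  by_cases h : i = j ∧ (r : ℤ) + 1 ∣ i
  · rw [if_pos h]
    obtain ⟨rfl, t, rfl⟩ := h
    have h0 : ∀ m t : ℤ, ((r : ℤ) + 1) * t = 0 + m * per r → t = 2 * m := fun m t h =>
      mul_left_cancel₀ hr (h.trans (by rw [hp]; ring))
    have h1 : ∀ m t : ℤ, ((r : ℤ) + 1) * t = r + 1 + m * per r → t = 2 * m + 1 := fun m t h =>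
      mul_left_cancel₀ hr (h.trans (by rw [hp]; ring))
    obtain ⟨m, rfl | rfl⟩ := Int.even_or_odd' t
    · rw [if_pos ⟨m, by rw [hp]; ring, by rw [hp]; ring⟩, if_neg]
      · rfl
      · rintro ⟨m', e, -⟩
        have := h1 _ _ e
        omega
    · rw [if_neg, if_pos ⟨m, by rw [hp]; ring, by rw [hp]; ring⟩]
      · rfl
      · rintro ⟨m', e, -⟩
        have := h0 _ _ e
        omega
  · rw [if_neg h, if_neg, if_neg]
    · rfl
    · rintro ⟨m, h1, h2⟩
      exact h ⟨h1.trans h2.symm, 1 + 2 * m, by rw [h1, hp]; ring⟩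
    · rintro ⟨m, h1, h2⟩
      exact h ⟨h1.trans h2.symm, 2 * m, by rw [h1, hp]; ring⟩

theorem AST_add_Efix (A S T : ZMat) : AST (A + Efix r) S T = AST A S T + Efix r := by
  rw [AST, AST]
  abel

theorem mem_Xi_iff : A ∈ Xi r d ↔ A - Efix r ∈ cXi r d :=
  ⟨fun ⟨A₀, h, e⟩ => by rwa [← e, add_sub_cancel_right], fun h => ⟨_, h, sub_add_cancel _ _⟩⟩

theorem Efix_eq_zero {i : ℤ} (h0 : i ≠ 0) (h1 : -(r : ℤ) - 1 < i) (h2 : i < r + 1) (j : ℤ) :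
    Efix r i j = 0 := by
  rw [Efix_apply, if_neg]
  rintro ⟨-, t, rfl⟩
  have : t < 1 := by nlinarith
  have : -1 < t := by nlinarith
  obtain rfl : t = 0 := by omega
  simp at h0

theorem Efix_center {c : ℤ} (hc : c = 0 ∨ c = -(r : ℤ) - 1) (j : ℤ) :
    Efix r c j = if j = c then 1 else 0 := by
  classical
  have h : (r : ℤ) + 1 ∣ c := by
    obtain rfl | rfl := hc
    · exact dvd_zero _
    · exact ⟨-1, by ring⟩
  rw [Efix_apply]
  exact if_congr ⟨fun h => h.1.symm, fun h' => ⟨h'.symm, h⟩⟩ rfl rfl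

theorem bracketB_add_Efix (C S : ZMat) : bracketB r (C + Efix r) S = bracketC r C S := by
  rw [bracketB, bracketC]
  congr 1
  · refine finprod_mem_congr rfl fun p hp => ?_
    have h : Efix r p.1 p.2 = 0 := by
      rcases hp with ⟨h1, h2⟩ | ⟨h1, h2⟩ | ⟨h1, h2⟩
      · rw [h1, Efix_center (Or.inr rfl), if_neg h2.ne']
      · exact Efix_eq_zero (by omega) (by omega) (by omega) _
      · rw [h1, Efix_center (Or.inl rfl), if_neg h2.ne]
    rw [Matrix.add_apply, h, add_zero]
  · refine Finset.prod_congr rfl fun i hi => Finset.prod_congr rfl fun k _ => ?_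
    rw [Finset.mem_insert, Finset.mem_singleton] at hi
    rw [Matrix.add_apply, Efix_center hi, if_pos rfl]
    congr 2
    ring

theorem xiB_add_Efix {N : ℤ} (hNS : Window r N S) (hNC : Window r N C) (hN : 0 ≤ N) :
    xiB r (C + Efix r) S = xiC r C S := by
  have hp : per r = 2 * (r : ℤ) + 2 := rfl
  have s0 : ∀ i, -(r : ℤ) - 1 ≤ i → i ≤ r → ∀ j, j ∉ Finset.Icc (-(N + r + 1)) (N + r + 1) → S i j = 0 := by
    intro i h1 h2 j hj
    rw [Finset.mem_Icc] at hj
    exact hNS i j h1 (by omega) (by omega)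
  have c0 : ∀ i, -(r : ℤ) - 1 ≤ i → i ≤ r → ∀ j, j ∉ Finset.Icc (-(N + r + 1)) (N + r + 1) → C i j = 0 := by
    intro i h1 h2 j hj
    rw [Finset.mem_Icc] at hj
    exact hNC i j h1 (by omega) (by omega)
  have h1 : ∀ i ∈ Finset.Icc (-(r : ℤ) - 1) r,
      ∑ᶠ (j : ℤ) (l : ℤ) (_ : l < j), ((C + Efix r) i j - S i j) * S i l =
      (∑ᶠ (j : ℤ) (l : ℤ) (_ : l < j), (C i j - S i j) * S i l) +
        if i ∈ ({-(r : ℤ) - 1, 0} : Finset ℤ) then ∑ᶠ (l : ℤ) (_ : l < i), S i l else 0 := by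
    intro i hi
    rw [Finset.mem_Icc] at hi
    have s1 := s0 i hi.1 hi.2
    have c1 := c0 i hi.1 hi.2
    have hE : ∀ j, j ∉ Finset.Icc (-(N + r + 1)) (N + r + 1) → Efix r i j = 0 := by
      classical
      intro j hj
      rw [Finset.mem_Icc] at hj
      rw [Efix_apply, if_neg]
      rintro ⟨rfl, -⟩
      omega
    have e := pairSum_add_right (P := (· < ·)) (N := N + r + 1) (S i) (fun j => C i j - S i j)
      (Efix r i)
    have e0 := pairSum_eq_finsum (p := S i) (q := fun j => C i j - S i j) s1
      (fun j hj => by rw [c1 j hj, s1 j hj, sub_zero])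
    have e2 := pairSum_eq_finsum (p := S i) (q := (fun j => C i j - S i j) + Efix r i) s1
      (fun j hj => by
        have h : C i j - S i j + Efix r i j = 0 := by rw [c1 j hj, s1 j hj, hE j hj]; rfl
        exact h)
    rw [e2, e0] at e
    have e3 : ∀ j l, ((C + Efix r) i j - S i j) * S i l =
        ((fun j => C i j - S i j) + Efix r i) j * S i l := fun j l => by
      rw [Matrix.add_apply, Pi.add_apply]
      ring
    refine (finsum_congr fun j => finsum_congr fun l => finsum_congr fun _ => e3 j l).trans
      (e.trans ?_)
    congr 1
    split_ifs with hi'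
    · have hc : i = 0 ∨ i = -(r : ℤ) - 1 := by
        rw [Finset.mem_insert, Finset.mem_singleton] at hi'
        exact hi'.symm
      have e4 : Efix r i = Pi.single i 1 := by
        funext j
        rw [Efix_center hc, Pi.single_apply]
      rw [e4, pairSum_single_right _ (Finset.mem_Icc.2 (by omega)), finsum_cond_eq_sum_Icc s1]
    · have e4 : Efix r i = 0 := by
        rw [Finset.mem_insert, Finset.mem_singleton] at hi'
        exact funext fun j => Efix_eq_zero (by omega) (by omega) (by omega) j
      rw [e4, pairSum]
      simp
  have h2 : ∀ i ∈ ({-(r : ℤ) - 1, 0} : Finset ℤ), ∑ᶠ (j : ℤ) (_ : j < i), S i j * (S i j + 1) / 2 =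
      (∑ᶠ (j : ℤ) (_ : j < i), S i j * (S i j - 1) / 2) + ∑ᶠ (l : ℤ) (_ : l < i), S i l := by
    intro i hi
    rw [Finset.mem_insert, Finset.mem_singleton] at hi
    have s1 := s0 i (by omega) (by omega)
    rw [finsum_cond_eq_sum_Icc (N := N + r + 1) fun j hj => by rw [s1 j hj]; rfl,
      finsum_cond_eq_sum_Icc (N := N + r + 1) fun j hj => by rw [s1 j hj]; rfl,
      finsum_cond_eq_sum_Icc s1, ← Finset.sum_add_distrib]
    refine Finset.sum_congr rfl fun j _ => ?_
    split_ifs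
    · rw [show S i j * (S i j + 1) = S i j * (S i j - 1) + S i j * 2 by ring,
        Int.add_mul_ediv_right _ _ two_ne_zero]
    · rfl
  rw [xiB, xiC, Finset.sum_congr rfl h1, Finset.sum_congr rfl h2, Finset.sum_add_distrib,
    Finset.sum_add_distrib, ← Finset.sum_filter]
  have h3 : (Finset.Icc (-(r : ℤ) - 1) r).filter (· ∈ ({-(r : ℤ) - 1, 0} : Finset ℤ)) =
      {-(r : ℤ) - 1, 0} := by
    ext i
    simp only [Finset.mem_filter, Finset.mem_Icc, Finset.mem_insert, Finset.mem_singleton]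
    omega
  rw [h3]
  ring

/-- The coefficient attached to the pair `(S, T)` in the formula for `Ξ_{n,d}`. -/
noncomputable def coeffB (r : ℕ) (C S T : ZMat) : Qv :=
  v ^ (2 * xiB r C S) * nST r S T * bracketB r C S

theorem exists_common_window (hS : S ∈ Theta r) (hC : C ∈ Theta r) :
    ∃ N, 0 ≤ N ∧ Window r N S ∧ Window r N C := by
  obtain ⟨a, ha⟩ := exists_forall_window hS
  obtain ⟨b, hb⟩ := exists_forall_window hC
  exact ⟨max 0 (max a b), by omega, ha _ (by omega), hb _ (by omega)⟩

theorem coeffB_add_Efix (hS : S ∈ Theta r) (hC : C ∈ Theta r) :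
    coeffB r (C + Efix r) S T = coeffC r C S T := by
  obtain ⟨N, h0, hNS, hNC⟩ := exists_common_window hS hC
  rw [coeffB, coeffC, bracketB_add_Efix, xiB_add_Efix hNS hNC h0]

theorem bracketC_eq_zero {c : ℤ} (hc : c = 0 ∨ c = -(r : ℤ) - 1) (h0 : 0 ≤ C c c)
    (hev : Even (C c c)) (h : C c c < S c c) : bracketC r C S = 0 := by
  obtain ⟨t, ht⟩ := hev
  refine mul_eq_zero_of_right _ (Finset.prod_eq_zero (i := c) (by simpa using hc)
    (Finset.prod_eq_zero (i := t.toNat) (Finset.mem_range.2 (by omega)) ?_))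
  rw [Int.toNat_of_nonneg (by omega), show C c c - 2 * t = 0 by omega, qint_eq]
  simp

theorem exists_center {X : ZMat} (hX : ∀ i j, X (i + per r) (j + per r) = X i j) {i : ℤ}
    (hi : (r : ℤ) + 1 ∣ i) : ∃ c, (c = 0 ∨ c = -(r : ℤ) - 1) ∧ X c c = X i i := by
  obtain ⟨t, rfl⟩ := hi
  obtain ⟨m, rfl | rfl⟩ := Int.even_or_odd' t
  · refine ⟨0, Or.inl rfl, ?_⟩
    rw [← apply_add_mul_per₂ hX 0 0 m, per]
    congr 1 <;> ring
  · refine ⟨-(r : ℤ) - 1, Or.inr rfl, ?_⟩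
    rw [← apply_add_mul_per₂ hX _ _ (m + 1), per]
    congr 1 <;> ring

theorem Efix_mem_Theta (r : ℕ) : Efix r ∈ Theta r := by
  refine ⟨fun i j => add_nonneg (E_nonneg ..) (E_nonneg ..), fun i j => ?_, fun i =>
    ((E_support_finite r 0 0 i).union (E_support_finite r (r + 1) (r + 1) i)).subset
      (Function.support_add _ _)⟩
  rw [Efix, Matrix.add_apply, Matrix.add_apply, E_periodic, E_periodic]

theorem Theta.add (hA : A ∈ Theta r) (hB : B ∈ Theta r) : A + B ∈ Theta r :=
  ⟨fun i j => add_nonneg (hA.1 i j) (hB.1 i j), fun i j => by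
    rw [Matrix.add_apply, Matrix.add_apply, hA.2.1, hB.2.1],
    fun i => ((hA.2.2 i).union (hB.2.2 i)).subset (Function.support_add _ _)⟩

theorem cXi.even_center (hC : C ∈ cXi r d) {c : ℤ} (hc : c = 0 ∨ c = -(r : ℤ) - 1) : Even (C c c) := by
  obtain rfl | rfl := hc
  · exact hC.2.2.1
  · have h := hC.2.2.2
    rwa [← cXi.neg_neg hC, neg_add'] at h

/-- The pairs for `Ξ_{n,d}` that are no pairs for `ᶜΞ_{n,d}` do not contribute. -/
theorem mem_pairs_of_coeffC_ne_zero {p : ZMat × ZMat} (hA : A ∈ cXi r d)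
    (hp : p ∈ pairs r (Xi r d) α (A + Efix r)) (h0 : coeffC r (AST A p.1 p.2) p.1 p.2 ≠ 0) :
    p ∈ pairs r (cXi r d) α A := by
  classical
  obtain ⟨hS, hT, h1, h2, h3, h4, h5⟩ := hp
  rw [AST_add_Efix, mem_Xi_iff, add_sub_cancel_right] at h5
  have hper : ∀ i j, (A - p.2 + rowShift p.2) (i + per r) (j + per r) = (A - p.2 + rowShift p.2) i j := by
    intro i j
    have e2 := hT.2.1 (i - 1) j
    rw [show i - 1 + per r = i + per r - 1 by ring] at e2
    simp only [Matrix.add_apply, Matrix.sub_apply, rowShift, hA.1.1.2.1, hT.2.1, e2]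
  refine ⟨hS, hT, h1, h2, h3, ⟨fun i j => ?_, hper, fun i => ?_⟩, h5⟩
  · by_contra hneg
    have h6 := h4.1 i j
    rw [show A + Efix r - p.2 + rowShift p.2 = (A - p.2 + rowShift p.2) + Efix r by abel,
      Matrix.add_apply, Efix_apply] at h6
    split_ifs at h6 with hij
    · obtain ⟨rfl, hi⟩ := hij
      obtain ⟨c, hc, hcc⟩ := exists_center hper hi
      have h7 : AST A p.1 p.2 c c = (A - p.2 + rowShift p.2) c c + p.1 c c - p.1 (c - 1) c := by
        simp only [AST, Matrix.add_apply, Matrix.sub_apply, rowShift]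
        ring
      have h8 := hS.1 (c - 1) c
      refine h0 (mul_eq_zero_of_right _ (bracketC_eq_zero hc (h5.1.1.1 c c)
        (cXi.even_center h5 hc) ?_))
      omega
    · omega
  · refine ((h4.2.2 i).union ((Efix_mem_Theta r).2.2 i)).subset fun j hj => ?_
    by_contra h'
    simp only [Set.mem_union, Set.mem_ofPred_eq, not_or, not_not] at h'
    refine hj ?_
    have h6 := h'.1
    rw [show A + Efix r - p.2 + rowShift p.2 = (A - p.2 + rowShift p.2) + Efix r by abel,
      Matrix.add_apply, h'.2, add_zero] at h6
    exact h6

theorem mem_pairs_add_Efix {p : ZMat × ZMat} (hp : p ∈ pairs r (cXi r d) α A) :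
    p ∈ pairs r (Xi r d) α (A + Efix r) := by
  obtain ⟨hS, hT, h1, h2, h3, h4, h5⟩ := hp
  refine ⟨hS, hT, h1, h2, h3, ?_, ?_⟩
  · rw [show A + Efix r - p.2 + rowShift p.2 = (A - p.2 + rowShift p.2) + Efix r by abel]
    exact Theta.add h4 (Efix_mem_Theta r)
  · rwa [AST_add_Efix, mem_Xi_iff, add_sub_cancel_right]

theorem co_add (hA : A ∈ Theta r) (hB : B ∈ Theta r) (j : ℤ) : co (A + B) j = co A j + co B j := by
  have hfin : ∀ {X : ZMat}, X ∈ Theta r → (Function.support fun i => X i j).Finite := fun hX => by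
    obtain ⟨w, -, hw⟩ := exists_band hX
    refine (Finset.Icc (j - w) (j + w)).finite_toSet.subset fun i hi => ?_
    have := abs_le.1 (hw i j hi)
    exact Finset.mem_coe.2 (Finset.mem_Icc.2 (by omega))
  exact finsum_add_distrib (hfin hA) (hfin hB)

theorem Compatible.of_add_Efix (hA : A ∈ cXi r d) (hB : B ∈ cXi r d)
    (h : Compatible r α (A + Efix r) (B + Efix r)) : Compatible r α A B := by
  classical
  refine ⟨funext fun i => ?_, fun i j hij => ?_⟩
  · have h1 := congrFun h.1 i
    rw [co_add hB.1.1 (Efix_mem_Theta r), ro_add hA.1.1.2.2 (Efix_mem_Theta r).2.2] at h1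
    have h2 : co (Efix r) i = ro (Efix r) i := finsum_congr fun j => by
      rw [Efix_apply, Efix_apply]
      exact if_congr ⟨fun ⟨a, b⟩ => ⟨a.symm, a ▸ b⟩, fun ⟨a, b⟩ => ⟨a.symm, a ▸ b⟩⟩ rfl rfl
    omega
  · have h1 : (B + Efix r - ∑ i ∈ Finset.Icc 1 (per r), (α i : ℤ) • Etheta r i (i + 1)) i j = 0 :=
      h.2 hij
    change (B - ∑ i ∈ Finset.Icc 1 (per r), (α i : ℤ) • Etheta r i (i + 1)) i j = 0
    rw [Matrix.sub_apply, Matrix.add_apply, Efix_apply, if_neg fun h => hij h.1, add_zero] at h1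
    exact h1

theorem conv_eB (hα : ∀ i : ℤ, α (i + per r) = α i) (hA : A ∈ Xi r d) (hB : B ∈ Xi r d)
    (hAB : Compatible r α A B) : conv r d (eB r d B) (eB r d A) =
    ∑ᶠ p ∈ pairs r (Xi r d) α A, coeffB r (AST A p.1 p.2) p.1 p.2 • eB r d (AST A p.1 p.2) := by
  obtain ⟨A, hA, rfl⟩ := hA
  obtain ⟨B, hB, rfl⟩ := hB
  dsimp only at *
  rw [eB, eB, add_sub_cancel_right, add_sub_cancel_right,
    conv_eC hα hA (hAB.of_add_Efix hA hB) hB]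
  have h : ∀ p ∈ pairs r (Xi r d) α (A + Efix r), coeffB r (AST (A + Efix r) p.1 p.2) p.1 p.2 •
      eB r d (AST (A + Efix r) p.1 p.2) =
      coeffC r (AST A p.1 p.2) p.1 p.2 • eC r d (AST A p.1 p.2) := by
    rintro p ⟨hS, -, -, -, -, -, h5⟩
    rw [AST_add_Efix, mem_Xi_iff, add_sub_cancel_right] at h5
    rw [AST_add_Efix, eB, add_sub_cancel_right, coeffB_add_Efix hS h5.1.1]
  rw [finsum_mem_congr rfl h]
  refine finsum_mem_inter_support_eq' _ _ _ fun p hp => ⟨mem_pairs_add_Efix, fun h' => ?_⟩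
  exact mem_pairs_of_coeffC_ne_zero hA h' fun h0 => hp (by dsimp only; rw [h0, zero_smul])

end Shifted

/-! ### Quadratic forms in the rows of a periodic matrix -/

section Pairing

variable {P : ℤ → ℤ → Prop} {f g h : ℤ → ℤ}

/-- The sum of `f j * g l` over the pairs `(j, l)` in the relation `P`. -/
noncomputable def pairing (P : ℤ → ℤ → Prop) (f g : ℤ → ℤ) : ℤ :=
  ∑ᶠ (j : ℤ) (l : ℤ) (_ : P j l), f j * g l

theorem pairing_eq_sum [∀ j l, Decidable (P j l)] {s : Finset ℤ} (hf : f.support ⊆ s)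
    (hg : g.support ⊆ s) :
    pairing P f g = ∑ j ∈ s, ∑ l ∈ s, if P j l then f j * g l else 0 := by
  rw [pairing, finsum_congr fun j => finsum_congr fun l => finsum_eq_if (p := P j l)]
  have h1 : ∀ j, ∑ᶠ l, (if P j l then f j * g l else 0) =
      ∑ l ∈ s, if P j l then f j * g l else 0 := fun j =>
    finsum_eq_sum_of_support_subset _ fun l hl => hg fun h => hl (by simp [h])
  rw [finsum_congr h1]
  refine finsum_eq_sum_of_support_subset _ fun j hj => hf fun h => hj ?_
  simp [h]

theorem exists_support_subset₃ (hf : f.support.Finite) (hg : g.support.Finite)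
    (hh : h.support.Finite) : ∃ s : Finset ℤ, f.support ⊆ s ∧ g.support ⊆ s ∧ h.support ⊆ s := by
  refine ⟨((hf.union hg).union hh).toFinset, ?_, ?_, ?_⟩ <;> rw [Set.Finite.coe_toFinset] <;>
    intro x hx <;> simp only [Set.mem_union] <;> tauto

theorem pairing_add_left (hf : f.support.Finite) (hg : g.support.Finite) (hh : h.support.Finite) :
    pairing P (f + g) h = pairing P f h + pairing P g h := by
  classical
  obtain ⟨s, h1, h2, h3⟩ := exists_support_subset₃ hf hg hh
  rw [pairing_eq_sum (f := f + g) ((Function.support_add f g).trans (Set.union_subset h1 h2)) h3,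
    pairing_eq_sum h1 h3, pairing_eq_sum h2 h3]
  simp only [← Finset.sum_add_distrib, ite_add_ite, add_zero, Pi.add_apply, add_mul]

theorem pairing_neg_left : pairing P (-f) g = -pairing P f g := by
  rw [pairing, pairing, ← finsum_neg_distrib]
  refine finsum_congr fun j => ?_
  rw [← finsum_neg_distrib]
  refine finsum_congr fun l => ?_
  rw [← finsum_neg_distrib]
  exact finsum_congr fun _ => neg_mul _ _

theorem pairing_swap (hf : f.support.Finite) (hg : g.support.Finite) :
    pairing P f g = pairing (fun j l => P l j) g f := by
  classical
  obtain ⟨s, h1, h2, -⟩ := exists_support_subset₃ hf hg hg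
  rw [pairing_eq_sum h1 h2, pairing_eq_sum h2 h1, Finset.sum_comm]
  exact Finset.sum_congr rfl fun j _ => Finset.sum_congr rfl fun l _ => by rw [mul_comm]

theorem pairing_add_right (hf : f.support.Finite) (hg : g.support.Finite) (hh : h.support.Finite) :
    pairing P h (f + g) = pairing P h f + pairing P h g := by
  rw [pairing_swap (g := f + g) hh ((hf.union hg).subset (Function.support_add f g)), pairing_add_left hf hg hh,
    pairing_swap hh hf, pairing_swap hh hg]

theorem pairing_sub_left (hf : f.support.Finite) (hg : g.support.Finite) (hh : h.support.Finite) :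
    pairing P (f - g) h = pairing P f h - pairing P g h := by
  rw [sub_eq_add_neg, pairing_add_left hf (by rwa [Function.support_neg]) hh, pairing_neg_left,
    sub_eq_add_neg]

theorem pairing_sub_right (hf : f.support.Finite) (hg : g.support.Finite) (hh : h.support.Finite) :
    pairing P h (f - g) = pairing P h f - pairing P h g := by
  rw [pairing_swap (g := f - g) hh ((hf.union hg).subset (Function.support_sub f g)), pairing_sub_left hf hg hh,
    pairing_swap hh hf, pairing_swap hh hg]

theorem support_single_finite (c x : ℤ) : (Pi.single c x : ℤ → ℤ).support.Finite :=
  (Set.finite_singleton c).subset fun j hj => by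
    by_contra h
    exact hj (Pi.single_eq_of_ne h _)

theorem pairing_single_left (c : ℤ) : pairing P (Pi.single c 1) g = ∑ᶠ (l : ℤ) (_ : P c l), g l := by
  rw [pairing, finsum_eq_single _ c fun j hj => ?_]
  · simp only [Pi.single_eq_same, one_mul]
  · simp only [Pi.single_eq_of_ne hj, zero_mul, finsum_zero]

theorem pairing_single_single (a b x y : ℤ) [Decidable (P a b)] :
    pairing P (Pi.single a x) (Pi.single b y) = if P a b then x * y else 0 := by
  rw [pairing, finsum_eq_single _ a fun j hj => ?_, finsum_eq_single _ b fun l hl => ?_]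
  · rw [finsum_eq_if, Pi.single_eq_same, Pi.single_eq_same]
  · simp only [Pi.single_eq_of_ne hl, mul_zero, finsum_zero]
  · simp only [Pi.single_eq_of_ne hj, zero_mul, finsum_zero]

theorem pairing_eq_diag : pairing (· = ·) f g = ∑ᶠ j, f j * g j :=
  finsum_congr fun _ => finsum_cond_eq_right

/-- Reversal of both indices exchanges the arguments. -/
theorem pairing_lt_neg (hf : f.support.Finite) (hg : g.support.Finite) :
    pairing (· < ·) (fun j => f (-j)) (fun l => g (-l)) = pairing (· < ·) g f := by
  rw [pairing_swap hg hf, pairing, ← finsum_comp_equiv (Equiv.neg ℤ), pairing]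
  refine finsum_congr fun j => ?_
  rw [← finsum_comp_equiv (Equiv.neg ℤ)]
  refine finsum_congr fun l => ?_
  simp only [Equiv.neg_apply, neg_neg, neg_lt_neg_iff]

theorem pairing_trichotomy (hf : f.support.Finite) (hg : g.support.Finite) :
    pairing (· < ·) f g + pairing (fun j l => l < j) f g + ∑ᶠ j, f j * g j =
      (∑ᶠ j, f j) * ∑ᶠ j, g j := by
  obtain ⟨s, h1, h2, -⟩ := exists_support_subset₃ hf hg hg
  rw [pairing_eq_sum h1 h2, pairing_eq_sum h1 h2, finsum_eq_sum_of_support_subset _ h1,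
    finsum_eq_sum_of_support_subset _ h2, Finset.sum_mul_sum, finsum_eq_sum_of_support_subset
      (fun j => f j * g j) (s := s) fun j hj => h1 (left_ne_zero_of_mul hj),
    ← Finset.sum_add_distrib, ← Finset.sum_add_distrib]
  refine Finset.sum_congr rfl fun j hj => ?_
  rw [← Finset.sum_add_distrib, ← Finset.sum_ite_eq_of_mem s j (fun l => f j * g l) hj,
    ← Finset.sum_add_distrib]
  refine Finset.sum_congr rfl fun l _ => ?_
  rcases lt_trichotomy j l with h | h | h
  · rw [if_pos h, if_neg h.not_gt, if_neg h.ne]; ring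
  · rw [if_neg h.not_lt, if_neg h.not_gt, if_pos h]; ring
  · rw [if_neg h.not_gt, if_pos h, if_neg h.ne']; ring

/-- A finite sum, split at `c`. -/
theorem finsum_split_at (hg : g.support.Finite) (c : ℤ) :
    (∑ᶠ (j : ℤ) (_ : c < j), g j) + (∑ᶠ (j : ℤ) (_ : j < c), g j) + g c = ∑ᶠ j, g j := by
  have h := pairing_trichotomy (support_single_finite c 1) hg
  rw [pairing_single_left, pairing_single_left, finsum_eq_single
    (fun j => (Pi.single c (1 : ℤ) : ℤ → ℤ) j * g j) c fun j hj => ?_, finsum_eq_single (Pi.single c (1 : ℤ) : ℤ → ℤ) c fun j hj => Pi.single_eq_of_ne hj 1, Pi.single_eq_same,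
    one_mul, one_mul] at h
  · exact h
  · rw [Pi.single_eq_of_ne hj, zero_mul]

theorem even_sum_sub_diag {F : ℤ → ℤ → ℤ} (hF : ∀ i j, F i j = F j i) (s : Finset ℤ) :
    Even (∑ i ∈ s, ∑ j ∈ s, F i j - ∑ i ∈ s, F i i) := by
  induction s using Finset.induction_on with
  | empty => simp
  | insert a s ha ih =>
    obtain ⟨t, ht⟩ := ih
    refine ⟨t + ∑ j ∈ s, F a j, ?_⟩
    simp only [Finset.sum_insert ha, Finset.sum_add_distrib]
    rw [Finset.sum_congr rfl fun i _ => hF i a]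
    linarith

theorem even_pairing_reflect (hf : f.support.Finite) (c : ℤ) :
    Even (pairing (· < ·) f (fun l => f (2 * c - l)) + ∑ᶠ (j : ℤ) (_ : j < c), f j) := by
  have e : pairing (· < ·) f (fun l => f (2 * c - l)) = pairing (fun j l => j + l < 2 * c) f f := by
    refine finsum_congr fun j => ?_
    rw [← finsum_comp_equiv (Equiv.subLeft (2 * c))]
    refine finsum_congr fun l => ?_
    simp only [Equiv.subLeft_apply, sub_sub_cancel, lt_sub_iff_add_lt]
  have hs := hf.coe_toFinset.symm.subset
  obtain ⟨t, ht⟩ := even_sum_sub_diag (F := fun j l => if j + l < 2 * c then f j * f l else 0)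
    (fun i j => by simp only [add_comm i, mul_comm (f i)]) hf.toFinset
  rw [e, pairing_eq_sum hs hs, sub_eq_iff_eq_add.1 ht, finsum_congr fun j => finsum_eq_if (p := j < c),
    finsum_eq_sum_of_support_subset (fun j => if j < c then f j else 0) (s := hf.toFinset)
      fun j hj => hs fun h => hj (by simp [h]), add_assoc, ← Finset.sum_add_distrib]
  refine (Even.add_self t).add (Finset.even_sum _ fun j _ => ?_)
  by_cases h : j < c
  · rw [if_pos (by omega), if_pos h, ← mul_add_one]
    exact Int.even_mul_succ_self _
  · rw [if_neg (by omega), if_neg h]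
    exact Even.zero

end Pairing

section Periodic

variable {r : ℕ} {φ : ℤ → ℤ}

theorem sum_period (hφ : ∀ i, φ (i + per r) = φ i) (a : ℤ) :
    ∑ i ∈ Finset.Icc 1 (per r), φ i = ∑ i ∈ Finset.Ico a (a + per r), φ i := by
  have hp := per_pos r
  have h : Function.Periodic (fun a => ∑ i ∈ Finset.Ico a (a + per r), φ i) 1 := fun a => by
    have e : insert a (Finset.Ico (a + 1) (a + 1 + per r)) =
        insert (a + per r) (Finset.Ico a (a + per r)) := by
      ext i
      simp only [Finset.mem_insert, Finset.mem_Ico]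
      omega
    have e' := congrArg (fun s => ∑ i ∈ s, φ i) e
    rw [Finset.sum_insert (by simp), Finset.sum_insert (by simp), hφ] at e'
    exact add_left_cancel e'
  have h1 := h.int_mul (a - 1) 1
  rw [mul_one, Int.cast_id, add_sub_cancel] at h1
  rw [h1]
  refine Finset.sum_congr ?_ fun _ _ => rfl
  ext i
  simp only [Finset.mem_Icc, Finset.mem_Ico]
  omega

theorem sum_period_reflect (hφ : ∀ i, φ (i + per r) = φ i) (t : ℤ) :
    ∑ i ∈ Finset.Icc 1 (per r), φ (t - i) = ∑ i ∈ Finset.Icc 1 (per r), φ i := by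
  rw [sum_period hφ (t - per r)]
  exact Finset.sum_nbij' (t - ·) (t - ·) (by intro i; simp only [Finset.mem_Icc, Finset.mem_Ico]; omega)
    (by intro i; simp only [Finset.mem_Icc, Finset.mem_Ico]; omega) (fun i _ => sub_sub_cancel _ _)
    (fun i _ => sub_sub_cancel _ _) fun _ _ => rfl

theorem sum_period_shift (hφ : ∀ i, φ (i + per r) = φ i) (t : ℤ) :
    ∑ i ∈ Finset.Icc 1 (per r), φ (i + t) = ∑ i ∈ Finset.Icc 1 (per r), φ i := by
  rw [← sum_period_reflect hφ t,
    ← sum_period_reflect (φ := fun i => φ (i + t)) (fun i => by rw [add_right_comm, hφ]) 0]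
  exact Finset.sum_congr rfl fun i _ => congrArg φ (by ring)

theorem sum_period_eq (hφ : ∀ i, φ (i + per r) = φ i) :
    ∑ i ∈ Finset.Icc 1 (per r), φ i = ∑ i ∈ Finset.Icc (-(r : ℤ) - 1) r, φ i := by
  rw [sum_period hφ (-(r : ℤ) - 1)]
  refine Finset.sum_congr ?_ fun _ _ => rfl
  ext i
  simp only [Finset.mem_Icc, Finset.mem_Ico, per]
  omega

theorem even_sum_period (hφ : ∀ i, φ (i + per r) = φ i) (hs : ∀ i, φ (-i) = φ i) :
    Even (∑ i ∈ Finset.Icc 1 (per r), φ i + φ 0 + φ (r + 1)) := by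
  rw [sum_period_eq hφ, sum_Icc_all_rows, ← neg_add', hs]
  have h : Even (∑ i ∈ Finset.range r, (φ (-((i : ℤ) + 1)) + φ ((i : ℤ) + 1))) :=
    Finset.even_sum _ fun i _ => by rw [hs]; exact Even.add_self _
  obtain ⟨t, ht⟩ := h
  exact ⟨t + φ 0 + φ (r + 1), by rw [ht]; ring⟩

theorem even_sum_period_of_odd (hφ : ∀ i, φ (i + per r) = φ i) (hs : ∀ i, φ (-1 - i) = φ i) :
    Even (∑ i ∈ Finset.Icc 1 (per r), φ i) := by
  rw [sum_period_eq hφ]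
  have e : Finset.Icc (-(r : ℤ) - 1) r = Finset.Icc (-(r : ℤ) - 1) (-1) ∪ Finset.Icc 0 (r : ℤ) := by
    ext i
    simp only [Finset.mem_Icc, Finset.mem_union]
    omega
  rw [e, Finset.sum_union]
  · rw [Finset.sum_nbij' (s := Finset.Icc (-(r : ℤ) - 1) (-1)) (t := Finset.Icc 0 (r : ℤ)) (g := φ)
      (-1 - ·) (-1 - ·) (by intro i; simp only [Finset.mem_Icc]; omega)
      (by intro i; simp only [Finset.mem_Icc]; omega) (fun i _ => sub_sub_cancel _ _)
      (fun i _ => sub_sub_cancel _ _) fun i _ => (hs i).symm]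
    exact Even.add_self _
  · rw [Finset.disjoint_left]
    intro i
    simp only [Finset.mem_Icc]
    omega

end Periodic

/-! ### The dimension `d^𝔠` -/

section Dimension

/-- Periodic matrices supported in a band around the diagonal. -/
structure IsPeriodicBand (r : ℕ) (w : ℤ) (X : ℤ → ℤ → ℤ) : Prop where
  periodic : ∀ i j, X (i + per r) (j + per r) = X i j
  band : ∀ i j, w < |i - j| → X i j = 0

variable {r : ℕ} {w : ℤ} {X Y U : ℤ → ℤ → ℤ}

theorem IsPeriodicBand.mono {w' : ℤ} (h : IsPeriodicBand r w X) (hw : w ≤ w') :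
    IsPeriodicBand r w' X :=
  ⟨h.periodic, fun i j hij => h.band i j (hw.trans_lt hij)⟩

theorem IsPeriodicBand.add (hX : IsPeriodicBand r w X) (hY : IsPeriodicBand r w Y) :
    IsPeriodicBand r w (X + Y) :=
  ⟨fun i j => congrArg₂ (· + ·) (hX.periodic i j) (hY.periodic i j), fun i j h => by
    rw [Pi.add_apply, Pi.add_apply, hX.band i j h, hY.band i j h, add_zero]⟩

theorem IsPeriodicBand.sub (hX : IsPeriodicBand r w X) (hY : IsPeriodicBand r w Y) :
    IsPeriodicBand r w (X - Y) :=
  ⟨fun i j => congrArg₂ (· - ·) (hX.periodic i j) (hY.periodic i j), fun i j h => by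
    rw [Pi.sub_apply, Pi.sub_apply, hX.band i j h, hY.band i j h, sub_zero]⟩

theorem IsPeriodicBand.shift (hX : IsPeriodicBand r w X) :
    IsPeriodicBand r (w + 1) fun i => X (i - 1) :=
  ⟨fun i j => by rw [add_sub_right_comm, hX.periodic], fun i j h => hX.band _ _ (by
    rw [lt_abs] at *
    omega)⟩

theorem IsPeriodicBand.row_finite (hX : IsPeriodicBand r w X) (i : ℤ) : (X i).support.Finite :=
  (Set.finite_Icc (i - w) (i + w)).subset fun j hj => by
    by_contra h
    refine hj (hX.band i j ?_)
    rw [Set.mem_Icc] at h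
    rw [lt_abs]
    omega

theorem IsPeriodicBand.pairing_eq_zero (hX : IsPeriodicBand r w X) (hY : IsPeriodicBand r w Y)
    {i k : ℤ} (h : 2 * w ≤ i - k) : pairing (· < ·) (X i) (Y k) = 0 := by
  refine finsum_eq_zero_of_forall_eq_zero fun j => finsum_eq_zero_of_forall_eq_zero fun l => ?_
  rw [finsum_eq_if]
  split_ifs with hjl
  · by_cases h1 : w < |i - j|
    · rw [hX.band i j h1, zero_mul]
    · rw [hY.band k l, mul_zero]
      rw [not_lt, abs_le] at h1
      rw [lt_abs]
      omega
  · rfl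

theorem IsPeriodicBand.half_eq_zero (hX : IsPeriodicBand r w X) {i c : ℤ} (h : w ≤ i - c) :
    ∑ᶠ (j : ℤ) (_ : j < c), X i j = 0 :=
  finsum_eq_zero_of_forall_eq_zero fun j => by
    rw [finsum_eq_if]
    split_ifs with hj
    · exact hX.band i j (by rw [lt_abs]; omega)
    · rfl

theorem IsPeriodicBand.pairing_periodic (hX : IsPeriodicBand r w X) (hY : IsPeriodicBand r w Y)
    {P : ℤ → ℤ → Prop} (hP : ∀ j l m, P (j + m) (l + m) ↔ P j l) (i k : ℤ) :
    pairing P (X (i + per r)) (Y (k + per r)) = pairing P (X i) (Y k) := by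
  rw [pairing, ← finsum_comp_equiv (Equiv.addRight (per r)), pairing]
  refine finsum_congr fun j => ?_
  rw [← finsum_comp_equiv (Equiv.addRight (per r))]
  refine finsum_congr fun l => ?_
  simp only [Equiv.coe_addRight, hP, hX.periodic, hY.periodic]

theorem finsum_cond_eq_sum_range {f : ℕ → ℤ} (hf : f.Injective) {P : ℤ → Prop}
    (hP : ∀ k, P k ↔ ∃ t, f t = k) {F : ℤ → ℤ} {M : ℕ} (h : ∀ t, M ≤ t → F (f t) = 0) :
    ∑ᶠ (k : ℤ) (_ : P k), F k = ∑ t ∈ Finset.range M, F (f t) := by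
  have e : ∑ᶠ (k : ℤ) (_ : P k), F k = ∑ᶠ k ∈ Set.range f, F k :=
    finsum_congr fun k => by rw [show P k = (k ∈ Set.range f) from propext (hP k)]
  rw [e, finsum_mem_range hf]
  refine finsum_eq_sum_of_support_subset _ fun t ht => ?_
  by_contra h'
  exact ht (h t (by simpa using h'))

theorem dTwice_eq (hX : IsPeriodicBand r w X) {M M' : ℕ} (hM : 2 * w ≤ M) (hM' : w ≤ M') :
    dTwice r X = (∑ i ∈ Finset.Icc 1 (per r), ∑ t ∈ Finset.range M,
        pairing (· < ·) (X i) (X (i - t))) +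
      (∑ t ∈ Finset.range M', ∑ᶠ (j : ℤ) (_ : j < 0), X (0 + t) j) +
      ∑ t ∈ Finset.range M', ∑ᶠ (j : ℤ) (_ : j < (r : ℤ) + 1), X (r + 1 + t) j := by
  have e : dTwice r X =
      (∑ i ∈ Finset.Icc 1 (per r), ∑ᶠ (k : ℤ) (_ : k ≤ i), pairing (· < ·) (X i) (X k)) +
      (∑ᶠ (i : ℤ) (_ : 0 ≤ i), ∑ᶠ (j : ℤ) (_ : j < 0), X i j) +
      ∑ᶠ (i : ℤ) (_ : (r : ℤ) + 1 ≤ i), ∑ᶠ (j : ℤ) (_ : j < (r : ℤ) + 1), X i j := rfl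
  rw [e]
  congr 1
  · congr 1
    · refine Finset.sum_congr rfl fun i _ => ?_
      refine finsum_cond_eq_sum_range (f := fun t => i - t)
        (F := fun k => pairing (· < ·) (X i) (X k)) (fun a b h => ?_) (fun k => ⟨fun h =>
          ⟨(i - k).toNat, ?_⟩, ?_⟩) fun t ht => hX.pairing_eq_zero hX ?_
      · dsimp only at h
        omega
      · omega
      · rintro ⟨t, rfl⟩
        omega
      · omega
    · refine finsum_cond_eq_sum_range (f := fun t => 0 + t)
        (F := fun i => ∑ᶠ (j : ℤ) (_ : j < 0), X i j) (fun a b h => ?_) (fun k => ⟨fun h =>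
          ⟨k.toNat, ?_⟩, ?_⟩) fun t ht => hX.half_eq_zero ?_
      · dsimp only at h
        omega
      · omega
      · rintro ⟨t, rfl⟩
        omega
      · omega
  · refine finsum_cond_eq_sum_range (f := fun t => r + 1 + t)
      (F := fun i => ∑ᶠ (j : ℤ) (_ : j < (r : ℤ) + 1), X i j) (fun a b h => ?_) (fun k => ⟨fun h =>
        ⟨(k - (r + 1)).toNat, ?_⟩, ?_⟩) fun t ht => hX.half_eq_zero ?_
    · dsimp only at h
      omega
    · omega
    · rintro ⟨t, rfl⟩
      omega
    · omega

theorem sum_pairing_telescope (hX : IsPeriodicBand r w X) (hU : IsPeriodicBand r w U) {M : ℕ}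
    (hM : 2 * w ≤ M) (i : ℤ) :
    ∑ t ∈ Finset.range M, pairing (· < ·) (X i) (U (i - t) - U (i - t - 1)) =
      pairing (· < ·) (X i) (U i) := by
  rw [Finset.sum_congr rfl fun t _ => pairing_sub_right (hU.row_finite _) (hU.row_finite _)
    (hX.row_finite _)]
  have h := Finset.sum_range_sub' (fun t : ℕ => pairing (· < ·) (X i) (U (i - t))) M
  simp only [Nat.cast_add, Nat.cast_one, ← sub_sub, Nat.cast_zero, sub_zero] at h
  rw [h, hX.pairing_eq_zero hU (k := i - M) (by omega), sub_zero]

/-- Symmetry of a periodic matrix around the fixed points of the reflections. -/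
theorem reflect_center (hX : ∀ i j, X (i + per r) (j + per r) = X i j) {c : ℤ}
    (hc : c = 0 ∨ c = (r : ℤ) + 1) (i j : ℤ) : X (i + 2 * c) (j + 2 * c) = X i j := by
  obtain rfl | rfl := hc
  · simp
  · rw [show 2 * ((r : ℤ) + 1) = per r by rw [per]; ring, hX]

theorem sum_half_telescope (hX : IsPeriodicBand r w X) (hU : IsPeriodicBand r w U) {M : ℕ}
    (hM : w + 1 ≤ M) (hUs : ∀ i j, U (-i - 1) (-j) = -U i j) {c : ℤ} (hc : c = 0 ∨ c = (r : ℤ) + 1) :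
    ∑ t ∈ Finset.range M, ∑ᶠ (j : ℤ) (_ : j < c), (X (c + t) + (U (c + t) - U (c + t - 1))) j =
      (∑ t ∈ Finset.range M, ∑ᶠ (j : ℤ) (_ : j < c), X (c + t) j) + ∑ᶠ (j : ℤ) (_ : c < j), U c j := by
  have e : ∀ f : ℤ → ℤ, ∑ᶠ (j : ℤ) (_ : j < c), f j =
      pairing (fun j l => l < j) (Pi.single c 1) f := fun f =>
    (pairing_single_left (P := fun j l => l < j) c).symm
  have hs := support_single_finite c 1
  have h1 : ∀ t : ℕ, ∑ᶠ (j : ℤ) (_ : j < c), (X (c + t) + (U (c + t) - U (c + t - 1))) j =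
      (∑ᶠ (j : ℤ) (_ : j < c), X (c + t) j) +
        ((∑ᶠ (j : ℤ) (_ : j < c), U (c + t) j) - ∑ᶠ (j : ℤ) (_ : j < c), U (c + t - 1) j) := fun t => by
    rw [e, e, e, e, pairing_add_right (g := U (c + t) - U (c + t - 1)) (hX.row_finite _) (((hU.row_finite _).union
      (hU.row_finite _)).subset (Function.support_sub _ _)) hs,
      pairing_sub_right (hU.row_finite _) (hU.row_finite _) hs]
  have h2 := Finset.sum_range_sub (fun t : ℕ => ∑ᶠ (j : ℤ) (_ : j < c), U (c + t - 1) j) M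
  simp only [Nat.cast_add, Nat.cast_one, ← add_assoc, add_sub_cancel_right, Nat.cast_zero,
    add_zero] at h2
  rw [Finset.sum_congr rfl fun t _ => h1 t, Finset.sum_add_distrib, h2,
    hU.half_eq_zero (by omega), zero_sub]
  congr 1
  rw [← finsum_neg_distrib, ← finsum_comp_equiv (Equiv.subLeft (2 * c))]
  refine finsum_congr fun j => ?_
  rw [← finsum_neg_distrib]
  simp only [Equiv.subLeft_apply]
  have e1 : (2 * c - j < c) = (c < j) := propext ⟨fun h => by omega, fun h => by omega⟩
  rw [e1]
  refine finsum_congr fun _ => ?_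
  have h3 := reflect_center hU.periodic hc (-c - 1) (-j)
  rw [hUs, show -c - 1 + 2 * c = c - 1 by ring, show -j + 2 * c = 2 * c - j by ring] at h3
  rw [h3, neg_neg]

theorem sum_pairing_symm (hX : IsPeriodicBand r w X) (hY : IsPeriodicBand r w Y)
    (hXs : ∀ i j, X (-i) (-j) = X i j) (hYs : ∀ i j, Y (-i) (-j) = Y i j) (t : ℤ) :
    ∑ i ∈ Finset.Icc 1 (per r), pairing (· < ·) (Y i) (X (i - t)) =
      ∑ i ∈ Finset.Icc 1 (per r), pairing (· < ·) (X i) (Y (i - t)) := by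
  rw [← sum_period_reflect (φ := fun i => pairing (· < ·) (X i) (Y (i - t))) (fun i => by
    rw [add_sub_right_comm, hX.pairing_periodic hY fun j l m => add_lt_add_iff_right m]) t]
  refine Finset.sum_congr rfl fun i _ => ?_
  have e1 : X (t - i) = fun j => X (i - t) (-j) := funext fun j => by
    rw [← hXs (i - t), neg_sub, neg_neg]
  have e2 : Y (t - i - t) = fun j => Y i (-j) := funext fun j => by
    rw [← hYs i, neg_neg, sub_sub_cancel_left]
  rw [e1, e2, pairing_lt_neg (hX.row_finite _) (hY.row_finite _)]

theorem dTwice_add_diff (hX : IsPeriodicBand r w X) (hU : IsPeriodicBand r w U)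
    (hXs : ∀ i j, X (-i) (-j) = X i j) (hUs : ∀ i j, U (-i - 1) (-j) = -U i j) :
    dTwice r (fun i => X i + (U i - U (i - 1))) = dTwice r X +
      (∑ i ∈ Finset.Icc 1 (per r), (2 * pairing (· < ·) (X i) (U i) +
        pairing (· < ·) (U i - U (i - 1)) (U i))) +
      (∑ᶠ (j : ℤ) (_ : 0 < j), U 0 j) + ∑ᶠ (j : ℤ) (_ : (r : ℤ) + 1 < j), U (r + 1) j := by
  have hX1 := hX.mono (w' := w + 1) (by omega)
  have hU1 := hU.mono (w' := w + 1) (by omega)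
  set D : ℤ → ℤ → ℤ := fun i => U i - U (i - 1) with hDdef
  have hD : IsPeriodicBand r (w + 1) D := hU1.sub hU.shift
  have hDs : ∀ i j, D (-i) (-j) = D i j := fun i j => by
    have h1 := hUs i j
    have h2 := hUs (i - 1) j
    rw [show -(i - 1) - 1 = -i by ring] at h2
    simp only [hDdef, Pi.sub_apply, h1, h2]
    ring
  have hY : IsPeriodicBand r (w + 1) (fun i => X i + D i) := hX1.add hD
  obtain ⟨M, hM⟩ : ∃ M : ℕ, w + 2 ≤ M := ⟨(w + 2).toNat, by omega⟩
  have hM2 : 2 * (w + 1) ≤ ((2 * M : ℕ) : ℤ) := by push_cast; omega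
  have h3 : ∀ i, ∑ t ∈ Finset.range (2 * M), pairing (· < ·) (X i + D i) (X (i - t) + D (i - t)) =
      (∑ t ∈ Finset.range (2 * M), pairing (· < ·) (X i) (X (i - t))) +
      (∑ t ∈ Finset.range (2 * M), pairing (· < ·) (D i) (X (i - t))) +
      (pairing (· < ·) (X i) (U i) + pairing (· < ·) (D i) (U i)) := fun i => by
    rw [← sum_pairing_telescope hX1 hU1 hM2, ← sum_pairing_telescope hD hU1 hM2]
    simp only [← Finset.sum_add_distrib]
    refine Finset.sum_congr rfl fun t _ => ?_
    rw [pairing_add_left (hX1.row_finite _) (hD.row_finite _) (hY.row_finite _),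
      pairing_add_right (hX1.row_finite _) (hD.row_finite _) (hX1.row_finite _),
      pairing_add_right (hX1.row_finite _) (hD.row_finite _) (hD.row_finite _)]
    ring
  have h4 : ∑ i ∈ Finset.Icc 1 (per r), ∑ t ∈ Finset.range (2 * M),
      pairing (· < ·) (D i) (X (i - t)) = ∑ i ∈ Finset.Icc 1 (per r), pairing (· < ·) (X i) (U i) := by
    rw [Finset.sum_comm, Finset.sum_congr rfl fun (t : ℕ) _ =>
      sum_pairing_symm hX1 hD hXs hDs (t : ℤ),
      Finset.sum_comm]
    exact Finset.sum_congr rfl fun i _ => sum_pairing_telescope hX1 hU1 hM2 i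
  rw [dTwice_eq hY hM2 (M' := M) (by omega), dTwice_eq hX1 hM2 (M' := M) (by omega),
    Finset.sum_congr rfl fun i _ => h3 i,
    sum_half_telescope hX hU (by omega) hUs (Or.inl rfl),
    sum_half_telescope hX hU (by omega) hUs (Or.inr rfl)]
  simp only [Finset.sum_add_distrib, h4, ← Finset.mul_sum]
  ring

theorem sum_range_two_mul (a : ℕ → ℤ) (M : ℕ) :
    ∑ t ∈ Finset.range (2 * M), a t = ∑ s ∈ Finset.range M, (a (2 * s) + a (2 * s + 1)) := by
  induction M with
  | zero => simp
  | succ M ih =>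
    rw [Finset.sum_range_succ, ← ih, show 2 * (M + 1) = 2 * M + 1 + 1 by ring,
      Finset.sum_range_succ, Finset.sum_range_succ, add_assoc]

theorem even_dTwice (hX : IsPeriodicBand r w X) (hXs : ∀ i j, X (-i) (-j) = X i j) :
    Even (dTwice r X) := by
  obtain ⟨M, hM⟩ : ∃ M : ℕ, w ≤ M := ⟨w.toNat, by omega⟩
  rw [dTwice_eq hX (M := 2 * M) (M' := M) (by push_cast; omega) hM, Finset.sum_comm,
    sum_range_two_mul, ← Finset.sum_add_distrib, ← Finset.sum_add_distrib]
  refine Finset.even_sum _ fun s _ => ?_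
  have hlt : ∀ j l m : ℤ, j + m < l + m ↔ j < l := fun j l m => add_lt_add_iff_right m
  have hneg : ∀ i j, pairing (· < ·) (X (-i)) (X (-j)) = pairing (· < ·) (X j) (X i) := fun i j => by
    rw [← pairing_lt_neg (hX.row_finite i) (hX.row_finite j)]
    congr 1 <;> funext l <;> rw [← hXs, neg_neg]
  have h1 : Even (∑ i ∈ Finset.Icc 1 (per r), pairing (· < ·) (X i) (X (i - ((2 * s + 1 : ℕ) : ℤ)))) := by
    rw [← sum_period_shift (fun i => by rw [add_sub_right_comm, hX.pairing_periodic hX hlt])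
      ((s : ℤ) + 1)]
    refine even_sum_period_of_odd (φ := fun i => pairing (· < ·) (X (i + (s + 1)))
      (X (i + (s + 1) - ((2 * s + 1 : ℕ) : ℤ)))) (fun i => ?_) fun i => ?_
    · rw [add_right_comm, add_sub_right_comm, hX.pairing_periodic hX hlt]
    · rw [← hneg]
      congr 2 <;> push_cast <;> ring
  have h2 : Even ((∑ i ∈ Finset.Icc 1 (per r), pairing (· < ·) (X i) (X (i - ((2 * s : ℕ) : ℤ)))) +
      pairing (· < ·) (X (0 + s)) (X (0 + s - ((2 * s : ℕ) : ℤ))) +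
      pairing (· < ·) (X (r + 1 + s)) (X (r + 1 + s - ((2 * s : ℕ) : ℤ)))) := by
    rw [← sum_period_shift (fun i => by rw [add_sub_right_comm, hX.pairing_periodic hX hlt]) (s : ℤ)]
    refine even_sum_period (φ := fun i => pairing (· < ·) (X (i + s))
      (X (i + s - ((2 * s : ℕ) : ℤ)))) (fun i => ?_) fun i => ?_
    · rw [add_right_comm, add_sub_right_comm, hX.pairing_periodic hX hlt]
    · rw [← hneg]
      congr 2 <;> push_cast <;> ring
  have h3 : ∀ {c : ℤ}, c = 0 ∨ c = (r : ℤ) + 1 →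
      Even (pairing (· < ·) (X (c + s)) (X (c + s - ((2 * s : ℕ) : ℤ))) +
        ∑ᶠ (j : ℤ) (_ : j < c), X (c + s) j) := fun {c} hc => by
    have e : X (c + s - ((2 * s : ℕ) : ℤ)) = fun l => X (c + s) (2 * c - l) := funext fun l => by
      have h := reflect_center hX.periodic hc (s - c) (-l)
      rw [show s - c + 2 * c = c + s by ring, neg_add_eq_sub] at h
      rw [h, ← hXs (s - c), neg_neg]
      congr 1
      push_cast
      ring
    rw [e]
    exact even_pairing_reflect (hX.row_finite _) c
  have h4 := h3 (Or.inl rfl)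
  have h5 := h3 (Or.inr rfl)
  rw [Int.even_iff] at *
  omega

end Dimension

/-! ### The exponent `h_{S,T}` -/

section Exponent

variable {r d : ℕ} {α : ℤ → ℕ} {A B S T : ZMat}

theorem exists_isPeriodicBand (hA : A ∈ Theta r) : ∃ w, IsPeriodicBand r w A := by
  obtain ⟨w, -, hw⟩ := exists_band hA
  exact ⟨w, hA.2.1, fun i j h => by
    by_contra h'
    exact (hw i j h').not_gt h⟩

theorem even_dTwice_of_mem (hA : A ∈ cXi r d) : Even (dTwice r A) := by
  obtain ⟨w, hw⟩ := exists_isPeriodicBand hA.1.1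
  exact even_dTwice hw (cXi.neg_neg hA)

theorem ro_periodic (hA : ∀ i j, A (i + per r) (j + per r) = A i j) (i : ℤ) :
    ro A (i + per r) = ro A i := by
  rw [ro, ← finsum_comp_equiv (Equiv.addRight (per r)), ro]
  exact finsum_congr fun j => hA i j

theorem ro_neg (hA : A ∈ cXi r d) (i : ℤ) : ro A (-i) = ro A i := by
  rw [ro, ← finsum_comp_equiv (Equiv.neg ℤ), ro]
  exact finsum_congr fun j => cXi.neg_neg hA i j

theorem dTwice_tridiagonal (hα : ∀ i : ℤ, α (i + per r) = α i) (hA : A ∈ cXi r d)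
    (hB : IsTridiagonal α B) (hco : co B = ro A) :
    dTwice r B = (∑ i ∈ Finset.Icc 1 (per r), (2 * (ro A i * α i) +
      ((α (-i) * α i - α (i - 1) * α i - α (-i) * α (-i - 1) - α (-i - 1) * α i : ℤ)))) +
      α 0 + α (r + 1) := by
  set X : ℤ → ℤ → ℤ := fun i => Pi.single i (ro A i) with hX
  set U : ℤ → ℤ → ℤ := fun i => Pi.single (i + 1) (α i : ℤ) - Pi.single i (α (-i - 1) : ℤ) with hU
  have hα' : ∀ i : ℤ, α (-(i + per r) - 1) = α (-i - 1) := fun i => by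
    rw [← hα, show -(i + per r) - 1 + per r = -i - 1 by ring]
  have single_add : ∀ (i j m x : ℤ), (Pi.single (i + m) x : ℤ → ℤ) (j + m) =
      (Pi.single i x : ℤ → ℤ) j :=
    fun i j m x => by simp only [Pi.single_apply, add_left_inj]
  have hXp : IsPeriodicBand r 0 X := ⟨fun i j => by
    simp only [hX, single_add, ro_periodic hA.1.1.2.1], fun i j h =>
      Pi.single_eq_of_ne (fun e => by rw [e, sub_self, abs_zero] at h; exact h.false) _⟩
  have hUp : IsPeriodicBand r 1 U := ⟨fun i j => by
    simp only [hU, Pi.sub_apply, show i + per r + 1 = i + 1 + per r by ring, single_add, hα, hα'], fun i j h => by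
      rw [lt_abs] at h
      simp only [hU, Pi.sub_apply]
      rw [Pi.single_eq_of_ne (by omega), Pi.single_eq_of_ne (by omega), sub_zero]⟩
  have hXs : ∀ i j, X (-i) (-j) = X i j := fun i j => by
    simp only [hX, Pi.single_apply, neg_inj, ro_neg hA]
  have hUs : ∀ i j, U (-i - 1) (-j) = -U i j := fun i j => by
    simp only [hU, Pi.sub_apply, Pi.single_apply, sub_add_cancel, neg_inj, neg_sub]
    rw [show 1 - -i - 1 = i by ring]
    exact congrArg (_ - ·) (if_congr ⟨fun h => by omega, fun h => by omega⟩ rfl rfl)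
  have hBX : B = fun i => X i + (U i - U (i - 1)) := by
    funext i j
    simp only [hX, hU, Pi.add_apply, Pi.sub_apply, Pi.single_apply, sub_add_cancel]
    have h1 := hB.co_eq i
    have h2 := hB.upper (i - 1)
    have h3 := hB.lower i
    have h4 := hB.upper i
    have h5 := hB.lower (i - 1)
    rw [hco] at h1
    rw [sub_add_cancel] at h2 h5
    rw [show -(i - 1) - 1 = -i by ring] at *
    rcases lt_trichotomy j i with h | rfl | h
    · by_cases h' : j = i - 1
      · subst h'
        rw [h5]
        split_ifs <;> omega
      · rw [hB.far i j (by omega)]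
        split_ifs <;> omega
    · split_ifs <;> omega
    · by_cases h' : j = i + 1
      · subst h'
        rw [h4]
        split_ifs <;> omega
      · rw [hB.far i j (by omega)]
        split_ifs <;> omega
  have hX0 : dTwice r X = 0 := by
    rw [dTwice_eq hXp (M := 0) (M' := 0) le_rfl le_rfl]
    simp
  have hs := support_single_finite
  have hs2 : ∀ a x b y : ℤ, (Pi.single a x - Pi.single b y : ℤ → ℤ).support.Finite := fun a x b y =>
    ((hs a x).union (hs b y)).subset (Function.support_sub _ _)
  have tail : ∀ c : ℤ, ∑ᶠ (j : ℤ) (_ : c < j), U c j = α c := fun c => by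
    rw [← pairing_single_left (P := (· < ·)), pairing_sub_right (hs _ _) (hs _ _) (hs _ _),
      pairing_single_single, pairing_single_single, if_pos (lt_add_one c), if_neg (lt_irrefl c),
      one_mul, sub_zero]
  rw [hBX, dTwice_add_diff (hXp.mono zero_le_one) hUp hXs hUs, hX0, zero_add, tail, tail]
  congr 2
  refine Finset.sum_congr rfl fun i _ => ?_
  simp only [hX, hU, pairing_sub_left, pairing_sub_right, hs, hs2, pairing_single_single]
  rw [show -(i - 1) - 1 = -i by ring]
  simp [show ¬ (i + 1 < i) by omega]
  ring

theorem Efix_row (i : ℤ) [Decidable ((r : ℤ) + 1 ∣ i)] :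
    Efix r i = if (r : ℤ) + 1 ∣ i then Pi.single i 1 else 0 := by
  classical
  funext j
  rw [Efix_apply]
  split_ifs with h1 h2 h2
  · rw [h1.1, Pi.single_eq_same]
  · exact absurd h1.2 h2
  · rw [Pi.single_eq_of_ne fun h => h1 ⟨h.symm, h2⟩]
  · rfl

theorem two_mul_finsum_half (c : ℤ) (f : ℤ → ℤ) :
    2 * ∑ᶠ (j : ℤ) (_ : j < c), f j * (f j - 1) / 2 = ∑ᶠ (j : ℤ) (_ : j < c), f j * (f j - 1) := by
  rw [← smul_eq_mul, smul_finsum]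
  refine finsum_congr fun j => ?_
  rw [smul_finsum]
  refine finsum_congr fun _ => ?_
  rw [smul_eq_mul, Int.mul_ediv_cancel']
  exact (Int.even_mul_pred_self _).two_dvd

/-- The contribution of `E^{00} + E^{r+1,r+1}` to the exponent. -/
theorem sum_pairing_Efix {w : ℤ} (hS : IsPeriodicBand r w S) (hT : IsPeriodicBand r w T) :
    ∑ i ∈ Finset.Icc 1 (per r), (pairing (fun j l => l < j) (Efix r i) (S i) -
      pairing (· < ·) (Efix r i) (T i) - pairing (· = ·) (Efix r i) (S i)) =
    ((∑ᶠ (j : ℤ) (_ : j < 0), S 0 j) - (∑ᶠ (j : ℤ) (_ : 0 < j), T 0 j) - S 0 0) +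
    ((∑ᶠ (j : ℤ) (_ : j < (r : ℤ) + 1), S (r + 1) j) - (∑ᶠ (j : ℤ) (_ : (r : ℤ) + 1 < j), T (r + 1) j) -
      S (r + 1) (r + 1)) := by
  classical
  obtain ⟨w', hE⟩ := exists_isPeriodicBand (Efix_mem_Theta r)
  have hp : per r = 2 * (r : ℤ) + 2 := rfl
  set φ : ℤ → ℤ := fun i => pairing (fun j l => l < j) (Efix r i) (S i) -
      pairing (· < ·) (Efix r i) (T i) - pairing (· = ·) (Efix r i) (S i) with hφ
  have h0 : ∀ i, (r : ℤ) + 1 ∣ i → φ i = (∑ᶠ (j : ℤ) (_ : j < i), S i j) -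
      (∑ᶠ (j : ℤ) (_ : i < j), T i j) - S i i := fun i hi => by
    simp only [hφ]
    rw [Efix_row, if_pos hi, pairing_single_left, pairing_single_left, pairing_single_left,
      finsum_cond_eq_right]
  have h1 : ∀ i, φ (i + per r) = φ i := fun i => by
    simp only [hφ]
    have hE' := hE.mono (le_max_left w' w)
    have hS' := hS.mono (le_max_right w' w)
    have hT' := hT.mono (le_max_right w' w)
    rw [hE'.pairing_periodic hS' (P := fun j l => l < j) fun j l m => add_lt_add_iff_right m,
      hE'.pairing_periodic hT' (P := (· < ·)) fun j l m => add_lt_add_iff_right m,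
      hE'.pairing_periodic hS' (P := (· = ·)) fun j l m => add_left_inj m]
  have h2 : ∀ i : ℤ, i ≠ 0 → -(r : ℤ) - 1 < i → i < r + 1 → φ i = 0 := fun i a b c => by
    have e : Efix r i = 0 := funext fun j => Efix_eq_zero a b c j
    simp only [hφ]
    rw [e]
    simp [pairing]
  rw [sum_period_eq h1, sum_Icc_all_rows, Finset.sum_eq_zero fun i hi => ?_, add_zero, ← h1,
    show -(r : ℤ) - 1 + per r = r + 1 by rw [hp]; ring, h0 _ (dvd_refl _), h0 _ (dvd_zero _), add_comm]
  rw [Finset.mem_range] at hi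
  rw [h2 _ (by omega) (by omega) (by omega), h2 _ (by omega) (by omega) (by omega), add_zero]

theorem hTwice_eq (hα : ∀ i : ℤ, α (i + per r) = α i) (hA : A ∈ cXi r d)
    (hB : IsTridiagonal α B) (hco : co B = ro A) (hS : S ∈ Theta r) (hT : T ∈ Theta r)
    (hST : ∀ i j, S i j + S (-i - 1) (-j) = T i j + T (-i - 1) (-j)) (hSα : ∀ i, ro S i = α i) :
    hTwice r α (A + Efix r) S T =
      dTwice r (AST A S T) - dTwice r A - dTwice r B + 4 * xiC r (AST A S T) S := by
  obtain ⟨a, ha⟩ := exists_isPeriodicBand hA.1.1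
  obtain ⟨s, hs⟩ := exists_isPeriodicBand hS
  obtain ⟨t, ht⟩ := exists_isPeriodicBand hT
  obtain ⟨e, he⟩ := exists_isPeriodicBand (Efix_mem_Theta r)
  obtain ⟨w, h1, h2, h3, h4⟩ : ∃ w, a ≤ w ∧ s ≤ w ∧ t ≤ w ∧ e ≤ w :=
    ⟨max (max a s) (max t e), by omega, by omega, by omega, by omega⟩
  replace ha := ha.mono h1
  replace hs := hs.mono h2
  replace ht := ht.mono h3
  replace he := he.mono h4
  have fA := ha.row_finite
  have fS := hs.row_finite
  have fT := ht.row_finite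
  have fE := he.row_finite
  have fs : ∀ {f g : ℤ → ℤ}, f.support.Finite → g.support.Finite → (f - g).support.Finite :=
    fun hf hg => (hf.union hg).subset (Function.support_sub _ _)
  have fa : ∀ {f g : ℤ → ℤ}, f.support.Finite → g.support.Finite → (f + g).support.Finite :=
    fun hf hg => (hf.union hg).subset (Function.support_add _ _)
  set U : ℤ → ℤ → ℤ := fun i => S i - T i with hU
  have hd := dTwice_add_diff ha (U := U) (hs.sub ht) (cXi.neg_neg hA) fun i j => by
    have := hST i j
    simp only [hU, Pi.sub_apply]
    linarith
  have hAST : AST A S T = fun i => A i + (U i - U (i - 1)) := by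
    funext i j
    change A i j + S i j - T i j - (S (i - 1) j - T (i - 1) j) =
      A i j + ((S i j - T i j) - (S (i - 1) j - T (i - 1) j))
    ring
  have hdB := dTwice_tridiagonal hα hA hB hco
  have hdA : dTwice r (AST A S T) = dTwice r fun i => A i + (U i - U (i - 1)) := congrArg _ hAST
  rw [hd] at hdA
  have tail : ∀ c : ℤ, ∑ᶠ (j : ℤ) (_ : c < j), U c j =
      (∑ᶠ (j : ℤ) (_ : c < j), S c j) - ∑ᶠ (j : ℤ) (_ : c < j), T c j := fun c => by
    rw [← pairing_single_left (P := (· < ·)), ← pairing_single_left (P := (· < ·)) (g := S c),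
      ← pairing_single_left (P := (· < ·)) (g := T c)]
    exact pairing_sub_right (fS c) (fT c) (support_single_finite c 1)
  rw [tail, tail] at hdA
  have hsplit : ∀ c : ℤ, _ := fun c => (finsum_split_at (fS c) c).trans (hSα c)
  have hxi : xiC r (AST A S T) S = (∑ i ∈ Finset.Icc 1 (per r), pairing (fun j l => l < j)
      (A i - T i - S (i - 1) + T (i - 1)) (S i)) - crossSum r S -
      ∑ i ∈ ({-(r : ℤ) - 1, 0} : Finset ℤ), ∑ᶠ (j : ℤ) (_ : j < i), S i j * (S i j - 1) / 2 := by
    rw [sum_period_eq fun i => ?_, xiC]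
    · congr 2
      refine Finset.sum_congr rfl fun i _ => finsum_congr fun j => finsum_congr fun l =>
        finsum_congr fun _ => congrArg (· * S i l) ?_
      change A i j + S i j - T i j - (S (i - 1) j - T (i - 1) j) - S i j =
        A i j - T i j - S (i - 1) j + T (i - 1) j
      ring
    · have hw : w ≤ w + 1 := by omega
      exact (((ha.mono hw).sub (ht.mono hw)).sub hs.shift |>.add ht.shift).pairing_periodic
        (hs.mono hw) (P := fun j l => l < j) (fun j l m => add_lt_add_iff_right m) i i
  have hh : hTwice r α (A + Efix r) S T = (∑ i ∈ Finset.Icc 1 (per r),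
      (2 * pairing (fun j l => l < j) (A i + Efix r i) (S i)
        - 2 * pairing (· < ·) (A i + Efix r i) (T i)
        - 2 * (∑ᶠ j : ℤ, (A i + Efix r i : ℤ → ℤ) j * S i j)
        + 2 * (α i * α (i - 1) : ℤ) - (α (per r - i) * α i : ℤ) + (α i * α (per r - 1 - i) : ℤ)
        - 4 * pairing (fun j l => l < j) (T i) (S i)
        - 4 * pairing (fun j l => l < j) (S (i - 1)) (S i)
        + 4 * pairing (fun j l => l < j) (T (i - 1)) (S i)
        + pairing (· < ·) (U i - U (i - 1)) (U i)))
    - 4 * crossSum r S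
    - 2 * (∑ i ∈ ({-(r : ℤ) - 1, 0} : Finset ℤ), ∑ᶠ (j : ℤ) (_ : j < i), S i j * (S i j - 1))
    + (∑ᶠ (j : ℤ) (_ : 0 < j), T 0 j)
    - 3 * (∑ᶠ (j : ℤ) (_ : j < 0), S 0 j) + S 0 0
    + (∑ᶠ (j : ℤ) (_ : (r : ℤ) + 1 < j), T (r + 1) j)
    - 3 * (∑ᶠ (j : ℤ) (_ : j < (r : ℤ) + 1), S (r + 1) j) + S (r + 1) (r + 1) := rfl
  have hE := sum_pairing_Efix hs ht
  have hrefl := sum_period_reflect (r := r) (φ := fun i => (α i * α (i - 1) : ℤ)) (fun i => by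
    rw [hα, add_sub_right_comm, hα]) 0
  simp only [zero_sub] at hrefl
  have hsum : ∀ i : ℤ, (2 * pairing (fun j l => l < j) (A i + Efix r i) (S i)
        - 2 * pairing (· < ·) (A i + Efix r i) (T i)
        - 2 * (∑ᶠ j : ℤ, (A i + Efix r i : ℤ → ℤ) j * S i j)
        + 2 * (α i * α (i - 1) : ℤ) - (α (per r - i) * α i : ℤ) + (α i * α (per r - 1 - i) : ℤ)
        - 4 * pairing (fun j l => l < j) (T i) (S i)
        - 4 * pairing (fun j l => l < j) (S (i - 1)) (S i)
        + 4 * pairing (fun j l => l < j) (T (i - 1)) (S i)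
        + pairing (· < ·) (U i - U (i - 1)) (U i)) =
      (2 * pairing (· < ·) (A i) (U i) + pairing (· < ·) (U i - U (i - 1)) (U i)) +
      4 * pairing (fun j l => l < j) (A i - T i - S (i - 1) + T (i - 1)) (S i) +
      2 * (pairing (fun j l => l < j) (Efix r i) (S i) -
        pairing (· < ·) (Efix r i) (T i) - pairing (· = ·) (Efix r i) (S i)) -
      (2 * (ro A i * α i) +
        ((α (-i) * α i - α (i - 1) * α i - α (-i) * α (-i - 1) - α (-i - 1) * α i : ℤ))) +
      ((α i * α (i - 1) : ℤ) - (α (-i) * α (-i - 1) : ℤ)) := fun i => by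
    have e1 : α (per r - i) = α (-i) := by rw [← hα (-i), neg_add_eq_sub]
    have e2 : α (per r - 1 - i) = α (-i - 1) := by
      rw [← hα (-i - 1), show -i - 1 + per r = per r - 1 - i by ring]
    have e3 := pairing_trichotomy (fA i) (fS i)
    have e4 : (∑ᶠ j, A i j) * ∑ᶠ j, S i j = ro A i * α i := congrArg (ro A i * ·) (hSα i)
    rw [e4, ← pairing_eq_diag] at e3
    rw [← pairing_eq_diag, pairing_add_left (fA i) (fE i) (fS i), pairing_add_left (fA i) (fE i) (fT i),
      pairing_add_left (fA i) (fE i) (fS i), show pairing (· < ·) (A i) (U i) = _ from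
        pairing_sub_right (fS i) (fT i) (fA i),
      pairing_add_left (fs (fs (fA i) (fT i)) (fS (i - 1))) (fT (i - 1)) (fS i),
      pairing_sub_left (fs (fA i) (fT i)) (fS (i - 1)) (fS i), pairing_sub_left (fA i) (fT i) (fS i),
      e1, e2]
    linarith
  rw [hh, hdA, hdB, hxi, Finset.sum_congr rfl fun i _ => hsum i]
  have h5 : 2 * ∑ i ∈ ({-(r : ℤ) - 1, 0} : Finset ℤ), ∑ᶠ (j : ℤ) (_ : j < i), S i j * (S i j - 1) / 2 =
      ∑ i ∈ ({-(r : ℤ) - 1, 0} : Finset ℤ), ∑ᶠ (j : ℤ) (_ : j < i), S i j * (S i j - 1) := by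
    rw [Finset.mul_sum]
    exact Finset.sum_congr rfl fun i _ => two_mul_finsum_half i (S i)
  rw [← h5]
  have h6 := hsplit 0
  have h7 := hsplit (r + 1)
  have h8 : ∀ a x e b c c' : ℤ → ℤ,
      ∑ i ∈ Finset.Icc 1 (per r), (a i + 4 * x i + 2 * e i - b i + (c i - c' i)) =
      (∑ i ∈ Finset.Icc 1 (per r), a i) + 4 * (∑ i ∈ Finset.Icc 1 (per r), x i) +
        2 * (∑ i ∈ Finset.Icc 1 (per r), e i) - (∑ i ∈ Finset.Icc 1 (per r), b i) +
        ((∑ i ∈ Finset.Icc 1 (per r), c i) - ∑ i ∈ Finset.Icc 1 (per r), c' i) := fun a x e b c c' => by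
    simp only [Finset.sum_add_distrib, Finset.sum_sub_distrib, Finset.mul_sum]
  rw [h8, hE, hrefl]
  linarith

end Exponent

section Standard

variable {r d : ℕ} {α : ℤ → ℕ} {A B : ZMat}

theorem conv_smul_eB (a b : Qv) (hA : A ∈ Xi r d) (hB : B ∈ Xi r d) :
    conv r d (b • eB r d B) (a • eB r d A) = (b * a) • conv r d (eB r d B) (eB r d A) := by
  rw [eB, eB, eC, eC, dif_pos (mem_Xi_iff.1 hA), dif_pos (mem_Xi_iff.1 hB), Finsupp.smul_single,
    Finsupp.smul_single, conv, conv]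
  simp [Finsupp.sum_single_index]

theorem Xi_subset_Theta (hA : A ∈ Xi r d) : A ∈ Theta r := by
  obtain ⟨A, hA, rfl⟩ := hA
  exact Theta.add hA.1.1 (Efix_mem_Theta r)

theorem hTwice_eq_of_mem_pairs (hα : ∀ i : ℤ, α (i + per r) = α i) (hA : A ∈ Xi r d)
    (hB : B ∈ Xi r d) (hAB : Compatible r α A B) {p : ZMat × ZMat}
    (hp : p ∈ pairs r (Xi r d) α A) :
    hTwice r α A p.1 p.2 = dTwice r (AST A p.1 p.2 - Efix r) - dTwice r (A - Efix r) -
      dTwice r (B - Efix r) + 4 * xiB r (AST A p.1 p.2) p.1 := by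
  obtain ⟨A, hA, rfl⟩ := hA
  obtain ⟨B, hB, rfl⟩ := hB
  have hAB' := Compatible.of_add_Efix hA hB hAB
  obtain ⟨hS, hT, h1, h2, -, -, h5⟩ := hp
  change hTwice r α (A + Efix r) p.1 p.2 = dTwice r (AST (A + Efix r) p.1 p.2 - Efix r) -
    dTwice r (A + Efix r - Efix r) - dTwice r (B + Efix r - Efix r) +
    4 * xiB r (AST (A + Efix r) p.1 p.2) p.1
  have h6 : AST (A + Efix r) p.1 p.2 - Efix r ∈ cXi r d := mem_Xi_iff.1 h5
  rw [AST_add_Efix, add_sub_cancel_right] at *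
  obtain ⟨N, h0, hNS, hNC⟩ := exists_common_window hS h6.1.1
  rw [xiB_add_Efix hNS hNC h0, add_sub_cancel_right, add_sub_cancel_right]
  exact hTwice_eq hα hA (isTridiagonal_of_isDiag hα hAB'.2) hAB'.1 hS hT h1 h2

theorem conv_std (hα : ∀ i : ℤ, α (i + per r) = α i) (hA : A ∈ Xi r d) (hB : B ∈ Xi r d)
    (hAB : Compatible r α A B) : conv r d (std r d B) (std r d A) =
    ∑ᶠ p ∈ pairs r (Xi r d) α A, (v ^ (hTwice r α A p.1 p.2 / 2) * nST r p.1 p.2 *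
      bracketB r (AST A p.1 p.2) p.1) • std r d (AST A p.1 p.2) := by
  have hfin := finite_pairs hα (Xi_subset_Theta hA) (Xi r d)
  rw [std, std, conv_smul_eB _ _ hA hB, conv_eB hα hA hB hAB, smul_finsum_mem hfin]
  refine finsum_mem_congr rfl fun p hp => ?_
  have h := hTwice_eq_of_mem_pairs hα hA hB hAB hp
  obtain ⟨a, ha⟩ := even_dTwice_of_mem (mem_Xi_iff.1 hA)
  obtain ⟨b, hb⟩ := even_dTwice_of_mem (mem_Xi_iff.1 hB)
  obtain ⟨c, hc⟩ := even_dTwice_of_mem (mem_Xi_iff.1 hp.2.2.2.2.2.2)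
  have hv : v ≠ 0 := RatFunc.X_ne_zero
  rw [std, smul_smul, smul_smul, coeffB, ha, hb, hc,
    show hTwice r α A p.1 p.2 / 2 = c - a - b + 2 * xiB r (AST A p.1 p.2) p.1 by omega,
    show -((a + a) / 2) = -a by omega, show -((b + b) / 2) = -b by omega,
    show -((c + c) / 2) = -c by omega]
  congr 1
  have e : v ^ (c - a - b + 2 * xiB r (AST A p.1 p.2) p.1) * v ^ (-c) =
      v ^ (-b) * v ^ (-a) * v ^ (2 * xiB r (AST A p.1 p.2) p.1) := by
    rw [← zpow_add₀ hv, ← zpow_add₀ hv, ← zpow_add₀ hv]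
    congr 1
    ring
  linear_combination -(nST r p.1 p.2 * bracketB r (AST A p.1 p.2) p.1) * e

end Standard

end AffineSchurC

theorem mainTheorem1 (r d : ℕ) (α : ℤ → ℕ)
    (hα : ∀ i : ℤ, α (i + AffineSchurC.per r) = α i) :
    -- matrices in `ᶜΞ_{n,d}`
    (∀ A ∈ AffineSchurC.cXi r d, ∀ B ∈ AffineSchurC.cXi r d, AffineSchurC.Compatible r α A B →
      (∀ C ∈ AffineSchurC.cXi r d, ∃! g, AffineSchurC.IsStructureConst r d B A C g) ∧
      {C | C ∈ AffineSchurC.cXi r d ∧ AffineSchurC.structureConst r d B A C ≠ 0}.Finite ∧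
      (AffineSchurC.pairs r (AffineSchurC.cXi r d) α A).Finite ∧
      AffineSchurC.conv r d (AffineSchurC.eC r d B) (AffineSchurC.eC r d A) =
        ∑ᶠ p ∈ AffineSchurC.pairs r (AffineSchurC.cXi r d) α A,
          (AffineSchurC.v ^ (2 * AffineSchurC.xiC r (AffineSchurC.AST A p.1 p.2) p.1) *
            AffineSchurC.nST r p.1 p.2 *
            AffineSchurC.bracketC r (AffineSchurC.AST A p.1 p.2) p.1) •
          AffineSchurC.eC r d (AffineSchurC.AST A p.1 p.2)) ∧
    -- matrices in `Ξ_{n,d}`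
    (∀ A ∈ AffineSchurC.Xi r d, ∀ B ∈ AffineSchurC.Xi r d, AffineSchurC.Compatible r α A B →
      (AffineSchurC.pairs r (AffineSchurC.Xi r d) α A).Finite ∧
      AffineSchurC.conv r d (AffineSchurC.eB r d B) (AffineSchurC.eB r d A) =
        ∑ᶠ p ∈ AffineSchurC.pairs r (AffineSchurC.Xi r d) α A,
          (AffineSchurC.v ^ (2 * AffineSchurC.xiB r (AffineSchurC.AST A p.1 p.2) p.1) *
            AffineSchurC.nST r p.1 p.2 *
            AffineSchurC.bracketB r (AffineSchurC.AST A p.1 p.2) p.1) •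
          AffineSchurC.eB r d (AffineSchurC.AST A p.1 p.2) ∧
      -- the exponents `d^𝔠` and `h_{S,T}` are integers, and
      -- `h_{S,T} = d^𝔠(A_{S,T}) - d^𝔠(A) - d^𝔠(B) + 2 ξ^𝔟`
      Even (AffineSchurC.dTwice r (A - AffineSchurC.Efix r)) ∧
      Even (AffineSchurC.dTwice r (B - AffineSchurC.Efix r)) ∧
      (∀ p ∈ AffineSchurC.pairs r (AffineSchurC.Xi r d) α A,
        Even (AffineSchurC.dTwice r (AffineSchurC.AST A p.1 p.2 - AffineSchurC.Efix r)) ∧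
        Even (AffineSchurC.hTwice r α A p.1 p.2) ∧
        AffineSchurC.hTwice r α A p.1 p.2 =
          AffineSchurC.dTwice r (AffineSchurC.AST A p.1 p.2 - AffineSchurC.Efix r)
            - AffineSchurC.dTwice r (A - AffineSchurC.Efix r)
            - AffineSchurC.dTwice r (B - AffineSchurC.Efix r)
            + 4 * AffineSchurC.xiB r (AffineSchurC.AST A p.1 p.2) p.1) ∧
      AffineSchurC.conv r d (AffineSchurC.std r d B) (AffineSchurC.std r d A) =
        ∑ᶠ p ∈ AffineSchurC.pairs r (AffineSchurC.Xi r d) α A,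
          (AffineSchurC.v ^ (AffineSchurC.hTwice r α A p.1 p.2 / 2) *
            AffineSchurC.nST r p.1 p.2 *
            AffineSchurC.bracketB r (AffineSchurC.AST A p.1 p.2) p.1) •
          AffineSchurC.std r d (AffineSchurC.AST A p.1 p.2)) := by
  open AffineSchurC in
  refine ⟨fun A hA B hB hAB => ⟨fun C hC => existsUnique_isStructureConst hα hA hAB hC,
    finite_structureConst_ne_zero hα hA hAB, finite_pairs hα hA.1.1 _, conv_eC hα hA hAB hB⟩,
    fun A hA B hB hAB => ⟨finite_pairs hα (Xi_subset_Theta hA) _, conv_eB hα hA hB hAB,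
      even_dTwice_of_mem (mem_Xi_iff.1 hA), even_dTwice_of_mem (mem_Xi_iff.1 hB), fun p hp => ?_,
      conv_std hα hA hB hAB⟩⟩
  open AffineSchurC in
  have h := hTwice_eq_of_mem_pairs hα hA hB hAB hp
  open AffineSchurC in
  have h1 := even_dTwice_of_mem (mem_Xi_iff.1 hp.2.2.2.2.2.2)
  refine ⟨h1, ?_, h⟩
  rw [h]
  open AffineSchurC in
  exact ((h1.sub (even_dTwice_of_mem (mem_Xi_iff.1 hA))).sub
    (even_dTwice_of_mem (mem_Xi_iff.1 hB))).add ((by decide : Even (4 : ℤ)).mul_right _)
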